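/- **Setting.** Let $d\ge 2$, let $E_d$ be the set of non-oriented nearest-neighbour edges of $\mathbb Z^d$ (write $x\sim y$ if $\{x,y\}\in E_d$, and $\mathcal N=\{x:x\sim 0\}$), let $\Omega=(0,\infty)^{\mathbb R\times E_d}$, and set $\omega_t(x,y)=\omega_t(\{x,y\})$ if $x\sim y$ and $\omega_t(x,y)=0$ otherwise. Space-time shifts are given by $(\tau_{s,z}\omega)_t(\{x,y\})=\omega_{t+s}(\{x+z,y+z\})$. Let $\mathcal F$ be a $\sigma$-algebra on $\Omega$ and $\mathbb P$ a probability measure on $(\Omega,\mathcal F)$ such that: (a) $\mathbb E[\omega_t(e)]<\infty$ and $\mathbb E[\omega_t(e)^{-1}]<\infty$ for all $t\in\mathbb R$, $e\in E_d$ (the maps $\omega\mapsto\omega_t(e)$ being measurable up to $\mathbb P$-null sets); (b) $\mathbb P\circ\tau_{t,x}^{-1}=\mathbb P$ for all $(t,x)\in\mathbb R\times\mathbb Z^d$, and $\mathbb P[A]\in\{0,1\}$ for every $A\in\mathcal F$ with $\mathbb P[A\,\triangle\,\tau_{t,x}(A)]=0$ for all $(t,x)$; (c) for every $A\in\mathcal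 F$ the map $(\omega,t,x)\mapsto \mathbf 1_A(\tau_{t,x}\omega)$ is jointly measurable. Put $(\mathcal L^\omega_t f)(x)=\sum_{y\sim x}\omega_t(x,y)(f(y)-f(x))$, $\mu^\omega_t(x)=\sum_{y\sim x}\omega_t(x,y)$, $\nu^\omega_t(x)=\sum_{y\sim x}\omega_t(x,y)^{-1}$, and $Q(n)=[0,n^2]\times B(n)$, where $B(n)$ is the closed ball of radius $n$ around $0$ for the graph distance. Let $$\|u\|_{p,p',Q(n)}=\Big(\frac1{n^2}\int_0^{n^2}\Big(\frac1{|B(n)|}\sum_{x\in B(n)}|u(t,x)|^p\Big)^{p'/p}dt\Big)^{1/p'},$$ with (essential) suprema for infinite exponents. Assume that there are $p,p',q,q'\in(1,\infty]$ with $$\frac1p\cdot\frac{p'}{p'-1}\cdot\frac{q'+1}{q'}+\frac1q<\frac2d$$ such that, $\mathbb P$-a.s., $\limsup_n\|\mu^\omega\|_{p,p',Q(n)}<\infty$ and $\limsup_n\|\nu^\omega\|_{q,q',Q(n)}<\infty$. Let $m(d\omega,dz)=\sum_{x\in\mathcal N}\omega_0(0,x)\,\mathbb P(d\omega)\otimes\delta_x(dz)$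 on $\Omega\times\mathcal N$, and let $L^2_{pot}$ be the closure in $L^2(\Omega\times\mathcal N,m)$ of the gradients $(\omega,z)\mapsto\varphi(\tau_{0,z}\omega)-\varphi(\omega)$ of bounded measurable $\varphi:\Omega\to\mathbb R$. The extension of $\psi\in L^2_{pot}$ is the (a.s. unique) $\Psi:\Omega\times\mathbb Z^d\to\mathbb R$ such that, for $\mathbb P$-a.e. $\omega$, $\Psi(\omega,x)=\sum_{i=1}^k\psi(\tau_{0,x_{i-1}}\omega,x_i-x_{i-1})$ for every $x$ and every nearest-neighbour path $0=x_0,\dots,x_k=x$ (in particular $\Psi(\omega,0)=0$). Let $L^2_{cov}$ be the set of measurable $\Psi:\Omega\times\mathbb Z^d\to\mathbb R$ that satisfy, for $\mathbb P$-a.e. $\omega$, $\Psi(\tau_{0,x}\omega,y-x)=\Psi(\omega,y)-\Psi(\omega,x)$ for all $x,y\in\mathbb Z^d$, and $\mathbb E[\sum_x\omega_0(0,x)\Psi(\omega,x)^2]<\infty$. Let $\Pi^j(\omega,x)=x^j$. **Theorem 2.5.** There is a function $\Phi_0=(\Phi_0^1,\dots,\Phi_0^d):\Omega\times\mathbb Z^d\to\mathbb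 R^d$ with $\Phi_0^j\in L^2_{cov}$ for all $j$ such that the following hold. (i) For every $j$, $\chi_0^j=\Pi^j-\Phi_0^j$ is the (a.s. unique) extension of an element of $L^2_{pot}$. (ii) For $\mathbb P$-a.e. $\omega$, $s\mapsto(\mathcal L^\omega_s\Phi_0(\tau_{s,0}\omega,\cdot))(0)$ is locally integrable, and the harmonic coordinates $$\Phi(\omega,t,x)=\Phi_0(\tau_{t,0}\omega,x)-\int_0^t\big(\mathcal L^\omega_s\Phi_0(\tau_{s,0}\omega,\cdot)\big)(0)\,ds$$ have the following properties: $t\mapsto\Phi(\omega,t,x)$ is locally absolutely continuous on $\mathbb R$ for every $x$; for almost every $t\in\mathbb R$ and all $x\in\mathbb Z^d$, $\Phi(\omega,\cdot,x)$ is differentiable at $t$ and $\partial_t\Phi(\omega,t,x)+\mathcal L^\omega_t\Phi(\omega,t,x)=0$; and $\Phi(\omega,0,0)=0$. (iii) For $\mathbb P$-a.e. $\omega$, $$\lim_{n\to\infty}\ \max_{(t,x)\in Q(n)}\frac1n\,\big|\Phi(\omega,t,x)-x\big|=0 .$$ -/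

import Mathlib

open MeasureTheory Filter Topology
open scoped ENNReal

noncomputable section

/-- The points of the lattice `ℤ^d`. -/
abbrev ZLat (d : ℕ) : Type := Fin d → ℤ

/-- The nearest neighbour graph `(ℤ^d, E_d)`: `x` and `y` are adjacent iff `|x - y| = 1`. -/
def latticeGraph (d : ℕ) : SimpleGraph (ZLat d) where
  Adj x y := ∑ i, |x i - y i| = 1
  symm := ⟨fun x y h => by simpa only [abs_sub_comm] using h⟩
  loopless := ⟨fun x h => by simp at h⟩

theorem latticeGraph_neighborSet_finite (d : ℕ) (x : ZLat d) :
    ((latticeGraph d).neighborSet x).Finite := by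
  refine (Set.finite_Icc (x - 1) (x + 1)).subset fun y hy => ?_
  have hy' : ∑ i, |x i - y i| = 1 := hy
  have key : ∀ i, |x i - y i| ≤ 1 := fun i => by
    rw [← hy']
    exact Finset.single_le_sum (f := fun i => |x i - y i|) (fun j _ => abs_nonneg _)
      (Finset.mem_univ i)
  refine ⟨fun i => ?_, fun i => ?_⟩ <;>
    · have := abs_le.mp (key i)
      simp only [Pi.sub_apply, Pi.add_apply, Pi.one_apply]
      omega

instance latticeGraph_locallyFinite (d : ℕ) : (latticeGraph d).LocallyFinite :=
  fun x => (latticeGraph_neighborSet_finite d x).fintype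

/-- The set `𝒩` of neighbours of the origin. -/
abbrev Nbr (d : ℕ) : Type := (latticeGraph d).neighborSet 0

/-- The set `E_d` of non-oriented nearest neighbour bonds. -/
abbrev Edge (d : ℕ) : Type := (latticeGraph d).edgeSet

theorem latticeGraph_adj_add {d : ℕ} {x y : ZLat d} (h : (latticeGraph d).Adj x y) (z : ZLat d) :
    (latticeGraph d).Adj (x + z) (y + z) := by
  have h' : ∑ i, |x i - y i| = 1 := h
  change ∑ i, |(x + z) i - (y + z) i| = 1
  simpa using h'

/-- Translation of edges: `{x, y} ↦ {x + z, y + z}`. -/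
def shiftEdge {d : ℕ} (z : ZLat d) (e : Edge d) : Edge d :=
  ⟨Sym2.map (· + z) e.1, by
    obtain ⟨e, he⟩ := e
    induction e using Sym2.ind with
    | _ x y => exact latticeGraph_adj_add he z⟩

/-- The environments `Ω = (0, ∞)^{ℝ × E_d}`; `ω t e` is the conductance of the edge `e` at
time `t`. (A plain `def`: the `σ`-algebra on `Ω` is a datum and not the product one.) -/
def Env (d : ℕ) : Type := ℝ → Edge d → Set.Ioi (0 : ℝ)

/-- The space-time shift `(τ_{s,z} ω)_t({x, y}) = ω_{t+s}({x + z, y + z})`. -/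
def shift {d : ℕ} (s : ℝ) (z : ZLat d) (ω : Env d) : Env d :=
  fun t e => ω (t + s) (shiftEdge z e)

open Classical in
/-- `ω_t(x, y)`, equal to the conductance of `{x, y}` if `x ∼ y` and to `0` otherwise. -/
def conduct {d : ℕ} (ω : Env d) (t : ℝ) (x y : ZLat d) : ℝ :=
  if h : (latticeGraph d).Adj x y then (ω t ⟨s(x, y), h⟩ : ℝ) else 0

/-- The generator `(ℒ_t^ω f)(x) = ∑_{y ∼ x} ω_t(x, y) (f(y) - f(x))`, for vector-valued `f`. -/
def gen {d : ℕ} {V : Type*} [AddCommGroup V] [Module ℝ V] (ω : Env d) (t : ℝ)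
    (f : ZLat d → V) (x : ZLat d) : V :=
  ∑ y ∈ (latticeGraph d).neighborFinset x, conduct ω t x y • (f y - f x)

/-- The standing assumption on the law `P` of the environment. Integrability of `ω_t(e)` and
`1 / ω_t(e)` contains their measurability with respect to the `P`-completed `σ`-algebra. -/
structure StationaryErgodicEnv {d : ℕ} [MeasurableSpace (Env d)] (P : Measure (Env d)) :
    Prop where
  integrable_cond : ∀ (t : ℝ) (e : Edge d), Integrable (fun ω : Env d => (ω t e : ℝ)) P
  integrable_inv : ∀ (t : ℝ) (e : Edge d), Integrable (fun ω : Env d => (ω t e : ℝ)⁻¹) P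
  stationary : ∀ (t : ℝ) (x : ZLat d), MeasurePreserving (shift t x) P P
  ergodic : ∀ A : Set (Env d), MeasurableSet A →
    (∀ (t : ℝ) (x : ZLat d), P (symmDiff A (shift t x '' A)) = 0) → P A = 0 ∨ P A = 1
  measurable_shift : ∀ A : Set (Env d), MeasurableSet A →
    Measurable fun p : Env d × ℝ × ZLat d => A.indicator (1 : Env d → ℝ) (shift p.2.1 p.2.2 p.1)

/-- `μ_t^ω(x) = ∑_{y ∼ x} ω_t(x, y)`. -/
def muW {d : ℕ} (ω : Env d) (t : ℝ) (x : ZLat d) : ℝ :=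
  ∑ y ∈ (latticeGraph d).neighborFinset x, conduct ω t x y

/-- `ν_t^ω(x) = ∑_{y ∼ x} 1 / ω_t(x, y)`. -/
def nuW {d : ℕ} (ω : Env d) (t : ℝ) (x : ZLat d) : ℝ :=
  ∑ y ∈ (latticeGraph d).neighborFinset x, (conduct ω t x y)⁻¹

/-- The ball `B(n)` around the origin in the graph distance. -/
def ball (d n : ℕ) : Set (ZLat d) := {x | (latticeGraph d).dist 0 x ≤ n}

/-- The space-time cylinder `Q(n) = [0, n²] × B(n)`. -/
def cylinder (d n : ℕ) : Set (ℝ × ZLat d) := Set.Icc (0 : ℝ) ((n : ℝ) ^ 2) ×ˢ ball d n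

/-- The averaged norm `‖u‖_{p, p', Q(n)}`: the `L^{p'}` norm, with respect to the uniform
distribution on `[0, n²]`, of the `L^p` norm with respect to the uniform distribution on `B(n)`.
For infinite exponents these are (essential) suprema. -/
def cylNorm {d : ℕ} (p p' : ℝ≥0∞) (n : ℕ) (u : ℝ → ZLat d → ℝ) : ℝ≥0∞ :=
  eLpNorm (fun t => eLpNorm (u t) p (ProbabilityTheory.uniformOn (ball d n))) p'
    (ProbabilityTheory.cond volume (Set.Icc (0 : ℝ) ((n : ℝ) ^ 2)))

/-- The moment condition. In `ℝ≥0∞`, the factors `(1 - 1/p')⁻¹` and `1 + 1/q'` are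
`p' / (p' - 1)` and `(q' + 1) / q'`, with the value `1` at infinite exponents. -/
def MomentCondition {d : ℕ} [MeasurableSpace (Env d)] (P : Measure (Env d)) : Prop :=
  ∃ p p' q q' : ℝ≥0∞, 1 < p ∧ 1 < p' ∧ 1 < q ∧ 1 < q' ∧
    p⁻¹ * (1 - p'⁻¹)⁻¹ * (1 + q'⁻¹) + q⁻¹ < 2 / (d : ℝ≥0∞) ∧
    ∀ᵐ ω ∂P,
      limsup (fun n : ℕ => cylNorm p p' n (muW ω)) atTop < ∞ ∧
      limsup (fun n : ℕ => cylNorm q q' n (nuW ω)) atTop < ∞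

/-- The measure `m(dω, dz) = ∑_x ω_0(0, x) P(dω) ⊗ δ_x(dz)` on `Ω × 𝒩`. -/
def mMeasure {d : ℕ} [MeasurableSpace (Env d)] (P : Measure (Env d)) :
    Measure (Env d × Nbr d) :=
  ∑ x : Nbr d, (P.withDensity fun ω => ENNReal.ofReal (conduct ω 0 0 x)).prod (Measure.dirac x)

/-- The horizontal gradient `Dφ(ω, x) = φ(τ_{0,x} ω) - φ(ω)`. -/
def hgrad {d : ℕ} (φ : Env d → ℝ) (p : Env d × Nbr d) : ℝ :=
  φ (shift 0 (p.2 : ZLat d) p.1) - φ p.1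

/-- `L²_pot`: the closure in `L²(Ω × 𝒩, m)` of the gradients of bounded functions. -/
def L2pot {d : ℕ} [MeasurableSpace (Env d)] (P : Measure (Env d)) :
    Set (Lp ℝ 2 (mMeasure P)) :=
  closure {f | ∃ φ : Env d → ℝ, Measurable φ ∧ (∃ C : ℝ, ∀ ω, |φ ω| ≤ C) ∧
    f =ᵐ[mMeasure P] hgrad φ}

/-- The increment `y - x ∈ 𝒩` of an oriented edge `(x, y)`. -/
def dartStep {d : ℕ} (e : (latticeGraph d).Dart) : Nbr d :=
  ⟨e.snd - e.fst, by
    have h := latticeGraph_adj_add e.adj (-e.fst)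
    simpa [sub_eq_add_neg] using h⟩

/-- `Ψ` is the extension of `ψ : Ω × 𝒩 → ℝ`: almost surely, for every nearest neighbour path
`0 = x_0, …, x_k = x`, `Ψ(ω, x) = ∑_{i=1}^k ψ(τ_{0,x_{i-1}} ω, x_i - x_{i-1})`. -/
def IsExtension {d : ℕ} [MeasurableSpace (Env d)] (P : Measure (Env d))
    (ψ : Env d × Nbr d → ℝ) (Ψ : Env d → ZLat d → ℝ) : Prop :=
  ∀ᵐ ω ∂P, ∀ (x : ZLat d) (w : (latticeGraph d).Walk 0 x),
    Ψ ω x = (w.darts.map fun e => ψ (shift 0 e.fst ω, dartStep e)).sum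

/-- `Ψ ∈ L²_cov`: `Ψ` is measurable, satisfies the cocycle property (in space), and
`E[∑_x ω_0(0, x) Ψ(ω, x)²] < ∞`. -/
structure IsL2cov {d : ℕ} [MeasurableSpace (Env d)] (P : Measure (Env d))
    (Ψ : Env d → ZLat d → ℝ) : Prop where
  measurable : Measurable fun p : Env d × ZLat d => Ψ p.1 p.2
  cocycle : ∀ᵐ ω ∂P, ∀ x y : ZLat d, Ψ (shift 0 x ω) (y - x) = Ψ ω y - Ψ ω x
  norm_lt_top :
    ∫⁻ ω, ∑ x : Nbr d, ENNReal.ofReal (conduct ω 0 0 x * Ψ ω x ^ 2) ∂P < ∞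

/-- The integrand `s ↦ (ℒ_s^ω Φ₀(τ_{s,0} ω, ·))(0)`. -/
def driftAtZero {d : ℕ} (Φ₀ : Env d → ZLat d → EuclideanSpace ℝ (Fin d)) (ω : Env d) (s : ℝ) :
    EuclideanSpace ℝ (Fin d) :=
  gen ω s (Φ₀ (shift s 0 ω)) 0

/-- `Φ(ω, t, x) = Φ₀(τ_{t,0} ω, x) - ∫_0^t (ℒ_s^ω Φ₀(τ_{s,0} ω, ·))(0) ds`. -/
def harmCoord {d : ℕ} (Φ₀ : Env d → ZLat d → EuclideanSpace ℝ (Fin d)) (ω : Env d) (t : ℝ)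
    (x : ZLat d) : EuclideanSpace ℝ (Fin d) :=
  Φ₀ (shift t 0 ω) x - ∫ s in (0 : ℝ)..t, driftAtZero Φ₀ ω s

/-- The position field `Π(x) = x`, with values in `ℝ^d`. -/
def posField {d : ℕ} (x : ZLat d) : EuclideanSpace ℝ (Fin d) :=
  WithLp.toLp 2 fun i => (x i : ℝ)

end

set_option linter.unusedSectionVars false
set_option linter.style.longLine false

noncomputable section

/-! ### Shifts, neighbours and measurable versions of the conductances -/

section Lattice

variable {d : ℕ}

/-! Construction. For an odd function q on 𝒩, the space-time corrector X should solve ∂_t X(t,x) =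
-∑_z ω_t(x,x+z) (X(t,x+z) - X(t,x) + q(z)), and only its spatial gradient can be expected to be
stationary. The unknown is therefore a field ψ ∈ L²_pot, the gradient of -X, and the equation is
tested only with divergences f = ∑_z (a_z∘τ_{0,-z} - a_z) of functions a_z differentiable along the
time shift, so that the time derivative can be written with ψ alone. Since E[f' f] = 0, the problem
is coercive in the gradient, and a theorem of Lions type (`exists_inner_eq_of_coercive`) yields ψ
(`exists_weak_solution`). Testing with time averages of indicators identifies the time increments of
ψ as integrals of differences of the drift V = ∑_z ω_0(0,z)(q(z) - ψ(·,z)) (`ae_time_increment`).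
Hence the extension χ of ψ has a version for which, almost surely and for all t and x, X(t,x) =
-χ(ω,x) - ∫_0^t V(τ_{s,x}ω) ds = -χ(τ_{t,0}ω,x) - ∫_0^t V(τ_{s,0}ω) ds. With q(z) = z^j, the
function x^j + X is the j-th harmonic coordinate. The first formula shows that it solves the
equation, the second that it has the form required in (ii).

Sublinearity in mean (`IsCorrector.ae_mean_sublinear`). In space, ψ is approximated in L¹ by
gradients of bounded functions. A Poincaré inequality then bounds the oscillation of X at scale n by
n times a small error plus a constant. In time, the mean of X against a smooth weight η on B(n)
changes at the rate of a weighted sum of the divergence of the flux. The flux is split into a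
spatially invariant part, spatial coboundaries and a small error. Summation by parts kills the
first, gains n⁻² on the second and n⁻¹ on the third, and over a time n² this is O(1) plus a small
multiple of n. All errors are controlled simultaneously at all scales by a weak (1,1) maximal
inequality over parabolic cylinders (`measure_maxFun_le`).

From mean to maximum. De Giorgi's first lemma (`exists_le_one_of_mean_le`) says that a solution
bounded by L on Q(N) with small mean positive part is at most one on [0,N²/4]×B(N/2). Its
ingredients are a Caccioppoli inequality, a Sobolev inequality weighted by the conductances
(`weighted_sobolev`) and interpolation in mixed norms; the moment condition is exactly what makes
the exponent of the iteration larger than one (`exists_exponentSystem`). A barrier added to the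
level replaces cutoff functions, so every step of the iteration lives on the same cylinder.

Conclusion. Applied to X minus a constant, suitably normalised, the lemma gives max_{Q(n)} |X| ≤ ε
max(max_{Q(2n)} |X|, n) for all large n (`exists_step_le`). Together with an a priori polynomial
bound (`IsCorrector.ae_polynomial_growth`), iteration over dyadic scales turns this into max_{Q(n)}
|X| = o(n) (`sublinear_of_le_max`). -/

theorem shiftEdge_shiftEdge (z x : ZLat d) (e : Edge d) :
    shiftEdge x (shiftEdge z e) = shiftEdge (z + x) e := by
  obtain ⟨e, he⟩ := e
  apply Subtype.ext
  induction e using Sym2.ind with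
  | _ a b => simp [shiftEdge, add_assoc]

theorem shiftEdge_zero (e : Edge d) : shiftEdge 0 e = e := by
  obtain ⟨e, he⟩ := e
  apply Subtype.ext
  induction e using Sym2.ind with
  | _ a b => simp [shiftEdge]

theorem shift_shift (s t : ℝ) (z x : ZLat d) (ω : Env d) :
    shift s z (shift t x ω) = shift (s + t) (z + x) ω := by
  funext r e
  simp [shift, shiftEdge_shiftEdge, add_assoc]

theorem shift_zero (ω : Env d) : shift 0 0 ω = ω := by
  funext r e
  simp [shift, shiftEdge_zero]

theorem latticeGraph_adj_add_iff {x y : ZLat d} (z : ZLat d) :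
    (latticeGraph d).Adj (x + z) (y + z) ↔ (latticeGraph d).Adj x y := by
  refine ⟨fun h => ?_, fun h => latticeGraph_adj_add h z⟩
  simpa using latticeGraph_adj_add h (-z)

theorem conduct_shift (ω : Env d) (s t : ℝ) (z x y : ZLat d) :
    conduct (shift s z ω) t x y = conduct ω (t + s) (x + z) (y + z) := by
  unfold conduct
  by_cases h : (latticeGraph d).Adj x y
  · rw [dif_pos h, dif_pos (latticeGraph_adj_add h z)]
    rfl
  · rw [dif_neg h, dif_neg (by rwa [latticeGraph_adj_add_iff])]

theorem conduct_comm (ω : Env d) (t : ℝ) (x y : ZLat d) :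
    conduct ω t x y = conduct ω t y x := by
  unfold conduct
  by_cases h : (latticeGraph d).Adj x y
  · rw [dif_pos h, dif_pos h.symm]
    congr 3
    exact Sym2.eq_swap
  · rw [dif_neg h, dif_neg (fun h' => h h'.symm)]

theorem conduct_pos {ω : Env d} {t : ℝ} {x y : ZLat d} (h : (latticeGraph d).Adj x y) :
    0 < conduct ω t x y := by
  unfold conduct
  rw [dif_pos h]
  exact (ω t ⟨s(x, y), h⟩).2

theorem conduct_nonneg (ω : Env d) (t : ℝ) (x y : ZLat d) : 0 ≤ conduct ω t x y := by
  by_cases h : (latticeGraph d).Adj x y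
  · exact (conduct_pos h).le
  · simp [conduct, h]

theorem Nbr.adj (z : Nbr d) : (latticeGraph d).Adj 0 (z : ZLat d) := z.2

theorem Nbr.adj_add (z : Nbr d) (x : ZLat d) : (latticeGraph d).Adj x (x + z) := by
  have := latticeGraph_adj_add z.adj x
  simpa [add_comm] using this

/-- The opposite neighbour `-z`. -/
def Nbr.neg (z : Nbr d) : Nbr d :=
  ⟨-(z : ZLat d), by
    have := (latticeGraph_adj_add z.adj (-(z : ZLat d))).symm
    simpa using this⟩

@[simp] theorem Nbr.coe_neg (z : Nbr d) : (z.neg : ZLat d) = -(z : ZLat d) := rfl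

@[simp] theorem Nbr.neg_neg (z : Nbr d) : z.neg.neg = z := by
  apply Subtype.ext
  simp

theorem Nbr.sum_neg {M : Type*} [AddCommMonoid M] (f : Nbr d → M) :
    ∑ z : Nbr d, f z.neg = ∑ z : Nbr d, f z :=
  Fintype.sum_equiv ⟨Nbr.neg, Nbr.neg, Nbr.neg_neg, Nbr.neg_neg⟩ _ _ fun _ => rfl

/-- The neighbour of the origin given by a pair of adjacent points. -/
def Nbr.ofAdj {x y : ZLat d} (h : (latticeGraph d).Adj x y) : Nbr d :=
  ⟨y - x, by
    have := latticeGraph_adj_add h (-x)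
    simpa [sub_eq_add_neg] using this⟩

theorem sum_neighborFinset {M : Type*} [AddCommMonoid M] (x : ZLat d) (f : ZLat d → M) :
    ∑ y ∈ (latticeGraph d).neighborFinset x, f y = ∑ z : Nbr d, f (x + z) := by
  symm
  refine Finset.sum_bij (fun z _ => x + (z : ZLat d)) ?_ ?_ ?_ ?_
  · intro z _
    simpa using z.adj_add x
  · intro a _ b _ h
    exact Subtype.ext (by simpa using h)
  · intro y hy
    have hy' : (latticeGraph d).Adj x y := by simpa using hy
    exact ⟨Nbr.ofAdj hy', Finset.mem_univ _, by simp [Nbr.ofAdj]⟩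
  · intro z _
    rfl

theorem latticeGraph_adj_single (x : ZLat d) (i : Fin d) {c : ℤ} (hc : |c| = 1) :
    (latticeGraph d).Adj x (x + Pi.single i c) := by
  have : ∀ j, |x j - (x + Pi.single i c : ZLat d) j| = if j = i then 1 else 0 := by
    intro j
    by_cases h : j = i
    · subst h
      simp [hc]
    · simp [h]
  have key : ∑ j, |x j - (x + Pi.single i c : ZLat d) j| = 1 := by
    rw [Finset.sum_congr rfl fun j _ => this j]
    simp
  exact key

/-- The `ℓ¹` norm of a lattice point. -/
def l1norm (x : ZLat d) : ℕ := ∑ i, (x i).natAbs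

theorem l1norm_cast (x : ZLat d) : ((l1norm x : ℕ) : ℤ) = ∑ i, |x i| := by
  simp [l1norm]

theorem l1norm_sub_of_adj {x y : ZLat d} (h : (latticeGraph d).Adj x y) : l1norm (y - x) = 1 := by
  have h' : ∑ i, |x i - y i| = 1 := h
  have := l1norm_cast (y - x)
  simp only [Pi.sub_apply, abs_sub_comm] at this
  rw [h'] at this
  exact_mod_cast this

theorem l1norm_add_le (x y : ZLat d) : l1norm (x + y) ≤ l1norm x + l1norm y := by
  unfold l1norm
  rw [← Finset.sum_add_distrib]
  exact Finset.sum_le_sum fun i _ => Int.natAbs_add_le _ _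

theorem l1norm_neg (x : ZLat d) : l1norm (-x) = l1norm x := by
  simp [l1norm]

theorem l1norm_zero : l1norm (0 : ZLat d) = 0 := by simp [l1norm]

theorem Nbr.l1norm_eq (z : Nbr d) : l1norm (z : ZLat d) = 1 := by
  simpa using l1norm_sub_of_adj z.adj

theorem l1norm_sub_le_length {x y : ZLat d} (w : (latticeGraph d).Walk x y) :
    l1norm (y - x) ≤ w.length := by
  induction w with
  | nil => simp [l1norm]
  | @cons a b c h w ih =>
    have : c - a = (c - b) + (b - a) := by abel
    rw [this, SimpleGraph.Walk.length_cons]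
    exact (l1norm_add_le _ _).trans (add_le_add ih (l1norm_sub_of_adj h).le)

/-- Moving a coordinate that is still wrong by one unit towards its target lowers the ℓ¹ distance by
exactly one. This identifies the graph distance with the ℓ¹ distance. -/
theorem exists_walk_length (x y : ZLat d) :
    ∃ w : (latticeGraph d).Walk x y, w.length = l1norm (y - x) := by
  induction hn : l1norm (y - x) generalizing x with
  | zero =>
    have : x = y := by
      have h : ∀ i, y i - x i = 0 := by
        intro i
        have := Finset.sum_eq_zero_iff.mp (show ∑ i, ((y - x) i).natAbs = 0 from hn) i
          (Finset.mem_univ i)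
        simpa using this
      funext i
      linarith [h i]
    subst this
    exact ⟨.nil, rfl⟩
  | succ n ih =>
    have : ∃ i, (y - x) i ≠ 0 := by
      by_contra! h
      simp [l1norm, h] at hn
    obtain ⟨i, hi⟩ := this
    have hc : |Int.sign ((y - x) i)| = 1 := by
      rcases lt_or_gt_of_ne hi with h | h
      · rw [Int.sign_eq_neg_one_of_neg h]; rfl
      · rw [Int.sign_eq_one_of_pos h]; rfl
    have hlen : l1norm (y - (x + Pi.single i (Int.sign ((y - x) i)))) = n := by
      have key : l1norm (y - (x + Pi.single i (Int.sign ((y - x) i)))) + 1 = l1norm (y - x) := by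
        unfold l1norm
        rw [← Finset.add_sum_erase _ _ (Finset.mem_univ i),
          ← Finset.add_sum_erase _ (fun j => ((y - x) j).natAbs) (Finset.mem_univ i)]
        have h1 : ∀ j ∈ Finset.univ.erase i,
            ((y - (x + Pi.single i (Int.sign ((y - x) i))) : ZLat d) j).natAbs
              = ((y - x) j).natAbs := by
          intro j hj
          have : j ≠ i := Finset.ne_of_mem_erase hj
          simp [this]
        rw [Finset.sum_congr rfl h1]
        have h2 : ((y - (x + Pi.single i (Int.sign ((y - x) i))) : ZLat d) i).natAbs + 1
            = ((y - x) i).natAbs := by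
          simp only [Pi.sub_apply, Pi.add_apply, Pi.single_eq_same] at hi ⊢
          rcases lt_or_gt_of_ne hi with h | h
          · rw [Int.sign_eq_neg_one_of_neg h]; omega
          · rw [Int.sign_eq_one_of_pos h]; omega
        omega
      omega
    obtain ⟨w, hw⟩ := ih _ hlen
    exact ⟨.cons (latticeGraph_adj_single x i hc) w, by simp [hw]⟩

theorem latticeGraph_dist (x y : ZLat d) : (latticeGraph d).dist x y = l1norm (y - x) := by
  obtain ⟨w, hw⟩ := exists_walk_length x y
  refine le_antisymm (hw ▸ SimpleGraph.dist_le w) ?_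
  obtain ⟨w', hw'⟩ := (w.reachable).exists_walk_length_eq_dist
  rw [← hw']
  exact l1norm_sub_le_length w'

theorem mem_ball_iff {n : ℕ} {x : ZLat d} : x ∈ ball d n ↔ l1norm x ≤ n := by
  simp [ball, latticeGraph_dist]

theorem natAbs_le_l1norm (x : ZLat d) (i : Fin d) : (x i).natAbs ≤ l1norm x :=
  Finset.single_le_sum (f := fun i => (x i).natAbs) (fun _ _ => Nat.zero_le _) (Finset.mem_univ i)

theorem ball_subset_Icc (n : ℕ) : ball d n ⊆ Set.Icc (fun _ => -(n : ℤ)) (fun _ => (n : ℤ)) := by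
  intro x hx
  rw [mem_ball_iff] at hx
  refine ⟨fun i => ?_, fun i => ?_⟩ <;>
  · have := natAbs_le_l1norm x i
    simp only
    omega

theorem ball_finite (d n : ℕ) : (ball d n).Finite :=
  (Set.finite_Icc _ _).subset (ball_subset_Icc n)

/-- The ball `B(n)` as a finset. -/
def fball (d n : ℕ) : Finset (ZLat d) := (ball_finite d n).toFinset

theorem mem_fball {n : ℕ} {x : ZLat d} : x ∈ fball d n ↔ l1norm x ≤ n := by
  simp [fball, mem_ball_iff]

theorem coe_fball (n : ℕ) : (fball d n : Set (ZLat d)) = ball d n := by simp [fball]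

theorem fball_nonempty (n : ℕ) : (fball d n).Nonempty := ⟨0, by simp [mem_fball, l1norm_zero]⟩

theorem fball_card_pos (n : ℕ) : 0 < (fball d n).card := (fball_nonempty n).card_pos

theorem fball_mono {m n : ℕ} (h : m ≤ n) : fball d m ⊆ fball d n := fun x hx => by
  rw [mem_fball] at hx ⊢
  omega

theorem fball_card_le (n : ℕ) : (fball d n).card ≤ (2 * n + 1) ^ d := by
  have h : fball d n ⊆ Finset.Icc (fun _ => -(n : ℤ)) (fun _ => (n : ℤ)) := by
    intro x hx
    have := ball_subset_Icc n ((coe_fball n ▸ hx : x ∈ ball d n))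
    simpa using this
  refine (Finset.card_le_card h).trans ?_
  rw [Pi.card_Icc]
  simp only [Int.card_Icc, Finset.prod_const, Finset.card_univ, Fintype.card_fin]
  apply le_of_eq
  congr 1
  omega

/-- A cube of radius ⌊n/d⌋ fits into the ℓ¹ ball of radius n. Together with the enclosing cube this
makes volume doubling explicit, as used in all covering and averaging arguments. -/
theorem le_fball_card (n : ℕ) : (2 * (n / d) + 1) ^ d ≤ (fball d n).card := by
  have h : Finset.Icc (fun _ => -((n / d : ℕ) : ℤ)) (fun _ => ((n / d : ℕ) : ℤ)) ⊆ fball d n := by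
    intro x hx
    rw [Finset.mem_Icc] at hx
    rw [mem_fball]
    have : l1norm x ≤ ∑ _i : Fin d, n / d := by
      refine Finset.sum_le_sum fun i _ => ?_
      have h1 : -((n / d : ℕ) : ℤ) ≤ x i := hx.1 i
      have h2 : x i ≤ ((n / d : ℕ) : ℤ) := hx.2 i
      omega
    refine this.trans ?_
    simp only [Finset.sum_const, Finset.card_univ, Fintype.card_fin, smul_eq_mul]
    exact Nat.mul_div_le n d
  refine le_trans ?_ (Finset.card_le_card h)
  rw [Pi.card_Icc]
  simp only [Int.card_Icc, Finset.prod_const, Finset.card_univ, Fintype.card_fin]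
  apply le_of_eq
  congr 1
  omega

theorem fball_card_mul_le (hd : d ≠ 0) (a n : ℕ) :
    (fball d (a * n)).card ≤ (2 * a * d + 1) ^ d * (fball d n).card := by
  refine (fball_card_le _).trans (le_trans ?_ (Nat.mul_le_mul_left _ (le_fball_card n)))
  rw [← mul_pow]
  apply Nat.pow_le_pow_left
  have h : n < d * (n / d) + d := by
    have := Nat.div_add_mod n d
    have := Nat.mod_lt n (Nat.pos_of_ne_zero hd)
    omega
  have h2 : a * n ≤ a * d * (n / d) + a * d := by
    calc a * n ≤ a * (d * (n / d) + d) := Nat.mul_le_mul_left _ h.le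
      _ = _ := by ring
  nlinarith [Nat.zero_le (a * d * (n / d)), Nat.zero_le (n / d)]

end Lattice

/-! ### Stationarity along orbits, and measurable versions of the conductances. -/

section Stationary

variable {d : ℕ} [MeasurableSpace (Env d)] {P : Measure (Env d)}

theorem StationaryErgodicEnv.measurable_joint (hP : StationaryErgodicEnv P) :
    Measurable fun p : Env d × ℝ × ZLat d => shift p.2.1 p.2.2 p.1 := by
  intro A hA
  have h := hP.measurable_shift A hA (measurableSet_singleton (1 : ℝ))
  convert h using 1
  ext p
  by_cases hp : shift p.2.1 p.2.2 p.1 ∈ A <;> simp [hp]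

theorem StationaryErgodicEnv.measurable_time (hP : StationaryErgodicEnv P) (x : ZLat d) :
    Measurable fun p : Env d × ℝ => shift p.2 x p.1 :=
  hP.measurable_joint.comp (f := fun p : Env d × ℝ => (p.1, p.2, x)) (by fun_prop)

theorem StationaryErgodicEnv.measurable_orbit (hP : StationaryErgodicEnv P) (x : ZLat d)
    (ω : Env d) : Measurable fun s : ℝ => shift s x ω :=
  (hP.measurable_time x).comp (f := fun s : ℝ => (ω, s)) (by fun_prop)

theorem StationaryErgodicEnv.measurable_shift' (hP : StationaryErgodicEnv P) (s : ℝ)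
    (x : ZLat d) : Measurable (shift s x : Env d → Env d) :=
  (hP.stationary s x).measurable

theorem StationaryErgodicEnv.ae_shift (hP : StationaryErgodicEnv P) {Q : Env d → Prop}
    (h : ∀ᵐ ω ∂P, Q ω) (s : ℝ) (x : ZLat d) : ∀ᵐ ω ∂P, Q (shift s x ω) :=
  (hP.stationary s x).quasiMeasurePreserving.ae h

theorem StationaryErgodicEnv.ae_shift_space (hP : StationaryErgodicEnv P) {Q : Env d → Prop}
    (h : ∀ᵐ ω ∂P, Q ω) (s : ℝ) : ∀ᵐ ω ∂P, ∀ x, Q (shift s x ω) :=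
  ae_all_iff.mpr fun x => hP.ae_shift h s x

/-- Fubini: the exceptional set is enlarged to a measurable null set, whose preimage under (ω,s) ↦
τ_{s,x}ω is jointly measurable and has null time sections by stationarity. This passes almost sure
statements to almost every time of an orbit. -/
theorem StationaryErgodicEnv.ae_ae_shift [IsProbabilityMeasure P] (hP : StationaryErgodicEnv P)
    {Q : Env d → Prop} (h : ∀ᵐ ω ∂P, Q ω) :
    ∀ᵐ ω ∂P, ∀ᵐ s : ℝ, ∀ x, Q (shift s x ω) := by
  have key : ∀ x, ∀ᵐ ω ∂P, ∀ᵐ s : ℝ, Q (shift s x ω) := by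
    intro x
    have hN : P (toMeasurable P {ω | ¬ Q ω}) = 0 := by
      rw [measure_toMeasurable]
      exact h
    have hm : MeasurableSet ((fun p : Env d × ℝ => shift p.2 x p.1) ⁻¹'
        (toMeasurable P {ω | ¬ Q ω})) :=
      hP.measurable_time x (measurableSet_toMeasurable _ _)
    have h0 : (P.prod (volume : Measure ℝ)) ((fun p : Env d × ℝ => shift p.2 x p.1) ⁻¹'
        (toMeasurable P {ω | ¬ Q ω})) = 0 := by
      rw [Measure.prod_apply_symm hm]
      have : ∀ s : ℝ, P ((fun ω => (ω, s)) ⁻¹' ((fun p : Env d × ℝ => shift p.2 x p.1) ⁻¹'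
          (toMeasurable P {ω | ¬ Q ω}))) = 0 := by
        intro s
        have := (hP.stationary s x).measure_preimage
          (measurableSet_toMeasurable P {ω | ¬ Q ω}).nullMeasurableSet
        rw [hN] at this
        exact this
      simp [this]
    have h1 : ∀ᵐ p ∂(P.prod (volume : Measure ℝ)), Q (shift p.2 x p.1) := by
      refine measure_mono_null (fun p hp => ?_) h0
      exact subset_toMeasurable P _ hp
    exact Measure.ae_ae_of_ae_prod h1
  filter_upwards [ae_all_iff.mpr key] with ω hω
  exact ae_all_iff.mpr hω

theorem StationaryErgodicEnv.lintegral_shift (hP : StationaryErgodicEnv P) {f : Env d → ℝ≥0∞}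
    (hf : Measurable f) (s : ℝ) (x : ZLat d) :
    ∫⁻ ω, f (shift s x ω) ∂P = ∫⁻ ω, f ω ∂P :=
  (hP.stationary s x).lintegral_comp hf

theorem StationaryErgodicEnv.integral_shift (hP : StationaryErgodicEnv P) {f : Env d → ℝ}
    (hf : Measurable f) (s : ℝ) (x : ZLat d) :
    ∫ ω, f (shift s x ω) ∂P = ∫ ω, f ω ∂P := by
  have h := (hP.stationary s x)
  conv_rhs => rw [← h.map_eq]
  rw [integral_map h.measurable.aemeasurable hf.aestronglyMeasurable]

theorem StationaryErgodicEnv.integrable_shift (hP : StationaryErgodicEnv P) {f : Env d → ℝ}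
    (hf : Integrable f P) (s : ℝ) (x : ZLat d) : Integrable (fun ω => f (shift s x ω)) P :=
  (hP.stationary s x).integrable_comp_of_integrable hf

/-- The integral over a bounded time window, in mean. -/
theorem StationaryErgodicEnv.lintegral_lintegral_shift [IsProbabilityMeasure P]
    (hP : StationaryErgodicEnv P)
    {f : Env d → ℝ≥0∞} (hf : Measurable f) (x : ZLat d) (ν : Measure ℝ) [SFinite ν] :
    ∫⁻ ω, ∫⁻ s, f (shift s x ω) ∂ν ∂P = ν Set.univ * ∫⁻ ω, f ω ∂P := by
  rw [lintegral_lintegral_swap (f := fun ω s => f (shift s x ω))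
    (hf.comp (hP.measurable_time x)).aemeasurable]
  simp_rw [hP.lintegral_shift hf]
  rw [lintegral_const, mul_comm]

/-- By stationarity the integral of |f| over a bounded time window has finite mean, hence is finite
almost surely; countably many windows suffice. -/
theorem StationaryErgodicEnv.ae_locallyIntegrable [IsProbabilityMeasure P]
    (hP : StationaryErgodicEnv P) {f : Env d → ℝ} (hfm : Measurable f) (hf : Integrable f P) :
    ∀ᵐ ω ∂P, ∀ x, LocallyIntegrable (fun s => f (shift s x ω)) volume := by
  rw [ae_all_iff]
  intro x
  have key : ∀ n : ℕ, ∀ᵐ ω ∂P, IntegrableOn (fun s => f (shift s x ω)) (Set.Icc (-n : ℝ) n) := by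
    intro n
    have hlt : ∫⁻ ω, (∫⁻ s in Set.Icc (-n : ℝ) n, ‖f (shift s x ω)‖ₑ) ∂P ≠ ∞ := by
      rw [hP.lintegral_lintegral_shift (f := fun ω => ‖f ω‖ₑ) hfm.enorm x]
      refine ENNReal.mul_ne_top ?_ hf.2.ne
      simp
    have hm : Measurable fun ω => ∫⁻ s in Set.Icc (-n : ℝ) n, ‖f (shift s x ω)‖ₑ :=
      Measurable.lintegral_prod_right' (f := fun p : Env d × ℝ => ‖f (shift p.2 x p.1)‖ₑ)
        (hfm.comp (hP.measurable_time x)).enorm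
    filter_upwards [ae_lt_top hm hlt] with ω hω
    exact ⟨(hfm.comp (hP.measurable_orbit x ω)).aestronglyMeasurable, hω⟩
  filter_upwards [ae_all_iff.mpr key] with ω hω
  rw [locallyIntegrable_iff]
  intro K hK
  obtain ⟨C, hC⟩ := hK.isBounded.subset_closedBall 0
  obtain ⟨n, hn⟩ := exists_nat_ge C
  refine (hω n).mono_set (hC.trans ?_)
  rw [Real.closedBall_eq_Icc]
  exact Set.Icc_subset_Icc (by linarith) (by linarith)

theorem aemeasurable_conduct (hP : StationaryErgodicEnv P) (z : Nbr d) :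
    AEMeasurable (fun ω : Env d => conduct ω 0 0 z) P := by
  have := (hP.integrable_cond 0 ⟨s(0, (z : ZLat d)), z.adj⟩).aestronglyMeasurable.aemeasurable
  simpa [conduct, z.adj] using this

/-- A measurable, everywhere positive version of `ω ↦ ω_0(0, z)`. -/
def wver (hP : StationaryErgodicEnv P) (z : Nbr d) (ω : Env d) : ℝ :=
  -- The default value 1 on a null set makes positivity, and hence division by the weight,
  -- unconditional.
  if 0 < (aemeasurable_conduct hP z).mk _ ω then (aemeasurable_conduct hP z).mk _ ω else 1

theorem measurable_wver (hP : StationaryErgodicEnv P) (z : Nbr d) : Measurable (wver hP z) :=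
  Measurable.ite (measurableSet_lt measurable_const (AEMeasurable.measurable_mk _))
    (AEMeasurable.measurable_mk _) measurable_const

theorem wver_pos (hP : StationaryErgodicEnv P) (z : Nbr d) (ω : Env d) : 0 < wver hP z ω := by
  unfold wver
  split_ifs with h
  · exact h
  · exact one_pos

theorem wver_ae_eq (hP : StationaryErgodicEnv P) :
    ∀ᵐ ω ∂P, ∀ z, wver hP z ω = conduct ω 0 0 z := by
  rw [ae_all_iff]
  intro z
  filter_upwards [(aemeasurable_conduct hP z).ae_eq_mk] with ω hω
  have : 0 < (aemeasurable_conduct hP z).mk _ ω := by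
    rw [← hω]
    exact conduct_pos z.adj
  rw [wver, if_pos this, ← hω]

theorem integrable_wver (hP : StationaryErgodicEnv P) (z : Nbr d) : Integrable (wver hP z) P := by
  have := (hP.integrable_cond 0 ⟨s(0, (z : ZLat d)), z.adj⟩)
  refine this.congr ?_
  filter_upwards [wver_ae_eq hP] with ω hω
  rw [hω z]
  simp [conduct, z.adj]

theorem integrable_inv_wver (hP : StationaryErgodicEnv P) (z : Nbr d) :
    Integrable (fun ω => (wver hP z ω)⁻¹) P := by
  have := (hP.integrable_inv 0 ⟨s(0, (z : ZLat d)), z.adj⟩)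
  refine this.congr ?_
  filter_upwards [wver_ae_eq hP] with ω hω
  rw [hω z]
  simp [conduct, z.adj]

/-- Measurability of the conductances is assumed only at fixed times. Through this identity they
become measurable in time, up to null sets, along almost every orbit. -/
theorem wver_ae_ae_eq [IsProbabilityMeasure P] (hP : StationaryErgodicEnv P) :
    ∀ᵐ ω ∂P, ∀ᵐ s : ℝ, ∀ x, ∀ z, wver hP z (shift s x ω) = conduct ω s x (x + z) := by
  filter_upwards [hP.ae_ae_shift (wver_ae_eq hP)] with ω hω
  filter_upwards [hω] with s hs x z
  rw [hs x z, conduct_shift]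
  simp [add_comm]

/-- Symmetry of the conductances, in terms of the measurable versions. -/
theorem wver_neg_ae (hP : StationaryErgodicEnv P) (z : Nbr d) :
    ∀ᵐ ω ∂P, wver hP z.neg (shift 0 z ω) = wver hP z ω := by
  filter_upwards [wver_ae_eq hP, hP.ae_shift (wver_ae_eq hP) 0 (z : ZLat d)] with ω h1 h2
  rw [h1, h2, conduct_shift]
  simp [conduct_comm ω 0 (z : ZLat d) 0]

theorem mMeasure_eq (hP : StationaryErgodicEnv P) :
    mMeasure P = ∑ z : Nbr d,
      (P.withDensity fun ω => ENNReal.ofReal (wver hP z ω)).prod (Measure.dirac z) := by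
  unfold mMeasure
  refine Finset.sum_congr rfl fun z _ => ?_
  congr 1
  apply withDensity_congr_ae
  filter_upwards [wver_ae_eq hP] with ω hω
  rw [hω z]

theorem lintegral_mMeasure [IsProbabilityMeasure P] (hP : StationaryErgodicEnv P)
    {F : Env d × Nbr d → ℝ≥0∞} (hF : Measurable F) :
    ∫⁻ p, F p ∂(mMeasure P) = ∑ z, ∫⁻ ω, ENNReal.ofReal (wver hP z ω) * F (ω, z) ∂P := by
  rw [mMeasure_eq hP, lintegral_finsetSum_measure]
  refine Finset.sum_congr rfl fun z _ => ?_
  rw [Measure.prod_dirac, lintegral_map hF (by fun_prop),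
    lintegral_withDensity_eq_lintegral_mul _ (measurable_wver hP z).ennreal_ofReal (by fun_prop)]
  rfl

end Stationary

/-! ### Weak solvability and the time increments of the corrector -/

/-- A version of Lions' theorem: solvability of a variational problem which is coercive on a
space of test functions. -/
theorem exists_inner_eq_of_coercive {H F : Type*} [NormedAddCommGroup H] [InnerProductSpace ℝ H]
    [CompleteSpace H] [AddCommGroup F] [Module ℝ F] (j S : F →ₗ[ℝ] H) {c : ℝ} (hc : 0 < c)
    (h : ∀ f, c * ‖j f‖ ^ 2 ≤ inner ℝ (S f) (j f)) (p : H) :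
    ∃ ψ : H, ∀ f, inner ℝ (S f) ψ = inner ℝ p (j f) := by
  -- Coercivity and Cauchy–Schwarz: S controls j.
  have hb : ∀ f, c * ‖j f‖ ≤ ‖S f‖ := by
    intro f
    rcases eq_or_ne (‖j f‖) 0 with h0 | h0
    · rw [h0, mul_zero]
      exact norm_nonneg _
    · have h1 := (h f).trans (real_inner_le_norm (S f) (j f))
      have h2 : 0 < ‖j f‖ := lt_of_le_of_ne (norm_nonneg _) (Ne.symm h0)
      have h3 : (c * ‖j f‖) * ‖j f‖ ≤ ‖S f‖ * ‖j f‖ := by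
        calc _ = c * ‖j f‖ ^ 2 := by ring
          _ ≤ _ := h1
      exact le_of_mul_le_mul_right h3 h2
  let ℓ : F →ₗ[ℝ] ℝ := (innerₗ H p) ∘ₗ j
  have hℓ : ∀ f, ℓ f = inner ℝ p (j f) := fun f => rfl
  -- So ⟨p, j f⟩ depends on S f only and defines a bounded functional on the range of S.
  have hker : LinearMap.ker S ≤ LinearMap.ker ℓ := by
    intro f hf
    rw [LinearMap.mem_ker] at hf ⊢
    have := hb f
    rw [hf, norm_zero] at this
    have h0 : ‖j f‖ = 0 := by
      have := norm_nonneg (j f)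
      nlinarith
    rw [hℓ, norm_eq_zero.mp h0, inner_zero_right]
  let g : LinearMap.range S →ₗ[ℝ] ℝ :=
    (LinearMap.ker S).liftQ ℓ hker ∘ₗ S.quotKerEquivRange.symm.toLinearMap
  have hg : ∀ f, g ⟨S f, LinearMap.mem_range_self S f⟩ = ℓ f := by
    intro f
    have : S.quotKerEquivRange.symm ⟨S f, LinearMap.mem_range_self S f⟩
        = (LinearMap.ker S).mkQ f := by
      rw [LinearEquiv.symm_apply_eq]
      rfl
    simp [g, this]
  have hbound : ∀ v : LinearMap.range S, ‖g v‖ ≤ (‖p‖ / c) * ‖v‖ := by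
    rintro ⟨_, f, rfl⟩
    rw [hg, hℓ]
    refine (norm_inner_le_norm (𝕜 := ℝ) _ _).trans ?_
    have h1 : ‖j f‖ ≤ ‖S f‖ / c := by
      rw [le_div_iff₀ hc, mul_comm]
      exact hb f
    calc ‖p‖ * ‖j f‖ ≤ ‖p‖ * (‖S f‖ / c) := mul_le_mul_of_nonneg_left h1 (norm_nonneg _)
      _ = (‖p‖ / c) * ‖S f‖ := by ring
  -- Hahn–Banach extends the functional from the range, which need not be closed, and Riesz
  -- represents it.
  obtain ⟨G, hG, -⟩ := exists_extension_norm_eq (LinearMap.range S) (g.mkContinuous _ hbound)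
  refine ⟨(InnerProductSpace.toDual ℝ H).symm G, fun f => ?_⟩
  rw [real_inner_comm, InnerProductSpace.toDual_symm_apply]
  have := hG ⟨S f, LinearMap.mem_range_self S f⟩
  rw [← hℓ f, ← hg f]
  exact this

/-! ### Test functions that are differentiable along the time shift. -/

section TestPairs

variable {d : ℕ} [MeasurableSpace (Env d)] {P : Measure (Env d)}

theorem intervalIntegrable_of_bounded (hP : StationaryErgodicEnv P) {f : Env d → ℝ}
    (hf : Measurable f) (hb : ∃ C, ∀ ω, |f ω| ≤ C) (x : ZLat d) (ω : Env d) (a b : ℝ) :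
    IntervalIntegrable (fun s => f (shift s x ω)) volume a b := by
  obtain ⟨C, hC⟩ := hb
  rw [intervalIntegrable_iff]
  refine Measure.integrableOn_of_bounded (M := C) (by simp) ?_ ?_
  · exact (hf.comp (hP.measurable_orbit x ω)).aestronglyMeasurable
  · exact ae_of_all _ fun s => hC _

theorem integrable_of_bounded [IsFiniteMeasure P] {f : Env d → ℝ}
    (hf : Measurable f) (hb : ∃ C, ∀ ω, |f ω| ≤ C) : Integrable f P := by
  obtain ⟨C, hC⟩ := hb
  exact Integrable.of_bound hf.aestronglyMeasurable C (ae_of_all _ hC)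

/-- Bounded functions together with their bounded derivative along the time shift. -/
def testPairs (hP : StationaryErgodicEnv P) : Submodule ℝ ((Env d → ℝ) × (Env d → ℝ)) where
  carrier := {p | Measurable p.1 ∧ Measurable p.2 ∧ (∃ C, ∀ ω, |p.1 ω| ≤ C) ∧
    (∃ C, ∀ ω, |p.2 ω| ≤ C) ∧
    ∀ ω s, p.1 (shift s 0 ω) - p.1 ω = ∫ r in (0 : ℝ)..s, p.2 (shift r 0 ω)}
  zero_mem' := ⟨measurable_const, measurable_const, ⟨0, by simp⟩, ⟨0, by simp⟩, by simp⟩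
  add_mem' := by
    rintro a b ⟨ha1, ha2, ⟨Ca, ha3⟩, ⟨Ca', ha4⟩, ha5⟩ ⟨hb1, hb2, ⟨Cb, hb3⟩, ⟨Cb', hb4⟩, hb5⟩
    refine ⟨ha1.add hb1, ha2.add hb2, ⟨Ca + Cb, fun ω => ?_⟩, ⟨Ca' + Cb', fun ω => ?_⟩, ?_⟩
    · exact (abs_add_le _ _).trans (add_le_add (ha3 ω) (hb3 ω))
    · exact (abs_add_le _ _).trans (add_le_add (ha4 ω) (hb4 ω))
    · intro ω s
      simp only [Prod.fst_add, Prod.snd_add, Pi.add_apply]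
      rw [intervalIntegral.integral_add
        (intervalIntegrable_of_bounded hP ha2 ⟨Ca', ha4⟩ 0 ω 0 s)
        (intervalIntegrable_of_bounded hP hb2 ⟨Cb', hb4⟩ 0 ω 0 s), ← ha5, ← hb5]
      ring
  smul_mem' := by
    rintro c a ⟨ha1, ha2, ⟨Ca, ha3⟩, ⟨Ca', ha4⟩, ha5⟩
    refine ⟨ha1.const_smul c, ha2.const_smul c, ⟨|c| * Ca, fun ω => ?_⟩,
      ⟨|c| * Ca', fun ω => ?_⟩, ?_⟩
    · simp only [Prod.smul_fst, Pi.smul_apply, smul_eq_mul, abs_mul]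
      exact mul_le_mul_of_nonneg_left (ha3 ω) (abs_nonneg c)
    · simp only [Prod.smul_snd, Pi.smul_apply, smul_eq_mul, abs_mul]
      exact mul_le_mul_of_nonneg_left (ha4 ω) (abs_nonneg c)
    · intro ω s
      simp only [Prod.smul_fst, Prod.smul_snd, Pi.smul_apply, smul_eq_mul]
      rw [intervalIntegral.integral_const_mul, ← ha5]
      ring

theorem testPairs_shift (hP : StationaryErgodicEnv P) {p : (Env d → ℝ) × (Env d → ℝ)}
    (hp : p ∈ testPairs hP) (x : ZLat d) :
    ((fun ω => p.1 (shift 0 x ω), fun ω => p.2 (shift 0 x ω)) :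
      (Env d → ℝ) × (Env d → ℝ)) ∈ testPairs hP := by
  obtain ⟨h1, h2, ⟨C, h3⟩, ⟨C', h4⟩, h5⟩ := hp
  refine ⟨h1.comp (hP.measurable_shift' 0 x), h2.comp (hP.measurable_shift' 0 x),
    ⟨C, fun ω => h3 _⟩, ⟨C', fun ω => h4 _⟩, fun ω s => ?_⟩
  have := h5 (shift 0 x ω) s
  simp only [shift_shift, add_zero, zero_add] at this ⊢
  exact this

theorem integrable_prod_shift [IsProbabilityMeasure P] (hP : StationaryErgodicEnv P)
    {f : Env d → ℝ} (hf : Measurable f) (hfi : Integrable f P) (x : ZLat d)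
    (ν : Measure ℝ) [IsFiniteMeasure ν] :
    Integrable (fun p : Env d × ℝ => f (shift p.2 x p.1)) (P.prod ν) := by
  refine ⟨(hf.comp (hP.measurable_time x)).aestronglyMeasurable, ?_⟩
  rw [hasFiniteIntegral_iff_enorm, lintegral_prod (fun p : Env d × ℝ => ‖f (shift p.2 x p.1)‖ₑ)
    (hf.comp (hP.measurable_time x)).enorm.aemeasurable]
  rw [hP.lintegral_lintegral_shift (f := fun ω => ‖f ω‖ₑ) hf.enorm x ν]
  exact ENNReal.mul_lt_top (measure_lt_top _ _) hfi.2

theorem integral_mul_intervalIntegral [IsProbabilityMeasure P] (hP : StationaryErgodicEnv P)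
    {f h : Env d → ℝ} (hf : Measurable f) (hfi : Integrable f P) (hh : Measurable h)
    (hb : ∃ C, ∀ ω, |h ω| ≤ C) (x : ZLat d) (a b : ℝ) :
    ∫ ω, h ω * (∫ s in a..b, f (shift s x ω)) ∂P
      = ∫ s in a..b, ∫ ω, h ω * f (shift s x ω) ∂P := by
  obtain ⟨C, hC⟩ := hb
  simp_rw [← intervalIntegral.integral_const_mul]
  have hint : ∀ u v : ℝ, Integrable (fun p : Env d × ℝ => h p.1 * f (shift p.2 x p.1))
      (P.prod (volume.restrict (Set.Ioc u v))) := by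
    intro u v
    refine (integrable_prod_shift hP hf hfi x (volume.restrict (Set.Ioc u v))).bdd_mul (c := C)
      (hh.comp measurable_fst).aestronglyMeasurable ?_
    exact ae_of_all _ fun p => hC p.1
  simp_rw [intervalIntegral]
  rw [integral_sub ((hint a b).integral_prod_left) ((hint b a).integral_prod_left)]
  rw [integral_integral_swap (f := fun ω s => h ω * f (shift s x ω)) (hint a b),
    integral_integral_swap (f := fun ω s => h ω * f (shift s x ω)) (hint b a)]

/-- Formally f' f is half the time derivative of the stationary quantity f², so its mean vanishes.
In integrated form, f(τ_s ω)² - f(ω)² has mean zero and differs from 2∫_0^s f' f by O(s²); taking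
means, dividing by s and letting s → 0 gives the claim. Only boundedness of f and f' is needed. -/
theorem integral_pair_mul_eq_zero [IsProbabilityMeasure P] (hP : StationaryErgodicEnv P)
    {p : (Env d → ℝ) × (Env d → ℝ)} (hp : p ∈ testPairs hP) :
    ∫ ω, p.2 ω * p.1 ω ∂P = 0 := by
  obtain ⟨h1, h2, ⟨C, h3⟩, ⟨C', h4⟩, h5⟩ := hp
  have hC : 0 ≤ C := (abs_nonneg _).trans (h3 (Classical.choice P.nonempty_of_neZero))
  have hC' : 0 ≤ C' := (abs_nonneg _).trans (h4 (Classical.choice P.nonempty_of_neZero))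
  have hprodb : ∃ K, ∀ ω, |p.2 ω * p.1 ω| ≤ K := ⟨C' * C, fun ω => by
    rw [abs_mul]
    exact mul_le_mul (h4 ω) (h3 ω) (abs_nonneg _) hC'⟩
  have hprodm : Measurable fun ω => p.2 ω * p.1 ω := h2.mul h1
  -- Lipschitz bound along orbits
  have hlip : ∀ ω s, |p.1 (shift s 0 ω) - p.1 ω| ≤ C' * |s| := by
    intro ω s
    rw [h5]
    have := intervalIntegral.norm_integral_le_of_norm_le_const (a := 0) (b := s) (C := C')
      (f := fun r => p.2 (shift r 0 ω)) (fun r _ => h4 _)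
    simpa using this
  have key : ∀ s : ℝ, 0 < s → |∫ ω, p.2 ω * p.1 ω ∂P| ≤ C' * C' * s := by
    intro s hs
    have hpt : ∀ ω, |(p.1 (shift s 0 ω) ^ 2 - p.1 ω ^ 2)
        - 2 * ∫ r in (0 : ℝ)..s, p.2 (shift r 0 ω) * p.1 (shift r 0 ω)|
          ≤ 2 * (C' * C' * s) * s := by
      intro ω
      have e1 : p.1 (shift s 0 ω) ^ 2 - p.1 ω ^ 2
          = ∫ r in (0 : ℝ)..s, p.2 (shift r 0 ω) * (p.1 (shift s 0 ω) + p.1 ω) := by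
        rw [intervalIntegral.integral_mul_const, ← h5]
        ring
      rw [e1, ← intervalIntegral.integral_const_mul, ← intervalIntegral.integral_sub]
      · have := intervalIntegral.norm_integral_le_of_norm_le_const (a := 0) (b := s)
          (C := 2 * (C' * C' * s))
          (f := fun r => p.2 (shift r 0 ω) * (p.1 (shift s 0 ω) + p.1 ω)
            - 2 * (p.2 (shift r 0 ω) * p.1 (shift r 0 ω))) ?_
        · simpa [abs_of_pos hs] using this
        · intro r hr
          rw [Set.uIoc_of_le hs.le] at hr
          have a1 := hlip ω r
          have a2 := hlip (shift r 0 ω) (s - r)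
          rw [shift_shift] at a2
          simp only [sub_add_cancel, add_zero] at a2
          rw [abs_of_pos hr.1] at a1
          rw [abs_of_nonneg (sub_nonneg.mpr hr.2)] at a2
          -- The difference is regrouped into the increments over [r,s] and [0,r], whose Lipschitz
          -- bounds are each at most C' s.
          have e2 : p.2 (shift r 0 ω) * (p.1 (shift s 0 ω) + p.1 ω)
            - 2 * (p.2 (shift r 0 ω) * p.1 (shift r 0 ω)) = p.2 (shift r 0 ω) *
              ((p.1 (shift s 0 ω) - p.1 (shift r 0 ω)) - (p.1 (shift r 0 ω) - p.1 ω)) := by ring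
          rw [Real.norm_eq_abs, e2, abs_mul]
          have a3 : |(p.1 (shift s 0 ω) - p.1 (shift r 0 ω)) - (p.1 (shift r 0 ω) - p.1 ω)|
              ≤ 2 * (C' * s) := by
            refine (abs_sub _ _).trans ?_
            have : C' * (s - r) + C' * r = C' * s := by ring
            have : 0 ≤ C' * s := by positivity
            linarith
          calc _ ≤ C' * (2 * (C' * s)) := mul_le_mul (h4 _) a3 (abs_nonneg _) hC'
            _ = _ := by ring
      · exact (intervalIntegrable_of_bounded hP h2 ⟨C', h4⟩ 0 ω 0 s).mul_const _
      · exact (intervalIntegrable_of_bounded hP hprodm hprodb 0 ω 0 s).const_mul _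
    have hI : ∫ ω, ((p.1 (shift s 0 ω) ^ 2 - p.1 ω ^ 2)
        - 2 * ∫ r in (0 : ℝ)..s, p.2 (shift r 0 ω) * p.1 (shift r 0 ω)) ∂P
        = - (2 * s * ∫ ω, p.2 ω * p.1 ω ∂P) := by
      have hsq : Integrable (fun ω => p.1 ω ^ 2) P :=
        integrable_of_bounded (h1.pow_const 2) ⟨C ^ 2, fun ω => by
          rw [abs_pow]
          exact pow_le_pow_left₀ (abs_nonneg _) (h3 ω) 2⟩
      have hF := integral_mul_intervalIntegral hP hprodm
        (integrable_of_bounded (P := P) hprodm hprodb) (h := fun _ => 1)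
        measurable_const ⟨1, by simp⟩ 0 0 s
      simp only [one_mul] at hF
      have hFi : Integrable (fun ω => ∫ r in (0 : ℝ)..s, p.2 (shift r 0 ω) * p.1 (shift r 0 ω))
          P := by
        simp_rw [intervalIntegral.integral_of_le hs.le]
        exact (integrable_prod_shift hP hprodm (integrable_of_bounded (P := P) hprodm hprodb) 0
          (volume.restrict (Set.Ioc 0 s))).integral_prod_left
      have hdiff : Integrable (fun ω => p.1 (shift s 0 ω) ^ 2 - p.1 ω ^ 2) P :=
        (hP.integrable_shift hsq s 0).sub hsq
      rw [integral_sub hdiff (hFi.const_mul 2),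
        integral_sub (hP.integrable_shift hsq s 0) hsq,
        hP.integral_shift (f := fun ω => p.1 ω ^ 2) (h1.pow_const 2), integral_const_mul, hF]
      simp_rw [hP.integral_shift hprodm]
      simp
      ring
    have hle := norm_integral_le_of_norm_le_const (μ := P)
      (f := fun ω => (p.1 (shift s 0 ω) ^ 2 - p.1 ω ^ 2)
        - 2 * ∫ r in (0 : ℝ)..s, p.2 (shift r 0 ω) * p.1 (shift r 0 ω)) (ae_of_all _ hpt)
    rw [hI, Real.norm_eq_abs, abs_neg, abs_mul, abs_of_pos (by positivity : (0 : ℝ) < 2 * s)] at hle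
    simp only [probReal_univ, mul_one] at hle
    have : 2 * s * |∫ ω, p.2 ω * p.1 ω ∂P| ≤ 2 * s * (C' * C' * s) := by linarith
    exact le_of_mul_le_mul_left this (by positivity)
  by_contra hne
  have hpos : 0 < |∫ ω, p.2 ω * p.1 ω ∂P| := abs_pos.mpr hne
  -- This value of s makes the upper bound at most half of the quantity it bounds.
  have := key (|∫ ω, p.2 ω * p.1 ω ∂P| / (2 * (C' * C' + 1))) (by positivity)
  have h6 : C' * C' * (|∫ ω, p.2 ω * p.1 ω ∂P| / (2 * (C' * C' + 1)))
      ≤ |∫ ω, p.2 ω * p.1 ω ∂P| / 2 := by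
    rw [mul_div_assoc', div_le_div_iff₀ (by positivity) (by norm_num)]
    nlinarith [hpos.le, mul_nonneg hC' hC']
  linarith

end TestPairs

/-! ### The Hilbert space L²(m). -/

section Ltwo

variable {d : ℕ} [MeasurableSpace (Env d)] {P : Measure (Env d)} [IsProbabilityMeasure P]

theorem isFiniteMeasure_mMeasure (hP : StationaryErgodicEnv P) :
    IsFiniteMeasure (mMeasure P) := by
  refine ⟨?_⟩
  have := lintegral_mMeasure hP (F := fun _ => 1) measurable_const
  simp only [lintegral_const, one_mul, mul_one] at this
  rw [this]
  refine ENNReal.sum_lt_top.mpr fun z _ => ?_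
  have := (integrable_wver hP z).2
  rw [hasFiniteIntegral_iff_ofReal (ae_of_all _ fun ω => (wver_pos hP z ω).le)] at this
  exact this

theorem integrable_wver_mul (hP : StationaryErgodicEnv P) {F : Env d × Nbr d → ℝ}
    (hF : Measurable F) (hFi : Integrable F (mMeasure P)) (z : Nbr d) :
    Integrable (fun ω => wver hP z ω * F (ω, z)) P := by
  refine ⟨((measurable_wver hP z).mul
    (hF.comp (measurable_id.prodMk measurable_const))).aestronglyMeasurable, ?_⟩
  have h := hFi.2
  rw [hasFiniteIntegral_iff_enorm, lintegral_mMeasure hP hF.enorm] at h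
  have := ENNReal.sum_lt_top.mp h z (Finset.mem_univ z)
  rw [hasFiniteIntegral_iff_enorm]
  refine lt_of_eq_of_lt (lintegral_congr fun ω => ?_) this
  rw [enorm_mul, Real.enorm_eq_ofReal (wver_pos hP z ω).le]

theorem integral_mMeasure (hP : StationaryErgodicEnv P) {F : Env d × Nbr d → ℝ}
    (hF : Measurable F) (hFi : Integrable F (mMeasure P)) :
    ∫ p, F p ∂(mMeasure P) = ∑ z, ∫ ω, wver hP z ω * F (ω, z) ∂P := by
  rw [mMeasure_eq hP] at hFi ⊢
  rw [integral_finsetSum_measure fun z _ => integrable_finsetSum_measure.mp hFi z (Finset.mem_univ z)]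
  refine Finset.sum_congr rfl fun z _ => ?_
  rw [Measure.prod_dirac, integral_map measurable_prodMk_right.aemeasurable
    hF.aestronglyMeasurable, integral_withDensity_eq_integral_toReal_smul
    (measurable_wver hP z).ennreal_ofReal (ae_of_all _ fun _ => ENNReal.ofReal_lt_top)]
  refine integral_congr_ae (ae_of_all _ fun ω => ?_)
  simp [ENNReal.toReal_ofReal (wver_pos hP z ω).le]

theorem memLp_two_mMeasure_iff (hP : StationaryErgodicEnv P) {F : Env d × Nbr d → ℝ}
    (hF : Measurable F) :
    MemLp F 2 (mMeasure P) ↔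
      ∀ z, ∫⁻ ω, ENNReal.ofReal (wver hP z ω * F (ω, z) ^ 2) ∂P < ∞ := by
  have h1 : MemLp F 2 (mMeasure P) ↔ eLpNorm F 2 (mMeasure P) < ∞ :=
    ⟨fun h => h.2, fun h => ⟨hF.aestronglyMeasurable, h⟩⟩
  rw [h1, eLpNorm_lt_top_iff_lintegral_rpow_enorm_lt_top (by norm_num) (by norm_num),
    lintegral_mMeasure hP (by fun_prop), ENNReal.sum_lt_top]
  have : ∀ z, ∀ ω, ENNReal.ofReal (wver hP z ω) * ‖F (ω, z)‖ₑ ^ (2 : ℝ≥0∞).toReal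
      = ENNReal.ofReal (wver hP z ω * F (ω, z) ^ 2) := by
    intro z ω
    rw [ENNReal.ofReal_mul (wver_pos hP z ω).le]
    congr 1
    rw [Real.enorm_eq_ofReal_abs, ENNReal.toReal_ofNat, ← sq_abs]
    rw [ENNReal.ofReal_pow (abs_nonneg _)]
    norm_cast
  simp_rw [this]
  simp

/-- Cauchy–Schwarz with the factors w^{-1/2} and w^{1/2}. Integrability of the inverse conductances
enters here: it embeds L²(m) into L¹ on each component. -/
theorem lintegral_enorm_le_eLpNorm (hP : StationaryErgodicEnv P) {F : Env d × Nbr d → ℝ}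
    (hF : Measurable F) (z : Nbr d) :
    ∫⁻ ω, ‖F (ω, z)‖ₑ ∂P
      ≤ (∫⁻ ω, ENNReal.ofReal ((wver hP z ω)⁻¹) ∂P) ^ (1 / 2 : ℝ) *
        eLpNorm F 2 (mMeasure P) := by
  have hFz : Measurable fun ω => F (ω, z) := hF.comp measurable_prodMk_right
  have hw := measurable_wver hP z
  have h := ENNReal.lintegral_mul_le_Lp_mul_Lq P
    (Real.HolderConjugate.two_two)
    (f := fun ω => ENNReal.ofReal ((wver hP z ω)⁻¹) ^ (1 / 2 : ℝ))
    (g := fun ω => ENNReal.ofReal (wver hP z ω) ^ (1 / 2 : ℝ) * ‖F (ω, z)‖ₑ)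
    (by fun_prop) (by fun_prop)
  have e1 : ∀ ω, ENNReal.ofReal ((wver hP z ω)⁻¹) ^ (1 / 2 : ℝ) *
      (ENNReal.ofReal (wver hP z ω) ^ (1 / 2 : ℝ) * ‖F (ω, z)‖ₑ) = ‖F (ω, z)‖ₑ := by
    intro ω
    rw [← mul_assoc, ← ENNReal.mul_rpow_of_nonneg _ _ (by norm_num), ← ENNReal.ofReal_mul
      (inv_nonneg.mpr (wver_pos hP z ω).le), inv_mul_cancel₀ (wver_pos hP z ω).ne']
    simp
  have e2 : ∀ ω, (ENNReal.ofReal ((wver hP z ω)⁻¹) ^ (1 / 2 : ℝ)) ^ (2 : ℝ)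
      = ENNReal.ofReal ((wver hP z ω)⁻¹) := by
    intro ω
    rw [← ENNReal.rpow_mul]
    norm_num
  have e3 : ∀ ω, (ENNReal.ofReal (wver hP z ω) ^ (1 / 2 : ℝ) * ‖F (ω, z)‖ₑ) ^ (2 : ℝ)
      = ENNReal.ofReal (wver hP z ω) * ‖F (ω, z)‖ₑ ^ (2 : ℝ) := by
    intro ω
    rw [ENNReal.mul_rpow_of_nonneg _ _ (by norm_num), ← ENNReal.rpow_mul]
    norm_num
  simp only [Pi.mul_apply, e1, e2, e3] at h
  refine h.trans (mul_le_mul_right ?_ _)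
  rw [eLpNorm_eq_lintegral_rpow_enorm_toReal (by norm_num) (by norm_num)]
  simp only [ENNReal.toReal_ofNat]
  refine ENNReal.rpow_le_rpow ?_ (by norm_num)
  rw [lintegral_mMeasure hP (by fun_prop)]
  exact Finset.single_le_sum (f := fun z => ∫⁻ ω, ENNReal.ofReal (wver hP z ω) *
    ‖F (ω, z)‖ₑ ^ (2 : ℝ) ∂P) (fun _ _ => zero_le) (Finset.mem_univ z)

theorem integrable_of_memLp_mMeasure (hP : StationaryErgodicEnv P) {F : Env d × Nbr d → ℝ}
    (hF : Measurable F) (hF2 : MemLp F 2 (mMeasure P)) (z : Nbr d) :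
    Integrable (fun ω => F (ω, z)) P := by
  refine ⟨(hF.comp measurable_prodMk_right).aestronglyMeasurable, ?_⟩
  rw [hasFiniteIntegral_iff_enorm]
  refine (lintegral_enorm_le_eLpNorm hP hF z).trans_lt (ENNReal.mul_lt_top ?_ hF2.2)
  refine ENNReal.rpow_lt_top_of_nonneg (by norm_num) ?_
  have := (integrable_inv_wver hP z).2
  rw [hasFiniteIntegral_iff_ofReal (ae_of_all _ fun ω => (inv_pos.mpr (wver_pos hP z ω)).le)] at this
  exact this.ne

omit [IsProbabilityMeasure P] in
theorem measurable_hgrad (hP : StationaryErgodicEnv P) {φ : Env d → ℝ} (hφ : Measurable φ) :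
    Measurable (hgrad φ) := by
  refine measurable_from_prod_countable_left fun z => ?_
  exact (hφ.comp (hP.measurable_shift' 0 z)).sub hφ

theorem memLp_hgrad (hP : StationaryErgodicEnv P) {φ : Env d → ℝ} (hφ : Measurable φ)
    (hb : ∃ C : ℝ, ∀ ω, |φ ω| ≤ C) : MemLp (hgrad φ) 2 (mMeasure P) := by
  obtain ⟨C, hC⟩ := hb
  have := isFiniteMeasure_mMeasure hP
  refine MemLp.of_bound (measurable_hgrad hP hφ).aestronglyMeasurable (C + C)
    (ae_of_all _ fun p => ?_)
  exact (abs_sub _ _).trans (add_le_add (hC _) (hC _))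

/-- The space of gradients of bounded functions. -/
def gradSubmodule (P : Measure (Env d)) : Submodule ℝ (Lp ℝ 2 (mMeasure P)) where
  carrier := {f | ∃ φ : Env d → ℝ, Measurable φ ∧ (∃ C : ℝ, ∀ ω, |φ ω| ≤ C) ∧
    f =ᵐ[mMeasure P] hgrad φ}
  zero_mem' := ⟨0, measurable_const, ⟨0, by simp⟩, by
    filter_upwards [Lp.coeFn_zero ℝ 2 (mMeasure P)] with p hp
    rw [hp]
    simp [hgrad]⟩
  add_mem' := by
    rintro f g ⟨φ, h1, ⟨C, h2⟩, h3⟩ ⟨φ', h1', ⟨C', h2'⟩, h3'⟩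
    refine ⟨φ + φ', h1.add h1', ⟨C + C', fun ω =>
      (abs_add_le _ _).trans (add_le_add (h2 ω) (h2' ω))⟩, ?_⟩
    filter_upwards [Lp.coeFn_add f g, h3, h3'] with p e1 e2 e3
    rw [e1, Pi.add_apply, e2, e3]
    simp only [hgrad, Pi.add_apply]
    ring
  smul_mem' := by
    rintro c f ⟨φ, h1, ⟨C, h2⟩, h3⟩
    refine ⟨c • φ, h1.const_smul c, ⟨|c| * C, fun ω => ?_⟩, ?_⟩
    · simp only [Pi.smul_apply, smul_eq_mul, abs_mul]
      exact mul_le_mul_of_nonneg_left (h2 ω) (abs_nonneg c)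
    · filter_upwards [Lp.coeFn_smul c f, h3] with p e1 e2
      rw [e1, Pi.smul_apply, e2]
      simp only [hgrad, Pi.smul_apply, smul_eq_mul]
      ring

omit [IsProbabilityMeasure P] in
theorem coe_closure_gradSubmodule :
    ((gradSubmodule P).topologicalClosure : Set (Lp ℝ 2 (mMeasure P))) = L2pot P := by
  rw [Submodule.topologicalClosure_coe]
  rfl

theorem inner_toLp_toLp (hP : StationaryErgodicEnv P) {F G : Env d × Nbr d → ℝ}
    (hF : Measurable F) (hG : Measurable G) (hF2 : MemLp F 2 (mMeasure P))
    (hG2 : MemLp G 2 (mMeasure P)) :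
    inner ℝ (hF2.toLp F) (hG2.toLp G) = ∑ z, ∫ ω, wver hP z ω * (F (ω, z) * G (ω, z)) ∂P := by
  rw [L2.inner_def, ← integral_mMeasure hP (F := fun p => F p * G p) (hF.mul hG)
    (hF2.integrable_mul hG2)]
  refine integral_congr_ae ?_
  filter_upwards [hF2.coeFn_toLp, hG2.coeFn_toLp] with p h1 h2
  rw [h1, h2]
  simp [mul_comm]

end Ltwo

/-! ### The weak corrector equation, tested with divergences. -/

section WeakSolution

variable {d : ℕ} [MeasurableSpace (Env d)] {P : Measure (Env d)} [IsProbabilityMeasure P]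

theorem measurable_coeFn_mMeasure (ψ : Lp ℝ 2 (mMeasure P)) : Measurable (ψ : Env d × Nbr d → ℝ) :=
  (Lp.stronglyMeasurable ψ).measurable

/-- Elements of `L²_pot` are `L¹` limits of gradients of bounded functions, with a rate. -/
theorem exists_potential (hP : StationaryErgodicEnv P) {ψ : Lp ℝ 2 (mMeasure P)}
    (hψ : ψ ∈ L2pot P) :
    ∃ φ : ℕ → Env d → ℝ, (∀ k, Measurable (φ k)) ∧ (∀ k, ∃ C, ∀ ω, |φ k ω| ≤ C) ∧
      ∀ k z, ∫⁻ ω, ‖ψ (ω, z) - hgrad (φ k) (ω, z)‖ₑ ∂P ≤ (4⁻¹ : ℝ≥0∞) ^ k := by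
  -- This dominates the constants of the embedding of L²(m) into L¹ for all neighbours at once; the
  -- summand 1 keeps it away from zero.
  set C : ℝ≥0∞ := 1 + ∑ z : Nbr d, (∫⁻ ω, ENNReal.ofReal ((wver hP z ω)⁻¹) ∂P) ^ (1 / 2 : ℝ)
    with hC
  have hC1 : C ≠ 0 := by simp [hC]
  have hC2 : C ≠ ∞ := by
    rw [hC]
    refine ENNReal.add_ne_top.mpr ⟨by simp, (ENNReal.sum_lt_top.mpr fun z _ => ?_).ne⟩
    refine ENNReal.rpow_lt_top_of_nonneg (by norm_num) ?_
    have := (integrable_inv_wver hP z).2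
    rw [hasFiniteIntegral_iff_ofReal
      (ae_of_all _ fun ω => (inv_pos.mpr (wver_pos hP z ω)).le)] at this
    exact this.ne
  have key : ∀ k : ℕ, ∃ φ : Env d → ℝ, Measurable φ ∧ (∃ C, ∀ ω, |φ ω| ≤ C) ∧
      ∀ z, ∫⁻ ω, ‖ψ (ω, z) - hgrad φ (ω, z)‖ₑ ∂P ≤ (4⁻¹ : ℝ≥0∞) ^ k := by
    intro k
    have hpos : 0 < (4⁻¹ : ℝ≥0∞) ^ k / C :=
      ENNReal.div_pos (pow_ne_zero _ (by simp)) hC2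
    obtain ⟨f, ⟨φ, h1, h2, h3⟩, h4⟩ := EMetric.mem_closure_iff.mp hψ _ hpos
    refine ⟨φ, h1, h2, fun z => ?_⟩
    have hm : Measurable fun p => ψ p - hgrad φ p :=
      (measurable_coeFn_mMeasure ψ).sub (measurable_hgrad hP h1)
    refine (lintegral_enorm_le_eLpNorm hP hm z).trans ?_
    rw [Lp.edist_def] at h4
    have h5 : eLpNorm (fun p => ψ p - hgrad φ p) 2 (mMeasure P) ≤ (4⁻¹ : ℝ≥0∞) ^ k / C := by
      refine le_trans (le_of_eq (eLpNorm_congr_ae ?_)) h4.le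
      filter_upwards [h3] with p hp
      simp [hp]
    calc _ ≤ C * ((4⁻¹ : ℝ≥0∞) ^ k / C) := by
          refine mul_le_mul' ?_ h5
          rw [hC]
          refine le_trans ?_ le_add_self
          exact Finset.single_le_sum (f := fun z : Nbr d =>
            (∫⁻ ω, ENNReal.ofReal ((wver hP z ω)⁻¹) ∂P) ^ (1 / 2 : ℝ))
            (fun _ _ => zero_le) (Finset.mem_univ z)
      _ = _ := ENNReal.mul_div_cancel hC1 hC2
  choose φ h1 h2 h3 using key
  exact ⟨φ, h1, h2, h3⟩

/-- The L¹ errors are summable, so the sum of the errors is integrable and hence almost everywhere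
finite: convergence holds without passing to a subsequence. -/
theorem ae_tendsto_of_lintegral_le {α : Type*} [MeasurableSpace α] {μ : Measure α}
    {f : ℕ → α → ℝ} {g : α → ℝ} (hf : ∀ k, Measurable (f k)) (hg : Measurable g)
    (h : ∀ k, ∫⁻ a, ‖g a - f k a‖ₑ ∂μ ≤ (4⁻¹ : ℝ≥0∞) ^ k) :
    ∀ᵐ a ∂μ, Tendsto (fun k => f k a) atTop (𝓝 (g a)) := by
  have hm : ∀ k, Measurable fun a => ‖g a - f k a‖ₑ := fun k => (hg.sub (hf k)).enorm
  have hsum : ∫⁻ a, ∑' k, ‖g a - f k a‖ₑ ∂μ ≠ ∞ := by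
    rw [lintegral_tsum fun k => (hm k).aemeasurable]
    refine ((ENNReal.tsum_le_tsum h).trans_lt ?_).ne
    rw [ENNReal.tsum_geometric, ENNReal.inv_lt_top]
    exact tsub_pos_of_lt (ENNReal.inv_lt_one.mpr (by norm_num))
  filter_upwards [ae_lt_top (Measurable.tsum hm) hsum] with a ha
  have h0 := ENNReal.tendsto_atTop_zero_of_tsum_ne_top ha.ne
  rw [tendsto_iff_edist_tendsto_0]
  refine h0.congr fun k => ?_
  rw [edist_comm, edist_eq_enorm_sub]

theorem ae_tendsto_hgrad (hP : StationaryErgodicEnv P) {ψ : Lp ℝ 2 (mMeasure P)}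
    {φ : ℕ → Env d → ℝ} (hφ : ∀ k, Measurable (φ k))
    (h : ∀ k z, ∫⁻ ω, ‖ψ (ω, z) - hgrad (φ k) (ω, z)‖ₑ ∂P ≤ (4⁻¹ : ℝ≥0∞) ^ k) :
    ∀ᵐ ω ∂P, ∀ z, Tendsto (fun k => hgrad (φ k) (ω, z)) atTop (𝓝 (ψ (ω, z))) := by
  rw [ae_all_iff]
  intro z
  exact ae_tendsto_of_lintegral_le (fun k => (measurable_hgrad hP (hφ k)).comp
    measurable_prodMk_right) ((measurable_coeFn_mMeasure ψ).comp measurable_prodMk_right)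
    fun k => h k z

/-- Gradients satisfy this identity exactly, and it survives the almost sure limit. -/
theorem L2pot_antisymm (hP : StationaryErgodicEnv P) {ψ : Lp ℝ 2 (mMeasure P)}
    (hψ : ψ ∈ L2pot P) : ∀ᵐ ω ∂P, ∀ z : Nbr d, ψ (shift 0 z ω, z.neg) = - ψ (ω, z) := by
  obtain ⟨φ, h1, -, h3⟩ := exists_potential hP hψ
  have := ae_tendsto_hgrad hP h1 h3
  filter_upwards [this, hP.ae_shift_space this 0] with ω ha hb z
  refine tendsto_nhds_unique (hb z z.neg) ?_
  refine (ha z).neg.congr fun k => ?_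
  simp [hgrad, shift_shift, shift_zero]

/-- The spatial shift on test pairs. -/
def shiftPair (hP : StationaryErgodicEnv P) (x : ZLat d) : testPairs hP →ₗ[ℝ] testPairs hP where
  toFun p := ⟨_, testPairs_shift hP p.2 x⟩
  map_add' _ _ := rfl
  map_smul' _ _ := rfl

/-- The divergence `∑_z (g_z ∘ τ_{0,-z} - g_z)` of a family of test pairs. -/
def divPair (hP : StationaryErgodicEnv P) : (Nbr d → testPairs hP) →ₗ[ℝ] testPairs hP :=
  ∑ z : Nbr d, (shiftPair hP (-(z : ZLat d)) - LinearMap.id) ∘ₗ LinearMap.proj z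

theorem divPair_fst (hP : StationaryErgodicEnv P) (a : Nbr d → testPairs hP) (ω : Env d) :
    (divPair hP a).1.1 ω = ∑ z : Nbr d, ((a z).1.1 (shift 0 (-(z : ZLat d)) ω) - (a z).1.1 ω) := by
  simp [divPair, shiftPair, Prod.fst_sum]

theorem divPair_snd (hP : StationaryErgodicEnv P) (a : Nbr d → testPairs hP) (ω : Env d) :
    (divPair hP a).1.2 ω = ∑ z : Nbr d, ((a z).1.2 (shift 0 (-(z : ZLat d)) ω) - (a z).1.2 ω) := by
  simp [divPair, shiftPair, Prod.snd_sum]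

/-- The horizontal gradient of a test pair, as an element of `L²(m)`. -/
def gradMap (hP : StationaryErgodicEnv P) : testPairs hP →ₗ[ℝ] Lp ℝ 2 (mMeasure P) where
  toFun p := (memLp_hgrad hP p.2.1 p.2.2.2.1).toLp _
  map_add' p q := by
    rw [← MemLp.toLp_add]
    refine MemLp.toLp_congr _ _ (ae_of_all _ fun r => ?_)
    simp only [hgrad, Submodule.coe_add, Prod.fst_add, Pi.add_apply]
    ring
  map_smul' c p := by
    rw [RingHom.id_apply, ← MemLp.toLp_const_smul]
    refine MemLp.toLp_congr _ _ (ae_of_all _ fun r => ?_)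
    simp only [hgrad, Submodule.coe_smul, Prod.smul_fst, Pi.smul_apply, smul_eq_mul]
    ring

theorem measurable_dual (hP : StationaryErgodicEnv P) (a : Nbr d → testPairs hP) :
    Measurable fun r : Env d × Nbr d => (a r.2).1.2 r.1 / wver hP r.2 r.1 :=
  measurable_from_prod_countable_left fun z => ((a z).2.2.1).div (measurable_wver hP z)

/-- The m-weighted square of a'/w has mean E[a'²/w], which is finite because a' is bounded and 1/w
is integrable. -/
theorem memLp_dual (hP : StationaryErgodicEnv P) (a : Nbr d → testPairs hP) :
    MemLp (fun r : Env d × Nbr d => (a r.2).1.2 r.1 / wver hP r.2 r.1) 2 (mMeasure P) := by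
  rw [memLp_two_mMeasure_iff hP (measurable_dual hP a)]
  intro z
  obtain ⟨C, hC⟩ := (a z).2.2.2.2.1
  have hi := ((integrable_inv_wver hP z).const_mul (C ^ 2)).2
  rw [hasFiniteIntegral_iff_ofReal (ae_of_all _ fun ω =>
    mul_nonneg (sq_nonneg _) (inv_pos.mpr (wver_pos hP z ω)).le)] at hi
  refine lt_of_le_of_lt (lintegral_mono fun ω => ENNReal.ofReal_le_ofReal ?_) hi
  have hw := wver_pos hP z ω
  have h1 : (a z).1.2 ω ^ 2 ≤ C ^ 2 := sq_le_sq' (by linarith [abs_le.mp (hC ω)]) (abs_le.mp (hC ω)).2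
  calc wver hP z ω * ((a z).1.2 ω / wver hP z ω) ^ 2
      = (a z).1.2 ω ^ 2 * (wver hP z ω)⁻¹ := by field_simp
    _ ≤ _ := mul_le_mul_of_nonneg_right h1 (inv_pos.mpr hw).le

/-- The functional `ψ ↦ ∑_z E[g'_z ψ(·, z)]`, represented in `L²(m)`. -/
def dualMap (hP : StationaryErgodicEnv P) :
    (Nbr d → testPairs hP) →ₗ[ℝ] Lp ℝ 2 (mMeasure P) where
  toFun a := (memLp_dual hP a).toLp _
  map_add' a b := by
    rw [← MemLp.toLp_add]
    refine MemLp.toLp_congr _ _ (ae_of_all _ fun r => ?_)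
    simp only [Submodule.coe_add, Prod.snd_add, Pi.add_apply]
    ring
  map_smul' c a := by
    rw [RingHom.id_apply, ← MemLp.toLp_const_smul]
    refine MemLp.toLp_congr _ _ (ae_of_all _ fun r => ?_)
    simp only [Submodule.coe_smul, Prod.smul_snd, Pi.smul_apply, smul_eq_mul]
    ring

theorem integral_mul_shift (hP : StationaryErgodicEnv P) {A B : Env d → ℝ} (hA : Measurable A)
    (hB : Measurable B) (s : ℝ) (x : ZLat d) :
    ∫ ω, A ω * B (shift s x ω) ∂P = ∫ ω, A (shift (-s) (-x) ω) * B ω ∂P := by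
  rw [← hP.integral_shift (f := fun ω => A (shift (-s) (-x) ω) * B ω)
    ((hA.comp (hP.measurable_shift' _ _)).mul hB) s x]
  simp [shift_shift, shift_zero]

theorem inner_dualMap (hP : StationaryErgodicEnv P) (a : Nbr d → testPairs hP)
    {F : Env d × Nbr d → ℝ} (hF : Measurable F) (hF2 : MemLp F 2 (mMeasure P)) :
    inner ℝ (dualMap hP a) (hF2.toLp F) = ∑ z, ∫ ω, (a z).1.2 ω * F (ω, z) ∂P := by
  have := inner_toLp_toLp hP (measurable_dual hP a) hF (memLp_dual hP a) hF2
  rw [show dualMap hP a = (memLp_dual hP a).toLp _ from rfl, this]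
  refine Finset.sum_congr rfl fun z _ => integral_congr_ae (ae_of_all _ fun ω => ?_)
  have hw := (wver_pos hP z ω).ne'
  simp only
  field_simp

/-- Moving the shifts by stationarity turns ∑_z E[a_z' (f∘τ_z - f)] into E[f' f], which vanishes.
The time derivative contributes nothing to the energy, and this is what leaves the problem coercive.
-/
theorem inner_dualMap_gradMap (hP : StationaryErgodicEnv P) (a : Nbr d → testPairs hP) :
    inner ℝ (dualMap hP a) (gradMap hP (divPair hP a)) = 0 := by
  have hf := (divPair hP a).2
  have hfb := integrable_of_bounded (P := P) hf.1 hf.2.2.1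
  rw [show gradMap hP (divPair hP a) = (memLp_hgrad hP hf.1 hf.2.2.1).toLp _ from rfl,
    inner_dualMap hP a (measurable_hgrad hP hf.1)]
  rw [← integral_pair_mul_eq_zero hP hf]
  have h1 : ∀ z, ∫ ω, (a z).1.2 ω * hgrad (divPair hP a).1.1 (ω, z) ∂P
      = ∫ ω, ((a z).1.2 (shift 0 (-(z : ZLat d)) ω) - (a z).1.2 ω) * (divPair hP a).1.1 ω ∂P := by
    intro z
    have hb := (a z).2.2.2.2.1
    have hm := (a z).2.2.1
    simp only [hgrad, mul_sub, sub_mul]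
    have bd : ∀ {g : Env d → ℝ} (_ : Measurable g) (_ : Integrable g P),
        Integrable (fun ω => (a z).1.2 ω * g ω) P := by
      intro g hg hgi
      obtain ⟨C, hC⟩ := hb
      exact hgi.bdd_mul (c := C) hm.aestronglyMeasurable (ae_of_all _ hC)
    have bd' : Integrable (fun ω => (a z).1.2 (shift 0 (-(z : ZLat d)) ω)
        * (divPair hP a).1.1 ω) P := by
      obtain ⟨C, hC⟩ := hb
      exact hfb.bdd_mul (c := C) (hm.comp (hP.measurable_shift' _ _)).aestronglyMeasurable
        (ae_of_all _ fun ω => hC _)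
    have bd2 : Integrable (fun ω => (a z).1.2 ω * (divPair hP a).1.1 (shift 0 z ω)) P :=
      bd (hf.1.comp (hP.measurable_shift' 0 z)) (hP.integrable_shift hfb 0 z)
    rw [integral_sub bd2 (bd hf.1 hfb), integral_sub bd' (bd hf.1 hfb),
      integral_mul_shift hP hm hf.1 0 z]
    simp
  rw [Finset.sum_congr rfl fun z _ => h1 z, ← integral_finsetSum]
  · refine integral_congr_ae (ae_of_all _ fun ω => ?_)
    simp only
    rw [divPair_snd, Finset.sum_mul]
  · intro z _
    obtain ⟨C, hC⟩ := (a z).2.2.2.2.1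
    have hm := (a z).2.2.1
    exact hfb.bdd_mul (c := C + C)
      ((hm.comp (hP.measurable_shift' _ _)).sub hm).aestronglyMeasurable
      (ae_of_all _ fun ω => (abs_sub _ _).trans (add_le_add (hC _) (hC _)))

theorem memLp_const_field (hP : StationaryErgodicEnv P) (q : Nbr d → ℝ) :
    MemLp (fun r : Env d × Nbr d => q r.2) 2 (mMeasure P) := by
  have := isFiniteMeasure_mMeasure hP
  refine MemLp.of_bound (measurable_of_finite q |>.comp measurable_snd).aestronglyMeasurable
    (∑ z, |q z|) (ae_of_all _ fun r => ?_)
  exact Finset.single_le_sum (f := fun z => |q z|) (fun _ _ => abs_nonneg _) (Finset.mem_univ r.2)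

/-- This is the weak form of the corrector equation. The corrector itself is not stationary, so its
time derivative is paired with a divergence f, and summation by parts replaces the corrector by its
gradient ψ. On the left only a_z' and ψ remain. The quadratic form is half the squared norm of the
gradient of f, so the abstract lemma applies in the closure of the gradients with constant 1/2. -/
theorem exists_weak_solution (hP : StationaryErgodicEnv P) (q : Nbr d → ℝ) :
    ∃ ψ : Lp ℝ 2 (mMeasure P), ψ ∈ L2pot P ∧ ∀ a : Nbr d → testPairs hP,
      ∑ z, ∫ ω, (a z).1.2 ω * ψ (ω, z) ∂P =
        (1 / 2) * ∑ z, ∫ ω, wver hP z ω *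
          (hgrad (divPair hP a).1.1 (ω, z) * (q z - ψ (ω, z))) ∂P := by
  let H := (gradSubmodule P).topologicalClosure
  have : CompleteSpace H := (Submodule.isClosed_topologicalClosure _).completeSpace_coe
  have hmem : ∀ a : Nbr d → testPairs hP, gradMap hP (divPair hP a) ∈ H := by
    intro a
    refine Submodule.le_topologicalClosure _ ?_
    exact ⟨_, (divPair hP a).2.1, (divPair hP a).2.2.2.1,
      MemLp.coeFn_toLp (memLp_hgrad hP (divPair hP a).2.1 (divPair hP a).2.2.2.1)⟩
  let j : (Nbr d → testPairs hP) →ₗ[ℝ] H :=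
    (gradMap hP ∘ₗ divPair hP).codRestrict H hmem
  let S0 : (Nbr d → testPairs hP) →ₗ[ℝ] Lp ℝ 2 (mMeasure P) :=
    (1 / 2 : ℝ) • (gradMap hP ∘ₗ divPair hP) + dualMap hP
  -- Projecting onto the closed subspace leaves the pairings with its elements unchanged and makes
  -- the abstract lemma produce a solution inside it.
  let S : (Nbr d → testPairs hP) →ₗ[ℝ] H := H.orthogonalProjectionOnto.toLinearMap ∘ₗ S0
  have hq := memLp_const_field hP q
  have hqm : Measurable (fun r : Env d × Nbr d => q r.2) :=
    (measurable_of_finite q).comp measurable_snd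
  have hS : ∀ a (v : H), inner ℝ (S a) v = inner ℝ (S0 a) (v : Lp ℝ 2 (mMeasure P)) := fun a v =>
    Submodule.inner_orthogonalProjectionOnto_eq_of_mem_right v (S0 a)
  have hcoer : ∀ a, (1 / 2) * ‖j a‖ ^ 2 ≤ inner ℝ (S a) (j a) := by
    intro a
    rw [hS]
    change _ ≤ inner ℝ ((1 / 2 : ℝ) • gradMap hP (divPair hP a) + dualMap hP a)
      (gradMap hP (divPair hP a))
    rw [inner_add_left, inner_dualMap_gradMap, inner_smul_left, real_inner_self_eq_norm_sq]
    simp [j]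
  obtain ⟨ψ, hψ⟩ := exists_inner_eq_of_coercive j S (by norm_num : (0 : ℝ) < 1 / 2) hcoer
    (H.orthogonalProjectionOnto ((1 / 2 : ℝ) • hq.toLp _))
  refine ⟨ψ, ?_, fun a => ?_⟩
  · rw [← coe_closure_gradSubmodule]
    exact ψ.2
  · have h := hψ a
    have hψm := measurable_coeFn_mMeasure (ψ : Lp ℝ 2 (mMeasure P))
    have hψ2 := Lp.memLp (ψ : Lp ℝ 2 (mMeasure P))
    have hf := (divPair hP a).2
    have hfg := memLp_hgrad hP hf.1 hf.2.2.1
    rw [hS, Submodule.inner_orthogonalProjectionOnto_eq_of_mem_right] at h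
    change inner ℝ ((1 / 2 : ℝ) • gradMap hP (divPair hP a) + dualMap hP a)
      (ψ : Lp ℝ 2 (mMeasure P)) = inner ℝ _ (gradMap hP (divPair hP a)) at h
    rw [inner_add_left, inner_smul_left, inner_smul_left] at h
    rw [show gradMap hP (divPair hP a) = hfg.toLp _ from rfl] at h
    have e1 : (ψ : Lp ℝ 2 (mMeasure P)) = hψ2.toLp _ := (Lp.toLp_coeFn _ hψ2).symm
    have e2 : inner ℝ (dualMap hP a) (ψ : Lp ℝ 2 (mMeasure P))
        = ∑ z, ∫ ω, (a z).1.2 ω * (ψ : Lp ℝ 2 (mMeasure P)) (ω, z) ∂P := by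
      conv_lhs => rw [e1]
      exact inner_dualMap hP a hψm hψ2
    have e3 : inner ℝ (hfg.toLp _) (ψ : Lp ℝ 2 (mMeasure P)) = ∑ z, ∫ ω, wver hP z ω *
        (hgrad (divPair hP a).1.1 (ω, z) * (ψ : Lp ℝ 2 (mMeasure P)) (ω, z)) ∂P := by
      conv_lhs => rw [e1]
      exact inner_toLp_toLp hP (measurable_hgrad hP hf.1) hψm hfg hψ2
    have e4 : inner ℝ (hq.toLp _) (hfg.toLp _) = ∑ z, ∫ ω, wver hP z ω *
        (hgrad (divPair hP a).1.1 (ω, z) * q z) ∂P := by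
      rw [real_inner_comm]
      exact inner_toLp_toLp hP (measurable_hgrad hP hf.1) hqm hfg hq
    rw [e2, e3, e4] at h
    have e5 : ∀ z, ∫ ω, wver hP z ω * (hgrad (divPair hP a).1.1 (ω, z) *
        (q z - (ψ : Lp ℝ 2 (mMeasure P)) (ω, z))) ∂P
        = (∫ ω, wver hP z ω * (hgrad (divPair hP a).1.1 (ω, z) * q z) ∂P)
        - ∫ ω, wver hP z ω * (hgrad (divPair hP a).1.1 (ω, z) *
          (ψ : Lp ℝ 2 (mMeasure P)) (ω, z)) ∂P := by
      intro z
      rw [← integral_sub]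
      · refine integral_congr_ae (ae_of_all _ fun ω => ?_)
        simp only
        ring
      · exact integrable_wver_mul hP (F := fun p => hgrad (divPair hP a).1.1 p * q p.2)
          ((measurable_hgrad hP hf.1).mul hqm) (hfg.integrable_mul hq) z
      · exact integrable_wver_mul hP (F := fun p => hgrad (divPair hP a).1.1 p *
          (ψ : Lp ℝ 2 (mMeasure P)) p)
          ((measurable_hgrad hP hf.1).mul hψm) (hfg.integrable_mul hψ2) z
    simp_rw [e5]
    rw [Finset.sum_sub_distrib]
    simp only [one_div, conj_trivial] at h ⊢
    linarith

end WeakSolution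

/-! ### Flux, drift, and the time increments of the potential field. -/

section Increments

variable {d : ℕ} [MeasurableSpace (Env d)] {P : Measure (Env d)} [IsProbabilityMeasure P]

/-- The flux `w_z (q_z - ψ(·, z))` of a field. -/
def flux (hP : StationaryErgodicEnv P) (q : Nbr d → ℝ) (ψ : Lp ℝ 2 (mMeasure P)) (z : Nbr d)
    (ω : Env d) : ℝ :=
  wver hP z ω * (q z - ψ (ω, z))

/-- The divergence of the flux. -/
def drift (hP : StationaryErgodicEnv P) (q : Nbr d → ℝ) (ψ : Lp ℝ 2 (mMeasure P))
    (ω : Env d) : ℝ :=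
  ∑ z, flux hP q ψ z ω

theorem measurable_flux (hP : StationaryErgodicEnv P) (q : Nbr d → ℝ) (ψ : Lp ℝ 2 (mMeasure P))
    (z : Nbr d) : Measurable (flux hP q ψ z) :=
  (measurable_wver hP z).mul (measurable_const.sub
    ((measurable_coeFn_mMeasure ψ).comp measurable_prodMk_right))

theorem measurable_drift (hP : StationaryErgodicEnv P) (q : Nbr d → ℝ)
    (ψ : Lp ℝ 2 (mMeasure P)) : Measurable (drift hP q ψ) :=
  Finset.measurable_fun_sum _ fun z _ => measurable_flux hP q ψ z

theorem integrable_flux (hP : StationaryErgodicEnv P) (q : Nbr d → ℝ) (ψ : Lp ℝ 2 (mMeasure P))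
    (z : Nbr d) : Integrable (flux hP q ψ z) P := by
  have := isFiniteMeasure_mMeasure hP
  exact integrable_wver_mul hP (F := fun p => q p.2 - ψ p)
    (((measurable_of_finite q).comp measurable_snd).sub (measurable_coeFn_mMeasure ψ))
    (((memLp_const_field hP q).sub (Lp.memLp ψ)).integrable (by norm_num)) z

theorem integrable_drift (hP : StationaryErgodicEnv P) (q : Nbr d → ℝ)
    (ψ : Lp ℝ 2 (mMeasure P)) : Integrable (drift hP q ψ) P :=
  integrable_finsetSum _ fun z _ => integrable_flux hP q ψ z

theorem flux_antisymm (hP : StationaryErgodicEnv P) {q : Nbr d → ℝ} (hq : ∀ z, q z.neg = - q z)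
    {ψ : Lp ℝ 2 (mMeasure P)} (hψ : ψ ∈ L2pot P) :
    ∀ᵐ ω ∂P, ∀ z : Nbr d, flux hP q ψ z.neg (shift 0 z ω) = - flux hP q ψ z ω := by
  filter_upwards [L2pot_antisymm hP hψ, ae_all_iff.mpr (wver_neg_ae hP)] with ω h1 h2 z
  simp only [flux]
  rw [h1, h2, hq]
  ring

theorem integral_mul_intervalIntegral' (hP : StationaryErgodicEnv P)
    {f h : Env d → ℝ} (hf : Measurable f) (hb : ∃ C, ∀ ω, |f ω| ≤ C)
    (hhi : Integrable h P) (x : ZLat d) (a b : ℝ) :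
    ∫ ω, h ω * (∫ s in a..b, f (shift s x ω)) ∂P
      = ∫ s in a..b, ∫ ω, h ω * f (shift s x ω) ∂P := by
  obtain ⟨C, hC⟩ := hb
  simp_rw [← intervalIntegral.integral_const_mul]
  have hint : ∀ u v : ℝ, Integrable (fun p : Env d × ℝ => h p.1 * f (shift p.2 x p.1))
      (P.prod (volume.restrict (Set.Ioc u v))) := by
    intro u v
    refine (hhi.comp_fst (volume.restrict (Set.Ioc u v))).mul_bdd (c := C)
      (hf.comp (hP.measurable_time x)).aestronglyMeasurable ?_
    exact ae_of_all _ fun p => hC _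
  simp_rw [intervalIntegral]
  rw [integral_sub ((hint a b).integral_prod_left) ((hint b a).integral_prod_left)]
  rw [integral_integral_swap (f := fun ω s => h ω * f (shift s x ω)) (hint a b),
    integral_integral_swap (f := fun ω s => h ω * f (shift s x ω)) (hint b a)]

theorem measurable_intervalIntegral_shift (hP : StationaryErgodicEnv P) {f : Env d → ℝ}
    (hf : Measurable f) (x : ZLat d) (a b : ℝ) :
    Measurable fun ω => ∫ s in a..b, f (shift s x ω) := by
  have h : ∀ u v : ℝ, Measurable fun ω => ∫ s in Set.Ioc u v, f (shift s x ω) := by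
    intro u v
    exact (StronglyMeasurable.integral_prod_right (f := fun ω s => f (shift s x ω))
      (hf.comp (hP.measurable_time x)).stronglyMeasurable).measurable
  exact (h a b).sub (h b a)

/-- The time average of a bounded function is a test function. -/
theorem timeAverage_mem_testPairs (hP : StationaryErgodicEnv P) {h : Env d → ℝ}
    (hm : Measurable h) (hb : ∃ C, ∀ ω, |h ω| ≤ C) (T : ℝ) :
    ((fun ω => ∫ u in (-T)..0, h (shift u 0 ω), fun ω => h ω - h (shift (-T) 0 ω)) :
      (Env d → ℝ) × (Env d → ℝ)) ∈ testPairs hP := by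
  have hI : ∀ ω a b, IntervalIntegrable (fun s => h (shift s 0 ω)) volume a b :=
    fun ω a b => intervalIntegrable_of_bounded hP hm hb 0 ω a b
  refine ⟨measurable_intervalIntegral_shift hP hm 0 _ _, hm.sub (hm.comp (hP.measurable_shift' _ _)),
    ?_, ?_, ?_⟩
  · obtain ⟨C, hC⟩ := hb
    refine ⟨C * |0 - -T|, fun ω => ?_⟩
    exact intervalIntegral.norm_integral_le_of_norm_le_const
      (f := fun u => h (shift u 0 ω)) fun s _ => hC _
  · obtain ⟨C, hC⟩ := hb
    exact ⟨C + C, fun ω => (abs_sub _ _).trans (add_le_add (hC _) (hC _))⟩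
  · intro ω r
    simp only [shift_shift, add_zero]
    have hI2 : IntervalIntegrable (fun s => h (shift (-T + s) 0 ω)) volume 0 r := by
      have := hI (shift (-T) 0 ω) 0 r
      simpa only [shift_shift, add_zero, add_comm] using this
    rw [intervalIntegral.integral_sub (hI ω 0 r) hI2]
    · have e1 : ∫ u in (-T)..0, h (shift (u + r) 0 ω) = ∫ u in (-T + r)..(0 + r), h (shift u 0 ω) :=
        intervalIntegral.integral_comp_add_right (fun u => h (shift u 0 ω)) r
      have e2 : ∫ u in (0 : ℝ)..r, h (shift (-T + u) 0 ω)
          = ∫ u in (-T + 0)..(-T + r), h (shift u 0 ω) :=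
        intervalIntegral.integral_comp_add_left (fun u => h (shift u 0 ω)) (-T)
      rw [e1, e2]
      have a1 := intervalIntegral.integral_add_adjacent_intervals (hI ω (-T) 0) (hI ω 0 r)
      have a2 := intervalIntegral.integral_add_adjacent_intervals (hI ω (-T) (-T + r)) (hI ω (-T + r) r)
      simp only [zero_add, add_zero]
      linarith

/-- The family of test pairs is concentrated in the single direction z₀, which isolates one
component of ψ. Antisymmetry of the flux makes the two endpoints of each edge contribute equally,
which cancels the factor 1/2. -/
theorem integral_testPair_mul (hP : StationaryErgodicEnv P) {q : Nbr d → ℝ}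
    (hq : ∀ z, q z.neg = - q z) {ψ : Lp ℝ 2 (mMeasure P)} (hψ : ψ ∈ L2pot P)
    (hw : ∀ a : Nbr d → testPairs hP, ∑ z, ∫ ω, (a z).1.2 ω * ψ (ω, z) ∂P =
        (1 / 2) * ∑ z, ∫ ω, wver hP z ω *
          (hgrad (divPair hP a).1.1 (ω, z) * (q z - ψ (ω, z))) ∂P)
    {p : (Env d → ℝ) × (Env d → ℝ)} (hp : p ∈ testPairs hP) (z₀ : Nbr d) :
    ∫ ω, p.2 ω * ψ (ω, z₀) ∂P
      = - ∫ ω, drift hP q ψ ω * (p.1 (shift 0 (-(z₀ : ZLat d)) ω) - p.1 ω) ∂P := by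
  classical
  have h := hw (Pi.single z₀ ⟨p, hp⟩)
  set f := (divPair hP (Pi.single z₀ ⟨p, hp⟩)).1.1 with hf
  have hf' : ∀ ω, f ω = p.1 (shift 0 (-(z₀ : ZLat d)) ω) - p.1 ω := by
    intro ω
    rw [hf, divPair_fst, Finset.sum_eq_single z₀]
    · simp
    · intro z _ hz
      simp [hz]
    · simp
  have hfm := (divPair hP (Pi.single z₀ ⟨p, hp⟩)).2.1
  obtain ⟨C, hC⟩ := (divPair hP (Pi.single z₀ ⟨p, hp⟩)).2.2.2.1
  rw [← hf] at hfm hC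
  rw [Finset.sum_eq_single z₀] at h
  · rw [Pi.single_eq_same] at h
    rw [h]
    simp_rw [← hf']
    have hfl := measurable_flux hP q ψ
    have hfi := integrable_flux hP q ψ
    have b1 : ∀ z, Integrable (fun ω => flux hP q ψ z ω * f ω) P := fun z =>
      (hfi z).mul_bdd (c := C) hfm.aestronglyMeasurable (ae_of_all _ hC)
    have b2 : ∀ z : Nbr d, Integrable (fun ω => flux hP q ψ z ω * f (shift 0 z ω)) P := fun z =>
      (hfi z).mul_bdd (c := C) (hfm.comp (hP.measurable_shift' 0 z)).aestronglyMeasurable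
        (ae_of_all _ fun ω => hC _)
    have e1 : ∀ z, ∫ ω, wver hP z ω * (hgrad f (ω, z) * (q z - ψ (ω, z))) ∂P
        = - (∫ ω, flux hP q ψ z.neg ω * f ω ∂P) - ∫ ω, flux hP q ψ z ω * f ω ∂P := by
      intro z
      have : ∀ ω, wver hP z ω * (hgrad f (ω, z) * (q z - ψ (ω, z)))
          = flux hP q ψ z ω * f (shift 0 z ω) - flux hP q ψ z ω * f ω := by
        intro ω
        simp only [hgrad, flux]
        ring
      simp_rw [this]
      rw [integral_sub (b2 z) (b1 z), integral_mul_shift hP (hfl z) hfm 0 z, ← integral_neg]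
      congr 1
      refine integral_congr_ae ?_
      filter_upwards [flux_antisymm hP hq hψ] with ω hω
      have := hω z.neg
      rw [Nbr.neg_neg, Nbr.coe_neg] at this
      rw [neg_zero, this]
      ring
    rw [Finset.sum_congr rfl fun z _ => e1 z, Finset.sum_sub_distrib, Finset.sum_neg_distrib,
      Nbr.sum_neg (fun z => ∫ ω, flux hP q ψ z ω * f ω ∂P)]
    simp_rw [drift, Finset.sum_mul]
    rw [integral_finsetSum _ fun z _ => b1 z]
    ring
  · intro z _ hz
    simp [hz]
  · simp

/-- The test function is the average ∫_{-T}^0 h∘τ_u du of an indicator h, with time derivative h -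
h∘τ_{-T}. The weak equation, after moving all shifts off h, says that both sides have the same
integral over every measurable set. -/
theorem ae_time_increment (hP : StationaryErgodicEnv P) {q : Nbr d → ℝ}
    (hq : ∀ z, q z.neg = - q z) {ψ : Lp ℝ 2 (mMeasure P)} (hψ : ψ ∈ L2pot P)
    (hw : ∀ a : Nbr d → testPairs hP, ∑ z, ∫ ω, (a z).1.2 ω * ψ (ω, z) ∂P =
        (1 / 2) * ∑ z, ∫ ω, wver hP z ω *
          (hgrad (divPair hP a).1.1 (ω, z) * (q z - ψ (ω, z))) ∂P)
    (z : Nbr d) (T : ℝ) :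
    ∀ᵐ ω ∂P, ψ (ω, z) - ψ (shift T 0 ω, z)
      = ∫ s in (0 : ℝ)..T, (drift hP q ψ (shift s 0 ω) - drift hP q ψ (shift s z ω)) := by
  set V := drift hP q ψ with hV
  have hVm : Measurable V := measurable_drift hP q ψ
  have hVi : Integrable V P := integrable_drift hP q ψ
  set U : Env d → ℝ := fun ω => V ω - V (shift 0 z ω) with hU
  have hUm : Measurable U := hVm.sub (hVm.comp (hP.measurable_shift' 0 z))
  have hUi : Integrable U P := hVi.sub (hP.integrable_shift hVi 0 z)
  have hψm : Measurable fun ω => ψ (ω, z) :=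
    (measurable_coeFn_mMeasure ψ).comp measurable_prodMk_right
  have hψi : Integrable (fun ω => ψ (ω, z)) P :=
    integrable_of_memLp_mMeasure hP (measurable_coeFn_mMeasure ψ) (Lp.memLp ψ) z
  have hψTi : Integrable (fun ω => ψ (shift T 0 ω, z)) P := hP.integrable_shift hψi T 0
  have hUint : ∀ ω s, V (shift s 0 ω) - V (shift s z ω) = U (shift s 0 ω) := by
    intro ω s
    simp [hU, shift_shift]
  simp_rw [hUint]
  have hRi : Integrable (fun ω => ∫ s in (0 : ℝ)..T, U (shift s 0 ω)) P := by
    simp_rw [intervalIntegral]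
    exact ((integrable_prod_shift hP hUm hUi 0
      (volume.restrict (Set.Ioc 0 T))).integral_prod_left).sub
      ((integrable_prod_shift hP hUm hUi 0
      (volume.restrict (Set.Ioc T 0))).integral_prod_left)
  refine Integrable.ae_eq_of_forall_setIntegral_eq _ _ (hψi.sub hψTi) hRi fun A hA _ => ?_
  set h : Env d → ℝ := A.indicator 1 with hh
  have hm : Measurable h := measurable_one.indicator hA
  have hb : ∃ C, ∀ ω, |h ω| ≤ C := ⟨1, fun ω => by
    by_cases hω : ω ∈ A <;> simp [hh, hω]⟩
  have key := integral_testPair_mul hP hq hψ hw (timeAverage_mem_testPairs hP hm hb T) z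
  simp only at key
  set g : Env d → ℝ := fun ω => ∫ u in (-T)..0, h (shift u 0 ω) with hg
  have hgp := timeAverage_mem_testPairs hP hm hb T
  have hset : ∀ F : Env d → ℝ, ∫ ω in A, F ω ∂P = ∫ ω, h ω * F ω ∂P := by
    intro F
    rw [← integral_indicator hA]
    refine integral_congr_ae (ae_of_all _ fun ω => ?_)
    by_cases hω : ω ∈ A <;> simp [hh, hω]
  have bmul : ∀ {F : Env d → ℝ} (s : ℝ), Integrable F P →
      Integrable (fun ω => h (shift s 0 ω) * F ω) P := by
    intro F s hF
    obtain ⟨C, hC⟩ := hb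
    exact hF.bdd_mul (c := C) (hm.comp (hP.measurable_shift' s 0)).aestronglyMeasurable
      (ae_of_all _ fun ω => hC _)
  have bmul0 : ∀ {F : Env d → ℝ}, Integrable F P → Integrable (fun ω => h ω * F ω) P := by
    intro F hF
    obtain ⟨C, hC⟩ := hb
    exact hF.bdd_mul (c := C) hm.aestronglyMeasurable (ae_of_all _ hC)
  -- left hand side
  have L : ∫ ω, (h ω - h (shift (-T) 0 ω)) * ψ (ω, z) ∂P
      = ∫ ω in A, (ψ (ω, z) - ψ (shift T 0 ω, z)) ∂P := by
    rw [hset]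
    simp_rw [sub_mul, mul_sub]
    rw [integral_sub (bmul0 hψi) (bmul (-T) hψi), integral_sub (bmul0 hψi) (bmul0 hψTi)]
    congr 1
    have := integral_mul_shift hP hm hψm T 0
    rw [neg_zero] at this
    exact this.symm
  have hgm : Measurable g := hgp.1
  obtain ⟨Cg, hCg⟩ := hgp.2.2.1
  have R : - ∫ ω, V ω * (g (shift 0 (-(z : ZLat d)) ω) - g ω) ∂P
      = ∫ ω in A, (∫ s in (0 : ℝ)..T, U (shift s 0 ω)) ∂P := by
    rw [hset]
    have c1 : Integrable (fun ω => V ω * g ω) P :=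
      hVi.mul_bdd (c := Cg) hgm.aestronglyMeasurable (ae_of_all _ hCg)
    have c2 : Integrable (fun ω => V ω * g (shift 0 (-(z : ZLat d)) ω)) P :=
      hVi.mul_bdd (c := Cg) (hgm.comp (hP.measurable_shift' _ _)).aestronglyMeasurable
        (ae_of_all _ fun ω => hCg _)
    have c3 : Integrable (fun ω => V (shift 0 z ω) * g ω) P :=
      (hP.integrable_shift hVi 0 z).mul_bdd (c := Cg) hgm.aestronglyMeasurable (ae_of_all _ hCg)
    have s1 : - ∫ ω, V ω * (g (shift 0 (-(z : ZLat d)) ω) - g ω) ∂P = ∫ ω, U ω * g ω ∂P := by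
      simp_rw [mul_sub, hU, sub_mul]
      rw [integral_sub c2 c1, integral_sub c1 c3, integral_mul_shift hP hVm hgm]
      simp
    rw [s1, hg, integral_mul_intervalIntegral' hP hm hb hUi,
      integral_mul_intervalIntegral hP hUm hUi hm hb]
    -- Stationarity moves the time shift from the indicator to the drift difference, reversing its
    -- sign; the window [-T,0] becomes [0,T].
    have s2 : ∀ s : ℝ, ∫ ω, U ω * h (shift s 0 ω) ∂P = ∫ ω, h ω * U (shift (-s) 0 ω) ∂P := by
      intro s
      rw [integral_mul_shift hP hUm hm s 0, neg_zero]
      simp_rw [mul_comm]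
    simp_rw [s2]
    have := intervalIntegral.integral_comp_neg (a := -T) (b := 0)
      (fun s => ∫ ω, h ω * U (shift s 0 ω) ∂P)
    rw [this]
    simp
  exact L.symm.trans (key.trans R)

end Increments

/-! ### Extension along paths, and a version valid at all times. -/

section Extension

variable {d : ℕ} [MeasurableSpace (Env d)] {P : Measure (Env d)} [IsProbabilityMeasure P]

theorem lattice_induction {Q : ZLat d → Prop} (h0 : Q 0)
    (h1 : ∀ x (z : Nbr d), Q x → Q (x + z)) (x : ZLat d) : Q x := by
  have key : ∀ {a b : ZLat d}, (latticeGraph d).Walk a b → Q a → Q b := by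
    intro a b w
    induction w with
    | nil => exact id
    | @cons a b c h w ih =>
      intro ha
      refine ih ?_
      have := h1 a (Nbr.ofAdj h) ha
      simpa [Nbr.ofAdj] using this
  exact key (exists_walk_length 0 x).choose h0

/-- The sum of a field along the steps of a walk. -/
def walkSum (ψ : Env d × Nbr d → ℝ) (ω : Env d) {x y : ZLat d} (w : (latticeGraph d).Walk x y) :
    ℝ :=
  (w.darts.map fun e => ψ (shift 0 e.fst ω, dartStep e)).sum

theorem walkSum_eq_of_step {ψ : Env d × Nbr d → ℝ} {ω : Env d} {χ : ZLat d → ℝ}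
    (h : ∀ x (z : Nbr d), χ (x + z) = χ x + ψ (shift 0 x ω, z)) {x y : ZLat d}
    (w : (latticeGraph d).Walk x y) : walkSum ψ ω w = χ y - χ x := by
  induction w with
  | nil => simp [walkSum]
  | @cons a b c hab w ih =>
    have h1 := h a (Nbr.ofAdj hab)
    have h2 : walkSum ψ ω (SimpleGraph.Walk.cons hab w)
        = ψ (shift 0 a ω, Nbr.ofAdj hab) + walkSum ψ ω w := by
      simp only [walkSum, SimpleGraph.Walk.darts_cons, List.map_cons, List.sum_cons]
      rfl
    rw [h2, ih]
    simp only [Nbr.ofAdj, add_sub_cancel] at h1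
    rw [h1]
    simp only [Nbr.ofAdj]
    ring

theorem intervalIntegrable_of_locallyIntegrable {f : ℝ → ℝ} (hf : LocallyIntegrable f volume)
    (a b : ℝ) : IntervalIntegrable f volume a b :=
  ((locallyIntegrable_iff.mp hf) _ isCompact_uIcc).intervalIntegrable

/-- The increments φ_k(τ_{0,x}ω) - φ_k(ω) of the approximate potentials converge along every step of
a path, hence for every x. Their limit is path independent by construction and has a measurable
version. -/
theorem exists_extension (hP : StationaryErgodicEnv P) {ψ : Lp ℝ 2 (mMeasure P)}
    {φ : ℕ → Env d → ℝ} (hφ : ∀ k, Measurable (φ k))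
    (h : ∀ k z, ∫⁻ ω, ‖ψ (ω, z) - hgrad (φ k) (ω, z)‖ₑ ∂P ≤ (4⁻¹ : ℝ≥0∞) ^ k) :
    ∃ Ψ : Env d → ZLat d → ℝ, (∀ x, Measurable fun ω => Ψ ω x) ∧
      (∀ᵐ ω ∂P, ∀ x (z : Nbr d), Ψ ω (x + z) = Ψ ω x + ψ (shift 0 x ω, z)) ∧
      (∀ᵐ ω ∂P, Ψ ω 0 = 0) := by
  have hst : ∀ᵐ ω ∂P, ∀ x (z : Nbr d), Tendsto (fun k => φ k (shift 0 (x + z) ω)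
      - φ k (shift 0 x ω)) atTop (𝓝 (ψ (shift 0 x ω, z))) := by
    filter_upwards [hP.ae_shift_space (ae_tendsto_hgrad hP hφ h) 0] with ω hω x z
    refine (hω x z).congr fun k => ?_
    simp [hgrad, shift_shift, add_comm]
  have hex : ∀ x, ∀ᵐ ω ∂P, ∃ l, Tendsto (fun k => φ k (shift 0 x ω) - φ k ω) atTop (𝓝 l) := by
    intro x
    filter_upwards [hst] with ω hω
    refine lattice_induction (Q := fun x => ∃ l, Tendsto (fun k => φ k (shift 0 x ω) - φ k ω)
      atTop (𝓝 l)) ⟨0, ?_⟩ ?_ x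
    · simp [shift_zero]
    · rintro x z ⟨l, hl⟩
      refine ⟨l + ψ (shift 0 x ω, z), (hl.add (hω x z)).congr fun k => ?_⟩
      ring
  have hlim : ∀ x, ∃ Ψx : Env d → ℝ, Measurable Ψx ∧
      ∀ᵐ ω ∂P, Tendsto (fun k => φ k (shift 0 x ω) - φ k ω) atTop (𝓝 (Ψx ω)) := fun x =>
    measurable_limit_of_tendsto_metrizable_ae
      (fun k => (((hφ k).comp (hP.measurable_shift' 0 x)).sub (hφ k)).aemeasurable) (hex x)
  choose Ψ hΨm hΨ using hlim
  refine ⟨fun ω x => Ψ x ω, hΨm, ?_, ?_⟩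
  · filter_upwards [hst, ae_all_iff.mpr hΨ] with ω h1 h2 x z
    refine tendsto_nhds_unique (h2 (x + z)) ?_
    refine ((h2 x).add (h1 x z)).congr fun k => ?_
    ring
  · filter_upwards [hΨ 0] with ω h1
    refine tendsto_nhds_unique h1 ?_
    simp [shift_zero]

theorem intervalIntegral_eq_mul (f : ℝ → ℝ) (s : ℝ) :
    ∫ r in (0 : ℝ)..s, f r = s * ∫ v in (0 : ℝ)..1, f (s * v) := by
  have := intervalIntegral.smul_integral_comp_mul_left (a := 0) (b := 1) f s
  simp only [mul_zero, mul_one, smul_eq_mul] at this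
  exact this.symm

/-- Rescaling to the fixed interval [0,1] turns the variable endpoint into a parameter of the
integrand, to which measurability of parameter integrals applies. -/
theorem measurable_primitive (hP : StationaryErgodicEnv P) {f : Env d → ℝ} (hf : Measurable f)
    (x : ZLat d) : Measurable fun p : Env d × ℝ => ∫ r in (0 : ℝ)..p.2, f (shift r x p.1) := by
  have h : ∀ p : Env d × ℝ, ∫ r in (0 : ℝ)..p.2, f (shift r x p.1)
      = p.2 * ∫ v in (0 : ℝ)..1, f (shift (p.2 * v) x p.1) := fun p =>
    intervalIntegral_eq_mul (fun r => f (shift r x p.1)) p.2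
  simp_rw [h]
  refine measurable_snd.mul ?_
  simp_rw [intervalIntegral.integral_of_le zero_le_one]
  refine (StronglyMeasurable.integral_prod_right
    (f := fun (p : Env d × ℝ) (v : ℝ) => f (shift (p.2 * v) x p.1)) ?_).measurable
  refine Measurable.stronglyMeasurable ?_
  exact hf.comp ((hP.measurable_time x).comp
    (f := fun r : (Env d × ℝ) × ℝ => (r.1.1, r.1.2 * r.2)) (by fun_prop))

/-- A field whose time increments are integrals, at each fixed time almost surely, has a version
for which this holds simultaneously for all times. -/
theorem exists_version_of_time_increment (hP : StationaryErgodicEnv P) {Y U : Env d → ℝ}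
    (hY : Measurable Y) (hU : Measurable U) (hUi : Integrable U P)
    (h : ∀ T : ℝ, ∀ᵐ ω ∂P, Y (shift T 0 ω) = Y ω - ∫ s in (0 : ℝ)..T, U (shift s 0 ω)) :
    ∃ Y' : Env d → ℝ, Measurable Y' ∧ (∀ᵐ ω ∂P, Y' ω = Y ω) ∧
      ∀ᵐ ω ∂P, ∀ t : ℝ, Y' (shift t 0 ω) = Y' ω - ∫ s in (0 : ℝ)..t, U (shift s 0 ω) := by
  have hYm : Measurable fun p : Env d × ℝ => Y (shift p.2 0 p.1) := hY.comp (hP.measurable_time 0)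
  have hset : MeasurableSet {p : Env d × ℝ | Y (shift p.2 0 p.1) =
      Y p.1 - ∫ s in (0 : ℝ)..p.2, U (shift s 0 p.1)} :=
    measurableSet_eq_fun hYm ((hY.comp measurable_fst).sub (measurable_primitive hP hU 0))
  -- The relation is a measurable condition on (ω,T), so Fubini exchanges the quantifiers: almost
  -- surely it holds at almost every time.
  have hae : ∀ᵐ ω ∂P, ∀ᵐ T : ℝ, Y (shift T 0 ω) = Y ω - ∫ s in (0 : ℝ)..T, U (shift s 0 ω) :=
    (Measure.ae_ae_comm (p := fun ω T => Y (shift T 0 ω) =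
      Y ω - ∫ s in (0 : ℝ)..T, U (shift s 0 ω)) hset).mpr (ae_of_all _ h)
  -- The initial value reconstructed from time s is averaged over s in [0,1]. An average does not
  -- see null sets of times, so at τ_{t,0}ω it can be evaluated for every t.
  set Y' : Env d → ℝ := fun ω => ∫ s in (0 : ℝ)..1,
    (Y (shift s 0 ω) + ∫ r in (0 : ℝ)..s, U (shift r 0 ω)) with hY'
  have hall : ∀ᵐ ω ∂P, ∀ t : ℝ, Y' (shift t 0 ω) = Y ω - ∫ s in (0 : ℝ)..t, U (shift s 0 ω) := by
    filter_upwards [hae, hP.ae_locallyIntegrable hU hUi] with ω h1 h2 t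
    have hI : ∀ a b, IntervalIntegrable (fun s => U (shift s 0 ω)) volume a b := fun a b =>
      intervalIntegrable_of_locallyIntegrable (h2 0) a b
    have h3 : ∀ᵐ s : ℝ, Y (shift (s + t) 0 ω)
        = Y ω - ∫ r in (0 : ℝ)..(s + t), U (shift r 0 ω) :=
      (measurePreserving_add_right volume t).quasiMeasurePreserving.ae h1
    have h4 : ∫ s in (0 : ℝ)..1, (Y (shift s 0 (shift t 0 ω))
        + ∫ r in (0 : ℝ)..s, U (shift r 0 (shift t 0 ω)))
        = ∫ s in (0 : ℝ)..1, (Y ω - ∫ s in (0 : ℝ)..t, U (shift s 0 ω)) := by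
      refine intervalIntegral.integral_congr_ae ?_
      filter_upwards [h3] with s hs _
      simp only [shift_shift, add_zero]
      rw [hs]
      have e1 : ∫ r in (0 : ℝ)..s, U (shift (r + t) 0 ω)
          = ∫ r in (0 + t)..(s + t), U (shift r 0 ω) :=
        intervalIntegral.integral_comp_add_right (fun r => U (shift r 0 ω)) t
      rw [e1, zero_add, ← intervalIntegral.integral_add_adjacent_intervals (hI 0 t) (hI t (s + t))]
      ring
    rw [hY']
    simp only
    rw [h4]
    simp
  have hY'0 : ∀ᵐ ω ∂P, Y' ω = Y ω := by
    filter_upwards [hall] with ω hω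
    have := hω 0
    simpa [shift_zero] using this
  refine ⟨Y', ?_, hY'0, ?_⟩
  · have := (StronglyMeasurable.integral_prod_right (ν := volume.restrict (Set.Ioc (0 : ℝ) 1))
      (f := fun ω s => Y (shift s 0 ω) + ∫ r in (0 : ℝ)..s, U (shift r 0 ω))
      (hYm.add (measurable_primitive hP hU 0)).stronglyMeasurable).measurable
    simpa only [hY', intervalIntegral.integral_of_le zero_le_one] using this
  · filter_upwards [hall, hY'0] with ω h1 h2 t
    rw [h1, h2]

/-- Existence of the corrector in the direction given by the odd function `q`. -/
theorem exists_corrector (hP : StationaryErgodicEnv P) {q : Nbr d → ℝ}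
    (hq : ∀ z, q z.neg = - q z) :
    ∃ (ψ : Lp ℝ 2 (mMeasure P)) (φ : ℕ → Env d → ℝ) (χ : Env d → ZLat d → ℝ),
      ψ ∈ L2pot P ∧ (∀ k, Measurable (φ k)) ∧ (∀ k, ∃ C, ∀ ω, |φ k ω| ≤ C) ∧
      (∀ k z, ∫⁻ ω, ‖ψ (ω, z) - hgrad (φ k) (ω, z)‖ₑ ∂P ≤ (4⁻¹ : ℝ≥0∞) ^ k) ∧
      (∀ x, Measurable fun ω => χ ω x) ∧
      (∀ᵐ ω ∂P, χ ω 0 = 0 ∧ ∀ x (z : Nbr d), χ ω (x + z) = χ ω x + ψ (shift 0 x ω, z)) ∧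
      ∀ᵐ ω ∂P, ∀ x (t : ℝ), χ (shift t 0 ω) x = χ ω x
        - ∫ s in (0 : ℝ)..t, (drift hP q ψ (shift s 0 ω) - drift hP q ψ (shift s x ω)) := by
  obtain ⟨ψ, hψ, hw⟩ := exists_weak_solution hP q
  obtain ⟨φ, hφ1, hφ2, hφ3⟩ := exists_potential hP hψ
  obtain ⟨Ψ, hΨm, hΨ1, hΨ0⟩ := exists_extension hP hφ1 hφ3
  set V := drift hP q ψ with hV
  have hVm : Measurable V := measurable_drift hP q ψ
  have hVi : Integrable V P := integrable_drift hP q ψ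
  have hU : ∀ x ω s, V (shift s 0 ω) - V (shift s x ω)
      = (fun ω => V ω - V (shift 0 x ω)) (shift s 0 ω) := by
    intro x ω s
    simp [shift_shift]
  have hUm : ∀ x, Measurable fun ω => V ω - V (shift 0 x ω) := fun x =>
    hVm.sub (hVm.comp (hP.measurable_shift' 0 x))
  have hUi : ∀ x, Integrable (fun ω => V ω - V (shift 0 x ω)) P := fun x =>
    hVi.sub (hP.integrable_shift hVi 0 x)
  have hloc := hP.ae_locallyIntegrable hVm hVi
  -- Induction along a path from 0: the drifts at the intermediate points telescope.
  have hinc : ∀ x, ∀ T : ℝ, ∀ᵐ ω ∂P, Ψ (shift T 0 ω) x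
      = Ψ ω x - ∫ s in (0 : ℝ)..T, (V (shift s 0 ω) - V (shift s x ω)) := by
    intro x T
    refine lattice_induction (Q := fun x => ∀ᵐ ω ∂P, Ψ (shift T 0 ω) x
      = Ψ ω x - ∫ s in (0 : ℝ)..T, (V (shift s 0 ω) - V (shift s x ω))) ?_ ?_ x
    · filter_upwards [hΨ0, hP.ae_shift hΨ0 T 0] with ω h1 h2
      simp [h1, h2]
    · intro x z hx
      filter_upwards [hx, hΨ1, hP.ae_shift hΨ1 T 0,
        hP.ae_shift (ae_time_increment hP hq hψ hw z T) 0 x, hloc] with ω h1 h2 h3 h4 h5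
      have hI : ∀ y, IntervalIntegrable (fun s => V (shift s y ω)) volume 0 T := fun y =>
        intervalIntegrable_of_locallyIntegrable (h5 y) 0 T
      rw [h3 x z, h2 x z, h1]
      simp only [shift_shift, zero_add, add_zero, ← hV] at h4 ⊢
      rw [intervalIntegral.integral_sub (hI _) (hI _)] at h4 ⊢
      rw [intervalIntegral.integral_sub (hI _) (hI _)]
      rw [add_comm (z : ZLat d) x] at h4
      linarith
  have hver := fun x => exists_version_of_time_increment hP (hΨm x) (hUm x) (hUi x)
    (fun T => by
      filter_upwards [hinc x T] with ω hω
      rw [hω]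
      simp [shift_shift])
  choose χ hχm hχ1 hχ2 using hver
  refine ⟨ψ, φ, fun ω x => χ x ω, hψ, hφ1, hφ2, hφ3, hχm, ?_, ?_⟩
  · filter_upwards [ae_all_iff.mpr hχ1, hΨ0, hΨ1] with ω h1 h2 h3
    refine ⟨by rw [h1, h2], fun x z => ?_⟩
    rw [h1, h1, h3]
  · filter_upwards [ae_all_iff.mpr hχ2] with ω h1 x t
    rw [h1 x t]
    simp [shift_shift, hV]

end Extension

/-! ### Weighted Sobolev inequality on the lattice -/

section Sobolev

variable {d : ℕ}

theorem lintegral_pi_count (f : ZLat d → ℝ≥0∞) :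
    ∫⁻ x, f x ∂(Measure.pi fun _ : Fin d => (Measure.count : Measure ℤ)) = ∑' x, f x := by
  rw [lintegral_countable']
  refine tsum_congr fun x => ?_
  rw [Measure.pi_singleton]
  simp

/-- The positive unit vectors as neighbours of the origin. -/
def unitNbr (i : Fin d) : Nbr d :=
  ⟨Pi.single i 1, by
    have := latticeGraph_adj_single (0 : ZLat d) i (c := 1) (by simp)
    rw [zero_add] at this
    exact this⟩

theorem unitNbr_injective : Function.Injective (unitNbr : Fin d → Nbr d) := by
  intro i j h
  have h1 : (Pi.single i 1 : ZLat d) = Pi.single j 1 := congrArg Subtype.val h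
  by_contra hne
  have := congrFun h1 i
  simp [hne] at this

theorem enorm_zero_le_add_sum (c : ℕ → ℝ) (g : ℕ → ℝ≥0∞)
    (h : ∀ k, ‖c (k + 1) - c k‖ₑ ≤ g k) (K : ℕ) :
    ‖c 0‖ₑ ≤ ‖c K‖ₑ + ∑ k ∈ Finset.range K, g k := by
  induction K with
  | zero => simp
  | succ K ih =>
    have h3 : ‖c K‖ₑ ≤ ‖c (K + 1)‖ₑ + g K := by
      have := enorm_sub_le (a := c (K + 1)) (b := c (K + 1) - c K)
      rw [sub_sub_cancel] at this
      exact this.trans (add_le_add le_rfl (h K))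
    rw [Finset.sum_range_succ]
    refine ih.trans ((add_le_add h3 le_rfl).trans (le_of_eq ?_))
    rw [add_assoc, add_comm (g K)]

/-- Telescoping along the positive i-th axis until the support of u is left. Bounding by the full
sum over directions gives a right hand side of the same form for all i, as the inequality for
products over grid lines requires. -/
theorem enorm_le_tsum_update {u : ZLat d → ℝ} {N : ℕ} (hu : ∀ x, N ≤ l1norm x → u x = 0)
    (x : ZLat d) (i : Fin d) :
    ‖u x‖ₑ ≤ ∑' m : ℤ, ∑ k : Fin d,
      ‖u (Function.update x i m + Pi.single k 1) - u (Function.update x i m)‖ₑ := by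
  set g : ℤ → ℝ≥0∞ := fun m => ∑ k : Fin d,
      ‖u (Function.update x i m + Pi.single k 1) - u (Function.update x i m)‖ₑ with hg
  have key : ∀ m : ℤ, ‖u (Function.update x i (m + 1)) - u (Function.update x i m)‖ₑ ≤ g m := by
    intro m
    have e2 : Function.update x i (m + 1) = Function.update x i m + Pi.single i 1 := by
      funext j
      by_cases h : j = i
      · subst h; simp
      · simp [h]
    rw [e2]
    exact Finset.single_le_sum (f := fun k' : Fin d =>
      ‖u (Function.update x i m + Pi.single k' 1) - u (Function.update x i m)‖ₑ)
      (fun _ _ => zero_le) (Finset.mem_univ i)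
  have h1 := enorm_zero_le_add_sum (fun k : ℕ => u (Function.update x i (x i + k)))
    (fun k : ℕ => g (x i + k)) (fun k => by
      have := key (x i + k)
      rw [add_assoc] at this
      simpa using this) (N + l1norm x)
  have hz : u (Function.update x i (x i + ((N + l1norm x : ℕ) : ℤ))) = 0 := by
    apply hu
    have h1 := natAbs_le_l1norm (Function.update x i (x i + ((N + l1norm x : ℕ) : ℤ))) i
    have h2 := natAbs_le_l1norm x i
    rw [Function.update_self] at h1
    generalize Function.update x i (x i + ((N + l1norm x : ℕ) : ℤ)) = y at h1 ⊢
    omega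
  simp only [Nat.cast_zero, add_zero, Function.update_eq_self] at h1
  rw [hz, enorm_zero, zero_add] at h1
  refine h1.trans ?_
  have hinj : Set.InjOn (fun k : ℕ => x i + (k : ℤ)) (Finset.range (N + l1norm x)) := by
    intro a _ b _ hab
    simpa using hab
  rw [← Finset.sum_image (f := g) hinj]
  exact ENNReal.sum_le_tsum _

/-- Discrete Gagliardo–Nirenberg–Sobolev inequality. -/
theorem tsum_rpow_le_tsum_grad (hd : 2 ≤ d) {u : ZLat d → ℝ} {N : ℕ}
    (hu : ∀ x, N ≤ l1norm x → u x = 0) :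
    ∑' x, ‖u x‖ₑ ^ ((d : ℝ) / (d - 1))
      ≤ (∑' x, ∑ k : Fin d, ‖u (x + Pi.single k 1) - u x‖ₑ) ^ ((d : ℝ) / (d - 1)) := by
  have hd1 : (1 : ℝ) < d := by exact_mod_cast (by omega : 1 < d)
  have hp : Real.HolderConjugate (Fintype.card (Fin d) : ℝ) ((d : ℝ) / (d - 1)) := by
    rw [Fintype.card_fin]
    exact Real.HolderConjugate.conjExponent hd1
  -- The grid-line inequality behind the continuous Gagliardo–Nirenberg–Sobolev inequality holds for
  -- arbitrary product measures; here all factors are counting measures on ℤ.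
  have key := lintegral_prod_lintegral_pow_le
    (fun _ : Fin d => (Measure.count : Measure ℤ)) hp
    (f := fun x : ZLat d => ∑ k : Fin d, ‖u (x + Pi.single k 1) - u x‖ₑ)
    (measurable_of_countable _)
  rw [lintegral_pi_count, lintegral_pi_count] at key
  refine le_trans (ENNReal.tsum_le_tsum fun x => ?_) key
  simp_rw [lintegral_count]
  -- The exponent d/(d-1) is split into d factors 1/(d-1), one for each coordinate line.
  calc ‖u x‖ₑ ^ ((d : ℝ) / (d - 1))
      = ∏ _i : Fin d, ‖u x‖ₑ ^ ((1 : ℝ) / ((Fintype.card (Fin d) : ℝ) - 1)) := by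
        rw [Finset.prod_const, Finset.card_univ, Fintype.card_fin, ← ENNReal.rpow_natCast,
          ← ENNReal.rpow_mul]
        congr 1
        field_simp
    _ ≤ _ := by
        refine Finset.prod_le_prod' fun i _ => ENNReal.rpow_le_rpow (enorm_le_tsum_update hu x i) ?_
        rw [Fintype.card_fin]
        exact div_nonneg zero_le_one (by linarith)

/-- Sums over oriented edges with both endpoints in a ball are symmetric. -/
theorem sum_fball_nbr_comm {M : Type*} [AddCommMonoid M] {N : ℕ} (G : ZLat d → ZLat d → M)
    (hG : ∀ x y, x ∉ fball d N ∨ y ∉ fball d N → G x y = 0) :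
    ∑ x ∈ fball d N, ∑ z : Nbr d, G x (x + z) = ∑ x ∈ fball d N, ∑ z : Nbr d, G (x + z) x := by
  classical
  have key : ∀ (G : ZLat d → ZLat d → M)
      (_ : ∀ x y, x ∉ fball d N ∨ y ∉ fball d N → G x y = 0),
      ∑ x ∈ fball d N, ∑ z : Nbr d, G x (x + z)
        = ∑ x ∈ fball d N, ∑ y ∈ fball d N, if (latticeGraph d).Adj x y then G x y else 0 := by
    intro G hG
    refine Finset.sum_congr rfl fun x _ => ?_
    rw [← sum_neighborFinset x (fun y => G x y), ← Finset.sum_filter]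
    symm
    refine Finset.sum_subset ?_ ?_
    · intro y hy
      simpa using (Finset.mem_filter.mp hy).2
    · intro y hy hy'
      refine hG x y (Or.inr fun hyB => hy' ?_)
      exact Finset.mem_filter.mpr ⟨hyB, by simpa using hy⟩
  rw [key G hG, key (fun x y => G y x) (fun x y h => hG y x h.symm), Finset.sum_comm]
  simp_rw [(latticeGraph d).adj_comm]

/-- Convexity in the form of Bernoulli's inequality at the larger endpoint; keeping both endpoints
on the right makes the bound symmetric. -/
theorem abs_rpow_sub_rpow_le {a b β : ℝ} (ha : 0 ≤ a) (hb : 0 ≤ b) (hβ : 1 ≤ β) :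
    |b ^ β - a ^ β| ≤ β * ((a ^ (β - 1) + b ^ (β - 1)) * |b - a|) := by
  have main : ∀ {a b : ℝ}, 0 ≤ a → 0 ≤ b → a ≤ b → b ^ β - a ^ β ≤ β * (b ^ (β - 1) * (b - a)) := by
    intro a b ha hb hab
    rcases hb.eq_or_lt with h0 | hpos
    · have : a = 0 := le_antisymm (h0 ▸ hab) ha
      rw [← h0, this]
      simp
    · have h1 := one_add_mul_self_le_rpow_one_add (s := a / b - 1)
        (by have : 0 ≤ a / b := by positivity
            linarith) hβ
      rw [add_sub_cancel, Real.div_rpow ha hb] at h1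
      have hbβ : 0 < b ^ β := Real.rpow_pos_of_pos hpos β
      have h2 : (1 + β * (a / b - 1)) * b ^ β ≤ a ^ β := by
        rwa [le_div_iff₀ hbβ] at h1
      have h3 : b ^ β = b ^ (β - 1) * b := by
        rw [← Real.rpow_add_one hpos.ne']
        ring_nf
      have h4 : (1 + β * (a / b - 1)) * b ^ β = b ^ β - β * (b ^ (β - 1) * (b - a)) := by
        rw [h3]
        field_simp
        ring
      linarith
  have hA : 0 ≤ a ^ (β - 1) := Real.rpow_nonneg ha _
  have hB : 0 ≤ b ^ (β - 1) := Real.rpow_nonneg hb _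
  rcases le_total a b with hab | hab
  · rw [abs_of_nonneg (sub_nonneg.mpr (Real.rpow_le_rpow ha hab (by linarith))),
      abs_of_nonneg (sub_nonneg.mpr hab)]
    refine (main ha hb hab).trans (mul_le_mul_of_nonneg_left ?_ (by linarith))
    exact mul_le_mul_of_nonneg_right (by linarith) (by linarith)
  · rw [abs_sub_comm, abs_of_nonneg (sub_nonneg.mpr (Real.rpow_le_rpow hb hab (by linarith))),
      abs_sub_comm, abs_of_nonneg (sub_nonneg.mpr hab)]
    refine (main hb ha hab).trans (mul_le_mul_of_nonneg_left ?_ (by linarith))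
    exact mul_le_mul_of_nonneg_right (by linarith) (by linarith)

theorem tsum_grad_le_sum_fball {u : ZLat d → ℝ} {N : ℕ} (hu : ∀ x, N ≤ l1norm x → u x = 0) :
    ∑' x, ∑ k : Fin d, ‖u (x + Pi.single k 1) - u x‖ₑ
      ≤ ∑ x ∈ fball d N, ∑ z : Nbr d, ‖u (x + z) - u x‖ₑ := by
  rw [tsum_eq_sum (s := fball d N)]
  · refine Finset.sum_le_sum fun x _ => ?_
    have h := Finset.sum_image (s := Finset.univ) (g := unitNbr)
      (f := fun z : Nbr d => ‖u (x + z) - u x‖ₑ) unitNbr_injective.injOn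
    refine le_trans (le_of_eq h.symm) ?_
    exact Finset.sum_le_sum_of_subset (Finset.subset_univ _)
  · intro x hx
    rw [mem_fball, not_le] at hx
    refine Finset.sum_eq_zero fun k _ => ?_
    rw [hu x hx.le, hu]
    · simp
    · have h1 := l1norm_add_le (x + Pi.single k 1) (-Pi.single k 1)
      rw [add_neg_cancel_right, l1norm_neg] at h1
      have h2 : l1norm (Pi.single k 1 : ZLat d) = 1 := (unitNbr k).l1norm_eq
      omega

/-- The chain rule for powers produces one term for each endpoint. The sum over oriented edges is
invariant under reversal, so both terms have the same sum, whence the factor 2. -/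
theorem sum_rpow_sub_le {N : ℕ} {β : ℝ} {v : ZLat d → ℝ} (hv0 : ∀ x, 0 ≤ v x)
    (hv : ∀ x, N ≤ l1norm x → v x = 0) (hβ : 1 ≤ β) :
    ∑ x ∈ fball d N, ∑ z : Nbr d, ‖v (x + z) ^ β - v x ^ β‖ₑ
      ≤ ENNReal.ofReal (2 * β) * ∑ x ∈ fball d N, ∑ z : Nbr d,
        ENNReal.ofReal (v x ^ (β - 1) * |v (x + z) - v x|) := by
  classical
  have hβ0 : 0 ≤ β := by linarith
  set G : ZLat d → ZLat d → ℝ≥0∞ := fun x y => ENNReal.ofReal (v x ^ (β - 1) * |v y - v x|) with hG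
  have h1 : ∀ x y : ZLat d, ‖v y ^ β - v x ^ β‖ₑ ≤ ENNReal.ofReal β * (G x y + G y x) := by
    intro x y
    have p1 := Real.rpow_nonneg (hv0 x) (β - 1)
    have p2 := Real.rpow_nonneg (hv0 y) (β - 1)
    simp only [hG]
    rw [← ENNReal.ofReal_add (mul_nonneg p1 (abs_nonneg _)) (mul_nonneg p2 (abs_nonneg _)),
      ← ENNReal.ofReal_mul hβ0, Real.enorm_eq_ofReal_abs]
    refine ENNReal.ofReal_le_ofReal ?_
    refine (abs_rpow_sub_rpow_le (hv0 x) (hv0 y) hβ).trans (le_of_eq ?_)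
    rw [abs_sub_comm (v x), add_mul]
  have hz : ∀ x y : ZLat d, (latticeGraph d).Adj x y → x ∉ fball d N ∨ y ∉ fball d N →
      G x y = 0 := by
    intro x y hxy h
    have hl1 := l1norm_sub_of_adj hxy
    have hl2 := l1norm_sub_of_adj hxy.symm
    have t1 := l1norm_add_le (y - x) x
    have t2 := l1norm_add_le (x - y) y
    rw [sub_add_cancel] at t1 t2
    rw [mem_fball, mem_fball] at h
    have e1 : v x = 0 := by apply hv; omega
    have e2 : v y = 0 := by apply hv; omega
    simp [hG, e1, e2]
  have hcomm := sum_fball_nbr_comm (N := N)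
    (fun x y => if (latticeGraph d).Adj x y then G x y else 0) (by
      intro x y h
      by_cases hxy : (latticeGraph d).Adj x y
      · simp only [hxy, if_true]
        exact hz x y hxy h
      · simp [hxy])
  have hcomm' : ∑ x ∈ fball d N, ∑ z : Nbr d, G x (x + z)
      = ∑ x ∈ fball d N, ∑ z : Nbr d, G (x + z) x := by
    refine Eq.trans ?_ (hcomm.trans ?_)
    · exact Finset.sum_congr rfl fun x _ => Finset.sum_congr rfl fun z _ =>
        (if_pos (Nbr.adj_add z x)).symm
    · exact Finset.sum_congr rfl fun x _ => Finset.sum_congr rfl fun z _ =>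
        if_pos (Nbr.adj_add z x).symm
  calc _ ≤ ∑ x ∈ fball d N, ∑ z : Nbr d, ENNReal.ofReal β * (G x (x + z) + G (x + z) x) :=
        Finset.sum_le_sum fun x _ => Finset.sum_le_sum fun z _ => h1 x (x + z)
    _ = ENNReal.ofReal (2 * β) * ∑ x ∈ fball d N, ∑ z : Nbr d, G x (x + z) := by
        simp_rw [← Finset.mul_sum, Finset.sum_add_distrib]
        rw [← hcomm', ← two_mul, ← mul_assoc, ENNReal.ofReal_mul (by norm_num),
          ENNReal.ofReal_ofNat, mul_comm (ENNReal.ofReal β)]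

/-- Cauchy–Schwarz over oriented edges, with the weight a on the gradient and its inverse on the
power of v. -/
theorem sum_rpow_mul_abs_sub_le {β : ℝ} {v : ZLat d → ℝ} (hv0 : ∀ x, 0 ≤ v x)
    (hβge : 1 ≤ β) {a : ZLat d → ZLat d → ℝ} (ha : ∀ x (z : Nbr d), 0 < a x (x + z))
    (B : Finset (ZLat d)) :
    ∑ x ∈ B, ∑ z : Nbr d, ENNReal.ofReal (v x ^ (β - 1) * |v (x + z) - v x|)
      ≤ (∑ x ∈ B, ∑ z : Nbr d, ENNReal.ofReal (a x (x + z) * (v (x + z) - v x) ^ 2)) ^ (1 / 2 : ℝ)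
        * (∑ x ∈ B, ENNReal.ofReal (v x) ^ (2 * (β - 1)) *
        ENNReal.ofReal (∑ z : Nbr d, (a x (x + z))⁻¹)) ^ (1 / 2 : ℝ) := by
  rw [← Finset.sum_product']
  have h1 := ENNReal.inner_le_Lp_mul_Lq (B ×ˢ (Finset.univ : Finset (Nbr d)))
    (fun r => ENNReal.ofReal (a r.1 (r.1 + r.2) * (v (r.1 + r.2) - v r.1) ^ 2) ^ (1 / 2 : ℝ))
    (fun r => (ENNReal.ofReal (v r.1) ^ (2 * (β - 1)) *
      ENNReal.ofReal ((a r.1 (r.1 + r.2))⁻¹)) ^ (1 / 2 : ℝ)) Real.HolderConjugate.two_two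
  have e0 : (1 / 2 : ℝ) * 2 = 1 := by norm_num
  simp_rw [← ENNReal.rpow_mul, e0, ENNReal.rpow_one] at h1
  rw [Finset.sum_product' (f := fun x (z : Nbr d) =>
      ENNReal.ofReal (a x (x + z) * (v (x + z) - v x) ^ 2)),
    Finset.sum_product' (f := fun x (z : Nbr d) =>
      ENNReal.ofReal (v x) ^ (2 * (β - 1)) * ENNReal.ofReal ((a x (x + z))⁻¹))] at h1
  have h2 : ∀ x : ZLat d, ENNReal.ofReal (∑ z : Nbr d, (a x (x + z))⁻¹)
      = ∑ z : Nbr d, ENNReal.ofReal ((a x (x + z))⁻¹) := fun x =>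
    ENNReal.ofReal_sum_of_nonneg fun z _ => (inv_pos.mpr (ha x z)).le
  simp_rw [h2, Finset.mul_sum]
  refine le_trans (le_of_eq ?_) h1
  refine Finset.sum_congr rfl fun r _ => ?_
  have hapos := ha r.1 r.2
  have hvr := hv0 r.1
  generalize a r.1 (r.1 + r.2) = α at hapos ⊢
  generalize v (r.1 + r.2) = b
  generalize v r.1 = c at hvr ⊢
  have hc1 := Real.rpow_nonneg hvr (2 * (β - 1))
  have hc2 := Real.rpow_nonneg hvr (β - 1)
  rw [← ENNReal.mul_rpow_of_nonneg _ _ (by norm_num),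
    ENNReal.ofReal_rpow_of_nonneg hvr (by linarith),
    ← ENNReal.ofReal_mul hc1, ← ENNReal.ofReal_mul (by positivity),
    ENNReal.ofReal_rpow_of_nonneg (by positivity) (by norm_num)]
  congr 1
  have e1 : α * (b - c) ^ 2 * (c ^ (2 * (β - 1)) * α⁻¹) = (c ^ (β - 1) * |b - c|) ^ 2 := by
    rw [mul_pow, sq_abs, mul_comm 2 (β - 1), Real.rpow_mul hvr]
    norm_cast
    field_simp
  rw [e1, ← Real.sqrt_eq_rpow, Real.sqrt_sq (by positivity)]

theorem sum_rpow_le_sum_grad (hd : 2 ≤ d) {u : ZLat d → ℝ} {N : ℕ}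
    (hu : ∀ x, N ≤ l1norm x → u x = 0) :
    (∑ x ∈ fball d N, ‖u x‖ₑ ^ ((d : ℝ) / (d - 1))) ^ (1 / ((d : ℝ) / (d - 1)))
      ≤ ∑ x ∈ fball d N, ∑ z : Nbr d, ‖u (x + z) - u x‖ₑ := by
  have hd1 : (1 : ℝ) < d := by exact_mod_cast (by omega : 1 < d)
  have hp0 : 0 < (d : ℝ) / (d - 1) := div_pos (by linarith) (by linarith)
  have h3 := ENNReal.rpow_le_rpow ((ENNReal.sum_le_tsum (fball d N)).trans
    (tsum_rpow_le_tsum_grad hd hu)) (by positivity : 0 ≤ 1 / ((d : ℝ) / (d - 1)))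
  rw [← ENNReal.rpow_mul, mul_one_div, div_self hp0.ne', ENNReal.rpow_one] at h3
  exact h3.trans (tsum_grad_le_sum_fball hu)

/-- The L¹ Sobolev inequality is applied to v^β. Cauchy–Schwarz separates the energy from ∑
v^{2(β-1)} ∑_z a⁻¹, and Hölder with exponent q separates the inverse weights. The exponent β is
chosen so that the power of v left over is again 2ρ; dividing by it gives the claim. -/
theorem weighted_sobolev (hd : 2 ≤ d) {q ρ : ℝ} (hq : 1 < q) (hρ : 1 < ρ)
    (hρq : 1 / ρ = 1 - 2 / d + 1 / q) {v : ZLat d → ℝ} (hv0 : ∀ x, 0 ≤ v x) {N : ℕ}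
    (hv : ∀ x, N ≤ l1norm x → v x = 0) {a : ZLat d → ZLat d → ℝ}
    (ha : ∀ x (z : Nbr d), 0 < a x (x + z)) :
    (∑ x ∈ fball d N, ENNReal.ofReal (v x) ^ (2 * ρ)) ^ (1 / ρ)
      ≤ ENNReal.ofReal ((4 * ρ) ^ 2 * 4) *
        (∑ x ∈ fball d N, ENNReal.ofReal (∑ z : Nbr d, (a x (x + z))⁻¹) ^ q) ^ (1 / q) *
        ∑ x ∈ fball d N, ∑ z : Nbr d, ENNReal.ofReal (a x (x + z) * (v (x + z) - v x) ^ 2) := by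
  have hd1 : (1 : ℝ) < d := by exact_mod_cast (by omega : 1 < d)
  have hd0 : (d : ℝ) ≠ 0 := by linarith
  have hdm : (d : ℝ) - 1 ≠ 0 := by linarith
  have hq0 : q ≠ 0 := by linarith
  have hρ0 : ρ ≠ 0 := by linarith
  set p : ℝ := d / (d - 1) with hp
  have hp0 : 0 < p := div_pos (by linarith) (by linarith)
  set β : ℝ := 2 * ρ / p with hβ
  have hpinv : 1 / p = 1 - 1 / d := by
    rw [hp]
    field_simp
  have hβ' : β = 2 * ρ * (1 - 1 / d) := by
    rw [hβ, div_eq_mul_one_div, hpinv]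
  have hρrel : 1 = ρ - 2 * ρ / d + ρ / q := by
    have : ρ * (1 / ρ) = ρ * (1 - 2 / d + 1 / q) := by rw [hρq]
    rw [mul_one_div, div_self hρ0] at this
    rw [this]
    ring
  -- The relation between ρ, d and q is used here: the conjugate exponent q/(q-1) turns the power
  -- 2(β-1) into 2ρ.
  have hβ1 : β - 1 = ρ * (1 - 1 / q) := by
    have e1 : 2 * ρ * (1 - 1 / (d : ℝ)) = 2 * ρ - 2 * ρ / d := by ring
    have e2 : ρ * (1 - 1 / q) = ρ - ρ / q := by ring
    rw [hβ', e1, e2]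
    linarith
  have hq1 : 0 < 1 - 1 / q := by
    rw [sub_pos, div_lt_one (by linarith)]
    exact hq
  have hβge : 1 ≤ β := by
    have : 0 < ρ * (1 - 1 / q) := mul_pos (by linarith) hq1
    linarith
  have hβle : β ≤ 2 * ρ := by
    rw [hβ']
    have : 0 < 1 / (d : ℝ) := by positivity
    nlinarith
  set B := fball d N with hB
  set S : ℝ≥0∞ := ∑ x ∈ B, ENNReal.ofReal (v x) ^ (2 * ρ) with hS
  set E : ℝ≥0∞ := ∑ x ∈ B, ∑ z : Nbr d, ENNReal.ofReal (a x (x + z) * (v (x + z) - v x) ^ 2)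
    with hE
  set Nq : ℝ≥0∞ := (∑ x ∈ B, ENNReal.ofReal (∑ z : Nbr d, (a x (x + z))⁻¹) ^ q) ^ (1 / q) with hNq
  have hv' : ∀ x, x ∉ B → v x = 0 := by
    intro x hx
    rw [hB, mem_fball, not_le] at hx
    exact hv x hx.le
  have g1 : S ^ (1 / p) ≤ ∑ x ∈ B, ∑ z : Nbr d, ‖v (x + z) ^ β - v x ^ β‖ₑ := by
    have h := sum_rpow_le_sum_grad hd (u := fun x => v x ^ β) (N := N) (fun x hx => by
      rw [hv x hx, Real.zero_rpow (by linarith)])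
    refine le_trans (le_of_eq ?_) h
    congr 1
    refine Finset.sum_congr rfl fun x _ => ?_
    rw [Real.enorm_eq_ofReal (Real.rpow_nonneg (hv0 x) _),
      ← ENNReal.ofReal_rpow_of_nonneg (hv0 x) (by linarith), ← ENNReal.rpow_mul, hβ,
      div_mul_cancel₀ _ hp0.ne']
  have g2 := sum_rpow_sub_le (N := N) hv0 hv hβge
  have g3 := sum_rpow_mul_abs_sub_le hv0 hβge ha B
  have g4 : ∑ x ∈ B, ENNReal.ofReal (v x) ^ (2 * (β - 1)) *
        ENNReal.ofReal (∑ z : Nbr d, (a x (x + z))⁻¹) ≤ S ^ (1 - 1 / q) * Nq := by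
    have hconj : (q / (q - 1)).HolderConjugate q := (Real.HolderConjugate.conjExponent hq).symm
    have h1 := ENNReal.inner_le_Lp_mul_Lq B (fun x => ENNReal.ofReal (v x) ^ (2 * (β - 1)))
      (fun x => ENNReal.ofReal (∑ z : Nbr d, (a x (x + z))⁻¹)) hconj
    refine h1.trans (le_of_eq ?_)
    have e1 : 1 / (q / (q - 1)) = 1 - 1 / q := by
      have : q - 1 ≠ 0 := by linarith
      field_simp
    have e2 : 2 * (β - 1) * (q / (q - 1)) = 2 * ρ := by
      rw [hβ1]
      have : q - 1 ≠ 0 := by linarith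
      field_simp
    simp_rw [← ENNReal.rpow_mul]
    rw [e1, e2]
  -- conclusion
  have hSE : S ^ (2 / p) ≤ ENNReal.ofReal ((4 * ρ) ^ 2 * 4) * Nq * E * S ^ (1 - 1 / q) := by
    have h1 : S ^ (1 / p) ≤ ENNReal.ofReal (2 * β) * (E ^ (1 / 2 : ℝ) *
        (S ^ (1 - 1 / q) * Nq) ^ (1 / 2 : ℝ)) := by
      refine g1.trans (g2.trans (mul_le_mul_right (g3.trans (mul_le_mul_right ?_ _)) _))
      exact ENNReal.rpow_le_rpow g4 (by norm_num)
    have h2 := ENNReal.rpow_le_rpow h1 (by norm_num : (0 : ℝ) ≤ 2)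
    rw [← ENNReal.rpow_mul, ENNReal.mul_rpow_of_nonneg _ _ (by norm_num),
      ENNReal.mul_rpow_of_nonneg _ _ (by norm_num), ← ENNReal.rpow_mul, ← ENNReal.rpow_mul] at h2
    have e1 : 1 / p * 2 = 2 / p := by ring
    have e2 : (1 / 2 : ℝ) * 2 = 1 := by norm_num
    rw [e1, e2, ENNReal.rpow_one, ENNReal.rpow_one] at h2
    refine h2.trans ?_
    have e3 : ENNReal.ofReal (2 * β) ^ (2 : ℝ) ≤ ENNReal.ofReal ((4 * ρ) ^ 2 * 4) := by
      rw [ENNReal.ofReal_rpow_of_nonneg (by linarith) (by norm_num)]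
      refine ENNReal.ofReal_le_ofReal ?_
      rw [Real.rpow_two]
      have := pow_le_pow_left₀ (by linarith : 0 ≤ 2 * β) (by linarith : 2 * β ≤ 4 * ρ) 2
      have h0 := sq_nonneg (4 * ρ)
      linarith
    calc _ ≤ ENNReal.ofReal ((4 * ρ) ^ 2 * 4) * (E * (S ^ (1 - 1 / q) * Nq)) :=
          mul_le_mul_left e3 _
      _ = _ := by
          generalize S ^ (1 - 1 / q) = A
          generalize ENNReal.ofReal ((4 * ρ) ^ 2 * 4) = A'
          clear_value E Nq
          ring
  have hS_top : S ≠ ∞ := by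
    refine (ENNReal.sum_lt_top.mpr fun x _ => ?_).ne
    exact ENNReal.rpow_lt_top_of_nonneg (by linarith) ENNReal.ofReal_ne_top
  rcases eq_or_ne S 0 with h0 | h0
  · rw [h0, ENNReal.zero_rpow_of_pos (by positivity)]
    exact zero_le
  -- The sum S is finite and nonzero here, so the factor S^{1-1/q} can be divided out, leaving the
  -- exponent 1/ρ.
  · have hexp : 1 / ρ = 2 / p - (1 - 1 / q) := by
      have : 2 / p = 2 * (1 / p) := by ring
      rw [this, hpinv, hρq]
      ring
    rw [hexp, ENNReal.rpow_sub _ _ h0 hS_top]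
    refine ENNReal.div_le_of_le_mul ?_
    exact hSE

end Sobolev

/-! ### The energy estimate with a barrier -/

section Chain

theorem AbsolutelyContinuousOnInterval.posPart {f : ℝ → ℝ} {a b : ℝ}
    (hf : AbsolutelyContinuousOnInterval f a b) :
    AbsolutelyContinuousOnInterval (fun t => max (f t) 0) a b := by
  apply squeeze_zero (fun t ↦ ?_) (fun t ↦ ?_) hf
  · exact Finset.sum_nonneg fun i _ => dist_nonneg
  · refine Finset.sum_le_sum fun i _ => ?_
    rw [Real.dist_eq, Real.dist_eq]
    exact abs_max_sub_max_le_abs _ _ _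

/-- The error of the linear approximation is at most (s - r)² in every sign configuration, so the
truncated square is differentiable also at the kink. -/
theorem hasDerivAt_posPart_sq (r : ℝ) :
    HasDerivAt (fun s : ℝ => (max s 0) ^ 2) (2 * max r 0) r := by
  rw [hasDerivAt_iff_isLittleO]
  have h : (fun s : ℝ => (s - r) ^ 2) =o[𝓝 r] fun s => s - r := by
    have := (hasDerivAt_pow 2 (0 : ℝ))
    rw [hasDerivAt_iff_isLittleO] at this
    have h2 := this.comp_tendsto (k := fun s : ℝ => s - r) (l' := 𝓝 r) (by
      have : Tendsto (fun s : ℝ => s - r) (𝓝 r) (𝓝 (r - r)) := by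
        exact (continuous_id.sub continuous_const).tendsto r
      rwa [sub_self] at this)
    simpa [Function.comp_def] using h2
  refine Asymptotics.IsBigO.trans_isLittleO ?_ h
  refine Asymptotics.IsBigO.of_bound 1 (Filter.Eventually.of_forall fun s => ?_)
  rw [one_mul, Real.norm_eq_abs, Real.norm_eq_abs, abs_of_nonneg (sq_nonneg (s - r)), smul_eq_mul,
    abs_le]
  rcases le_total s 0 with hs | hs <;> rcases le_total r 0 with hr | hr <;>
    simp only [max_eq_left, max_eq_right, hs, hr] <;> constructor <;> nlinarith

/-- Chain rule for an absolutely continuous function: the truncated square is a product of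
absolutely continuous functions, and its derivative exists wherever that of f does. -/
theorem integral_two_mul_posPart_mul {f g : ℝ → ℝ} {a b : ℝ}
    (hf : AbsolutelyContinuousOnInterval f a b)
    (hg : ∀ᵐ t, HasDerivAt f (g t) t) :
    IntervalIntegrable (fun t => 2 * max (f t) 0 * g t) volume a b ∧
    ∫ t in a..b, 2 * max (f t) 0 * g t = (max (f b) 0) ^ 2 - (max (f a) 0) ^ 2 := by
  have hAC := hf.posPart.fun_mul hf.posPart
  have hae : ∀ᵐ t, deriv (fun t => max (f t) 0 * max (f t) 0) t = 2 * max (f t) 0 * g t := by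
    filter_upwards [hg] with t ht
    have h1 := (hasDerivAt_posPart_sq (f t)).comp t ht
    have h2 : ((fun s : ℝ => (max s 0) ^ 2) ∘ f) = fun t => max (f t) 0 * max (f t) 0 := by
      funext t
      simp [pow_two]
    rw [h2] at h1
    exact h1.deriv
  refine ⟨hAC.intervalIntegrable_deriv.congr_ae (ae_restrict_of_ae hae), ?_⟩
  rw [pow_two, pow_two, ← hAC.integral_deriv_eq_sub]
  refine intervalIntegral.integral_congr_ae ?_
  filter_upwards [hae] with t ht _
  exact ht.symm

end Chain

/-! ### Caccioppoli inequality, barrier, and energy estimate. -/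

section Barrier

variable {d : ℕ}

/-- The positive part of `f` on the ball of radius `N`, extended by zero. -/
def truncPos (N : ℕ) (f : ZLat d → ℝ) (x : ZLat d) : ℝ :=
  if x ∈ fball d N then max (f x) 0 else 0

theorem truncPos_nonneg (N : ℕ) (f : ZLat d → ℝ) (x : ZLat d) : 0 ≤ truncPos N f x := by
  unfold truncPos
  split_ifs
  · exact le_max_right _ _
  · exact le_rfl

theorem truncPos_eq_zero {N : ℕ} {f : ZLat d → ℝ} (hf : ∀ x, l1norm x = N → f x ≤ 0) {x : ZLat d}
    (hx : N ≤ l1norm x) : truncPos N f x = 0 := by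
  unfold truncPos
  split_ifs with h
  · exact max_eq_right (hf x (le_antisymm (mem_fball.mp h) hx))
  · rfl

theorem l1norm_le_add_one_of_adj {x y : ZLat d} (h : (latticeGraph d).Adj x y) :
    l1norm y ≤ l1norm x + 1 := by
  have t1 := l1norm_add_le (y - x) x
  rw [sub_add_cancel, l1norm_sub_of_adj h] at t1
  omega

theorem conduct_of_not_adj {ω : Env d} {t : ℝ} {x y : ZLat d} (h : ¬ (latticeGraph d).Adj x y) :
    conduct ω t x y = 0 := by
  simp [conduct, h]

/-- A function of oriented edges, weighted by conductances, is symmetric if it vanishes as soon as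
its first argument is on the boundary. -/
theorem sum_conduct_comm {N : ℕ} (ω : Env d) (t : ℝ) (G : ZLat d → ZLat d → ℝ)
    (hG : ∀ x y, N ≤ l1norm x → G x y = 0) :
    ∑ x ∈ fball d N, ∑ z : Nbr d, conduct ω t x (x + z) * G x (x + z)
      = ∑ x ∈ fball d N, ∑ z : Nbr d, conduct ω t x (x + z) * G (x + z) x := by
  have h := sum_fball_nbr_comm (N := N) (fun x y => conduct ω t x y * G x y) (by
    intro x y h
    by_cases hxy : (latticeGraph d).Adj x y
    · rw [hG, mul_zero]
      rw [mem_fball, mem_fball] at h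
      have := l1norm_le_add_one_of_adj hxy
      omega
    · rw [conduct_of_not_adj hxy, zero_mul])
  rw [h]
  exact Finset.sum_congr rfl fun x _ => Finset.sum_congr rfl fun z _ => by rw [conduct_comm]

/-- Caccioppoli inequality at a fixed time. -/
theorem sum_truncPos_mul_le {N : ℕ} (ω : Env d) (t : ℝ) {u b ι : ZLat d → ℝ} {h : ZLat d → ℝ}
    (hodd : ∀ x, h (-x) = - h x) (hub : ∀ x, l1norm x = N → u x - b x ≤ 0) {r : ℝ}
    (hr : ∀ x (z : Nbr d), |b (x + z) - b x + h z| ≤ r)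
    (hι0 : ∀ x, 0 ≤ ι x) (hι : ∀ x, N ≤ l1norm x → ι x = 0)
    (hι1 : ∀ x, truncPos N (fun x => u x - b x) x ≠ 0 → 1 ≤ ι x) :
    ∑ x ∈ fball d N, truncPos N (fun x => u x - b x) x *
        ∑ z : Nbr d, conduct ω t x (x + z) * (u (x + z) - u x + h z)
      ≤ -(1 / 4) * ∑ x ∈ fball d N, ∑ z : Nbr d, conduct ω t x (x + z) *
          (truncPos N (fun x => u x - b x) (x + z) - truncPos N (fun x => u x - b x) x) ^ 2
        + r ^ 2 / 2 * ∑ x ∈ fball d N, muW ω t x * ι x := by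
  set w := truncPos N (fun x => u x - b x) with hw
  have hw0 : ∀ x, N ≤ l1norm x → w x = 0 := fun x hx => truncPos_eq_zero hub hx
  set G : ZLat d → ZLat d → ℝ := fun x y => w x * (u y - u x + h (y - x)) with hG
  have e1 : ∑ x ∈ fball d N, w x * ∑ z : Nbr d, conduct ω t x (x + z) * (u (x + z) - u x + h z)
      = ∑ x ∈ fball d N, ∑ z : Nbr d, conduct ω t x (x + z) * G x (x + z) := by
    refine Finset.sum_congr rfl fun x _ => ?_
    rw [Finset.mul_sum]
    refine Finset.sum_congr rfl fun z _ => ?_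
    simp only [hG, add_sub_cancel_left]
    ring
  have e2 := sum_conduct_comm ω t G (N := N) (fun x y hx => by simp [hG, hw0 x hx])
  have e3 := sum_conduct_comm ω t (fun x _ => ι x) (N := N) (fun x y hx => hι x hx)
  have e4 : ∑ x ∈ fball d N, muW ω t x * ι x
      = ∑ x ∈ fball d N, ∑ z : Nbr d, conduct ω t x (x + z) * ι x := by
    refine Finset.sum_congr rfl fun x _ => ?_
    rw [muW, sum_neighborFinset, Finset.sum_mul]
  -- Adding both orientations of an edge gives -∇w·(∇(u-b) + (∇b+h)). Truncation yields (∇w)² ≤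
  -- ∇w·∇(u-b), Young's inequality absorbs the remaining product into half of (∇w)², and ι supplies
  -- the indicator that w does not vanish at both endpoints.
  have key : ∀ x ∈ fball d N, ∀ z : Nbr d, G x (x + z) + G (x + z) x
      ≤ -(1 / 2) * (w (x + z) - w x) ^ 2 + r ^ 2 / 2 * (ι x + ι (x + z)) := by
    intro x hx z
    have hh : h (x - (x + z)) = - h z := by
      rw [← hodd]
      congr 1
      abel
    have hsum : G x (x + z) + G (x + z) x
        = -((w (x + z) - w x) * ((u (x + z) - b (x + z)) - (u x - b x)
          + (b (x + z) - b x + h z))) := by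
      simp only [hG, hh, add_sub_cancel_left]
      ring
    rw [hsum]
    have hrb := hr x z
    have hi1 := hι0 x
    have hi2 := hι0 (x + z)
    have hr2 : 0 ≤ r ^ 2 / 2 * (ι x + ι (x + z)) :=
      mul_nonneg (by positivity) (by linarith)
    by_cases hne : w (x + z) - w x = 0
    · rw [hne]
      nlinarith
    · have hone : 1 ≤ ι x + ι (x + z) := by
        by_cases h0 : w x = 0
        · have : w (x + z) ≠ 0 := fun h1 => hne (by rw [h0, h1, sub_zero])
          linarith [hι1 _ this]
        · linarith [hι1 _ h0]
      have hxz : x + z ∈ fball d N := by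
        by_contra hcon
        rw [mem_fball, not_le] at hcon
        have := l1norm_le_add_one_of_adj (Nbr.adj_add z x)
        exact hne (by rw [hw0 _ hcon.le, hw0 x (by omega), sub_zero])
      have hw1 : w x = max (u x - b x) 0 := by simp [hw, truncPos, hx]
      have hw2 : w (x + z) = max (u (x + z) - b (x + z)) 0 := by simp [hw, truncPos, hxz]
      generalize b (x + z) - b x + h z = e at hrb ⊢
      generalize u (x + z) - b (x + z) = B at hw2 ⊢
      generalize u x - b x = A at hw1 ⊢
      have hmono : (w (x + z) - w x) ^ 2 ≤ (w (x + z) - w x) * (B - A) := by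
        rw [hw1, hw2]
        rcases le_total A 0 with hA | hA <;> rcases le_total B 0 with hB | hB <;>
          simp only [max_eq_left, max_eq_right, hA, hB] <;> nlinarith
      generalize w (x + z) - w x = D at hmono ⊢
      have h1 : - (D * e) ≤ D ^ 2 / 2 + r ^ 2 / 2 := by
        have he : e ^ 2 ≤ r ^ 2 := sq_le_sq' (abs_le.mp hrb).1 (abs_le.mp hrb).2
        nlinarith [sq_nonneg (D + e)]
      have h2 : r ^ 2 / 2 ≤ r ^ 2 / 2 * (ι x + ι (x + z)) :=
        le_mul_of_one_le_right (by positivity) hone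
      nlinarith
  have hfin : ∑ x ∈ fball d N, ∑ z : Nbr d, conduct ω t x (x + z) * (G x (x + z) + G (x + z) x)
      ≤ ∑ x ∈ fball d N, ∑ z : Nbr d, conduct ω t x (x + z) *
        (-(1 / 2) * (w (x + z) - w x) ^ 2 + r ^ 2 / 2 * (ι x + ι (x + z))) :=
    Finset.sum_le_sum fun x hx => Finset.sum_le_sum fun z _ =>
      mul_le_mul_of_nonneg_left (key x hx z) (conduct_nonneg _ _ _ _)
  have hl : ∑ x ∈ fball d N, ∑ z : Nbr d, conduct ω t x (x + z) * (G x (x + z) + G (x + z) x)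
      = 2 * ∑ x ∈ fball d N, ∑ z : Nbr d, conduct ω t x (x + z) * G x (x + z) := by
    simp_rw [mul_add, Finset.sum_add_distrib]
    rw [← e2, two_mul]
  have hr' : ∑ x ∈ fball d N, ∑ z : Nbr d, conduct ω t x (x + z) *
        (-(1 / 2) * (w (x + z) - w x) ^ 2 + r ^ 2 / 2 * (ι x + ι (x + z)))
      = -(1 / 2) * ∑ x ∈ fball d N, ∑ z : Nbr d, conduct ω t x (x + z) * (w (x + z) - w x) ^ 2
        + r ^ 2 * ∑ x ∈ fball d N, ∑ z : Nbr d, conduct ω t x (x + z) * ι x := by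
    have : ∀ x (z : Nbr d), conduct ω t x (x + z) *
        (-(1 / 2) * (w (x + z) - w x) ^ 2 + r ^ 2 / 2 * (ι x + ι (x + z)))
        = -(1 / 2) * (conduct ω t x (x + z) * (w (x + z) - w x) ^ 2)
        + r ^ 2 / 2 * (conduct ω t x (x + z) * ι x) +
          r ^ 2 / 2 * (conduct ω t x (x + z) * ι (x + z)) := by
      intro x z
      ring
    simp_rw [this, Finset.sum_add_distrib, ← Finset.mul_sum]
    rw [← e3]
    ring
  rw [e1, e4]
  rw [hl, hr'] at hfin
  linarith

/-- The barrier function vanishes on `[0, N²/4] × B(N/2)` and is at least one on the part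
`{t = N²} ∪ {|x| = N}` of the boundary of `Q(N)`. -/
def barrier (N : ℕ) (t : ℝ) (x : ZLat d) : ℝ :=
  max (t - (N : ℝ) ^ 2 / 4) 0 / (3 * (N : ℝ) ^ 2 / 4) + max ((l1norm x : ℝ) - N / 2) 0 / (N / 2)

theorem barrier_nonneg (N : ℕ) (t : ℝ) (x : ZLat d) : 0 ≤ barrier N t x := by
  unfold barrier
  positivity

theorem one_le_barrier_of_l1norm {N : ℕ} (hN : 0 < N) (t : ℝ) {x : ZLat d} (hx : l1norm x = N) :
    1 ≤ barrier N t x := by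
  unfold barrier
  have hN' : (0 : ℝ) < N := by exact_mod_cast hN
  have h1 : (0 : ℝ) ≤ max (t - (N : ℝ) ^ 2 / 4) 0 / (3 * (N : ℝ) ^ 2 / 4) := by positivity
  have h2 : max ((l1norm x : ℝ) - N / 2) 0 / (N / 2) = 1 := by
    rw [hx, max_eq_left (by linarith)]
    field_simp
    norm_num
  linarith

theorem one_le_barrier_of_time {N : ℕ} (hN : 0 < N) (x : ZLat d) :
    1 ≤ barrier N ((N : ℝ) ^ 2) x := by
  unfold barrier
  have hN' : (0 : ℝ) < N := by exact_mod_cast hN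
  have h1 : (0 : ℝ) ≤ max ((l1norm x : ℝ) - N / 2) 0 / (N / 2) := by positivity
  have h2 : max ((N : ℝ) ^ 2 - (N : ℝ) ^ 2 / 4) 0 / (3 * (N : ℝ) ^ 2 / 4) = 1 := by
    rw [max_eq_left (by nlinarith)]
    field_simp
    norm_num
  linarith

theorem barrier_eq_zero {N : ℕ} {t : ℝ} {x : ZLat d} (ht : t ≤ (N : ℝ) ^ 2 / 4)
    (hx : (l1norm x : ℝ) ≤ N / 2) : barrier N t x = 0 := by
  unfold barrier
  rw [max_eq_right (by linarith), max_eq_right (by linarith)]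
  simp

theorem abs_barrier_sub_le {N : ℕ} (hN : 0 < N) (t : ℝ) (x : ZLat d) (z : Nbr d) :
    |barrier N t (x + (z : ZLat d)) - barrier N t x| ≤ 2 / N := by
  unfold barrier
  have hN' : (0 : ℝ) < N := by exact_mod_cast hN
  rw [add_sub_add_left_eq_sub, ← sub_div, abs_div, abs_of_pos (by positivity : (0 : ℝ) < N / 2),
    div_le_div_iff₀ (by positivity) hN']
  have h1 := l1norm_le_add_one_of_adj (Nbr.adj_add z x)
  have h2 := l1norm_le_add_one_of_adj (Nbr.adj_add z x).symm
  have h1' : (l1norm (x + (z : ZLat d)) : ℝ) ≤ l1norm x + 1 := by exact_mod_cast h1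
  have h2' : (l1norm x : ℝ) ≤ l1norm (x + (z : ZLat d)) + 1 := by exact_mod_cast h2
  have h3 : |max ((l1norm (x + (z : ZLat d)) : ℝ) - N / 2) 0 - max ((l1norm x : ℝ) - N / 2) 0| ≤ 1 :=
    (abs_max_sub_max_le_abs _ _ _).trans (by rw [abs_le]; constructor <;> linarith)
  nlinarith

theorem hasDerivAt_barrier {N : ℕ} (x : ZLat d) {t : ℝ} (ht : t ≠ (N : ℝ) ^ 2 / 4) :
    HasDerivAt (fun t => barrier N t x)
      (if (N : ℝ) ^ 2 / 4 < t then (3 * (N : ℝ) ^ 2 / 4)⁻¹ else 0) t := by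
  unfold barrier
  refine HasDerivAt.add_const _ ?_
  split_ifs with h
  · have h1 : HasDerivAt (fun t : ℝ => (t - (N : ℝ) ^ 2 / 4) / (3 * (N : ℝ) ^ 2 / 4))
        (3 * (N : ℝ) ^ 2 / 4)⁻¹ t := by
      have := ((hasDerivAt_id t).sub_const ((N : ℝ) ^ 2 / 4)).div_const (3 * (N : ℝ) ^ 2 / 4)
      simpa using this
    refine h1.congr_of_eventuallyEq ?_
    filter_upwards [lt_mem_nhds h] with s hs
    rw [max_eq_left (by linarith)]
  · have h' : t < (N : ℝ) ^ 2 / 4 := lt_of_le_of_ne (not_lt.mp h) ht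
    refine (hasDerivAt_const t (0 : ℝ)).congr_of_eventuallyEq ?_
    filter_upwards [gt_mem_nhds h'] with s hs
    rw [max_eq_right (by linarith), zero_div]

theorem continuous_barrier (N : ℕ) (x : ZLat d) : Continuous fun t => barrier N t x := by
  unfold barrier
  fun_prop

theorem absolutelyContinuousOnInterval_barrier (N : ℕ) (x : ZLat d) (a b : ℝ) :
    AbsolutelyContinuousOnInterval (fun t => barrier N t x) a b := by
  have h1 : AbsolutelyContinuousOnInterval (fun t : ℝ => t - (N : ℝ) ^ 2 / 4) a b :=
    (ContDiff.contDiffOn (by fun_prop)).absolutelyContinuousOnInterval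
  have h2 := (h1.posPart.const_mul (3 * (N : ℝ) ^ 2 / 4)⁻¹)
  have h3 : AbsolutelyContinuousOnInterval
      (fun _ : ℝ => max ((l1norm x : ℝ) - N / 2) 0 / (N / 2)) a b :=
    (ContDiff.contDiffOn (by fun_prop)).absolutelyContinuousOnInterval
  have h4 := h2.fun_add h3
  have e : (fun t => barrier N t x) = fun t => (3 * (N : ℝ) ^ 2 / 4)⁻¹ *
      max (t - (N : ℝ) ^ 2 / 4) 0 + max ((l1norm x : ℝ) - N / 2) 0 / (N / 2) := by
    funext t
    rw [barrier, div_eq_inv_mul]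
  rw [e]
  exact h4

/-- `u` solves `∂_t u(t, x) = - ∑_z ω_t(x, x + z) (u(t, x + z) - u(t, x) + h(z))`. -/
structure IsCorrectorSolution (ω : Env d) (h : ZLat d → ℝ) (u : ℝ → ZLat d → ℝ) : Prop where
  ac : ∀ x a b, AbsolutelyContinuousOnInterval (fun t => u t x) a b
  hasDerivAt : ∀ᵐ t, ∀ x, HasDerivAt (fun s => u s x)
    (-∑ z : Nbr d, conduct ω t x (x + z) * (u t (x + z) - u t x + h z)) t

theorem IsCorrectorSolution.continuous {ω : Env d} {h : ZLat d → ℝ} {u : ℝ → ZLat d → ℝ}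
    (hu : IsCorrectorSolution ω h u) (x : ZLat d) : Continuous fun t => u t x := by
  rw [continuous_iff_continuousAt]
  intro t
  have := (hu.ac x (t - 1) (t + 1)).continuousOn
  rw [Set.uIcc_of_le (by linarith)] at this
  exact this.continuousAt (Icc_mem_nhds (by linarith) (by linarith))

/-- The excess of `u` over the level `k` raised by the barrier. -/
def excess (N : ℕ) (L : ℝ) (u : ℝ → ZLat d → ℝ) (k t : ℝ) : ZLat d → ℝ :=
  truncPos N fun x => u t x - (L * barrier N t x + k)

theorem excess_nonneg (N : ℕ) (L : ℝ) (u : ℝ → ZLat d → ℝ) (k t : ℝ) (x : ZLat d) :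
    0 ≤ excess N L u k t x := truncPos_nonneg _ _ _

theorem continuous_excess {N : ℕ} {L : ℝ} {u : ℝ → ZLat d → ℝ}
    (hu : ∀ x, Continuous fun t => u t x) (k : ℝ) (x : ZLat d) :
    Continuous fun t => excess N L u k t x := by
  have := continuous_barrier N x
  have := hu x
  unfold excess truncPos
  split_ifs
  · fun_prop
  · fun_prop

theorem excess_anti {N : ℕ} {L : ℝ} {u : ℝ → ZLat d → ℝ} {k k' : ℝ} (h : k ≤ k') (t : ℝ)
    (x : ZLat d) : excess N L u k' t x ≤ excess N L u k t x := by
  unfold excess truncPos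
  split_ifs
  · exact max_le_max (by linarith) le_rfl
  · exact le_rfl

/-- The gap η between two levels converts the indicator of the upper excess into powers of the lower
excess divided by η. Every gain in the iteration comes from this. -/
theorem le_excess_of_ne_zero {N : ℕ} {L : ℝ} {u : ℝ → ZLat d → ℝ} {k η t : ℝ} {x : ZLat d}
    (h : excess N L u (k + η) t x ≠ 0) : η ≤ excess N L u k t x := by
  unfold excess truncPos at h ⊢
  split_ifs at h ⊢
  · have h1 : 0 < u t x - (L * barrier N t x + (k + η)) := by
      by_contra hcon
      exact h (max_eq_right (not_lt.mp hcon))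
    refine le_trans ?_ (le_max_left _ _)
    linarith
  · exact absurd rfl h

/-- The equation runs backwards in time, so the boundary relevant for [0,N²]×B(N) is {t = N²}
together with {|x| = N}. There the barrier is at least one while u ≤ L, so the excess vanishes for
every nonnegative level and no cutoff is needed. The barrier enters only through its slopes, of
order 1/N in space and 1/N² in time, against the indicator of the upper excess. -/
theorem energy_estimate_real {ω : Env d} {h : ZLat d → ℝ} {u : ℝ → ZLat d → ℝ}
    (hu : IsCorrectorSolution ω h u)
    (hω : ∀ x (z : Nbr d), LocallyIntegrable (fun t => conduct ω t x (x + z)) volume)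
    {N : ℕ} (hN : 0 < N) {L : ℝ} (hL : 1 ≤ L) (hodd : ∀ x, h (-x) = - h x)
    (hh : ∀ z : Nbr d, |h z| ≤ L / N)
    (huL : ∀ t ∈ Set.Icc (0 : ℝ) ((N : ℝ) ^ 2), ∀ x ∈ fball d N, u t x ≤ L)
    {k η : ℝ} (hk : 0 ≤ k) (hη : 0 < η) (hη1 : η ≤ 1) :
    (∀ x ∈ fball d N, ∀ z : Nbr d, IntervalIntegrable (fun t => conduct ω t x (x + z) *
        (excess N L u (k + η) t (x + z) - excess N L u (k + η) t x) ^ 2) volume 0 ((N : ℝ) ^ 2)) ∧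
    (∀ x ∈ fball d N, IntervalIntegrable (fun t => (muW ω t x + 1) * excess N L u k t x ^ 2)
      volume 0 ((N : ℝ) ^ 2)) ∧
    ∀ t₀ ∈ Set.Icc (0 : ℝ) ((N : ℝ) ^ 2),
      ∑ x ∈ fball d N, excess N L u (k + η) t₀ x ^ 2 +
        1 / 2 * ∫ t in t₀..((N : ℝ) ^ 2), ∑ x ∈ fball d N, ∑ z : Nbr d, conduct ω t x (x + z) *
          (excess N L u (k + η) t (x + z) - excess N L u (k + η) t x) ^ 2
      ≤ 9 * L ^ 2 / ((N : ℝ) ^ 2 * η ^ 2) * ∫ t in t₀..((N : ℝ) ^ 2), ∑ x ∈ fball d N,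
          (muW ω t x + 1) * excess N L u k t x ^ 2 := by
  have hN' : (0 : ℝ) < N := by exact_mod_cast hN
  have hcont := hu.continuous
  have hcw := fun k x => continuous_excess (N := N) (L := L) hcont k x
  have hint1 : ∀ x (z : Nbr d) (a b : ℝ), IntervalIntegrable (fun t => conduct ω t x (x + z) *
        (excess N L u (k + η) t (x + z) - excess N L u (k + η) t x) ^ 2) volume a b := by
    intro x z a b
    refine (intervalIntegrable_of_locallyIntegrable (hω x z) a b).mul_continuousOn ?_
    exact (((hcw (k + η) (x + z)).sub (hcw (k + η) x)).pow 2).continuousOn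
  have hint2 : ∀ x (a b : ℝ), IntervalIntegrable
      (fun t => (muW ω t x + 1) * excess N L u k t x ^ 2) volume a b := by
    intro x a b
    refine IntervalIntegrable.mul_continuousOn ?_ ((hcw k x).pow 2).continuousOn
    refine IntervalIntegrable.add ?_ (intervalIntegrable_const)
    have e : (fun t => muW ω t x) = fun t => ∑ z : Nbr d, conduct ω t x (x + z) := by
      funext t
      rw [muW, sum_neighborFinset]
    rw [e]
    have := IntervalIntegrable.sum (μ := volume) (a := a) (b := b) (Finset.univ : Finset (Nbr d))
      (f := fun z t => conduct ω t x (x + z))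
      (fun z _ => intervalIntegrable_of_locallyIntegrable (hω x z) a b)
    simpa [Finset.sum_fn] using this
  refine ⟨fun x _ z => hint1 x z _ _, fun x _ => hint2 x _ _, ?_⟩
  intro t₀ ht₀
  have hbd : ∀ t ∈ Set.Icc (0 : ℝ) ((N : ℝ) ^ 2), ∀ x, l1norm x = N →
      u t x - (L * barrier N t x + (k + η)) ≤ 0 := by
    intro t ht x hx
    have h1 := huL t ht x (mem_fball.mpr hx.le)
    have h2 := one_le_barrier_of_l1norm hN t hx
    nlinarith
  set D : ℝ → ℝ := fun t => if (N : ℝ) ^ 2 / 4 < t then (3 * (N : ℝ) ^ 2 / 4)⁻¹ else 0 with hD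
  have hD0 : ∀ t, 0 ≤ D t ∧ D t ≤ 4 / (3 * (N : ℝ) ^ 2) := by
    intro t
    simp only [hD]
    split_ifs
    · refine ⟨by positivity, le_of_eq ?_⟩
      rw [inv_div]
    · exact ⟨le_rfl, by positivity⟩
  set A : ℝ → ZLat d → ℝ := fun t x =>
    ∑ z : Nbr d, conduct ω t x (x + z) * (u t (x + z) - u t x + h z) with hA
  have hder : ∀ x, ∀ᵐ t, HasDerivAt (fun t => u t x - (L * barrier N t x + (k + η)))
      (-A t x - L * D t) t := by
    intro x
    have hne : ∀ᵐ t : ℝ, t ≠ (N : ℝ) ^ 2 / 4 := by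
      simp [ae_iff]
    filter_upwards [hu.hasDerivAt, hne] with t h1 h2
    exact (h1 x).sub (((hasDerivAt_barrier x h2).const_mul L).add_const _)
  have hAC : ∀ x a b, AbsolutelyContinuousOnInterval
      (fun t => u t x - (L * barrier N t x + (k + η))) a b := by
    intro x a b
    have h3 : AbsolutelyContinuousOnInterval (fun _ : ℝ => k + η) a b :=
      (ContDiff.contDiffOn (by fun_prop)).absolutelyContinuousOnInterval
    exact (hu.ac x a b).fun_sub
      (((absolutelyContinuousOnInterval_barrier N x a b).const_mul L).fun_add h3)
  have hchain := fun x => integral_two_mul_posPart_mul (hAC x t₀ ((N : ℝ) ^ 2)) (hder x)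
  have hwx : ∀ k t, ∀ x ∈ fball d N,
      excess N L u k t x = max (u t x - (L * barrier N t x + k)) 0 := by
    intro k t x hx
    simp [excess, truncPos, hx]
  -- No contribution from the terminal time.
  have hT : ∀ x ∈ fball d N, max (u ((N : ℝ) ^ 2) x
      - (L * barrier N ((N : ℝ) ^ 2) x + (k + η))) 0 = 0 := by
    intro x hx
    have h1 := huL _ ⟨by positivity, le_rfl⟩ x hx
    have h2 := one_le_barrier_of_time hN x
    exact max_eq_right (by nlinarith)
  -- sum of the chain rules
  have hsum : ∑ x ∈ fball d N, excess N L u (k + η) t₀ x ^ 2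
      = ∫ t in t₀..((N : ℝ) ^ 2), ∑ x ∈ fball d N,
        -(2 * max (u t x - (L * barrier N t x + (k + η))) 0 * (-A t x - L * D t)) := by
    have := intervalIntegral.integral_finsetSum (μ := volume) (a := t₀) (b := (N : ℝ) ^ 2)
      (s := fball d N)
      (f := fun x t => -(2 * max (u t x - (L * barrier N t x + (k + η))) 0 * (-A t x - L * D t)))
      (fun x _ => (hchain x).1.neg)
    rw [this]
    refine Finset.sum_congr rfl fun x hx => ?_
    rw [intervalIntegral.integral_neg, (hchain x).2, hT x hx, hwx _ _ x hx]
    ring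
  have hmono : ∫ t in t₀..((N : ℝ) ^ 2), ∑ x ∈ fball d N,
        -(2 * max (u t x - (L * barrier N t x + (k + η))) 0 * (-A t x - L * D t))
      ≤ ∫ t in t₀..((N : ℝ) ^ 2), (-(1 / 2) * (∑ x ∈ fball d N, ∑ z : Nbr d,
          conduct ω t x (x + z) *
          (excess N L u (k + η) t (x + z) - excess N L u (k + η) t x) ^ 2) +
        9 * L ^ 2 / ((N : ℝ) ^ 2 * η ^ 2) * ∑ x ∈ fball d N,
          (muW ω t x + 1) * excess N L u k t x ^ 2) := by
    refine intervalIntegral.integral_mono_on ht₀.2 ?_ ?_ ?_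
    · have := IntervalIntegrable.sum (μ := volume) (a := t₀) (b := (N : ℝ) ^ 2) (fball d N)
        (f := fun x t => -(2 * max (u t x - (L * barrier N t x + (k + η))) 0 * (-A t x - L * D t)))
        (fun x _ => (hchain x).1.neg)
      simpa [Finset.sum_fn] using this
    · refine IntervalIntegrable.add (IntervalIntegrable.const_mul ?_ _)
        (IntervalIntegrable.const_mul ?_ _)
      · have := IntervalIntegrable.sum (μ := volume) (a := t₀) (b := (N : ℝ) ^ 2)
          (fball d N ×ˢ (Finset.univ : Finset (Nbr d)))
          (f := fun p t => conduct ω t p.1 (p.1 + p.2) *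
          (excess N L u (k + η) t (p.1 + p.2) - excess N L u (k + η) t p.1) ^ 2)
          (fun p _ => hint1 p.1 p.2 _ _)
        simpa [Finset.sum_fn, Finset.sum_product] using this
      · have := IntervalIntegrable.sum (μ := volume) (a := t₀) (b := (N : ℝ) ^ 2) (fball d N)
          (f := fun x t => (muW ω t x + 1) * excess N L u k t x ^ 2)
          (fun x _ => hint2 x _ _)
        simpa [Finset.sum_fn] using this
    · intro t ht
      have ht' : t ∈ Set.Icc (0 : ℝ) ((N : ℝ) ^ 2) := ⟨ht₀.1.trans ht.1, ht.2⟩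
      have hι1 : ∀ x, excess N L u (k + η) t x ≠ 0 → 1 ≤ excess N L u k t x ^ 2 / η ^ 2 := by
        intro x hx
        rw [one_le_div (by positivity)]
        exact pow_le_pow_left₀ hη.le (le_excess_of_ne_zero hx) 2
      have hbd0 : ∀ x, l1norm x = N → u t x - (L * barrier N t x + k) ≤ 0 := by
        intro x hx
        have h1 := huL t ht' x (mem_fball.mpr hx.le)
        have h2 := one_le_barrier_of_l1norm hN t hx
        nlinarith
      -- The inhomogeneity is at most 3L/N: the spatial slope of L times the barrier gives 2L/N and
      -- h gives L/N.
      have hcac := sum_truncPos_mul_le ω t (N := N) (u := u t)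
        (b := fun x => L * barrier N t x + (k + η))
        (ι := fun x => excess N L u k t x ^ 2 / η ^ 2) (h := h) hodd (hbd t ht') (r := 3 * L / N)
        (by
          intro x z
          have h1 := abs_barrier_sub_le hN t x z
          have h2 := hh z
          have e : L * barrier N t (x + (z : ZLat d)) + (k + η) - (L * barrier N t x + (k + η)) + h z
            = L * (barrier N t (x + (z : ZLat d)) - barrier N t x) + h z := by ring
          rw [e]
          refine (abs_add_le _ _).trans ?_
          rw [abs_mul, abs_of_nonneg (by linarith : 0 ≤ L)]
          have : L * |barrier N t (x + (z : ZLat d)) - barrier N t x| ≤ L * (2 / N) :=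
            mul_le_mul_of_nonneg_left h1 (by linarith)
          have e2 : 3 * L / N = L * (2 / N) + L / N := by ring
          linarith)
        (fun x => by positivity)
        (fun x hx => by
          have : excess N L u k t x = 0 := truncPos_eq_zero hbd0 hx
          rw [this]
          simp) hι1
      have e1 : ∑ x ∈ fball d N,
          -(2 * max (u t x - (L * barrier N t x + (k + η))) 0 * (-A t x - L * D t))
          = 2 * (∑ x ∈ fball d N, excess N L u (k + η) t x * A t x)
            + 2 * (L * D t) * ∑ x ∈ fball d N, excess N L u (k + η) t x := by
        rw [Finset.mul_sum, Finset.mul_sum, ← Finset.sum_add_distrib]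
        refine Finset.sum_congr rfl fun x hx => ?_
        rw [hwx _ _ x hx]
        ring
      have e2 : ∑ x ∈ fball d N, excess N L u (k + η) t x
          ≤ ∑ x ∈ fball d N, excess N L u k t x ^ 2 / η ^ 2 := by
        refine Finset.sum_le_sum fun x _ => ?_
        by_cases h0 : excess N L u (k + η) t x = 0
        · rw [h0]
          positivity
        · have h1 := le_excess_of_ne_zero h0
          have h2 := excess_anti (N := N) (L := L) (u := u) (by linarith : k ≤ k + η) t x
          rw [le_div_iff₀ (by positivity)]
          have h3 := excess_nonneg N L u k t x
          calc _ ≤ excess N L u k t x * η ^ 2 := by gcongr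
            _ ≤ excess N L u k t x * η := by
                refine mul_le_mul_of_nonneg_left ?_ h3
                nlinarith
            _ ≤ _ := by
                rw [pow_two]
                exact mul_le_mul_of_nonneg_left h1 h3
      have e3 : 9 * L ^ 2 / ((N : ℝ) ^ 2 * η ^ 2) * ∑ x ∈ fball d N,
          (muW ω t x + 1) * excess N L u k t x ^ 2
          = 9 * L ^ 2 / (N : ℝ) ^ 2 * (∑ x ∈ fball d N,
              muW ω t x * (excess N L u k t x ^ 2 / η ^ 2) +
            ∑ x ∈ fball d N, excess N L u k t x ^ 2 / η ^ 2) := by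
        rw [← Finset.sum_add_distrib, Finset.mul_sum, Finset.mul_sum]
        refine Finset.sum_congr rfl fun x _ => ?_
        field_simp
      rw [e1, e3]
      have hS0 : 0 ≤ ∑ x ∈ fball d N, excess N L u (k + η) t x :=
        Finset.sum_nonneg fun x _ => excess_nonneg _ _ _ _ _ _
      -- The time slope of the barrier is at most 4/(3N²), and L ≥ 1 allows L to be replaced by L²,
      -- so this term is absorbed by the same constant as the spatial one.
      have e4 : 2 * (L * D t) * ∑ x ∈ fball d N, excess N L u (k + η) t x
          ≤ 9 * L ^ 2 / (N : ℝ) ^ 2 * ∑ x ∈ fball d N, excess N L u k t x ^ 2 / η ^ 2 := by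
        refine mul_le_mul ?_ e2 hS0 (by positivity)
        have := (hD0 t).2
        calc 2 * (L * D t) ≤ 2 * (L * (4 / (3 * (N : ℝ) ^ 2))) := by gcongr
          _ = (8 / 3 * L) / (N : ℝ) ^ 2 := by
              field_simp
              norm_num
          _ ≤ _ := by
              gcongr
              · norm_num
              · exact le_self_pow₀ hL (by norm_num)
      have e5 : (3 * L / N) ^ 2 / 2 = 9 * L ^ 2 / (N : ℝ) ^ 2 / 2 := by
        rw [div_pow]
        ring
      rw [e5] at hcac
      simp only [excess] at hcac e4 ⊢
      simp only [hA]
      linarith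
  rw [← hsum] at hmono
  rw [intervalIntegral.integral_add, intervalIntegral.integral_const_mul,
    intervalIntegral.integral_const_mul] at hmono
  · linarith
  · refine IntervalIntegrable.const_mul ?_ _
    have := IntervalIntegrable.sum (μ := volume) (a := t₀) (b := (N : ℝ) ^ 2)
      (fball d N ×ˢ (Finset.univ : Finset (Nbr d)))
      (f := fun p t => conduct ω t p.1 (p.1 + p.2) *
      (excess N L u (k + η) t (p.1 + p.2) - excess N L u (k + η) t p.1) ^ 2)
      (fun p _ => hint1 p.1 p.2 _ _)
    simpa [Finset.sum_fn, Finset.sum_product] using this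
  · refine IntervalIntegrable.const_mul ?_ _
    have := IntervalIntegrable.sum (μ := volume) (a := t₀) (b := (N : ℝ) ^ 2) (fball d N)
      (f := fun x t => (muW ω t x + 1) * excess N L u k t x ^ 2)
      (fun x _ => hint2 x _ _)
    simpa [Finset.sum_fn] using this

end Barrier

/-! ### Mixed norms -/

section MixNorm

variable {T X : Type*} [MeasurableSpace T] [MeasurableSpace X]

/-- The `L^b` norm in time of the `L^a` norm in space. -/
def mixNorm (π : Measure X) (τ : Measure T) (a b : ℝ) (f : T → X → ℝ≥0∞) : ℝ≥0∞ :=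
  (∫⁻ t, (∫⁻ x, f t x ^ a ∂π) ^ (b / a) ∂τ) ^ (1 / b)

variable {π : Measure X} {τ : Measure T}

theorem mixNorm_mono {a b : ℝ} (ha : 0 ≤ a) (hb : 0 ≤ b) {f g : T → X → ℝ≥0∞}
    (h : ∀ t, ∀ᵐ x ∂π, f t x ≤ g t x) : mixNorm π τ a b f ≤ mixNorm π τ a b g := by
  refine ENNReal.rpow_le_rpow (lintegral_mono fun t => ENNReal.rpow_le_rpow
    (lintegral_mono_ae ?_) (by positivity)) (by positivity)
  filter_upwards [h t] with x hx
  exact ENNReal.rpow_le_rpow hx ha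

theorem mixNorm_const_mul {a b : ℝ} (ha : 0 < a) (hb : 0 < b) {c : ℝ≥0∞} (hc : c ≠ ∞)
    (f : T → X → ℝ≥0∞) : mixNorm π τ a b (fun t x => c * f t x) = c * mixNorm π τ a b f := by
  unfold mixNorm
  have h1 : ∀ t, (∫⁻ x, (c * f t x) ^ a ∂π) ^ (b / a)
      = c ^ b * (∫⁻ x, f t x ^ a ∂π) ^ (b / a) := by
    intro t
    simp_rw [ENNReal.mul_rpow_of_nonneg _ _ ha.le]
    rw [lintegral_const_mul' _ _ (ENNReal.rpow_ne_top_of_nonneg ha.le hc),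
      ENNReal.mul_rpow_of_nonneg _ _ (by positivity), ← ENNReal.rpow_mul, mul_div_cancel₀ _ ha.ne']
  simp_rw [h1]
  rw [lintegral_const_mul' _ _ (ENNReal.rpow_ne_top_of_nonneg hb.le hc),
    ENNReal.mul_rpow_of_nonneg _ _ (by positivity), ← ENNReal.rpow_mul, mul_one_div,
    div_self hb.ne', ENNReal.rpow_one]

theorem lintegral_lintegral_mul_le_mixNorm {p p' P P' : ℝ} (hp : p.HolderConjugate P)
    (hp' : p'.HolderConjugate P') {f g : T → X → ℝ≥0∞} (hf : ∀ t, AEMeasurable (f t) π)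
    (hg : ∀ t, AEMeasurable (g t) π) (hft : AEMeasurable (fun t => ∫⁻ x, f t x ^ p ∂π) τ)
    (hgt : AEMeasurable (fun t => ∫⁻ x, g t x ^ P ∂π) τ) :
    ∫⁻ t, ∫⁻ x, f t x * g t x ∂π ∂τ ≤ mixNorm π τ p p' f * mixNorm π τ P P' g := by
  calc ∫⁻ t, ∫⁻ x, f t x * g t x ∂π ∂τ
      ≤ ∫⁻ t, (∫⁻ x, f t x ^ p ∂π) ^ (1 / p) * (∫⁻ x, g t x ^ P ∂π) ^ (1 / P) ∂τ :=
        lintegral_mono fun t => ENNReal.lintegral_mul_le_Lp_mul_Lq π hp (hf t) (hg t)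
    _ ≤ _ := by
        refine (ENNReal.lintegral_mul_le_Lp_mul_Lq τ hp' (hft.pow_const _)
          (hgt.pow_const _)).trans (le_of_eq ?_)
        unfold mixNorm
        simp_rw [← ENNReal.rpow_mul, one_div_mul_eq_div]

/-- Interpolation between `L^∞(L^1)` and `L^s(L^ρ)`. -/
theorem mixNorm_rpow_le {f : T → X → ℝ≥0∞} (hf : ∀ t, AEMeasurable (f t) π) {A K : ℝ≥0∞}
    {ν E : T → ℝ≥0∞} (hν : AEMeasurable ν τ) (hE : AEMeasurable E τ)
    {ρ κ P P' q' s α β : ℝ} (hs0 : 0 < s) (hq' : 0 < q') (hs : s / q' + s = 1) (hρ : 0 < ρ)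
    (hP : 0 < P) (hP' : 0 < P') (hβ : β = s * P / (ρ * P')) (hα : 0 ≤ α) (hαβ : α + β = 1)
    (hκ : κ * P = α + ρ * β) (hK : K ≠ ∞)
    (hA : ∀ᵐ t ∂τ, ∫⁻ x, f t x ∂π ≤ A)
    (hS : ∀ᵐ t ∂τ, (∫⁻ x, f t x ^ ρ ∂π) ^ (1 / ρ) ≤ K * (ν t * E t)) (hAtop : A ≠ ∞) :
    mixNorm π τ P P' (fun t x => f t x ^ κ)
      ≤ A ^ (α / P) * (K ^ s * ((∫⁻ t, ν t ^ q' ∂τ) ^ (s / q') * (∫⁻ t, E t ∂τ) ^ s))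
        ^ (1 / P') := by
  have hβ0 : 0 ≤ β := by rw [hβ]; positivity
  unfold mixNorm
  -- Hölder in space with weights α and β splits f^{κP} into f^α and (f^ρ)^β. After raising to the
  -- power P'/P, the formula for β leaves exactly the s-th power of the L^ρ norm, to which the
  -- Sobolev bound applies.
  have h1 : ∀ᵐ t ∂τ, (∫⁻ x, (f t x ^ κ) ^ P ∂π) ^ (P' / P)
      ≤ A ^ (α * (P' / P)) * (K ^ s * ((ν t ^ q') ^ (s / q') * E t ^ s)) := by
    filter_upwards [hA, hS] with t hAt hSt
    have e1 : ∀ x, (f t x ^ κ) ^ P = f t x ^ α * (f t x ^ ρ) ^ β := by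
      intro x
      rw [← ENNReal.rpow_mul, ← ENNReal.rpow_mul, hκ,
        ENNReal.rpow_add_of_nonneg _ _ hα (by positivity)]
    simp_rw [e1]
    have h2 := ENNReal.lintegral_mul_norm_pow_le (hf t) ((hf t).pow_const ρ) hα hβ0 hαβ
    have h3 := ENNReal.rpow_le_rpow h2 (by positivity : 0 ≤ P' / P)
    refine h3.trans ?_
    rw [ENNReal.mul_rpow_of_nonneg _ _ (by positivity), ← ENNReal.rpow_mul, ← ENNReal.rpow_mul]
    refine mul_le_mul' (ENNReal.rpow_le_rpow hAt (by positivity)) ?_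
    have e2 : β * (P' / P) = 1 / ρ * s := by
      rw [hβ]
      field_simp
    rw [e2, ENNReal.rpow_mul]
    refine (ENNReal.rpow_le_rpow hSt hs0.le).trans (le_of_eq ?_)
    rw [ENNReal.mul_rpow_of_nonneg _ _ hs0.le, ENNReal.mul_rpow_of_nonneg _ _ hs0.le,
      ← ENNReal.rpow_mul, mul_div_cancel₀ _ hq'.ne']
  have h4 := lintegral_mono_ae h1
  rw [lintegral_const_mul' _ _ (ENNReal.rpow_ne_top_of_nonneg (by positivity) hAtop),
    lintegral_const_mul' _ _ (ENNReal.rpow_ne_top_of_nonneg hs0.le hK)] at h4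
  have h5 := ENNReal.lintegral_mul_norm_pow_le (hν.pow_const q') hE
    (by positivity : 0 ≤ s / q') hs0.le hs
  have h6 := h4.trans (mul_le_mul_right (mul_le_mul_right h5 _) _)
  refine (ENNReal.rpow_le_rpow h6 (by positivity : 0 ≤ 1 / P')).trans (le_of_eq ?_)
  rw [ENNReal.mul_rpow_of_nonneg _ _ (by positivity), ← ENNReal.rpow_mul]
  congr 2
  field_simp

/-- On probability spaces, a mixed norm of a bounded function is controlled by its mean. -/
theorem mixNorm_le_of_le [IsProbabilityMeasure π] [IsProbabilityMeasure τ] {a b : ℝ} (ha : 1 ≤ a)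
    (hb : 1 ≤ b) {f : T → X → ℝ≥0∞} (hf : ∀ t, AEMeasurable (f t) π)
    (hft : ∀ c : ℝ, AEMeasurable (fun t => ∫⁻ x, f t x ^ c ∂π) τ) {M : ℝ≥0∞} (hM : M ≠ ∞)
    (hfM : ∀ᵐ t ∂τ, ∀ᵐ x ∂π, f t x ≤ M) :
    mixNorm π τ a b f ≤ (M ^ (max a b - 1) * ∫⁻ t, ∫⁻ x, f t x ∂π ∂τ) ^ (1 / max a b) := by
  -- By monotonicity of norms on probability spaces both exponents may be raised to R; then f^R ≤
  -- M^{R-1} f.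
  set R := max a b with hR
  have hR1 : 1 ≤ R := ha.trans (le_max_left _ _)
  have hR0 : 0 < R := by linarith
  have ha0 : 0 < a := by linarith
  have hb0 : 0 < b := by linarith
  have hspace : ∀ t, (∫⁻ x, f t x ^ a ∂π) ^ (1 / a) ≤ (∫⁻ x, f t x ^ R ∂π) ^ (1 / R) := by
    intro t
    have := eLpNorm'_le_eLpNorm'_of_exponent_le (μ := π) (f := f t) ha0 (le_max_left a b)
      (hf t).aestronglyMeasurable
    simpa [eLpNorm'] using this
  have htime : (∫⁻ t, ((∫⁻ x, f t x ^ R ∂π) ^ (1 / R)) ^ b ∂τ) ^ (1 / b)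
      ≤ (∫⁻ t, ((∫⁻ x, f t x ^ R ∂π) ^ (1 / R)) ^ R ∂τ) ^ (1 / R) := by
    have := eLpNorm'_le_eLpNorm'_of_exponent_le (μ := τ)
      (f := fun t => (∫⁻ x, f t x ^ R ∂π) ^ (1 / R)) hb0 (le_max_right a b)
      ((hft R).pow_const _).aestronglyMeasurable
    simpa [eLpNorm'] using this
  unfold mixNorm
  have h1 : (∫⁻ t, (∫⁻ x, f t x ^ a ∂π) ^ (b / a) ∂τ) ^ (1 / b)
      ≤ (∫⁻ t, ((∫⁻ x, f t x ^ R ∂π) ^ (1 / R)) ^ b ∂τ) ^ (1 / b) := by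
    refine ENNReal.rpow_le_rpow (lintegral_mono fun t => ?_) (by positivity)
    have := ENNReal.rpow_le_rpow (hspace t) hb0.le
    rwa [← ENNReal.rpow_mul, one_div_mul_eq_div] at this
  refine h1.trans (htime.trans (ENNReal.rpow_le_rpow ?_ (by positivity)))
  simp_rw [← ENNReal.rpow_mul, one_div_mul_cancel hR0.ne', ENNReal.rpow_one]
  rw [← lintegral_const_mul' _ _ (ENNReal.rpow_ne_top_of_nonneg (by linarith) hM)]
  refine lintegral_mono_ae ?_
  filter_upwards [hfM] with t ht
  rw [← lintegral_const_mul' _ _ (ENNReal.rpow_ne_top_of_nonneg (by linarith) hM)]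
  refine lintegral_mono_ae ?_
  filter_upwards [ht] with x hx
  have e : f t x ^ R = f t x ^ (R - 1) * f t x := by
    conv_rhs => rw [← ENNReal.rpow_one (f t x), ← ENNReal.rpow_mul, one_mul]
    rw [← ENNReal.rpow_add_of_nonneg _ _ (by linarith) zero_le_one, sub_add_cancel]
  rw [e]
  exact mul_le_mul_left (ENNReal.rpow_le_rpow hx (by linarith)) _

end MixNorm

/-! ### Averages over cylinders -/

section Cyl

variable {d : ℕ}

/-- The uniform distribution on `B(N)`. -/
abbrev unifB (d N : ℕ) : Measure (ZLat d) := ProbabilityTheory.uniformOn (ball d N)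

/-- The uniform distribution on `[0, N²]`. -/
abbrev unifT (N : ℕ) : Measure ℝ :=
  ProbabilityTheory.cond volume (Set.Icc (0 : ℝ) ((N : ℝ) ^ 2))

instance (N : ℕ) : IsProbabilityMeasure (unifB d N) :=
  ProbabilityTheory.isProbabilityMeasure_uniformOn (ball_finite d N)
    ⟨0, by rw [mem_ball_iff, l1norm_zero]; omega⟩

theorem isProbabilityMeasure_unifT {N : ℕ} (hN : 0 < N) : IsProbabilityMeasure (unifT N) := by
  have hN' : (0 : ℝ) < N := by exact_mod_cast hN
  refine ProbabilityTheory.cond_isProbabilityMeasure_of_finite ?_ ?_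
  · rw [Real.volume_Icc, sub_zero]
    simpa using hN.ne'
  · simp

theorem lintegral_unifB (N : ℕ) (f : ZLat d → ℝ≥0∞) :
    ∫⁻ x, f x ∂(unifB d N) = ((fball d N).card : ℝ≥0∞)⁻¹ * ∑ x ∈ fball d N, f x := by
  rw [unifB, ProbabilityTheory.uniformOn, ProbabilityTheory.cond, lintegral_smul_measure,
    ← coe_fball, Measure.count_apply_finset, lintegral_finset]
  simp

theorem lintegral_unifT (N : ℕ) (f : ℝ → ℝ≥0∞) :
    ∫⁻ t, f t ∂(unifT N) = (ENNReal.ofReal ((N : ℝ) ^ 2))⁻¹ *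
      ∫⁻ t in Set.Icc (0 : ℝ) ((N : ℝ) ^ 2), f t := by
  rw [unifT, ProbabilityTheory.cond, lintegral_smul_measure, Real.volume_Icc, sub_zero, smul_eq_mul]

theorem ae_unifB_iff (N : ℕ) (Q : ZLat d → Prop) :
    (∀ᵐ x ∂(unifB d N), Q x) ↔ ∀ x ∈ fball d N, Q x := by
  rw [unifB, ProbabilityTheory.uniformOn, ProbabilityTheory.cond, ← coe_fball,
    Measure.count_apply_finset, Measure.ae_ennreal_smul_measure_iff (by simp),
    ae_restrict_iff' (fball d N).measurableSet, Measure.ae_count_iff]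
  rfl

theorem ae_unifT (N : ℕ) {Q : ℝ → Prop} (h : ∀ t ∈ Set.Icc (0 : ℝ) ((N : ℝ) ^ 2), Q t) :
    ∀ᵐ t ∂(unifT N), Q t := by
  unfold unifT ProbabilityTheory.cond
  refine Measure.ae_smul_measure ?_ _
  exact (ae_restrict_iff' measurableSet_Icc).mpr (Eventually.of_forall h)

theorem cylNorm_eq_mixNorm {p p' : ℝ} (hp : 0 < p) (hp' : 0 < p') (N : ℕ)
    (u : ℝ → ZLat d → ℝ) :
    cylNorm (ENNReal.ofReal p) (ENNReal.ofReal p') N u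
      = mixNorm (unifB d N) (unifT N) p p' fun t x => ‖u t x‖ₑ := by
  unfold cylNorm mixNorm
  rw [eLpNorm_eq_lintegral_rpow_enorm_toReal (by simpa using hp') ENNReal.ofReal_ne_top,
    ENNReal.toReal_ofReal hp'.le]
  congr 1
  refine lintegral_congr fun t => ?_
  rw [eLpNorm_eq_lintegral_rpow_enorm_toReal (by simpa using hp) ENNReal.ofReal_ne_top,
    ENNReal.toReal_ofReal hp.le, enorm_eq_self, ← ENNReal.rpow_mul, one_div_mul_eq_div]

end Cyl

/-! ### De Giorgi iteration -/

section DeGiorgi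

variable {d : ℕ}

theorem ofReal_integral_eq_lintegral_Icc {f : ℝ → ℝ} {b : ℝ} (hb : 0 ≤ b)
    (hf : IntervalIntegrable f volume 0 b) (h0 : ∀ t, 0 ≤ f t) :
    ENNReal.ofReal (∫ t in (0 : ℝ)..b, f t) = ∫⁻ t in Set.Icc 0 b, ENNReal.ofReal (f t) := by
  rw [intervalIntegral.integral_of_le hb, ← integral_Icc_eq_integral_Ioc]
  rw [ofReal_integral_eq_lintegral_ofReal]
  · rw [intervalIntegrable_iff_integrableOn_Ioc_of_le hb] at hf
    exact (integrableOn_Icc_iff_integrableOn_Ioc).mpr hf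
  · exact Eventually.of_forall h0

/-- The real estimate is used twice: started at an arbitrary time it bounds the supremum in time of
the squares, started at 0 it bounds the total energy. -/
theorem energy_estimate {ω : Env d} {h : ZLat d → ℝ} {u : ℝ → ZLat d → ℝ}
    (hu : IsCorrectorSolution ω h u)
    (hω : ∀ x (z : Nbr d), LocallyIntegrable (fun t => conduct ω t x (x + z)) volume)
    {N : ℕ} (hN : 0 < N) {L : ℝ} (hL : 1 ≤ L) (hodd : ∀ x, h (-x) = - h x)
    (hh : ∀ z : Nbr d, |h z| ≤ L / N)
    (huL : ∀ t ∈ Set.Icc (0 : ℝ) ((N : ℝ) ^ 2), ∀ x ∈ fball d N, u t x ≤ L)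
    {k η : ℝ} (hk : 0 ≤ k) (hη : 0 < η) (hη1 : η ≤ 1) {R : ℝ≥0∞}
    (hR : R = ENNReal.ofReal (9 * L ^ 2 / ((N : ℝ) ^ 2 * η ^ 2)) *
      ∫⁻ t in Set.Icc (0 : ℝ) ((N : ℝ) ^ 2), ∑ x ∈ fball d N,
        ENNReal.ofReal (muW ω t x + 1) * ENNReal.ofReal (excess N L u k t x) ^ 2) :
    (∀ t ∈ Set.Icc (0 : ℝ) ((N : ℝ) ^ 2),
      ∑ x ∈ fball d N, ENNReal.ofReal (excess N L u (k + η) t x) ^ 2 ≤ R) ∧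
    ∫⁻ t in Set.Icc (0 : ℝ) ((N : ℝ) ^ 2), ∑ x ∈ fball d N, ∑ z : Nbr d,
      ENNReal.ofReal (conduct ω t x (x + z) *
        (excess N L u (k + η) t (x + z) - excess N L u (k + η) t x) ^ 2) ≤ 2 * R := by
  obtain ⟨hi1, hi2, hE⟩ := energy_estimate_real hu hω hN hL hodd hh huL hk hη hη1
  have hT : (0 : ℝ) ≤ (N : ℝ) ^ 2 := by positivity
  have hmu : ∀ t x, 0 ≤ muW ω t x := fun t x => Finset.sum_nonneg fun _ _ => conduct_nonneg _ _ _ _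
  have hJ0 : ∀ t, 0 ≤ ∑ x ∈ fball d N, (muW ω t x + 1) * excess N L u k t x ^ 2 := fun t =>
    Finset.sum_nonneg fun x _ => mul_nonneg (by linarith [hmu t x]) (sq_nonneg _)
  have hE0 : ∀ t, 0 ≤ ∑ x ∈ fball d N, ∑ z : Nbr d, conduct ω t x (x + z) *
        (excess N L u (k + η) t (x + z) - excess N L u (k + η) t x) ^ 2 := fun t =>
    Finset.sum_nonneg fun x _ => Finset.sum_nonneg fun z _ =>
      mul_nonneg (conduct_nonneg _ _ _ _) (sq_nonneg _)
  have hJi : IntervalIntegrable (fun t => ∑ x ∈ fball d N,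
      (muW ω t x + 1) * excess N L u k t x ^ 2) volume 0 ((N : ℝ) ^ 2) := by
    have := IntervalIntegrable.sum (μ := volume) (a := 0) (b := (N : ℝ) ^ 2) (fball d N)
      (f := fun x t => (muW ω t x + 1) * excess N L u k t x ^ 2) (fun x hx => hi2 x hx)
    simpa [Finset.sum_fn] using this
  have hEi : IntervalIntegrable (fun t => ∑ x ∈ fball d N, ∑ z : Nbr d, conduct ω t x (x + z) *
        (excess N L u (k + η) t (x + z) - excess N L u (k + η) t x) ^ 2) volume 0
        ((N : ℝ) ^ 2) := by
    have := IntervalIntegrable.sum (μ := volume) (a := 0) (b := (N : ℝ) ^ 2)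
      (fball d N ×ˢ (Finset.univ : Finset (Nbr d)))
      (f := fun p t => conduct ω t p.1 (p.1 + p.2) *
      (excess N L u (k + η) t (p.1 + p.2) - excess N L u (k + η) t p.1) ^ 2)
      (fun p hp => hi1 p.1 (Finset.mem_product.mp hp).1 p.2)
    simpa [Finset.sum_fn, Finset.sum_product] using this
  have hRr : R = ENNReal.ofReal (9 * L ^ 2 / ((N : ℝ) ^ 2 * η ^ 2) * ∫ t in (0 : ℝ)..(N : ℝ) ^ 2,
      ∑ x ∈ fball d N, (muW ω t x + 1) * excess N L u k t x ^ 2) := by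
    rw [hR, ENNReal.ofReal_mul (by positivity), ofReal_integral_eq_lintegral_Icc hT hJi hJ0]
    congr 1
    refine lintegral_congr fun t => ?_
    rw [ENNReal.ofReal_sum_of_nonneg fun x _ => mul_nonneg (by linarith [hmu t x]) (sq_nonneg _)]
    refine Finset.sum_congr rfl fun x _ => ?_
    rw [ENNReal.ofReal_mul (by linarith [hmu t x]), ENNReal.ofReal_pow (excess_nonneg _ _ _ _ _ _)]
  constructor
  · intro t ht
    have h1 := hE t ht
    have h2 : 0 ≤ ∫ t in t..((N : ℝ) ^ 2), ∑ x ∈ fball d N, ∑ z : Nbr d, conduct ω t x (x + z) *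
        (excess N L u (k + η) t (x + z) - excess N L u (k + η) t x) ^ 2 :=
      intervalIntegral.integral_nonneg ht.2 fun s _ => hE0 s
    have h3 : ∫ t in t..((N : ℝ) ^ 2), ∑ x ∈ fball d N, (muW ω t x + 1) * excess N L u k t x ^ 2
        ≤ ∫ t in (0 : ℝ)..((N : ℝ) ^ 2), ∑ x ∈ fball d N,
          (muW ω t x + 1) * excess N L u k t x ^ 2 := by
      refine intervalIntegral.integral_mono_interval ht.1 ht.2 le_rfl ?_ hJi
      exact Eventually.of_forall hJ0
    have e : ∑ x ∈ fball d N, ENNReal.ofReal (excess N L u (k + η) t x) ^ 2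
        = ENNReal.ofReal (∑ x ∈ fball d N, excess N L u (k + η) t x ^ 2) := by
      rw [ENNReal.ofReal_sum_of_nonneg fun x _ => sq_nonneg _]
      exact Finset.sum_congr rfl fun x _ => (ENNReal.ofReal_pow (excess_nonneg _ _ _ _ _ _) 2).symm
    rw [e, hRr]
    refine ENNReal.ofReal_le_ofReal ?_
    have h4 := mul_le_mul_of_nonneg_left h3
      (by positivity : 0 ≤ 9 * L ^ 2 / ((N : ℝ) ^ 2 * η ^ 2))
    linarith
  · have h1 := hE 0 ⟨le_rfl, hT⟩
    have h2 : 0 ≤ ∑ x ∈ fball d N, excess N L u (k + η) 0 x ^ 2 :=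
      Finset.sum_nonneg fun x _ => sq_nonneg _
    have e : ∫⁻ t in Set.Icc (0 : ℝ) ((N : ℝ) ^ 2), ∑ x ∈ fball d N, ∑ z : Nbr d,
        ENNReal.ofReal (conduct ω t x (x + z) *
        (excess N L u (k + η) t (x + z) - excess N L u (k + η) t x) ^ 2)
        = ENNReal.ofReal (∫ t in (0 : ℝ)..(N : ℝ) ^ 2, ∑ x ∈ fball d N, ∑ z : Nbr d,
          conduct ω t x (x + z) *
        (excess N L u (k + η) t (x + z) - excess N L u (k + η) t x) ^ 2) := by
      rw [ofReal_integral_eq_lintegral_Icc hT hEi hE0]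
      refine lintegral_congr fun t => ?_
      rw [ENNReal.ofReal_sum_of_nonneg fun x _ => Finset.sum_nonneg fun z _ =>
        mul_nonneg (conduct_nonneg _ _ _ _) (sq_nonneg _)]
      refine Finset.sum_congr rfl fun x _ => ?_
      rw [ENNReal.ofReal_sum_of_nonneg fun z _ =>
        mul_nonneg (conduct_nonneg _ _ _ _) (sq_nonneg _)]
    rw [e, hRr, ← ENNReal.ofReal_ofNat 2, ← ENNReal.ofReal_mul (by norm_num)]
    refine ENNReal.ofReal_le_ofReal ?_
    linarith

/-- Fast geometric convergence. -/
theorem tendsto_zero_of_le_geometric_mul_rpow {C : ℝ≥0∞} (hC : C ≠ ∞) {b : ℝ} (hb : 1 < b)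
    {κ : ℝ} (hκ : 1 < κ) :
    ∃ ε : ℝ≥0∞, ε ≠ 0 ∧ ∀ Y : ℕ → ℝ≥0∞, (∀ i, Y (i + 1) ≤ C * ENNReal.ofReal b ^ i * Y i ^ κ) →
      Y 0 ≤ ε → Tendsto Y atTop (𝓝 0) := by
  -- With this r and ε the bound Y_i ≤ ε r^i reproduces itself: r is chosen so that b^i (r^i)^{κ-1}
  -- = 1, and ε so that c ε^{κ-1} = r, where c ≥ C is positive.
  set r : ℝ := b ^ (-(1 / (κ - 1))) with hr
  have hr0 : 0 < r := Real.rpow_pos_of_pos (by linarith) _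
  have hr1 : r < 1 := Real.rpow_lt_one_of_one_lt_of_neg hb (by
    have : 0 < 1 / (κ - 1) := div_pos one_pos (by linarith)
    linarith)
  set c : ℝ := C.toReal + 1 with hc
  have hc0 : 0 < c := by positivity
  have hCc : C ≤ ENNReal.ofReal c := by
    rw [hc, ← ENNReal.ofReal_toReal hC]
    refine ENNReal.ofReal_le_ofReal ?_
    rw [ENNReal.toReal_ofReal ENNReal.toReal_nonneg]
    linarith
  set ε : ℝ := (r / c) ^ (1 / (κ - 1)) with hε
  have hε0 : 0 < ε := Real.rpow_pos_of_pos (by positivity) _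
  refine ⟨ENNReal.ofReal ε, by simpa using hε0, fun Y hY h0 => ?_⟩
  have hκ' : κ - 1 ≠ 0 := by linarith
  have key : ∀ i, Y i ≤ ENNReal.ofReal (ε * r ^ i) := by
    intro i
    induction i with
    | zero => simpa using h0
    | succ i ih =>
      refine (hY i).trans ((mul_le_mul' (mul_le_mul_left hCc _)
        (ENNReal.rpow_le_rpow ih (by linarith))).trans (le_of_eq ?_))
      rw [ENNReal.ofReal_rpow_of_nonneg (by positivity) (by linarith),
        ← ENNReal.ofReal_pow (by linarith), ← ENNReal.ofReal_mul hc0.le,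
        ← ENNReal.ofReal_mul (by positivity)]
      congr 1
      have e1 : (ε * r ^ i) ^ κ = (ε * r ^ i) ^ (κ - 1) * (ε * r ^ i) := by
        rw [← Real.rpow_add_one (by positivity), sub_add_cancel]
      have e2 : (ε * r ^ i) ^ (κ - 1) = r / c * (b ^ i)⁻¹ := by
        rw [Real.mul_rpow hε0.le (by positivity), hε, ← Real.rpow_mul (by positivity),
          one_div_mul_cancel hκ', Real.rpow_one]
        congr 1
        rw [hr, ← Real.rpow_natCast, ← Real.rpow_mul (by linarith), ← Real.rpow_mul (by linarith),
          ← Real.rpow_natCast, ← Real.rpow_neg (by linarith)]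
        congr 1
        field_simp
      have hbi : b ^ i ≠ 0 := by positivity
      rw [e1, e2, pow_succ]
      field_simp
  have hlim : Tendsto (fun i => ENNReal.ofReal (ε * r ^ i)) atTop (𝓝 0) := by
    have := (tendsto_pow_atTop_nhds_zero_of_lt_one hr0.le hr1).const_mul ε
    rw [mul_zero] at this
    simpa using ENNReal.tendsto_ofReal this
  exact tendsto_of_tendsto_of_tendsto_of_le_of_le tendsto_const_nhds hlim (fun i => zero_le) key

/-- The exponents of the De Giorgi iteration. -/
structure IsExponentSystem (d : ℕ) (p p' q q' P P' ρ s κ α β : ℝ) : Prop where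
  conj : p.HolderConjugate P
  conj' : p'.HolderConjugate P'
  one_lt_q : 1 < q
  q'_pos : 0 < q'
  s_pos : 0 < s
  s_eq : s / q' + s = 1
  one_lt_ρ : 1 < ρ
  ρ_eq : 1 / ρ = 1 - 2 / d + 1 / q
  β_eq : β = s * P / (ρ * P')
  α_nonneg : 0 ≤ α
  add_eq : α + β = 1
  κ_eq : κ * P = α + ρ * β
  one_lt_κ : 1 < κ
  κ_eq' : α / P + s / P' = κ

/-- P and P' are the conjugates of p and p', 1/ρ is the Sobolev exponent, and s is the power for
which Hölder in time splits ν^s E^s into L^{q'} and L¹. The equations for α, β and κ are then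
forced. -/
theorem exists_exponentSystem (hd : 2 ≤ d) {p p' q q' : ℝ} (hp : 1 < p) (hp' : 1 < p')
    (hq : 1 < q) (hq' : 1 < q')
    (h : p⁻¹ * (1 - p'⁻¹)⁻¹ * (1 + q'⁻¹) + q⁻¹ < 2 / d) :
    ∃ P P' ρ s κ α β : ℝ, IsExponentSystem d p p' q q' P P' ρ s κ α β := by
  have hd0 : (2 : ℝ) ≤ d := by exact_mod_cast hd
  have hpp : p'⁻¹ < 1 := inv_lt_one_of_one_lt₀ hp'
  have hp'1 : 0 < 1 - p'⁻¹ := by linarith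
  have hpos : 0 < p⁻¹ * (1 - p'⁻¹)⁻¹ * (1 + q'⁻¹) := by positivity
  set σ : ℝ := 1 - 2 / d + 1 / q with hσ
  have h2d : 2 / (d : ℝ) ≤ 1 := by rw [div_le_one (by linarith)]; exact hd0
  have hqinv : 0 < q⁻¹ := by positivity
  have hσ0 : 0 < σ := by rw [hσ, one_div]; linarith
  have hσ1 : σ < 1 := by rw [hσ, one_div]; linarith
  have cP := Real.HolderConjugate.conjExponent hp
  have cP' := Real.HolderConjugate.conjExponent hp'
  set P := p.conjExponent with hPdef
  set P' := p'.conjExponent with hP'def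
  have iP : P⁻¹ = 1 - p⁻¹ := by linarith [cP.inv_add_inv_eq_one]
  have iP' : P'⁻¹ = 1 - p'⁻¹ := by linarith [cP'.inv_add_inv_eq_one]
  have hP0 : 0 < P := cP.symm.pos
  have hP'0 : 0 < P' := cP'.symm.pos
  have hP1 : 1 < P := cP.symm.lt
  have hP'1 : 1 < P' := cP'.symm.lt
  set s : ℝ := (1 + q'⁻¹)⁻¹ with hs
  have hs0 : 0 < s := by positivity
  have hs1 : s < 1 := inv_lt_one_of_one_lt₀ (by linarith [inv_pos.mpr (by linarith : 0 < q')])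
  set β : ℝ := s * P / (σ⁻¹ * P') with hβ
  set κ : ℝ := P⁻¹ + (1 - σ) * s * P'⁻¹ with hκ
  -- Since 1 - σ = 2/d - 1/q, the inequality κ > 1 reads 1/p < (2/d - 1/q) (1 - 1/p') / (1 + 1/q'):
  -- this is the moment condition.
  have hκ1 : 1 < κ := by
    have h1 : p⁻¹ * (1 - p'⁻¹)⁻¹ * (1 + q'⁻¹) < 1 - σ := by
      rw [hσ, one_div]
      linarith
    have h2 : p⁻¹ < (1 - σ) * s * P'⁻¹ := by
      rw [iP', hs]
      have h3 : 0 < (1 + q'⁻¹) := by positivity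
      have h4 := mul_lt_mul_of_pos_right h1 (mul_pos (inv_pos.mpr h3) hp'1)
      have e : p⁻¹ * (1 - p'⁻¹)⁻¹ * (1 + q'⁻¹) * ((1 + q'⁻¹)⁻¹ * (1 - p'⁻¹)) = p⁻¹ := by
        have h5 := hp'1.ne'
        have h6 := h3.ne'
        generalize 1 - p'⁻¹ = B at h5 ⊢
        generalize 1 + q'⁻¹ = A at h6 ⊢
        field_simp
      rw [e] at h4
      linarith
    rw [hκ, iP]
    linarith
  have hα : 1 - β = P * (κ - s * P'⁻¹) := by
    rw [hβ, hκ]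
    field_simp
    ring
  refine ⟨P, P', σ⁻¹, s, κ, 1 - β, β, cP, cP', hq, by linarith, hs0, ?_, ?_, ?_, rfl, ?_, by ring,
    ?_, hκ1, ?_⟩
  · rw [hs]
    field_simp
    ring
  · exact (one_lt_inv₀ hσ0).mpr hσ1
  · rw [one_div, inv_inv]
  · rw [hα]
    refine mul_nonneg hP0.le ?_
    have : s * P'⁻¹ < 1 := mul_lt_one_of_nonneg_of_lt_one_left hs0.le hs1
      (inv_le_one_of_one_le₀ hP'1.le)
    linarith
  · rw [hκ, hβ]
    field_simp
    ring
  · rw [hα]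
    field_simp
    ring

end DeGiorgi

/-! ### Powers of the excess, and the averaged Sobolev inequality. -/

section DeGiorgi

variable {d : ℕ}

/-- The squared excess, in `ℝ≥0∞`. -/
def excessSq (N : ℕ) (L : ℝ) (u : ℝ → ZLat d → ℝ) (k t : ℝ) (x : ZLat d) : ℝ≥0∞ :=
  ENNReal.ofReal (excess N L u k t x) ^ 2

/-- Where the upper excess is nonzero, the lower excess divided by η is at least one and may be
raised to any higher power. -/
theorem excessSq_add_le {N : ℕ} {L : ℝ} {u : ℝ → ZLat d → ℝ} {k η κ : ℝ} (hη : 0 < η)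
    (hκ : 1 ≤ κ) (t : ℝ) (x : ZLat d) :
    excessSq N L u (k + η) t x ≤ ENNReal.ofReal (η⁻¹ ^ (2 * (κ - 1))) * excessSq N L u k t x ^ κ := by
  by_cases h0 : excess N L u (k + η) t x = 0
  · simp [excessSq, h0]
  · have h1 := le_excess_of_ne_zero h0
    have h2 := excess_anti (N := N) (L := L) (u := u) (by linarith : k ≤ k + η) t x
    have h3 := excess_nonneg N L u (k + η) t x
    set w := excess N L u k t x with hw
    have hw0 : 0 < w := hη.trans_le h1
    unfold excessSq
    rw [← hw, ← ENNReal.ofReal_pow h3, ← ENNReal.ofReal_pow hw0.le,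
      ENNReal.ofReal_rpow_of_nonneg (by positivity) (by linarith),
      ← ENNReal.ofReal_mul (by positivity)]
    refine ENNReal.ofReal_le_ofReal ((pow_le_pow_left₀ h3 h2 2).trans ?_)
    have e : (w ^ 2) ^ κ = w ^ (2 * (κ - 1)) * w ^ 2 := by
      rw [← Real.rpow_natCast w 2, ← Real.rpow_mul hw0.le, ← Real.rpow_add hw0]
      congr 1
      push_cast
      ring
    rw [e, ← mul_assoc, ← Real.mul_rpow (by positivity) hw0.le]
    refine le_mul_of_one_le_left (by positivity) (Real.one_le_rpow ?_ (by linarith))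
    rw [inv_mul_eq_div, one_le_div hη]
    exact h1

theorem aemeasurable_lintegral_unifB {N M : ℕ} {F : ℝ → ZLat d → ℝ≥0∞}
    (h : ∀ x, AEMeasurable (fun t => F t x) (unifT N)) :
    AEMeasurable (fun t => ∫⁻ x, F t x ∂(unifB d M)) (unifT N) := by
  simp_rw [lintegral_unifB]
  exact (Finset.aemeasurable_fun_sum _ fun x _ => h x).const_mul _

theorem aemeasurable_unifT {N : ℕ} {f : ℝ → ℝ≥0∞} (h : AEMeasurable f volume) :
    AEMeasurable f (unifT N) := by
  refine h.mono_ac ?_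
  exact (ProbabilityTheory.cond_absolutelyContinuous)

/-- The standing assumptions for the De Giorgi iteration on `Q(N)`. -/
structure IsBoundedSolution (ω : Env d) (p p' q q' : ℝ) (Λ : ℝ≥0∞) (N : ℕ) (L : ℝ)
    (h : ZLat d → ℝ) (u : ℝ → ZLat d → ℝ) : Prop where
  sol : IsCorrectorSolution ω h u
  locInt : ∀ x (z : Nbr d), LocallyIntegrable (fun t => conduct ω t x (x + z)) volume
  pos : 0 < N
  odd : ∀ x, h (-x) = - h x
  bound : ∀ z : Nbr d, |h z| ≤ L / N
  le : ∀ t ∈ Set.Icc (0 : ℝ) ((N : ℝ) ^ 2), ∀ x ∈ fball d N, u t x ≤ L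
  mu_le : cylNorm (ENNReal.ofReal p) (ENNReal.ofReal p') N (muW ω) ≤ Λ
  nu_le : cylNorm (ENNReal.ofReal q) (ENNReal.ofReal q') N (nuW ω) ≤ Λ

theorem muW_eq (ω : Env d) (t : ℝ) (x : ZLat d) :
    muW ω t x = ∑ z : Nbr d, conduct ω t x (x + z) := by
  rw [muW, sum_neighborFinset]

theorem nuW_eq (ω : Env d) (t : ℝ) (x : ZLat d) :
    nuW ω t x = ∑ z : Nbr d, (conduct ω t x (x + z))⁻¹ := by
  rw [nuW, sum_neighborFinset x (fun y => (conduct ω t x y)⁻¹)]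

theorem muW_nonneg (ω : Env d) (t : ℝ) (x : ZLat d) : 0 ≤ muW ω t x :=
  Finset.sum_nonneg fun _ _ => conduct_nonneg _ _ _ _

theorem nuW_nonneg (ω : Env d) (t : ℝ) (x : ZLat d) : 0 ≤ nuW ω t x :=
  Finset.sum_nonneg fun _ _ => inv_nonneg.mpr (conduct_nonneg _ _ _ _)

theorem aemeasurable_muW {ω : Env d}
    (h : ∀ x (z : Nbr d), AEMeasurable (fun t => conduct ω t x (x + z)) volume) (x : ZLat d) :
    AEMeasurable (fun t => muW ω t x) volume := by
  simp_rw [muW_eq]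
  exact Finset.aemeasurable_fun_sum _ fun z _ => h x z

theorem aemeasurable_nuW {ω : Env d}
    (h : ∀ x (z : Nbr d), AEMeasurable (fun t => conduct ω t x (x + z)) volume) (x : ZLat d) :
    AEMeasurable (fun t => nuW ω t x) volume := by
  simp_rw [nuW_eq]
  exact Finset.aemeasurable_fun_sum _ fun z _ => (h x z).inv

variable {p p' q q' P P' ρ s κ α β : ℝ}

/-- Hölder in space and time separates μ from the squared excess. The summand 1, which stems from
the time slope of the barrier, is treated as a second weight, of norm one. -/
theorem lintegral_mul_excessSq_le (hX : IsExponentSystem d p p' q q' P P' ρ s κ α β)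
    {ω : Env d} {Λ : ℝ≥0∞} {N : ℕ} {L : ℝ} {h : ZLat d → ℝ} {u : ℝ → ZLat d → ℝ}
    (hu : IsBoundedSolution ω p p' q q' Λ N L h u) (k : ℝ) :
    ∫⁻ t, ∫⁻ x, ENNReal.ofReal (muW ω t x + 1) * excessSq N L u k t x ∂(unifB d N) ∂(unifT N)
      ≤ (Λ + 1) * mixNorm (unifB d N) (unifT N) P P' (excessSq N L u k) := by
  have := isProbabilityMeasure_unifT hu.pos
  have hm := aemeasurable_muW (ω := ω) fun x z => (hu.locInt x z).aestronglyMeasurable.aemeasurable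
  have hmx : ∀ (g : ZLat d → ℝ≥0∞), AEMeasurable g (unifB d N) := fun g =>
    (measurable_of_countable g).aemeasurable
  have hex : ∀ x, AEMeasurable (fun t => excessSq N L u k t x) (unifT N) := fun x =>
    (((continuous_excess hu.sol.continuous k x).measurable.ennreal_ofReal).pow_const 2).aemeasurable
  have hmu' : ∀ x, AEMeasurable (fun t => ENNReal.ofReal (muW ω t x)) (unifT N) := fun x =>
    aemeasurable_unifT (hm x).ennreal_ofReal
  have h1 := lintegral_lintegral_mul_le_mixNorm (π := unifB d N) (τ := unifT N) hX.conj hX.conj'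
    (f := fun t x => ENNReal.ofReal (muW ω t x)) (g := excessSq N L u k)
    (fun t => hmx _) (fun t => hmx _)
    (aemeasurable_lintegral_unifB fun x => (hmu' x).pow_const p)
    (aemeasurable_lintegral_unifB fun x => (hex x).pow_const P)
  have h2 := lintegral_lintegral_mul_le_mixNorm (π := unifB d N) (τ := unifT N) hX.conj hX.conj'
    (f := fun _ _ => 1) (g := excessSq N L u k)
    (fun t => hmx _) (fun t => hmx _)
    (aemeasurable_lintegral_unifB fun x => aemeasurable_const)
    (aemeasurable_lintegral_unifB fun x => (hex x).pow_const P)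
  have h3 : mixNorm (unifB d N) (unifT N) p p' (fun _ _ => 1) = 1 := by
    simp [mixNorm]
  have h4 : mixNorm (unifB d N) (unifT N) p p' (fun t x => ENNReal.ofReal (muW ω t x)) ≤ Λ := by
    refine le_trans (le_of_eq ?_) hu.mu_le
    rw [cylNorm_eq_mixNorm hX.conj.pos hX.conj'.pos]
    simp_rw [Real.enorm_eq_ofReal (muW_nonneg ω _ _)]
  rw [h3] at h2
  rw [add_mul]
  refine le_trans (le_of_eq ?_) (add_le_add (h1.trans (mul_le_mul_left h4 _)) h2)
  rw [← lintegral_add_left']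
  · refine lintegral_congr fun t => ?_
    rw [← lintegral_add_left' (hmx _)]
    refine lintegral_congr fun x => ?_
    rw [ENNReal.ofReal_add (muW_nonneg ω t x) zero_le_one, ENNReal.ofReal_one, add_mul]
  · exact aemeasurable_lintegral_unifB fun x => (hmu' x).mul (hex x)

/-- Diffusive scaling: the volume factor |B(N)|^{2/d} of the averaged Sobolev inequality is
compensated by the normalisation N² of time. -/
theorem card_rpow_le (hd : 2 ≤ d) {N : ℕ} (hN : 0 < N) :
    ((fball d N).card : ℝ≥0∞) ^ (2 / (d : ℝ)) ≤ 9 * ENNReal.ofReal ((N : ℝ) ^ 2) := by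
  have h1 : (fball d N).card ≤ (3 * N) ^ d :=
    (fball_card_le N).trans (Nat.pow_le_pow_left (by omega) d)
  have h2 : ((fball d N).card : ℝ≥0∞) ≤ (((3 * N : ℕ) : ℝ≥0∞)) ^ d := by exact_mod_cast h1
  have hd0 : (d : ℝ) ≠ 0 := by
    have : d ≠ 0 := by omega
    exact_mod_cast this
  refine (ENNReal.rpow_le_rpow h2 (by positivity)).trans (le_of_eq ?_)
  rw [← ENNReal.rpow_natCast, ← ENNReal.rpow_mul, mul_div_cancel₀ _ hd0]
  have e : ENNReal.ofReal ((N : ℝ) ^ 2) = (N : ℝ≥0∞) ^ 2 := by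
    rw [ENNReal.ofReal_pow (by positivity), ENNReal.ofReal_natCast]
  rw [e, ENNReal.rpow_two]
  push_cast
  ring

/-- When sums are replaced by averages, the relation 1/ρ = 1 - 2/d + 1/q leaves the factor
|B(N)|^{2/d - 1} in front of the energy. -/
theorem sobolev_average (hd : 2 ≤ d) (hX : IsExponentSystem d p p' q q' P P' ρ s κ α β)
    (ω : Env d) (t : ℝ) {N : ℕ} {v : ZLat d → ℝ} (hv0 : ∀ x, 0 ≤ v x)
    (hv : ∀ x, N ≤ l1norm x → v x = 0) :
    (∫⁻ x, (ENNReal.ofReal (v x) ^ 2) ^ ρ ∂(unifB d N)) ^ (1 / ρ)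
      ≤ ENNReal.ofReal ((4 * ρ) ^ 2 * 4) *
        ((∫⁻ x, ENNReal.ofReal (nuW ω t x) ^ q ∂(unifB d N)) ^ (1 / q) *
        (((fball d N).card : ℝ≥0∞) ^ (2 / (d : ℝ) - 1) * ∑ x ∈ fball d N, ∑ z : Nbr d,
          ENNReal.ofReal (conduct ω t x (x + z) * (v (x + z) - v x) ^ 2))) := by
  have hS := weighted_sobolev hd hX.one_lt_q hX.one_lt_ρ hX.ρ_eq hv0 hv (a := conduct ω t)
    (fun x z => conduct_pos (Nbr.adj_add z x))
  have hρ0 : 0 < ρ := by linarith [hX.one_lt_ρ]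
  have hq0 : 0 < q := by linarith [hX.one_lt_q]
  have hc0 : ((fball d N).card : ℝ≥0∞) ≠ 0 := by
    exact_mod_cast (fball_card_pos N).ne'
  have hct : ((fball d N).card : ℝ≥0∞) ≠ ∞ := ENNReal.natCast_ne_top _
  rw [lintegral_unifB, lintegral_unifB, ENNReal.mul_rpow_of_nonneg _ _ (by positivity),
    ENNReal.mul_rpow_of_nonneg _ _ (by positivity)]
  have e1 : ∀ x, (ENNReal.ofReal (v x) ^ 2) ^ ρ = ENNReal.ofReal (v x) ^ (2 * ρ) := by
    intro x
    rw [← ENNReal.rpow_natCast, ← ENNReal.rpow_mul]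
    norm_num
  simp_rw [e1, nuW_eq]
  refine (mul_le_mul_right hS _).trans (le_of_eq ?_)
  have e2 : ((fball d N).card : ℝ≥0∞)⁻¹ ^ (1 / ρ)
      = ((fball d N).card : ℝ≥0∞)⁻¹ ^ (1 / q) * ((fball d N).card : ℝ≥0∞) ^ (2 / (d : ℝ) - 1) := by
    rw [ENNReal.inv_rpow, ENNReal.inv_rpow, ← ENNReal.rpow_neg, ← ENNReal.rpow_neg,
      ← ENNReal.rpow_add _ _ hc0 hct, hX.ρ_eq]
    congr 1
    ring
  rw [e2]
  generalize ((fball d N).card : ℝ≥0∞)⁻¹ ^ (1 / q) = a1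
  generalize ((fball d N).card : ℝ≥0∞) ^ (2 / (d : ℝ) - 1) = a2
  generalize (∑ x ∈ fball d N, ENNReal.ofReal (∑ z : Nbr d, (conduct ω t x (x + z))⁻¹) ^ q) ^ (1 / q)
    = a3
  generalize ENNReal.ofReal ((4 * ρ) ^ 2 * 4) = a4
  generalize ∑ x ∈ fball d N, ∑ z : Nbr d,
    ENNReal.ofReal (conduct ω t x (x + z) * (v (x + z) - v x) ^ 2) = a5
  ring

end DeGiorgi

/-! ### The iteration step and De Giorgi's first lemma. -/

section DeGiorgi

variable {d : ℕ} {p p' q q' P P' ρ s κ α β : ℝ}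

/-- The quantity A bounds both the supremum in time of the averaged squared excess and, up to a
factor, its averaged energy. These are the two endpoints between which `mixNorm_rpow_le`
interpolates. -/
theorem mixNorm_excess_step (hd : 2 ≤ d) (hX : IsExponentSystem d p p' q q' P P' ρ s κ α β)
    {ω : Env d} {Λ : ℝ≥0∞} {N : ℕ} {L : ℝ} (hL : 1 ≤ L) {h : ZLat d → ℝ} {u : ℝ → ZLat d → ℝ}
    (hu : IsBoundedSolution ω p p' q q' Λ N L h u) {k η : ℝ} (hk : 0 ≤ k) (hη : 0 < η)
    (hη1 : η ≤ 1) {A : ℝ≥0∞}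
    (hA : A = ENNReal.ofReal (9 * L ^ 2 / η ^ 2) *
      ((Λ + 1) * mixNorm (unifB d N) (unifT N) P P' (excessSq N L u k))) (hAt : A ≠ ∞) :
    mixNorm (unifB d N) (unifT N) P P' (fun t x => excessSq N L u (k + η) t x ^ κ)
      ≤ A ^ (α / P) * (ENNReal.ofReal ((4 * ρ) ^ 2 * 4) ^ s * (Λ ^ s * (18 * A) ^ s)) ^ (1 / P') := by
  have hN := hu.pos
  have hN' : (0 : ℝ) < N := by exact_mod_cast hN
  have hT := isProbabilityMeasure_unifT hN
  have hρ0 : 0 < ρ := by linarith [hX.one_lt_ρ]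
  have hq0 : 0 < q := by linarith [hX.one_lt_q]
  have hc0 : ((fball d N).card : ℝ≥0∞) ≠ 0 := by
    exact_mod_cast (fball_card_pos N).ne'
  have hct : ((fball d N).card : ℝ≥0∞) ≠ ∞ := ENNReal.natCast_ne_top _
  set c : ℝ≥0∞ := ((fball d N).card : ℝ≥0∞) with hc
  set n2 : ℝ≥0∞ := ENNReal.ofReal ((N : ℝ) ^ 2) with hn2
  have hn0 : n2 ≠ 0 := by simpa [hn2] using hN.ne'
  have hnt : n2 ≠ ∞ := ENNReal.ofReal_ne_top
  set R : ℝ≥0∞ := ENNReal.ofReal (9 * L ^ 2 / ((N : ℝ) ^ 2 * η ^ 2)) *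
      ∫⁻ t in Set.Icc (0 : ℝ) ((N : ℝ) ^ 2), ∑ x ∈ fball d N,
        ENNReal.ofReal (muW ω t x + 1) * ENNReal.ofReal (excess N L u k t x) ^ 2 with hR
  obtain ⟨hE1, hE2⟩ := energy_estimate hu.sol hu.locInt hN hL hu.odd hu.bound hu.le hk hη hη1 hR
  have hRA : R ≤ c * A := by
    have h1 := lintegral_mul_excessSq_le hX hu k
    rw [lintegral_unifT] at h1
    simp_rw [lintegral_unifB] at h1
    rw [lintegral_const_mul' _ _ (ENNReal.inv_ne_top.mpr hc0)] at h1
    have h2 : ∫⁻ t in Set.Icc (0 : ℝ) ((N : ℝ) ^ 2), ∑ x ∈ fball d N,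
        ENNReal.ofReal (muW ω t x + 1) * ENNReal.ofReal (excess N L u k t x) ^ 2
        ≤ n2 * (c * ((Λ + 1) * mixNorm (unifB d N) (unifT N) P P' (excessSq N L u k))) := by
      have h3 := mul_le_mul_right (mul_le_mul_right h1 n2) c
      refine le_trans (le_of_eq ?_) (h3.trans (le_of_eq (by ring)))
      rw [← mul_assoc n2, ENNReal.mul_inv_cancel hn0 hnt, one_mul, ← mul_assoc,
        ENNReal.mul_inv_cancel hc0 hct, one_mul]
      rfl
    rw [hR]
    refine (mul_le_mul_right h2 _).trans (le_of_eq ?_)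
    have e : ENNReal.ofReal (9 * L ^ 2 / ((N : ℝ) ^ 2 * η ^ 2)) * n2
        = ENNReal.ofReal (9 * L ^ 2 / η ^ 2) := by
      rw [hn2, ← ENNReal.ofReal_mul (by positivity)]
      congr 1
      field_simp
    rw [hA, ← mul_assoc, e]
    ring
  set E : ℝ → ℝ≥0∞ := fun t => c ^ (2 / (d : ℝ) - 1) * ∑ x ∈ fball d N, ∑ z : Nbr d,
    ENNReal.ofReal (conduct ω t x (x + z) *
      (excess N L u (k + η) t (x + z) - excess N L u (k + η) t x) ^ 2) with hE
  set ν : ℝ → ℝ≥0∞ := fun t =>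
    (∫⁻ x, ENNReal.ofReal (nuW ω t x) ^ q ∂(unifB d N)) ^ (1 / q) with hν
  have hcm : ∀ x (z : Nbr d), AEMeasurable (fun t => conduct ω t x (x + z)) volume :=
    fun x z => (hu.locInt x z).aestronglyMeasurable.aemeasurable
  have hEx : ∀ x, Measurable fun t => excess N L u (k + η) t x := fun x =>
    (continuous_excess hu.sol.continuous (k + η) x).measurable
  have hEm : AEMeasurable E (unifT N) := by
    refine AEMeasurable.const_mul (Finset.aemeasurable_fun_sum _ fun x _ =>
      Finset.aemeasurable_fun_sum _ fun z _ => aemeasurable_unifT ?_) _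
    exact ((hcm x z).mul
      (((hEx (x + z)).sub (hEx x)).pow_const 2).aemeasurable).ennreal_ofReal
  have hνm : AEMeasurable ν (unifT N) :=
    (aemeasurable_lintegral_unifB fun x =>
      (aemeasurable_unifT (aemeasurable_nuW hcm x).ennreal_ofReal).pow_const q).pow_const _
  have hcne : c ^ (2 / (d : ℝ) - 1) ≠ ∞ := ENNReal.rpow_ne_top_of_ne_zero hc0 hct
  -- The constant 18 is the factor 2 in the energy bound times the 9 from the volume of the ball.
  have hEint : ∫⁻ t, E t ∂(unifT N) ≤ 18 * A := by
    rw [lintegral_unifT, hE, lintegral_const_mul' _ _ hcne]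
    have h1 := hE2.trans (mul_le_mul_right hRA 2)
    refine (mul_le_mul_right (mul_le_mul_right h1 _) _).trans ?_
    have e : c ^ (2 / (d : ℝ) - 1) * c = c ^ (2 / (d : ℝ)) := by
      conv_lhs => rw [← ENNReal.rpow_one c, ← ENNReal.rpow_mul, one_mul]
      rw [← ENNReal.rpow_add _ _ hc0 hct, sub_add_cancel]
    calc n2⁻¹ * (c ^ (2 / (d : ℝ) - 1) * (2 * (c * A)))
        = n2⁻¹ * (c ^ (2 / (d : ℝ) - 1) * c) * (2 * A) := by ring
      _ ≤ n2⁻¹ * (9 * n2) * (2 * A) := by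
          rw [e]
          exact mul_le_mul_left (mul_le_mul_right (card_rpow_le hd hN) _) _
      _ = (n2 * n2⁻¹) * (18 * A) := by ring
      _ = 18 * A := by rw [ENNReal.mul_inv_cancel hn0 hnt, one_mul]
  have hνint : (∫⁻ t, ν t ^ q' ∂(unifT N)) ^ (s / q') ≤ Λ ^ s := by
    have h1 := hu.nu_le
    rw [cylNorm_eq_mixNorm hq0 hX.q'_pos] at h1
    have h2 := ENNReal.rpow_le_rpow h1 hX.s_pos.le
    refine le_trans (le_of_eq ?_) h2
    unfold mixNorm
    rw [← ENNReal.rpow_mul, one_div_mul_eq_div]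
    simp_rw [hν, ← ENNReal.rpow_mul, one_div_mul_eq_div, Real.enorm_eq_ofReal (nuW_nonneg ω _ _)]
  have hbd : ∀ t ∈ Set.Icc (0 : ℝ) ((N : ℝ) ^ 2), ∀ x, l1norm x = N →
      u t x - (L * barrier N t x + (k + η)) ≤ 0 := by
    intro t ht x hx
    have h1 := hu.le t ht x (mem_fball.mpr hx.le)
    have h2 := one_le_barrier_of_l1norm hN t hx
    nlinarith
  have key := mixNorm_rpow_le (π := unifB d N) (τ := unifT N) (f := excessSq N L u (k + η))
    (fun t => (measurable_of_countable _).aemeasurable) hνm hEm hX.s_pos hX.q'_pos hX.s_eq hρ0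
    hX.conj.symm.pos hX.conj'.symm.pos hX.β_eq hX.α_nonneg hX.add_eq hX.κ_eq
    (K := ENNReal.ofReal ((4 * ρ) ^ 2 * 4)) ENNReal.ofReal_ne_top (A := A)
    (ae_unifT N fun t ht => by
      rw [lintegral_unifB]
      refine (mul_le_mul_right ((hE1 t ht).trans hRA) _).trans (le_of_eq ?_)
      rw [← mul_assoc, ENNReal.inv_mul_cancel hc0 hct, one_mul])
    (ae_unifT N fun t ht => by
      exact sobolev_average hd hX ω t (N := N) (excess_nonneg N L u (k + η) t)
        (fun x hx => truncPos_eq_zero (hbd t ht) hx)) hAt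
  refine key.trans (mul_le_mul_right (ENNReal.rpow_le_rpow (mul_le_mul_right
    (mul_le_mul' hνint (ENNReal.rpow_le_rpow hEint hX.s_pos.le)) _) ?_) _)
  have := hX.conj'.symm.pos
  positivity

/-- One step of the De Giorgi iteration. -/
theorem exists_mixNorm_excess_le (hd : 2 ≤ d)
    (hX : IsExponentSystem d p p' q q' P P' ρ s κ α β) {Λ : ℝ≥0∞} (hΛ : Λ ≠ ∞) {L : ℝ}
    (hL : 1 ≤ L) :
    ∃ C : ℝ≥0∞, C ≠ ∞ ∧ ∀ (ω : Env d) (N : ℕ) (h : ZLat d → ℝ) (u : ℝ → ZLat d → ℝ),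
      IsBoundedSolution ω p p' q q' Λ N L h u → ∀ k η : ℝ, 0 ≤ k → 0 < η → η ≤ 1 →
      mixNorm (unifB d N) (unifT N) P P' (excessSq N L u (k + 2 * η))
        ≤ C * ENNReal.ofReal (η⁻¹ ^ (4 * κ - 2)) *
          mixNorm (unifB d N) (unifT N) P P' (excessSq N L u k) ^ κ := by
  have hP0 := hX.conj.symm.pos
  have hP'0 := hX.conj'.symm.pos
  have hs0 := hX.s_pos
  have hκ0 : 0 < κ := by linarith [hX.one_lt_κ]
  have hsP : 0 ≤ s / P' := by positivity
  set D : ℝ≥0∞ := (ENNReal.ofReal ((4 * ρ) ^ 2 * 4) * (Λ * 18)) ^ (s / P') *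
    (ENNReal.ofReal (9 * L ^ 2) * (Λ + 1)) ^ κ with hD
  have hDt : D ≠ ∞ := by
    refine ENNReal.mul_ne_top (ENNReal.rpow_ne_top_of_nonneg hsP ?_)
      (ENNReal.rpow_ne_top_of_nonneg hκ0.le ?_)
    · exact ENNReal.mul_ne_top ENNReal.ofReal_ne_top (ENNReal.mul_ne_top hΛ (by norm_num))
    · exact ENNReal.mul_ne_top ENNReal.ofReal_ne_top (by simpa using hΛ)
  refine ⟨D + 1, by simpa using hDt, fun ω N h u hu k η hk hη hη1 => ?_⟩
  set Y := mixNorm (unifB d N) (unifT N) P P' (excessSq N L u k) with hY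
  have hηpos : 0 < η⁻¹ := inv_pos.mpr hη
  -- If the previous norm is infinite the right hand side is infinite, because its prefactors are
  -- nonzero; the summand 1 in the constant ensures this.
  by_cases hYt : Y = ∞
  · rw [hYt, ENNReal.top_rpow_of_pos hκ0, ENNReal.mul_top]
    · exact le_top
    · refine mul_ne_zero (by simp) ?_
      simpa using Real.rpow_pos_of_pos hηpos _
  set A : ℝ≥0∞ := ENNReal.ofReal (9 * L ^ 2 / η ^ 2) * ((Λ + 1) * Y) with hA
  have hAt : A ≠ ∞ := ENNReal.mul_ne_top ENNReal.ofReal_ne_top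
    (ENNReal.mul_ne_top (by simpa using hΛ) hYt)
  have h1 := mixNorm_excess_step hd hX hL hu hk hη hη1 hA hAt
  -- The powers of A coming from the two endpoints add up to α/P + s/P' = κ, which is the
  -- superlinear gain.
  have e1 : A ^ (α / P) * (ENNReal.ofReal ((4 * ρ) ^ 2 * 4) ^ s * (Λ ^ s * (18 * A) ^ s)) ^ (1 / P')
      = (ENNReal.ofReal ((4 * ρ) ^ 2 * 4) * (Λ * 18)) ^ (s / P') * A ^ κ := by
    rw [← ENNReal.mul_rpow_of_nonneg _ _ hs0.le, ← ENNReal.mul_rpow_of_nonneg _ _ hs0.le,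
      ← ENNReal.rpow_mul, mul_one_div, ← hX.κ_eq',
      ENNReal.rpow_add_of_nonneg _ _ (div_nonneg hX.α_nonneg hP0.le) hsP,
      show ENNReal.ofReal ((4 * ρ) ^ 2 * 4) * (Λ * (18 * A))
        = (ENNReal.ofReal ((4 * ρ) ^ 2 * 4) * (Λ * 18)) * A by ring,
      ENNReal.mul_rpow_of_nonneg _ _ hsP]
    ring
  have e2 : A ^ κ = (ENNReal.ofReal (9 * L ^ 2) * (Λ + 1)) ^ κ *
      ENNReal.ofReal (η⁻¹ ^ (2 * κ)) * Y ^ κ := by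
    have : A = (ENNReal.ofReal (9 * L ^ 2) * (Λ + 1)) * ENNReal.ofReal (η⁻¹ ^ 2) * Y := by
      rw [hA, div_eq_mul_inv, ENNReal.ofReal_mul (by positivity), inv_pow]
      ring
    rw [this, ENNReal.mul_rpow_of_nonneg _ _ hκ0.le, ENNReal.mul_rpow_of_nonneg _ _ hκ0.le,
      ENNReal.ofReal_rpow_of_nonneg (by positivity) hκ0.le, ← Real.rpow_natCast η⁻¹ 2,
      ← Real.rpow_mul hηpos.le]
    norm_num
  rw [e1, e2] at h1
  -- The second half of the level gap raises the squared excess to the power κ, at the price of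
  -- η^{-2(κ-1)}. With the η^{-2κ} coming from A^κ this makes up the exponent 4κ - 2.
  have h2 : mixNorm (unifB d N) (unifT N) P P' (excessSq N L u (k + 2 * η))
      ≤ ENNReal.ofReal (η⁻¹ ^ (2 * (κ - 1))) *
        mixNorm (unifB d N) (unifT N) P P' (fun t x => excessSq N L u (k + η) t x ^ κ) := by
    rw [← mixNorm_const_mul hP0 hP'0 ENNReal.ofReal_ne_top]
    refine mixNorm_mono hP0.le hP'0.le fun t => Eventually.of_forall fun x => ?_
    have := excessSq_add_le (N := N) (L := L) (u := u) (k := k + η) hη hX.one_lt_κ.le t x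
    rwa [add_assoc, ← two_mul] at this
  refine h2.trans ((mul_le_mul_right h1 _).trans ?_)
  have e3 : ENNReal.ofReal (η⁻¹ ^ (4 * κ - 2))
      = ENNReal.ofReal (η⁻¹ ^ (2 * (κ - 1))) * ENNReal.ofReal (η⁻¹ ^ (2 * κ)) := by
    rw [← ENNReal.ofReal_mul (by positivity), ← Real.rpow_add hηpos]
    congr 2
    ring
  calc _ = D * ENNReal.ofReal (η⁻¹ ^ (4 * κ - 2)) * Y ^ κ := by
        rw [e3, hD]
        ring
    _ ≤ _ := mul_le_mul_left (mul_le_mul_left le_self_add _) _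

/-- A vanishing norm gives zero at almost every time only; continuity in time extends this to every
time of the closed interval. -/
theorem eq_zero_of_mixNorm_eq_zero {a b : ℝ} (ha : 0 < a) (hb : 0 < b) {N : ℕ} (hN : 0 < N)
    {f : ℝ → ZLat d → ℝ} (hf : ∀ x, Continuous fun t => f t x) (hf0 : ∀ t x, 0 ≤ f t x)
    (h : mixNorm (unifB d N) (unifT N) a b (fun t x => ENNReal.ofReal (f t x) ^ 2) = 0) {t : ℝ}
    (ht : t ∈ Set.Icc (0 : ℝ) ((N : ℝ) ^ 2)) {x : ZLat d} (hx : x ∈ fball d N) : f t x = 0 := by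
  have hN' : (0 : ℝ) < (N : ℝ) ^ 2 := by
    have : (0 : ℝ) < N := by exact_mod_cast hN
    positivity
  have hm : ∀ x, AEMeasurable (fun t => ENNReal.ofReal (f t x)) (unifT N) := fun x =>
    ((hf x).measurable.ennreal_ofReal).aemeasurable
  unfold mixNorm at h
  rw [ENNReal.rpow_eq_zero_iff_of_pos (by positivity), lintegral_eq_zero_iff'] at h
  · have h1 : ∀ᵐ t ∂(unifT N), f t x = 0 := by
      filter_upwards [h] with t ht
      have ht' : (∫⁻ x, (ENNReal.ofReal (f t x) ^ 2) ^ a ∂(unifB d N)) ^ (b / a) = 0 := ht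
      rw [ENNReal.rpow_eq_zero_iff_of_pos (by positivity), lintegral_unifB,
        mul_eq_zero, Finset.sum_eq_zero_iff] at ht'
      rcases ht' with h2 | h2
      · simp at h2
      · have h3 := h2 x hx
        rw [ENNReal.rpow_eq_zero_iff_of_pos ha] at h3
        have h4 := ENNReal.ofReal_eq_zero.mp (pow_eq_zero_iff (two_ne_zero) |>.mp h3)
        exact le_antisymm h4 (hf0 t x)
    have h2 : ∀ᵐ t ∂(volume.restrict (Set.Icc (0 : ℝ) ((N : ℝ) ^ 2))), f t x = 0 := by
      rw [unifT, ProbabilityTheory.cond, Measure.ae_ennreal_smul_measure_iff] at h1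
      · exact h1
      · simp
    have h3 : Set.EqOn (fun t => f t x) (fun _ => 0) (Set.Icc 0 ((N : ℝ) ^ 2)) :=
      Measure.eqOn_Icc_of_ae_eq volume hN'.ne h2 (hf x).continuousOn continuousOn_const
    exact h3 ht
  · exact (aemeasurable_lintegral_unifB fun x => ((hm x).pow_const 2).pow_const a).pow_const _

/-- De Giorgi's first lemma: a solution bounded above by `L` on `Q(N)` whose positive part has small
mean is at most one on `[0, N²/4] × B(N/2)`. -/
theorem exists_le_one_of_mean_le (hd : 2 ≤ d)
    (hX : IsExponentSystem d p p' q q' P P' ρ s κ α β) {Λ : ℝ≥0∞} (hΛ : Λ ≠ ∞) {L : ℝ}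
    (hL : 1 ≤ L) :
    ∃ c : ℝ≥0∞, c ≠ 0 ∧ ∀ (ω : Env d) (N : ℕ) (h : ZLat d → ℝ) (u : ℝ → ZLat d → ℝ),
      IsBoundedSolution ω p p' q q' Λ N L h u →
      ∫⁻ t, ∫⁻ x, ENNReal.ofReal (u t x) ∂(unifB d N) ∂(unifT N) ≤ c →
      ∀ t ∈ Set.Icc (0 : ℝ) ((N : ℝ) ^ 2 / 4), ∀ x : ZLat d, (l1norm x : ℝ) ≤ N / 2 →
        u t x ≤ 1 := by
  obtain ⟨C, hC, hstep⟩ := exists_mixNorm_excess_le hd hX hΛ hL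
  have hP0 := hX.conj.symm.pos
  have hP'0 := hX.conj'.symm.pos
  have hP1 := hX.conj.symm.lt
  have hP'1 := hX.conj'.symm.lt
  have hκ1 := hX.one_lt_κ
  set m : ℝ := 4 * κ - 2 with hm
  have hm0 : 0 < m := by linarith
  obtain ⟨ε, hε0, hε⟩ := tendsto_zero_of_le_geometric_mul_rpow
    (C := C * ENNReal.ofReal (4 ^ m)) (ENNReal.mul_ne_top hC ENNReal.ofReal_ne_top)
    (b := 2 ^ m) (Real.one_lt_rpow (by norm_num) hm0) hκ1
  set r : ℝ := max P P' with hr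
  have hr0 : 0 < r := hP0.trans_le (le_max_left _ _)
  set M : ℝ≥0∞ := ENNReal.ofReal L ^ 2 with hM
  have hMt : M ≠ ∞ := ENNReal.pow_ne_top ENNReal.ofReal_ne_top
  have hM0 : M ≠ 0 := pow_ne_zero 2 (by simp; linarith)
  set G : ℝ≥0∞ := M ^ (r - 1) * ENNReal.ofReal L with hG
  have hG0 : G ≠ 0 := mul_ne_zero
    (fun h => hM0 ((ENNReal.rpow_eq_zero_iff.mp h).resolve_right fun h' => hMt h'.1).1)
    (by simp; linarith)
  have hGt : G ≠ ∞ := ENNReal.mul_ne_top (ENNReal.rpow_ne_top_of_ne_zero hM0 hMt)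
    ENNReal.ofReal_ne_top
  -- At level 0 the mixed norm is at most (M^{r-1} L · mean)^{1/r} = (G · mean)^{1/r}, so this
  -- threshold makes it at most ε.
  refine ⟨ε ^ r / G, ?_, fun ω N h u hu hmean t ht x hx => ?_⟩
  · refine (ENNReal.div_pos ?_ hGt).ne'
    intro h0
    rcases ENNReal.rpow_eq_zero_iff.mp h0 with h1 | h1
    · exact hε0 h1.1
    · linarith [h1.2]
  have hN := hu.pos
  have hTp := isProbabilityMeasure_unifT hN
  have hcont := hu.sol.continuous
  have hNr : (0 : ℝ) < N := by exact_mod_cast hN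
  -- The levels increase to 1 with gaps 2^{-i-1} = 2η, where η = 2^{-i}/4, so that η^{-m} = 4^m
  -- (2^m)^i has the geometric form required by the iteration.
  set lev : ℕ → ℝ := fun i => 1 - (1 / 2) ^ i with hlev
  set Y : ℕ → ℝ≥0∞ := fun i => mixNorm (unifB d N) (unifT N) P P' (excessSq N L u (lev i)) with hYd
  have hYstep : ∀ i, Y (i + 1) ≤ C * ENNReal.ofReal (4 ^ m) * ENNReal.ofReal (2 ^ m) ^ i * Y i ^ κ := by
    intro i
    have hlev0 : 0 ≤ lev i := by
      simp only [hlev]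
      have : ((1 : ℝ) / 2) ^ i ≤ 1 := pow_le_one₀ (by norm_num) (by norm_num)
      linarith
    have h1 := hstep ω N h u hu (lev i) ((1 / 2) ^ i / 4) hlev0 (by positivity) (by
      have : ((1 : ℝ) / 2) ^ i ≤ 1 := pow_le_one₀ (by norm_num) (by norm_num)
      linarith)
    have e1 : lev i + 2 * ((1 / 2) ^ i / 4) = lev (i + 1) := by
      simp only [hlev, pow_succ]
      ring
    have e2 : (((1 : ℝ) / 2) ^ i / 4)⁻¹ ^ m = 4 ^ m * (2 ^ m) ^ i := by
      have : (((1 : ℝ) / 2) ^ i / 4)⁻¹ = 4 * 2 ^ i := by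
        rw [inv_div, one_div, inv_pow, div_inv_eq_mul]
      rw [this, Real.mul_rpow (by norm_num) (by positivity), ← Real.rpow_natCast (2 ^ m),
        ← Real.rpow_mul (by norm_num), mul_comm m, Real.rpow_mul (by norm_num), Real.rpow_natCast]
    rw [e1, e2, ENNReal.ofReal_mul (by positivity), ENNReal.ofReal_pow (by positivity)] at h1
    refine h1.trans (le_of_eq ?_)
    ring
  have hY0 : Y 0 ≤ ε := by
    have h1 := mixNorm_le_of_le (π := unifB d N) (τ := unifT N) hP1.le hP'1.le
      (f := excessSq N L u (lev 0)) (fun t => (measurable_of_countable _).aemeasurable)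
      (fun c => aemeasurable_lintegral_unifB fun x =>
        ((((continuous_excess hcont (lev 0) x).measurable.ennreal_ofReal).pow_const 2).pow_const
          c).aemeasurable) hMt
      (ae_unifT N fun t ht => (ae_unifB_iff N _).mpr fun x hx => by
        refine pow_le_pow_left' (ENNReal.ofReal_le_ofReal ?_) 2
        have h2 := hu.le t ht x hx
        have h3 := barrier_nonneg N t x
        simp only [excess, truncPos, hx, if_true, hlev, pow_zero, sub_self, add_zero]
        exact max_le (by nlinarith) (by linarith))
    have h2 : ∫⁻ t, ∫⁻ x, excessSq N L u (lev 0) t x ∂(unifB d N) ∂(unifT N)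
        ≤ ENNReal.ofReal L * (ε ^ r / G) := by
      refine le_trans ?_ (mul_le_mul_right hmean _)
      rw [← lintegral_const_mul' _ _ ENNReal.ofReal_ne_top]
      refine lintegral_mono_ae (ae_unifT N fun t ht => ?_)
      rw [← lintegral_const_mul' _ _ ENNReal.ofReal_ne_top]
      refine lintegral_mono_ae ((ae_unifB_iff N _).mpr fun x hx => ?_)
      have h2 := hu.le t ht x hx
      have h3 := barrier_nonneg N t x
      have h4 : excess N L u (lev 0) t x ≤ L ∧
          ENNReal.ofReal (excess N L u (lev 0) t x) ≤ ENNReal.ofReal (u t x) := by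
        simp only [excess, truncPos, hx, if_true, hlev, pow_zero, sub_self, add_zero]
        refine ⟨max_le (by nlinarith) (by linarith), ?_⟩
        rw [ENNReal.ofReal_max, ENNReal.ofReal_zero, max_eq_left zero_le]
        exact ENNReal.ofReal_le_ofReal (by nlinarith)
      unfold excessSq
      rw [pow_two]
      exact mul_le_mul' (ENNReal.ofReal_le_ofReal h4.1) h4.2
    refine h1.trans ?_
    have h3 : M ^ (r - 1) * ∫⁻ t, ∫⁻ x, excessSq N L u (lev 0) t x ∂(unifB d N) ∂(unifT N)
        ≤ ε ^ r := by
      refine (mul_le_mul_right h2 _).trans ?_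
      rw [← mul_assoc, ← hG]
      exact ENNReal.mul_div_le
    refine (ENNReal.rpow_le_rpow h3 (by positivity)).trans (le_of_eq ?_)
    rw [← ENNReal.rpow_mul, mul_one_div, div_self hr0.ne', ENNReal.rpow_one]
  have hlim := hε Y hYstep hY0
  have hzero : mixNorm (unifB d N) (unifT N) P P' (excessSq N L u 1) = 0 := by
    refine le_antisymm (ge_of_tendsto' hlim fun i => ?_) zero_le
    refine mixNorm_mono hP0.le hP'0.le fun t => Eventually.of_forall fun x => ?_
    refine pow_le_pow_left' (ENNReal.ofReal_le_ofReal (excess_anti ?_ t x)) 2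
    simp only [hlev]
    have : (0 : ℝ) ≤ (1 / 2) ^ i := by positivity
    linarith
  have hxN : x ∈ fball d N := by
    rw [mem_fball]
    have : (l1norm x : ℝ) ≤ N := by linarith
    exact_mod_cast this
  have htN : t ∈ Set.Icc (0 : ℝ) ((N : ℝ) ^ 2) := ⟨ht.1, ht.2.trans (by nlinarith [sq_nonneg (N : ℝ)])⟩
  -- The excess over level 1 vanishes on the whole cylinder; on the smaller one the barrier is zero,
  -- so this bounds u itself.
  have h0 := eq_zero_of_mixNorm_eq_zero hP0 hP'0 hN (f := excess N L u 1)
    (continuous_excess hcont 1) (excess_nonneg N L u 1) hzero htN hxN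
  simp only [excess, truncPos, hxN, if_true, barrier_eq_zero ht.2 hx, mul_zero, zero_add] at h0
  have := le_max_left (u t x - 1) 0
  linarith

end DeGiorgi

/-! ### Reduction to finite exponents. -/

section Exponents

variable {d : ℕ}

theorem cylNorm_mono {a a' : ℝ} {p p' : ℝ≥0∞} (ha : 0 < a)
    (hp : ENNReal.ofReal a ≤ p) (hp' : ENNReal.ofReal a' ≤ p') {N : ℕ} (hN : 0 < N)
    {u : ℝ → ZLat d → ℝ} (hu : ∀ x, AEMeasurable (fun t => u t x) volume) :
    cylNorm (ENNReal.ofReal a) (ENNReal.ofReal a') N u ≤ cylNorm p p' N u := by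
  have := isProbabilityMeasure_unifT hN
  unfold cylNorm
  refine (eLpNorm_le_eLpNorm_of_exponent_le hp' ?_).trans (eLpNorm_mono_enorm fun t => ?_)
  · have e : ∀ t, eLpNorm (u t) (ENNReal.ofReal a) (unifB d N)
        = (∫⁻ x, ‖u t x‖ₑ ^ a ∂(unifB d N)) ^ (1 / a) := by
      intro t
      rw [eLpNorm_eq_lintegral_rpow_enorm_toReal (by simpa using ha) ENNReal.ofReal_ne_top,
        ENNReal.toReal_ofReal ha.le]
    simp_rw [e]
    exact ((aemeasurable_lintegral_unifB fun x =>
      (aemeasurable_unifT (hu x).enorm).pow_const a).pow_const _).aestronglyMeasurable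
  · simp only [enorm_eq_self]
    exact eLpNorm_le_eLpNorm_of_exponent_le hp (measurable_of_countable _).aestronglyMeasurable

/-- The strict inequality depends continuously on the reciprocals of the exponents. Increasing each
reciprocal by a small ε keeps it and makes all exponents finite. -/
theorem exists_real_exponents (hd : 2 ≤ d) {p p' q q' : ℝ≥0∞} (hp : 1 < p) (hp' : 1 < p')
    (hq : 1 < q) (hq' : 1 < q')
    (h : p⁻¹ * (1 - p'⁻¹)⁻¹ * (1 + q'⁻¹) + q⁻¹ < 2 / (d : ℝ≥0∞)) :
    ∃ a a' b b' : ℝ, 1 < a ∧ 1 < a' ∧ 1 < b ∧ 1 < b' ∧ ENNReal.ofReal a ≤ p ∧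
      ENNReal.ofReal a' ≤ p' ∧ ENNReal.ofReal b ≤ q ∧ ENNReal.ofReal b' ≤ q' ∧
      a⁻¹ * (1 - a'⁻¹)⁻¹ * (1 + b'⁻¹) + b⁻¹ < 2 / d := by
  have hinv : ∀ {r : ℝ≥0∞}, 1 < r → ∃ x : ℝ, 0 ≤ x ∧ x < 1 ∧ r⁻¹ = ENNReal.ofReal x := by
    intro r hr
    have h1 : r⁻¹ < 1 := ENNReal.inv_lt_one.mpr hr
    refine ⟨r⁻¹.toReal, ENNReal.toReal_nonneg, ?_, (ENNReal.ofReal_toReal (h1.trans_le le_top).ne).symm⟩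
    have := (ENNReal.toReal_lt_toReal (h1.trans_le le_top).ne ENNReal.one_ne_top).mpr h1
    simpa using this
  obtain ⟨x, hx0, hx1, hx⟩ := hinv hp
  obtain ⟨x', hx'0, hx'1, hx'⟩ := hinv hp'
  obtain ⟨y, hy0, hy1, hy⟩ := hinv hq
  obtain ⟨y', hy'0, hy'1, hy'⟩ := hinv hq'
  have hdpos : (0 : ℝ) < d := by
    have : 0 < d := by omega
    exact_mod_cast this
  have hreal : x * (1 - x')⁻¹ * (1 + y') + y < 2 / d := by
    rw [hx, hx', hy, hy', ← ENNReal.ofReal_one, ← ENNReal.ofReal_sub _ hx'0,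
      ← ENNReal.ofReal_inv_of_pos (by linarith), ← ENNReal.ofReal_mul hx0,
      ← ENNReal.ofReal_add zero_le_one hy'0,
      ← ENNReal.ofReal_mul (mul_nonneg hx0 (inv_nonneg.mpr (by linarith))),
      ← ENNReal.ofReal_add (mul_nonneg (mul_nonneg hx0 (inv_nonneg.mpr (by linarith)))
        (by linarith)) hy0, ← ENNReal.ofReal_ofNat 2, ← ENNReal.ofReal_natCast,
      ← ENNReal.ofReal_div_of_pos hdpos, ENNReal.ofReal_lt_ofReal_iff (by positivity)] at h
    exact h
  have hcont : ContinuousAt (fun ε : ℝ => (x + ε) * (1 - (x' + ε))⁻¹ * (1 + (y' + ε)) + (y + ε)) 0 := by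
    refine ContinuousAt.add (ContinuousAt.mul (ContinuousAt.mul (by fun_prop) ?_) (by fun_prop))
      (by fun_prop)
    refine ContinuousAt.inv₀ (by fun_prop) ?_
    simp
    linarith
  have e1 : ∀ᶠ ε in 𝓝 (0 : ℝ),
      (x + ε) * (1 - (x' + ε))⁻¹ * (1 + (y' + ε)) + (y + ε) < 2 / d :=
    hcont.eventually_lt_const (by simpa using hreal)
  have e2 : ∀ {r : ℝ}, r < 1 → ∀ᶠ ε in 𝓝 (0 : ℝ), r + ε < 1 := fun {r} hr =>
    (by fun_prop : ContinuousAt (fun ε : ℝ => r + ε) 0).eventually_lt_const (by simpa using hr)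
  have e3 : ∀ᶠ ε in 𝓝[>] (0 : ℝ), (x + ε) * (1 - (x' + ε))⁻¹ * (1 + (y' + ε)) + (y + ε) < 2 / d ∧
      x + ε < 1 ∧ x' + ε < 1 ∧ y + ε < 1 ∧ y' + ε < 1 ∧ 0 < ε := by
    have hs : ∀ᶠ ε in 𝓝[>] (0 : ℝ), 0 < ε := self_mem_nhdsWithin
    filter_upwards [e1.filter_mono nhdsWithin_le_nhds, (e2 hx1).filter_mono nhdsWithin_le_nhds,
      (e2 hx'1).filter_mono nhdsWithin_le_nhds, (e2 hy1).filter_mono nhdsWithin_le_nhds,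
      (e2 hy'1).filter_mono nhdsWithin_le_nhds, hs] with ε h1 h2 h3 h4 h5 h6
    exact ⟨h1, h2, h3, h4, h5, h6⟩
  obtain ⟨ε, h1, h2, h3, h4, h5, h6⟩ := e3.exists
  have hle : ∀ {r : ℝ≥0∞} {z : ℝ}, 0 ≤ z → r⁻¹ = ENNReal.ofReal z →
      ENNReal.ofReal (z + ε)⁻¹ ≤ r := by
    intro r z hz hr
    rw [← ENNReal.inv_le_inv, hr, ENNReal.ofReal_inv_of_pos (by linarith), inv_inv]
    exact ENNReal.ofReal_le_ofReal (by linarith)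
  refine ⟨(x + ε)⁻¹, (x' + ε)⁻¹, (y + ε)⁻¹, (y' + ε)⁻¹, (one_lt_inv₀ (by linarith)).mpr h2,
    (one_lt_inv₀ (by linarith)).mpr h3, (one_lt_inv₀ (by linarith)).mpr h4,
    (one_lt_inv₀ (by linarith)).mpr h5, hle hx0 hx, hle hx'0 hx', hle hy0 hy, hle hy'0 hy', ?_⟩
  simpa only [inv_inv] using h1

variable [MeasurableSpace (Env d)] {P : Measure (Env d)}

theorem ae_locallyIntegrable_conduct [IsProbabilityMeasure P] (hP : StationaryErgodicEnv P) :
    ∀ᵐ ω ∂P, ∀ (x : ZLat d) (z : Nbr d), LocallyIntegrable (fun t => conduct ω t x (x + z)) volume := by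
  have h1 : ∀ᵐ ω ∂P, ∀ (x : ZLat d) (z : Nbr d),
      LocallyIntegrable (fun s => wver hP z (shift s x ω)) volume := by
    have := ae_all_iff.mpr fun z : Nbr d =>
      hP.ae_locallyIntegrable (measurable_wver hP z) (integrable_wver hP z)
    filter_upwards [this] with ω h x z
    exact h z x
  filter_upwards [h1, wver_ae_ae_eq hP] with ω h2 h3 x z
  refine (locallyIntegrable_congr ?_).mp (h2 x z)
  filter_upwards [h3] with s hs
  exact hs x z

/-- The moment condition, with finite exponents. -/
theorem MomentCondition.exists_real (hd : 2 ≤ d) [IsProbabilityMeasure P]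
    (hP : StationaryErgodicEnv P) (hmom : MomentCondition P) :
    ∃ p p' q q' P₁ P₁' ρ s κ α β : ℝ, IsExponentSystem d p p' q q' P₁ P₁' ρ s κ α β ∧
      ∀ᵐ ω ∂P, ∃ Λ : ℝ≥0∞, Λ ≠ ∞ ∧ ∀ᶠ n : ℕ in atTop,
        cylNorm (ENNReal.ofReal p) (ENNReal.ofReal p') n (muW ω) ≤ Λ ∧
        cylNorm (ENNReal.ofReal q) (ENNReal.ofReal q') n (nuW ω) ≤ Λ := by
  obtain ⟨p, p', q, q', hp, hp', hq, hq', hlt, hae⟩ := hmom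
  obtain ⟨a, a', b, b', ha, ha', hb, hb', h1, h2, h3, h4, hlt'⟩ :=
    exists_real_exponents hd hp hp' hq hq' hlt
  obtain ⟨P₁, P₁', ρ, s, κ, α, β, hX⟩ := exists_exponentSystem hd ha ha' hb hb' hlt'
  refine ⟨a, a', b, b', P₁, P₁', ρ, s, κ, α, β, hX, ?_⟩
  filter_upwards [hae, ae_locallyIntegrable_conduct hP] with ω hω hloc
  have hm : ∀ (x : ZLat d) (z : Nbr d), AEMeasurable (fun t => conduct ω t x (x + z)) volume :=
    fun x z => (hloc x z).aestronglyMeasurable.aemeasurable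
  obtain ⟨Λ, hΛ1, hΛ⟩ := exists_between (max_lt hω.1 hω.2)
  refine ⟨Λ, hΛ.ne, ?_⟩
  have e1 := eventually_lt_of_limsup_lt ((le_max_left _ _).trans_lt hΛ1)
  have e2 := eventually_lt_of_limsup_lt ((le_max_right _ _).trans_lt hΛ1)
  filter_upwards [e1, e2, eventually_gt_atTop 0] with n h5 h6 hn
  exact ⟨(cylNorm_mono (by linarith) h1 h2 hn (aemeasurable_muW hm)).trans h5.le,
    (cylNorm_mono (by linarith) h3 h4 hn (aemeasurable_nuW hm)).trans h6.le⟩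

end Exponents

/-! ### The maximal inequality -/

section Vitali

variable {d : ℕ}

/-- The discrete cylinder `[0, n²) × B(n)`. -/
def boxZero (d n : ℕ) : Finset (ℤ × ZLat d) := Finset.Ico 0 ((n : ℤ) ^ 2) ×ˢ fball d n

/-- The discrete cylinder translated by `p`. -/
def box (p : ℤ × ZLat d) (n : ℕ) : Finset (ℤ × ZLat d) := (boxZero d n).map (addRightEmbedding p)

theorem card_boxZero (n : ℕ) : (boxZero d n).card = n ^ 2 * (fball d n).card := by
  rw [boxZero, Finset.card_product, Int.card_Ico]
  rw [sub_zero, ← Nat.cast_pow, Int.toNat_natCast]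

theorem boxZero_mono {m n : ℕ} (h : m ≤ n) : boxZero d m ⊆ boxZero d n := by
  refine Finset.product_subset_product (Finset.Ico_subset_Ico le_rfl ?_) (fball_mono h)
  exact_mod_cast Nat.pow_le_pow_left h 2

/-- Vitali covering: among the cylinders attached to the bad points, a disjoint subfamily carries a
fixed proportion of all bad points, and on each of its members the sum of a exceeds λ times the
volume. -/
theorem card_le_of_vitali (hd : d ≠ 0) (a : ℤ × ZLat d → ℝ≥0∞) (lam : ℝ≥0∞)
    (G : Finset (ℤ × ZLat d)) (n : ℤ × ZLat d → ℕ) (W : Finset (ℤ × ZLat d))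
    (hn : ∀ p ∈ G, 1 ≤ n p) (hW : ∀ p ∈ G, box p (n p) ⊆ W)
    (h : ∀ p ∈ G, lam * (boxZero d (n p)).card ≤ ∑ q ∈ box p (n p), a q) :
    lam * G.card ≤ (5 * (6 * d + 1) ^ d : ℕ) * ∑ q ∈ W, a q := by
  classical
  obtain ⟨u, huG, hdisj, hcov⟩ := Vitali.exists_disjoint_subfamily_covering_enlargement
    (fun p : ℤ × ZLat d => (box p (n p) : Set (ℤ × ZLat d))) (G : Set (ℤ × ZLat d))
    (fun p => (n p : ℝ)) 2 (by norm_num) (fun _ _ => by positivity) (∑ p ∈ G, (n p : ℝ))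
    (fun p hp => Finset.single_le_sum (f := fun p => (n p : ℝ)) (fun _ _ => by positivity) hp)
    (fun p hp => by
      refine ⟨0 + p, ?_⟩
      rw [Finset.mem_coe, box, Finset.mem_map]
      refine ⟨0, Finset.mem_product.mpr ⟨?_, ?_⟩, rfl⟩
      · have := hn p hp
        simp only [Prod.fst_zero, Finset.mem_Ico, le_refl, true_and]
        positivity
      · simp [mem_fball, l1norm_zero])
  have hufin : u.Finite := G.finite_toSet.subset huG
  lift u to Finset (ℤ × ZLat d) using hufin
  have huG' : u ⊆ G := by exact_mod_cast huG
  -- If the cylinder at p meets the cylinder at b and n(p) ≤ 2n(b), then p - b has time coordinate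
  -- in [-4n(b)², n(b)²) and spatial norm at most 3n(b). The cylinders are one-sided in time, whence
  -- the asymmetry and the factor 5.
  set enl : ℤ × ZLat d → Finset (ℤ × ZLat d) := fun b =>
    (Finset.Ico (-(4 * (n b : ℤ) ^ 2)) ((n b : ℤ) ^ 2) ×ˢ fball d (3 * n b)).map
      (addRightEmbedding b) with henl
  have hsub : G ⊆ u.biUnion enl := by
    intro p hp
    obtain ⟨b, hb, ⟨q, hq1, hq2⟩, hle⟩ := hcov p hp
    have hle' : n p ≤ 2 * n b := by exact_mod_cast hle
    rw [Finset.mem_coe, box, Finset.mem_map] at hq1 hq2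
    obtain ⟨r, hr, hrq⟩ := hq1
    obtain ⟨r', hr', hrq'⟩ := hq2
    rw [boxZero, Finset.mem_product, Finset.mem_Ico, mem_fball] at hr hr'
    rw [Finset.mem_biUnion]
    refine ⟨b, hb, ?_⟩
    rw [henl, Finset.mem_map]
    refine ⟨r' - r, ?_, ?_⟩
    · rw [Finset.mem_product, Finset.mem_Ico, mem_fball]
      have hsq : (n p : ℤ) ^ 2 ≤ 4 * (n b : ℤ) ^ 2 := by
        have : (n p : ℤ) ≤ 2 * n b := by exact_mod_cast hle'
        nlinarith
      have hl := l1norm_add_le r'.2 (-r.2)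
      rw [l1norm_neg, ← sub_eq_add_neg] at hl
      simp only [Prod.fst_sub, Prod.snd_sub]
      refine ⟨⟨?_, ?_⟩, ?_⟩
      · linarith [hr.1.2, hr'.1.1]
      · linarith [hr.1.1, hr'.1.2]
      · linarith [hr.2, hr'.2]
    · have e : r' + b = r + p := by
        have h1 : r' + b = q := hrq'
        have h2 : r + p = q := hrq
        rw [h1, h2]
      change r' - r + b = p
      rw [sub_add_eq_add_sub, e]
      abel
  have hcard : ∀ b, (enl b).card ≤ 5 * (6 * d + 1) ^ d * (boxZero d (n b)).card := by
    intro b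
    rw [henl]
    simp only [Finset.card_map, Finset.card_product, Int.card_Ico, card_boxZero]
    have h1 := fball_card_mul_le hd 3 (n b)
    have h2 : ((n b : ℤ) ^ 2 - -(4 * (n b : ℤ) ^ 2)).toNat = 5 * n b ^ 2 := by
      have : (n b : ℤ) ^ 2 - -(4 * (n b : ℤ) ^ 2) = ((5 * n b ^ 2 : ℕ) : ℤ) := by
        push_cast
        ring
      rw [this, Int.toNat_natCast]
    rw [h2]
    calc 5 * n b ^ 2 * (fball d (3 * n b)).card
        ≤ 5 * n b ^ 2 * ((2 * 3 * d + 1) ^ d * (fball d (n b)).card) := Nat.mul_le_mul_left _ h1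
      _ = _ := by ring
  have hG : G.card ≤ ∑ b ∈ u, 5 * (6 * d + 1) ^ d * (boxZero d (n b)).card :=
    (Finset.card_le_card hsub).trans (Finset.card_biUnion_le.trans
      (Finset.sum_le_sum fun b _ => hcard b))
  have hdisj' : ∀ x ∈ u, ∀ y ∈ u, x ≠ y → Disjoint (box x (n x)) (box y (n y)) := by
    intro x hx y hy hxy
    have := hdisj hx hy hxy
    simpa using this
  calc lam * (G.card : ℝ≥0∞)
      ≤ lam * ((∑ b ∈ u, 5 * (6 * d + 1) ^ d * (boxZero d (n b)).card : ℕ) : ℝ≥0∞) := by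
        gcongr
    _ = (5 * (6 * d + 1) ^ d : ℕ) * ∑ b ∈ u, lam * ((boxZero d (n b)).card : ℝ≥0∞) := by
        rw [Nat.cast_sum, Finset.mul_sum, Finset.mul_sum]
        refine Finset.sum_congr rfl fun b _ => ?_
        rw [Nat.cast_mul]
        ring
    _ ≤ (5 * (6 * d + 1) ^ d : ℕ) * ∑ b ∈ u, ∑ q ∈ box b (n b), a q := by
        gcongr with b hb
        exact h b (huG' hb)
    _ = (5 * (6 * d + 1) ^ d : ℕ) * ∑ q ∈ u.biUnion (fun b => box b (n b)), a q := by
        rw [Finset.sum_biUnion hdisj']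
    _ ≤ _ := by
        gcongr
        exact Finset.biUnion_subset.mpr fun b hb => hW b (huG' hb)

end Vitali

/-! ### Transference of the covering estimate to the environment. -/

section Maximal

variable {d : ℕ}

theorem lintegral_Icc_le_sum (G : ℝ → ℝ≥0∞) (m : ℕ) :
    ∫⁻ s in Set.Icc (0 : ℝ) m, G s ≤ ∑ i ∈ Finset.range m, ∫⁻ s in Set.Icc (0 : ℝ) 1, G (s + i) := by
  induction m with
  | zero => simp
  | succ m ih =>
    rw [Finset.sum_range_succ]
    have h1 : Set.Icc (0 : ℝ) ((m + 1 : ℕ) : ℝ) ⊆ Set.Icc 0 (m : ℝ) ∪ Set.Icc (m : ℝ) (m + 1) := by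
      intro x hx
      push_cast at hx
      rcases le_total x m with h | h
      · exact Or.inl ⟨hx.1, h⟩
      · exact Or.inr ⟨h, hx.2⟩
    have h2 : ∫⁻ s in Set.Icc (m : ℝ) (m + 1), G s = ∫⁻ s in Set.Icc (0 : ℝ) 1, G (s + m) := by
      rw [← (measurePreserving_add_right volume (m : ℝ)).setLIntegral_comp_preimage_emb
        (measurableEmbedding_addRight (m : ℝ)) G (Set.Icc (m : ℝ) (m + 1))]
      simp
    refine (lintegral_mono_set h1).trans ((lintegral_union_le _ _ _).trans ?_)
    rw [h2]
    exact add_le_add ih le_rfl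

variable [MeasurableSpace (Env d)] {P : Measure (Env d)} [IsProbabilityMeasure P]

/-- The maximal function over the cylinders `Q(n)`, `n ≥ 1`. -/
def maxFun (F : Env d → ℝ≥0∞) (ω : Env d) : ℝ≥0∞ :=
  ⨆ n : ℕ, ⨆ _ : 1 ≤ n, ∫⁻ t, ∫⁻ x, F (shift t x ω) ∂(unifB d n) ∂(unifT n)

theorem le_maxFun (F : Env d → ℝ≥0∞) (ω : Env d) {n : ℕ} (hn : 1 ≤ n) :
    ∫⁻ t, ∫⁻ x, F (shift t x ω) ∂(unifB d n) ∂(unifT n) ≤ maxFun F ω :=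
  le_iSup₂ (f := fun (n : ℕ) (_ : 1 ≤ n) =>
    ∫⁻ t, ∫⁻ x, F (shift t x ω) ∂(unifB d n) ∂(unifT n)) n hn

/-- Transference: the bad event is averaged over base points p in the cylinder of size N. For each ω
the covering estimate applies to the orbit, and all cylinders involved stay in the one of size 2N,
because N² + N² ≤ (2N)². Stationarity turns both sums into means, and doubling compares the volumes.
-/
theorem measure_discrete_maximal_le (hd : d ≠ 0) (hP : StationaryErgodicEnv P)
    {F : Env d → ℝ≥0∞} (hF : Measurable F) (lam : ℝ≥0∞) {N : ℕ} (hN : 1 ≤ N) :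
    lam * P {ω | ∃ n, 1 ≤ n ∧ n ≤ N ∧
        lam * (boxZero d n).card < ∑ q ∈ boxZero d n, F (shift q.1 q.2 ω)}
      ≤ ((5 * (6 * d + 1) ^ d) * (4 * (4 * d + 1) ^ d) : ℕ) * ∫⁻ ω, F ω ∂P := by
  classical
  set S : ℕ → Env d → ℝ≥0∞ := fun n ω => ∑ q ∈ boxZero d n, F (shift q.1 q.2 ω) with hS
  have hSm : ∀ n, Measurable (S n) := fun n =>
    Finset.measurable_fun_sum _ fun q _ => hF.comp (hP.measurable_shift' _ _)
  set bad : Set (Env d) := {ω | ∃ n, 1 ≤ n ∧ n ≤ N ∧ lam * (boxZero d n).card < S n ω} with hbad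
  have hbm : MeasurableSet bad := by
    have : bad = ⋃ n ∈ Finset.Icc 1 N, {ω | lam * (boxZero d n).card < S n ω} := by
      ext ω
      simp only [hbad, Set.mem_ofPred_eq, Set.mem_iUnion, Finset.mem_Icc]
      constructor
      · rintro ⟨n, h1, h2, h3⟩
        exact ⟨n, ⟨h1, h2⟩, h3⟩
      · rintro ⟨n, ⟨h1, h2⟩, h3⟩
        exact ⟨n, h1, h2, h3⟩
    rw [this]
    exact Finset.measurableSet_biUnion _ fun n _ => measurableSet_lt measurable_const (hSm n)
  have key : ∀ ω, lam * ∑ p ∈ boxZero d N, bad.indicator 1 (shift p.1 p.2 ω)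
      ≤ (5 * (6 * d + 1) ^ d : ℕ) * ∑ q ∈ boxZero d (2 * N), F (shift q.1 q.2 ω) := by
    intro ω
    set G := (boxZero d N).filter fun p => shift (p.1 : ℝ) p.2 ω ∈ bad with hG
    have hex : ∀ p : ℤ × ZLat d, ∃ n : ℕ, p ∈ G →
        1 ≤ n ∧ n ≤ N ∧ lam * (boxZero d n).card < S n (shift p.1 p.2 ω) := by
      intro p
      by_cases hp : p ∈ G
      · obtain ⟨n, hn⟩ := (Finset.mem_filter.mp hp).2
        exact ⟨n, fun _ => hn⟩
      · exact ⟨0, fun h => absurd h hp⟩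
    choose n hn using hex
    have hcard : ∑ p ∈ boxZero d N, bad.indicator (1 : Env d → ℝ≥0∞) (shift p.1 p.2 ω) = G.card := by
      rw [hG, Finset.card_filter, Nat.cast_sum]
      refine Finset.sum_congr rfl fun p _ => ?_
      by_cases h : shift (p.1 : ℝ) p.2 ω ∈ bad
      · simp [h]
      · simp [h]
    rw [hcard]
    refine card_le_of_vitali hd (fun q => F (shift q.1 q.2 ω)) lam G n _ (fun p hp => (hn p hp).1)
      ?_ ?_
    · intro p hp q hq
      rw [box, Finset.mem_map] at hq
      obtain ⟨r, hr, rfl⟩ := hq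
      have hr' := boxZero_mono (hn p hp).2.1 hr
      have hp' := (Finset.mem_filter.mp hp).1
      rw [boxZero, Finset.mem_product, Finset.mem_Ico, mem_fball] at hr' hp' ⊢
      change (0 ≤ r.1 + p.1 ∧ r.1 + p.1 < _) ∧ l1norm (r.2 + p.2) ≤ _
      have hl := l1norm_add_le r.2 p.2
      have hsq : (N : ℤ) ^ 2 + (N : ℤ) ^ 2 ≤ ((2 * N : ℕ) : ℤ) ^ 2 := by
        push_cast
        nlinarith
      refine ⟨⟨?_, ?_⟩, ?_⟩
      · linarith [hr'.1.1, hp'.1.1]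
      · linarith [hr'.1.2, hp'.1.2]
      · linarith [hr'.2, hp'.2]
    · intro p hp
      refine (hn p hp).2.2.le.trans (le_of_eq ?_)
      rw [box, Finset.sum_map]
      refine Finset.sum_congr rfl fun q _ => ?_
      rw [shift_shift]
      simp
  have hint := lintegral_mono (μ := P) key
  have hindm : Measurable (bad.indicator (1 : Env d → ℝ≥0∞)) := measurable_one.indicator hbm
  have hmI : ∀ q : ℤ × ZLat d, Measurable fun ω => bad.indicator (1 : Env d → ℝ≥0∞)
      (shift q.1 q.2 ω) := fun q => hindm.comp (hP.measurable_shift' _ _)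
  have hmF : ∀ q : ℤ × ZLat d, Measurable fun ω => F (shift q.1 q.2 ω) := fun q =>
    hF.comp (hP.measurable_shift' _ _)
  rw [lintegral_const_mul _ (Finset.measurable_fun_sum _ fun q _ => hmI q),
    lintegral_const_mul _ (hSm (2 * N)), lintegral_finsetSum _ fun q _ => hmI q,
    lintegral_finsetSum _ fun q _ => hmF q] at hint
  have e1 : ∀ q : ℤ × ZLat d, ∫⁻ ω, bad.indicator (1 : Env d → ℝ≥0∞) (shift q.1 q.2 ω) ∂P = P bad := by
    intro q
    rw [hP.lintegral_shift hindm, lintegral_indicator_one hbm]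
  have e2 : ∀ q : ℤ × ZLat d, ∫⁻ ω, F (shift q.1 q.2 ω) ∂P = ∫⁻ ω, F ω ∂P := fun q =>
    hP.lintegral_shift hF _ _
  simp_rw [e1, e2, Finset.sum_const, nsmul_eq_mul] at hint
  have hc : ((boxZero d (2 * N)).card : ℝ≥0∞)
      ≤ (4 * (4 * d + 1) ^ d : ℕ) * ((boxZero d N).card : ℝ≥0∞) := by
    have : (boxZero d (2 * N)).card ≤ 4 * (4 * d + 1) ^ d * (boxZero d N).card := by
      rw [card_boxZero, card_boxZero]
      calc (2 * N) ^ 2 * (fball d (2 * N)).card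
          ≤ (2 * N) ^ 2 * ((2 * 2 * d + 1) ^ d * (fball d N).card) :=
            Nat.mul_le_mul_left _ (fball_card_mul_le hd 2 N)
        _ = _ := by ring
    exact_mod_cast this
  have hpos : ((boxZero d N).card : ℝ≥0∞) ≠ 0 := by
    rw [card_boxZero]
    have h1 := fball_card_pos (d := d) N
    have : N ^ 2 * (fball d N).card ≠ 0 := by positivity
    exact_mod_cast this
  have htop : ((boxZero d N).card : ℝ≥0∞) ≠ ∞ := ENNReal.natCast_ne_top _
  have h3 : ((boxZero d N).card : ℝ≥0∞) * (lam * P bad) ≤ ((boxZero d N).card : ℝ≥0∞) *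
      (((5 * (6 * d + 1) ^ d) * (4 * (4 * d + 1) ^ d) : ℕ) * ∫⁻ ω, F ω ∂P) := by
    calc _ = lam * (((boxZero d N).card : ℝ≥0∞) * P bad) := by ring
      _ ≤ _ := hint
      _ ≤ (5 * (6 * d + 1) ^ d : ℕ) * (((4 * (4 * d + 1) ^ d : ℕ) *
            ((boxZero d N).card : ℝ≥0∞)) * ∫⁻ ω, F ω ∂P) := by gcongr
      _ = _ := by
          rw [Nat.cast_mul (5 * (6 * d + 1) ^ d)]
          ring
  exact (ENNReal.mul_le_mul_iff_right hpos htop).mp h3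

/-- Weak type `(1,1)` maximal inequality. -/
theorem measure_maxFun_le (hd : d ≠ 0) (hP : StationaryErgodicEnv P) {F : Env d → ℝ≥0∞}
    (hF : Measurable F) (lam : ℝ≥0∞) :
    lam * P {ω | lam < maxFun F ω}
      ≤ ((5 * (6 * d + 1) ^ d) * (4 * (4 * d + 1) ^ d) : ℕ) * ∫⁻ ω, F ω ∂P := by
  -- Averaging over unit time intervals reduces continuous time to integer times without changing
  -- the mean.
  set F₁ : Env d → ℝ≥0∞ := fun ω => ∫⁻ s in Set.Icc (0 : ℝ) 1, F (shift s 0 ω) with hF₁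
  have hF₁m : Measurable F₁ :=
    Measurable.lintegral_prod_right' (f := fun p : Env d × ℝ => F (shift p.2 0 p.1))
      (hF.comp (hP.measurable_time 0))
  have hF₁i : ∫⁻ ω, F₁ ω ∂P = ∫⁻ ω, F ω ∂P := by
    rw [hF₁, hP.lintegral_lintegral_shift hF 0 (volume.restrict (Set.Icc (0 : ℝ) 1))]
    simp
  set A : ℕ → Set (Env d) := fun N => {ω | ∃ n, 1 ≤ n ∧ n ≤ N ∧
        lam * (boxZero d n).card < ∑ q ∈ boxZero d n, F₁ (shift q.1 q.2 ω)} with hA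
  have hmono : Monotone A := by
    rintro N M hNM ω ⟨n, h1, h2, h3⟩
    exact ⟨n, h1, h2.trans hNM, h3⟩
  have hsub : {ω | lam < maxFun F ω} ⊆ ⋃ N, A N := by
    intro ω hω
    rw [Set.mem_ofPred_eq, maxFun, lt_iSup_iff] at hω
    obtain ⟨n, hn⟩ := hω
    rw [lt_iSup_iff] at hn
    obtain ⟨h1, hlt⟩ := hn
    refine Set.mem_iUnion.mpr ⟨n, n, h1, le_rfl, ?_⟩
    have hn0 : n ≠ 0 := by omega
    set c : ℝ≥0∞ := ((fball d n).card : ℝ≥0∞) with hc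
    have hc0 : c ≠ 0 := by
      rw [hc]
      exact_mod_cast (fball_card_pos (d := d) n).ne'
    have hct : c ≠ ∞ := ENNReal.natCast_ne_top _
    have hn2 : ENNReal.ofReal ((n : ℝ) ^ 2) = ((n ^ 2 : ℕ) : ℝ≥0∞) := by
      rw [← ENNReal.ofReal_natCast]
      push_cast
      rfl
    set m : ℝ≥0∞ := ((n ^ 2 : ℕ) : ℝ≥0∞) with hm
    have hm0 : m ≠ 0 := by
      have : n ^ 2 ≠ 0 := by positivity
      rw [hm]
      exact_mod_cast this
    have hmt : m ≠ ∞ := ENNReal.natCast_ne_top _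
    have hle : ∫⁻ t, ∫⁻ x, F (shift t x ω) ∂(unifB d n) ∂(unifT n)
        ≤ m⁻¹ * (c⁻¹ * ∑ q ∈ boxZero d n, F₁ (shift q.1 q.2 ω)) := by
      rw [lintegral_unifT, hn2]
      gcongr
      simp_rw [lintegral_unifB]
      rw [lintegral_const_mul' _ _ (ENNReal.inv_ne_top.mpr hc0)]
      gcongr
      have hmo : ∀ x, Measurable fun s => F (shift s x ω) := fun x =>
        hF.comp (hP.measurable_orbit x ω)
      rw [lintegral_finsetSum _ fun x _ => hmo x, boxZero,
        Finset.sum_product_right]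
      refine Finset.sum_le_sum fun x _ => ?_
      have e : (n : ℝ) ^ 2 = ((n ^ 2 : ℕ) : ℝ) := by push_cast; rfl
      rw [e]
      refine (lintegral_Icc_le_sum _ _).trans (le_of_eq ?_)
      have e2 : Finset.Ico (0 : ℤ) ((n : ℤ) ^ 2)
          = (Finset.range (n ^ 2)).map Nat.castEmbedding := by
        ext j
        simp only [Finset.mem_Ico, Finset.mem_map, Finset.mem_range, Nat.castEmbedding_apply]
        constructor
        · rintro ⟨h1, h2⟩
          lift j to ℕ using h1
          exact ⟨j, by exact_mod_cast h2, rfl⟩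
        · rintro ⟨i, hi, rfl⟩
          exact ⟨by positivity, by exact_mod_cast hi⟩
      rw [e2, Finset.sum_map]
      refine Finset.sum_congr rfl fun i _ => ?_
      simp only [hF₁, Nat.castEmbedding_apply, Int.cast_natCast]
      refine lintegral_congr fun s => ?_
      rw [shift_shift, zero_add]
    have h2 := hlt.trans_le hle
    rw [← mul_assoc, ← ENNReal.mul_inv (Or.inl hm0) (Or.inl hmt), ← ENNReal.div_eq_inv_mul] at h2
    rw [card_boxZero, Nat.cast_mul]
    exact ENNReal.mul_lt_of_lt_div h2
  have hlim : P (⋃ N, A N) = ⨆ N, P (A N) := hmono.measure_iUnion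
  refine (mul_le_mul_right (measure_mono hsub) lam).trans ?_
  rw [hlim, ENNReal.mul_iSup]
  refine iSup_le fun N => ?_
  rcases Nat.eq_zero_or_pos N with h0 | hN
  · have : A N = ∅ := by
      ext ω
      simp only [hA, Set.mem_ofPred_eq, Set.mem_empty_iff_false, iff_false]
      rintro ⟨n, h1, h2, _⟩
      omega
    rw [this, measure_empty, mul_zero]
    exact zero_le
  · rw [← hF₁i]
    exact measure_discrete_maximal_le hd hP hF₁m lam hN

theorem ae_maxFun_lt_top (hd : d ≠ 0) (hP : StationaryErgodicEnv P) {F : Env d → ℝ≥0∞}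
    (hF : Measurable F) (hFi : ∫⁻ ω, F ω ∂P ≠ ∞) : ∀ᵐ ω ∂P, maxFun F ω < ∞ := by
  set K : ℝ≥0∞ := ((5 * (6 * d + 1) ^ d) * (4 * (4 * d + 1) ^ d) : ℕ) * ∫⁻ ω, F ω ∂P with hK
  have hKt : K ≠ ∞ := ENNReal.mul_ne_top (ENNReal.natCast_ne_top _) hFi
  rw [ae_iff]
  have hle : ∀ n : ℕ, P {ω | ¬ maxFun F ω < ∞} ≤ K / (n + 1 : ℕ) := by
    intro n
    have h1 := measure_maxFun_le hd hP hF ((n + 1 : ℕ) : ℝ≥0∞)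
    rw [ENNReal.le_div_iff_mul_le (Or.inl (by simp)) (Or.inl (ENNReal.natCast_ne_top _)),
      mul_comm]
    refine le_trans (mul_le_mul_right (measure_mono fun ω hω => ?_) _) h1
    have : maxFun F ω = ∞ := not_lt_top_iff.mp hω
    rw [Set.mem_ofPred_eq, this]
    exact ENNReal.natCast_lt_top _
  have hlim : Tendsto (fun n : ℕ => K / (n + 1 : ℕ)) atTop (𝓝 0) := by
    have := ENNReal.Tendsto.const_div (a := K) ENNReal.tendsto_nat_nhds_top (Or.inr hKt)
    rw [ENNReal.div_top] at this
    exact this.comp (tendsto_add_atTop_nat 1)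
  exact le_antisymm (ge_of_tendsto' hlim hle) zero_le

/-- Means of order 4^{-k} against thresholds 2^{-k} leave probabilities of order 2^{-k}, and
Borel–Cantelli applies. One statement thus controls the k-th error at all scales. -/
theorem ae_eventually_maxFun_le (hd : d ≠ 0) (hP : StationaryErgodicEnv P)
    {F : ℕ → Env d → ℝ≥0∞} (hF : ∀ k, Measurable (F k)) {C : ℝ≥0∞} (hC : C ≠ ∞)
    (hFi : ∀ k, ∫⁻ ω, F k ω ∂P ≤ C * (4 : ℝ≥0∞)⁻¹ ^ k) :
    ∀ᵐ ω ∂P, ∀ᶠ k in atTop, maxFun (F k) ω ≤ (2 : ℝ≥0∞)⁻¹ ^ k := by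
  set K : ℝ≥0∞ := ((5 * (6 * d + 1) ^ d) * (4 * (4 * d + 1) ^ d) : ℕ) * C with hK
  have hKt : K ≠ ∞ := ENNReal.mul_ne_top (ENNReal.natCast_ne_top _) hC
  have h2 : ∀ k : ℕ, ((2 : ℝ≥0∞)⁻¹ ^ k) ≠ 0 := fun k => pow_ne_zero _ (by simp)
  have h2t : ∀ k : ℕ, ((2 : ℝ≥0∞)⁻¹ ^ k) ≠ ∞ := fun k => ENNReal.pow_ne_top (by simp)
  have hle : ∀ k, P {ω | (2 : ℝ≥0∞)⁻¹ ^ k < maxFun (F k) ω} ≤ K * (2 : ℝ≥0∞)⁻¹ ^ k := by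
    intro k
    have h1 := measure_maxFun_le hd hP (hF k) ((2 : ℝ≥0∞)⁻¹ ^ k)
    have h3 : (2 : ℝ≥0∞)⁻¹ ^ k * P {ω | (2 : ℝ≥0∞)⁻¹ ^ k < maxFun (F k) ω}
        ≤ (2 : ℝ≥0∞)⁻¹ ^ k * (K * (2 : ℝ≥0∞)⁻¹ ^ k) := by
      refine h1.trans ((mul_le_mul_right (hFi k) _).trans (le_of_eq ?_))
      have e : (4 : ℝ≥0∞)⁻¹ = 2⁻¹ * 2⁻¹ := by
        rw [← ENNReal.mul_inv (by simp) (by simp)]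
        norm_num
      rw [e, mul_pow, hK]
      ring
    exact (ENNReal.mul_le_mul_iff_right (h2 k) (h2t k)).mp h3
  have hsum : ∑' k, P {ω | (2 : ℝ≥0∞)⁻¹ ^ k < maxFun (F k) ω} ≠ ∞ := by
    refine ne_top_of_le_ne_top ?_ (ENNReal.tsum_le_tsum hle)
    rw [ENNReal.tsum_mul_left, ENNReal.tsum_geometric]
    refine ENNReal.mul_ne_top hKt ?_
    simp
  have := ae_eventually_notMem hsum
  filter_upwards [this] with ω hω
  filter_upwards [hω] with k hk
  exact not_lt.mp hk

end Maximal

/-! ### Approximation by spatial coboundaries -/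

section Coboundary

variable {d : ℕ} [MeasurableSpace (Env d)] {P : Measure (Env d)} [IsProbabilityMeasure P]

theorem exists_memLp_two_eLpNorm_sub_le {f : Env d → ℝ} (hf : Integrable f P) {δ : ℝ≥0∞}
    (hδ : δ ≠ 0) : ∃ g : Env d → ℝ, MemLp g 2 P ∧ eLpNorm (f - g) 1 P ≤ δ := by
  obtain ⟨g, hg, hg'⟩ := (memLp_one_iff_integrable.mpr hf).exists_simpleFunc_eLpNorm_sub_lt
    ENNReal.one_ne_top hδ
  exact ⟨g, SimpleFunc.memLp_of_isFiniteMeasure g 2 P, hg.le⟩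

/-- The unitary operator induced by the spatial shift. -/
def koopman (hP : StationaryErgodicEnv P) (z : Nbr d) : Lp ℝ 2 P →ₗᵢ[ℝ] Lp ℝ 2 P :=
  Lp.compMeasurePreservingₗᵢ ℝ (shift 0 (z : ZLat d)) (hP.stationary 0 z)

theorem koopman_coeFn (hP : StationaryErgodicEnv P) (z : Nbr d) (g : Lp ℝ 2 P) :
    koopman hP z g =ᵐ[P] fun ω => g (shift 0 (z : ZLat d) ω) :=
  Lp.coeFn_compMeasurePreserving g (hP.stationary 0 z)

/-- The divergence operator `(g_z) ↦ ∑_z (g_z ∘ τ_z - g_z)`. -/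
def coboundary (hP : StationaryErgodicEnv P) : (Nbr d → Lp ℝ 2 P) →ₗ[ℝ] Lp ℝ 2 P :=
  ∑ z : Nbr d, ((koopman hP z).toLinearMap - LinearMap.id) ∘ₗ LinearMap.proj z

theorem coboundary_apply (hP : StationaryErgodicEnv P) (g : Nbr d → Lp ℝ 2 P) :
    coboundary hP g = ∑ z : Nbr d, (koopman hP z (g z) - g z) := by
  simp [coboundary, LinearMap.sum_apply]

/-- Orthogonality to the coboundary of h gives ⟨Uh, h⟩ = ‖h‖², and U is isometric, so ‖Uh - h‖² = 0.
-/
theorem koopman_eq_of_mem_orthogonal (hP : StationaryErgodicEnv P) {h : Lp ℝ 2 P}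
    (hh : h ∈ (LinearMap.range (coboundary hP)).topologicalClosureᗮ) (z : Nbr d) :
    koopman hP z h = h := by
  classical
  have h1 : inner ℝ (koopman hP z h - h) h = 0 := by
    refine (Submodule.mem_orthogonal _ _).mp hh _ (Submodule.le_topologicalClosure _ ?_)
    refine ⟨Pi.single z h, ?_⟩
    rw [coboundary_apply, Finset.sum_eq_single z]
    · simp
    · intro w _ hw
      simp [Pi.single_eq_of_ne hw]
    · simp
  rw [← sub_eq_zero, ← norm_eq_zero, ← sq_eq_zero_iff]
  have h2 := norm_sub_sq_real (koopman hP z h) h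
  rw [LinearIsometry.norm_map] at h2
  rw [inner_sub_left, real_inner_self_eq_norm_sq] at h1
  rw [h2]
  linarith

/-- Von Neumann's decomposition for the spatial shifts, after approximating f by a square integrable
function: the projection onto the closed range is nearly a coboundary, and its complement is
spatially invariant. The invariant part may still depend on time, but it is constant along each
spatial orbit. -/
theorem exists_invariant_add_coboundary (hP : StationaryErgodicEnv P) {f : Env d → ℝ}
    (hf : Integrable f P) {δ : ℝ≥0∞} (hδ : δ ≠ 0) :
    ∃ (h : Env d → ℝ) (g : Nbr d → Env d → ℝ), Measurable h ∧ (∀ z, Measurable (g z)) ∧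
      (∀ z, Integrable (g z) P) ∧ (∀ᵐ ω ∂P, ∀ z : Nbr d, h (shift 0 z ω) = h ω) ∧
      ∫⁻ ω, ‖f ω - h ω - ∑ z : Nbr d, (g z (shift 0 z ω) - g z ω)‖ₑ ∂P ≤ δ := by
  have hδ2 : δ / 2 ≠ 0 := by simpa using hδ
  obtain ⟨f', hf', hff⟩ := exists_memLp_two_eLpNorm_sub_le hf hδ2
  set K := (LinearMap.range (coboundary hP)).topologicalClosure with hK
  have : CompleteSpace K := Submodule.topologicalClosure.completeSpace _
  obtain ⟨y, hy, h, hh, hyh⟩ := K.exists_add_mem_mem_orthogonal (hf'.toLp f')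
  have hinv := fun z => koopman_eq_of_mem_orthogonal hP hh z
  obtain ⟨_, ⟨g, rfl⟩, hg⟩ := EMetric.mem_closure_iff.mp (show y ∈ closure
    (LinearMap.range (coboundary hP) : Set (Lp ℝ 2 P)) from hy) (δ / 2)
    (pos_iff_ne_zero.mpr hδ2)
  refine ⟨h, fun z => g z, (Lp.stronglyMeasurable h).measurable,
    fun z => (Lp.stronglyMeasurable (g z)).measurable,
    fun z => (Lp.memLp (g z)).integrable (by norm_num), ?_, ?_⟩
  · refine ae_all_iff.mpr fun z => ?_
    have h1 := koopman_coeFn hP z h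
    rw [hinv z] at h1
    filter_upwards [h1] with ω h1
    exact h1.symm
  · have hcob : coboundary hP g =ᵐ[P]
        fun ω => ∑ z : Nbr d, (g z (shift 0 (z : ZLat d) ω) - g z ω) := by
      rw [coboundary_apply]
      have h1 : ∀ᵐ ω ∂P, ∀ z : Nbr d, (koopman hP z (g z) - g z : Lp ℝ 2 P) ω
          = g z (shift 0 (z : ZLat d) ω) - g z ω := by
        refine ae_all_iff.mpr fun z => ?_
        filter_upwards [Lp.coeFn_sub (koopman hP z (g z)) (g z), koopman_coeFn hP z (g z)]
          with ω h1 h2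
        rw [h1, Pi.sub_apply, h2]
      filter_upwards [Lp.coeFn_finsetSum Finset.univ (fun z => koopman hP z (g z) - g z), h1]
        with ω h2 h3
      rw [h2, Finset.sum_apply]
      exact Finset.sum_congr rfl fun z _ => h3 z
    have hdec : f' =ᵐ[P] fun ω => y ω + h ω := by
      filter_upwards [hf'.coeFn_toLp, Lp.coeFn_add y h] with ω h1 h2
      rw [← h1, hyh, h2, Pi.add_apply]
    have hle : ∫⁻ ω, ‖f ω - h ω - ∑ z : Nbr d, (g z (shift 0 (z : ZLat d) ω) - g z ω)‖ₑ ∂P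
        ≤ ∫⁻ ω, (‖(f - f') ω‖ₑ + ‖(y - coboundary hP g : Lp ℝ 2 P) ω‖ₑ) ∂P := by
      refine lintegral_mono_ae ?_
      filter_upwards [hcob, hdec, Lp.coeFn_sub y (coboundary hP g)] with ω h1 h2 h3
      rw [h3, Pi.sub_apply, Pi.sub_apply, h1, h2]
      refine le_trans (le_of_eq ?_) (enorm_add_le _ _)
      congr 1
      ring
    refine hle.trans ?_
    rw [lintegral_add_right _ (Lp.stronglyMeasurable _).measurable.enorm,
      ← eLpNorm_one_eq_lintegral_enorm, ← eLpNorm_one_eq_lintegral_enorm, ← ENNReal.add_halves δ]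
    refine add_le_add hff ?_
    refine (eLpNorm_le_eLpNorm_of_exponent_le (p := 1) (q := 2) (by norm_num)
      (Lp.memLp (y - coboundary hP g)).1).trans ?_
    rw [← Lp.enorm_def, ← edist_eq_enorm_sub]
    exact hg.le

end Coboundary

/-! ### A smooth averaging weight -/

section Bump

/-- The square of the positive part. -/
def posSq (r : ℝ) : ℝ := max r 0 ^ 2

theorem posSq_nonneg (r : ℝ) : 0 ≤ posSq r := sq_nonneg _

theorem posSq_of_nonpos {r : ℝ} (h : r ≤ 0) : posSq r = 0 := by simp [posSq, h]

theorem abs_posSq_sub_le (a b : ℝ) {M : ℝ} (ha : a ≤ M) (hb : b ≤ M) (hM : 0 ≤ M) :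
    |posSq a - posSq b| ≤ 2 * M * |a - b| := by
  have h1 : posSq a - posSq b = (max a 0 + max b 0) * (max a 0 - max b 0) := by
    unfold posSq
    ring
  rw [h1, abs_mul]
  refine mul_le_mul ?_ (abs_max_sub_max_le_abs a b 0) (abs_nonneg _) (by positivity)
  rw [abs_of_nonneg (by positivity)]
  linarith [max_le ha hM, max_le hb hM]

/-- The squared positive part has derivative 2r₊, which is Lipschitz with constant 2. The remaining
sign patterns of s and t follow by moving the base point. -/
theorem abs_second_difference_posSq_of_nonneg (a : ℝ) {s t : ℝ} (hs : 0 ≤ s) (ht : 0 ≤ t) :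
    |posSq (a + s + t) - posSq (a + s) - posSq (a + t) + posSq a| ≤ 2 * (s * t) := by
  have hst := mul_nonneg hs ht
  unfold posSq
  rw [abs_le]
  rcases le_total a 0 with h1 | h1
  · rcases le_total (a + s) 0 with h2 | h2 <;> rcases le_total (a + t) 0 with h3 | h3 <;>
      rcases le_total (a + s + t) 0 with h4 | h4 <;>
      simp only [h1, h2, h3, h4, max_eq_left, max_eq_right] <;>
      constructor <;> nlinarith [mul_nonneg (sub_nonneg.mpr h1) hs, mul_nonneg (sub_nonneg.mpr h1) ht,
        mul_nonneg (sub_nonneg.mpr h2) (sub_nonneg.mpr h3)]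
  · have h2 : 0 ≤ a + s := by linarith
    have h3 : 0 ≤ a + t := by linarith
    have h4 : 0 ≤ a + s + t := by linarith
    rw [max_eq_left h1, max_eq_left h2, max_eq_left h3, max_eq_left h4]
    constructor <;> nlinarith

theorem abs_second_difference_posSq (a s t : ℝ) :
    |posSq (a + s + t) - posSq (a + s) - posSq (a + t) + posSq a| ≤ 2 * (|s| * |t|) := by
  rcases le_total 0 s with hs | hs <;> rcases le_total 0 t with ht | ht
  · rw [abs_of_nonneg hs, abs_of_nonneg ht]
    exact abs_second_difference_posSq_of_nonneg a hs ht
  · rw [abs_of_nonneg hs, abs_of_nonpos ht]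
    have := abs_second_difference_posSq_of_nonneg (a + t) hs (neg_nonneg.mpr ht)
    rw [← abs_neg]
    convert this using 2
    rw [show a + t + s + -t = a + s by ring, show a + t + -t = a by ring,
      show a + t + s = a + s + t by ring]
    ring
  · rw [abs_of_nonpos hs, abs_of_nonneg ht]
    have := abs_second_difference_posSq_of_nonneg (a + s) (neg_nonneg.mpr hs) ht
    rw [← abs_neg]
    convert this using 2
    rw [show a + s + -s + t = a + t by ring, show a + s + -s = a by ring]
    ring
  · rw [abs_of_nonpos hs, abs_of_nonpos ht]
    have := abs_second_difference_posSq_of_nonneg (a + s + t) (neg_nonneg.mpr hs)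
      (neg_nonneg.mpr ht)
    convert this using 2
    rw [show a + s + t + -s + -t = a by ring, show a + s + t + -s = a + t by ring,
      show a + s + t + -t = a + s by ring]
    ring

variable {d : ℕ}

/-- The Euclidean inner product on the lattice. -/
def ldot (x y : ZLat d) : ℝ := ∑ i, (x i : ℝ) * y i

theorem ldot_add_left (x y z : ZLat d) : ldot (x + y) z = ldot x z + ldot y z := by
  simp [ldot, add_mul, Finset.sum_add_distrib]

theorem ldot_comm (x y : ZLat d) : ldot x y = ldot y x := by
  simp [ldot, mul_comm]

theorem ldot_add_right (x y z : ZLat d) : ldot x (y + z) = ldot x y + ldot x z := by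
  rw [ldot_comm, ldot_add_left, ldot_comm y, ldot_comm z]

theorem l1norm_cast_real (x : ZLat d) : ((l1norm x : ℕ) : ℝ) = ∑ i, |(x i : ℝ)| := by
  simp [l1norm, Nat.cast_natAbs]

theorem abs_ldot_le (x y : ZLat d) : |ldot x y| ≤ l1norm x * l1norm y := by
  unfold ldot
  refine (Finset.abs_sum_le_sum_abs _ _).trans ?_
  rw [l1norm_cast_real x, Finset.sum_mul]
  refine Finset.sum_le_sum fun i _ => ?_
  rw [abs_mul]
  refine mul_le_mul_of_nonneg_left ?_ (abs_nonneg _)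
  rw [l1norm_cast_real]
  exact Finset.single_le_sum (f := fun i => |(y i : ℝ)|) (fun _ _ => abs_nonneg _)
    (Finset.mem_univ i)

theorem l1norm_sq_le (x : ZLat d) : (l1norm x : ℝ) ^ 2 ≤ d * ldot x x := by
  rw [l1norm_cast_real]
  refine (sq_sum_le_card_mul_sum_sq (s := Finset.univ) (f := fun i => |(x i : ℝ)|)).trans ?_
  simp [ldot, sq]

/-- The profile `n² - d |y|²` of the weight. -/
def bumpArg (n : ℕ) (y : ZLat d) : ℝ := (n : ℝ) ^ 2 - d * ldot y y

theorem bumpArg_le (n : ℕ) (y : ZLat d) : bumpArg n y ≤ (n : ℝ) ^ 2 := by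
  have := l1norm_sq_le y
  unfold bumpArg
  nlinarith [sq_nonneg (l1norm y : ℝ)]

theorem bumpArg_nonpos {n : ℕ} {y : ZLat d} (h : n ≤ l1norm y) : bumpArg n y ≤ 0 := by
  have := l1norm_sq_le y
  have h' : (n : ℝ) ≤ l1norm y := by exact_mod_cast h
  unfold bumpArg
  nlinarith [Nat.cast_nonneg (α := ℝ) n]

theorem bumpArg_add (n : ℕ) (y z : ZLat d) :
    bumpArg n (y + z) = bumpArg n y + -(d * (2 * ldot y z + ldot z z)) := by
  unfold bumpArg
  rw [ldot_add_left, ldot_add_right, ldot_add_right, ldot_comm z y]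
  ring

theorem abs_step_le {n : ℕ} (hn : 1 ≤ n) {y : ZLat d} (hy : l1norm y ≤ n + 2) (z : Nbr d) :
    |-((d : ℝ) * (2 * ldot y z + ldot (z : ZLat d) z))| ≤ 7 * d * n := by
  have h1 := abs_ldot_le y z
  have h2 := abs_ldot_le (z : ZLat d) z
  rw [z.l1norm_eq] at h1 h2
  have hy' : (l1norm y : ℝ) ≤ n + 2 := by exact_mod_cast hy
  have hn' : (1 : ℝ) ≤ n := by exact_mod_cast hn
  push_cast at h1 h2
  rw [abs_neg, abs_mul, Nat.abs_cast]
  have h3 : |2 * ldot y z + ldot (z : ZLat d) z| ≤ 7 * n := by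
    refine (abs_add_le _ _).trans ?_
    rw [abs_mul, abs_two]
    linarith
  nlinarith [Nat.cast_nonneg (α := ℝ) d]

theorem abs_posSq_bumpArg_sub_le {n : ℕ} (hn : 1 ≤ n) (y : ZLat d) (z : Nbr d) :
    |posSq (bumpArg n (y + (z : ZLat d))) - posSq (bumpArg n y)| ≤ 14 * d * (n : ℝ) ^ 3 := by
  by_cases hy : l1norm y ≤ n + 2
  · refine (abs_posSq_sub_le _ _ (bumpArg_le n _) (bumpArg_le n _) (by positivity)).trans ?_
    have h := abs_step_le hn hy z
    rw [bumpArg_add, add_sub_cancel_left]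
    calc 2 * (n : ℝ) ^ 2 * _ ≤ 2 * (n : ℝ) ^ 2 * (7 * d * n) := by gcongr
      _ = _ := by ring
  · have h1 := l1norm_add_le (y + (z : ZLat d)) (-(z : ZLat d))
    rw [l1norm_neg, z.l1norm_eq, add_neg_cancel_right] at h1
    rw [posSq_of_nonpos (bumpArg_nonpos (n := n) (by omega)),
      posSq_of_nonpos (bumpArg_nonpos (n := n) (by omega))]
    simp only [sub_zero, abs_zero]
    positivity

/-- Near the ball the steps of the argument are O(n), so the second difference of the squared
positive part is O(n²). Far from it, all four values vanish. -/
theorem abs_second_difference_posSq_bumpArg_le (hd : d ≠ 0) {n : ℕ} (hn : 1 ≤ n) (y : ZLat d)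
    (z w : Nbr d) :
    |posSq (bumpArg n (y + (w : ZLat d) + (z : ZLat d))) - posSq (bumpArg n (y + (w : ZLat d))) - posSq (bumpArg n (y + (z : ZLat d)))
      + posSq (bumpArg n y)| ≤ 110 * (d : ℝ) ^ 2 * (n : ℝ) ^ 2 := by
  have hd' : (1 : ℝ) ≤ d := by exact_mod_cast Nat.one_le_iff_ne_zero.mpr hd
  have hn' : (1 : ℝ) ≤ n := by exact_mod_cast hn
  by_cases hy : l1norm y ≤ n + 2
  · set a := bumpArg n y with ha
    set s := -((d : ℝ) * (2 * ldot y w + ldot (w : ZLat d) w)) with hs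
    set t := -((d : ℝ) * (2 * ldot y z + ldot (z : ZLat d) z)) with ht
    have h1 : bumpArg n (y + (w : ZLat d)) = a + s := bumpArg_add n y w
    have h2 : bumpArg n (y + (z : ZLat d)) = a + t := bumpArg_add n y z
    -- The argument is quadratic in y, so its two increments do not add exactly; the cross term
    -- 2d⟨w,z⟩ is bounded, and it costs only a first difference of the squared positive part.
    have h3 : bumpArg n (y + (w : ZLat d) + (z : ZLat d)) = a + s + t - 2 * d * ldot (w : ZLat d) z := by
      rw [bumpArg_add, h1, ldot_add_left, ht]
      ring
    have he := abs_ldot_le (w : ZLat d) z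
    rw [z.l1norm_eq, w.l1norm_eq] at he
    push_cast at he
    rw [mul_one] at he
    have he' := abs_le.mp he
    have hle := bumpArg_le n (y + (w : ZLat d) + (z : ZLat d))
    have h5 : |posSq (bumpArg n (y + (w : ZLat d) + (z : ZLat d))) - posSq (a + s + t)|
        ≤ 2 * ((n : ℝ) ^ 2 + 2 * d) * (2 * d) := by
      refine (abs_posSq_sub_le (M := (n : ℝ) ^ 2 + 2 * d) _ _ (by linarith) ?_
        (by positivity)).trans ?_
      · rw [h3] at hle
        nlinarith
      · refine mul_le_mul_of_nonneg_left ?_ (by positivity)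
        rw [h3, show a + s + t - 2 * d * ldot (w : ZLat d) z - (a + s + t)
          = -(2 * d * ldot (w : ZLat d) z) by ring, abs_neg, abs_mul, abs_of_nonneg (by positivity)]
        nlinarith
    have h6 := abs_second_difference_posSq a s t
    have h7 : |s| * |t| ≤ (7 * d * n) * (7 * d * n) :=
      mul_le_mul (abs_step_le hn hy w) (abs_step_le hn hy z) (abs_nonneg _) (by positivity)
    rw [h1, h2]
    calc _ = |(posSq (bumpArg n (y + (w : ZLat d) + (z : ZLat d))) - posSq (a + s + t)) +
          (posSq (a + s + t) - posSq (a + s) - posSq (a + t) + posSq a)| := by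
            congr 1
            ring
      _ ≤ 2 * ((n : ℝ) ^ 2 + 2 * d) * (2 * d) + 2 * ((7 * d * n) * (7 * d * n)) :=
          (abs_add_le _ _).trans (add_le_add h5 (by linarith))
      _ ≤ 110 * (d : ℝ) ^ 2 * (n : ℝ) ^ 2 := by
          have h8 : (d : ℝ) ≤ (d : ℝ) ^ 2 := by nlinarith
          have h9 : (1 : ℝ) ≤ (n : ℝ) ^ 2 := by nlinarith
          have h10 : (d : ℝ) * (n : ℝ) ^ 2 ≤ (d : ℝ) ^ 2 * (n : ℝ) ^ 2 := by gcongr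
          have h11 : (d : ℝ) ^ 2 * 1 ≤ (d : ℝ) ^ 2 * (n : ℝ) ^ 2 := by gcongr
          nlinarith
  · have h1 := l1norm_add_le (y + (z : ZLat d)) (-(z : ZLat d))
    rw [l1norm_neg, z.l1norm_eq, add_neg_cancel_right] at h1
    have h2 := l1norm_add_le (y + (w : ZLat d)) (-(w : ZLat d))
    rw [l1norm_neg, w.l1norm_eq, add_neg_cancel_right] at h2
    have h3 := l1norm_add_le (y + (w : ZLat d) + (z : ZLat d)) (-(z : ZLat d))
    rw [l1norm_neg, z.l1norm_eq, add_neg_cancel_right] at h3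
    rw [posSq_of_nonpos (bumpArg_nonpos (n := n) (by omega)),
      posSq_of_nonpos (bumpArg_nonpos (n := n) (by omega)),
      posSq_of_nonpos (bumpArg_nonpos (n := n) (by omega)),
      posSq_of_nonpos (bumpArg_nonpos (n := n) (by omega))]
    simp only [sub_zero, add_zero, abs_zero]
    positivity

/-- On the ball of radius n/(2d) the argument is at least 3n²/4, so the squared positive part is at
least n⁴/2 there, and doubling compares the two volumes. This fixes the size of the normalisation.
-/
theorem le_sum_posSq_bumpArg (hd : d ≠ 0) {n : ℕ} (hn : 2 * d ≤ n) :
    (n : ℝ) ^ 4 * (fball d n).card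
      ≤ 2 * (8 * (d : ℝ) ^ 2 + 1) ^ d * ∑ y ∈ fball d n, posSq (bumpArg n y) := by
  set m := n / (2 * d) with hm
  have h2d : 0 < 2 * d := by omega
  have hm1 : 1 ≤ m := (Nat.one_le_div_iff h2d).mpr hn
  have hmn : 2 * d * m ≤ n := Nat.mul_div_le n (2 * d)
  have hnm : n ≤ 4 * d * m := by
    have h := Nat.lt_mul_div_succ n h2d
    rw [← hm] at h
    nlinarith
  have hcard : ((fball d n).card : ℝ) ≤ (8 * (d : ℝ) ^ 2 + 1) ^ d * (fball d m).card := by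
    have h1 := (Finset.card_le_card (fball_mono (d := d) hnm)).trans
      (fball_card_mul_le hd (4 * d) m)
    have h2 : 2 * (4 * d) * d + 1 = 8 * d ^ 2 + 1 := by ring
    rw [h2] at h1
    exact_mod_cast h1
  have hlow : ∀ y ∈ fball d m, (n : ℝ) ^ 4 / 2 ≤ posSq (bumpArg n y) := by
    intro y hy
    rw [mem_fball] at hy
    have h1 := (le_abs_self _).trans (abs_ldot_le y y)
    have h2 : (l1norm y : ℝ) ≤ m := by exact_mod_cast hy
    have h3 : 2 * (d : ℝ) * m ≤ n := by exact_mod_cast hmn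
    have hd' : (1 : ℝ) ≤ d := by exact_mod_cast Nat.one_le_iff_ne_zero.mpr hd
    have h4 : ldot y y ≤ (m : ℝ) ^ 2 := by nlinarith [Nat.cast_nonneg (α := ℝ) (l1norm y)]
    have h5 : (d : ℝ) * (m : ℝ) ^ 2 ≤ (d * m : ℝ) ^ 2 := by nlinarith [sq_nonneg (m : ℝ)]
    have h6 : (d * m : ℝ) ^ 2 ≤ (n / 2 : ℝ) ^ 2 := by
      apply pow_le_pow_left₀ (by positivity)
      linarith
    have h7 : 3 / 4 * (n : ℝ) ^ 2 ≤ bumpArg n y := by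
      unfold bumpArg
      nlinarith
    have h8 : 3 / 4 * (n : ℝ) ^ 2 ≤ max (bumpArg n y) 0 := h7.trans (le_max_left _ _)
    unfold posSq
    nlinarith [sq_nonneg ((n : ℝ) ^ 2), pow_le_pow_left₀ (by positivity) h8 2]
  have hmn' : m ≤ n := by nlinarith
  have hsum : (n : ℝ) ^ 4 / 2 * (fball d m).card ≤ ∑ y ∈ fball d n, posSq (bumpArg n y) := by
    refine le_trans ?_ (Finset.sum_le_sum_of_subset_of_nonneg (fball_mono hmn')
      fun _ _ _ => posSq_nonneg _)
    rw [mul_comm, ← nsmul_eq_mul]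
    exact Finset.card_nsmul_le_sum _ _ _ hlow
  calc (n : ℝ) ^ 4 * (fball d n).card
      ≤ (n : ℝ) ^ 4 * ((8 * (d : ℝ) ^ 2 + 1) ^ d * (fball d m).card) := by gcongr
    _ = 2 * (8 * (d : ℝ) ^ 2 + 1) ^ d * ((n : ℝ) ^ 4 / 2 * (fball d m).card) := by ring
    _ ≤ _ := by gcongr

/-- `η` is a probability weight on the ball `B(n)` with two controlled derivatives. -/
structure IsBump (C : ℝ) (n : ℕ) (η : ZLat d → ℝ) : Prop where
  nonneg : ∀ y, 0 ≤ η y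
  eq_zero : ∀ y, y ∉ fball d n → η y = 0
  sum_eq : ∑ y ∈ fball d n, η y = 1
  le : ∀ y, η y ≤ C / (fball d n).card
  diff_le : ∀ y (z : Nbr d), |η (y + (z : ZLat d)) - η y| ≤ C / (n * (fball d n).card)
  diff_diff_le : ∀ y (z w : Nbr d), |η (y + (w : ZLat d) + (z : ZLat d)) - η (y + (w : ZLat d)) - η (y + (z : ZLat d)) + η y|
    ≤ C / ((n : ℝ) ^ 2 * (fball d n).card)

/-- The weight is the normalised squared positive part of n² - d|y|². Two differences are needed
because the coboundary part of the flux has to gain the full factor n⁻² against a time of length n².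
-/
theorem exists_isBump (hd : d ≠ 0) : ∃ C : ℝ, 0 < C ∧ ∀ n, 2 * d ≤ n →
    ∃ η : ZLat d → ℝ, IsBump C n η := by
  set C₀ : ℝ := 2 * (8 * (d : ℝ) ^ 2 + 1) ^ d with hC₀
  have hC₀p : 0 < C₀ := by positivity
  have hd' : (1 : ℝ) ≤ d := by exact_mod_cast Nat.one_le_iff_ne_zero.mpr hd
  have hdd : (d : ℝ) ≤ (d : ℝ) ^ 2 := by nlinarith
  refine ⟨110 * (d : ℝ) ^ 2 * C₀, by positivity, fun n hn => ?_⟩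
  have hn1 : 1 ≤ n := by omega
  have hn' : (0 : ℝ) < n := by exact_mod_cast hn1
  have hc : (0 : ℝ) < (fball d n).card := by exact_mod_cast fball_card_pos n
  set S : ℝ := ∑ y ∈ fball d n, posSq (bumpArg n y) with hS
  have hSl : (n : ℝ) ^ 4 * (fball d n).card ≤ C₀ * S := le_sum_posSq_bumpArg hd hn
  have hSp : 0 < S := by
    have : 0 < C₀ * S := lt_of_lt_of_le (by positivity) hSl
    exact (mul_pos_iff_of_pos_left hC₀p).mp this
  have key : ∀ u v m : ℝ, 0 < m → u ≤ v → 0 ≤ v → v * m ≤ 110 * (d : ℝ) ^ 2 * (n : ℝ) ^ 4 →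
      u / S ≤ 110 * (d : ℝ) ^ 2 * C₀ / (m * (fball d n).card) := by
    intro u v m hm huv hv hvm
    rw [div_le_div_iff₀ hSp (by positivity)]
    calc u * (m * (fball d n).card) ≤ v * (m * (fball d n).card) := by gcongr
      _ = v * m * (fball d n).card := by ring
      _ ≤ 110 * (d : ℝ) ^ 2 * (n : ℝ) ^ 4 * (fball d n).card := by gcongr
      _ = 110 * (d : ℝ) ^ 2 * ((n : ℝ) ^ 4 * (fball d n).card) := by ring
      _ ≤ 110 * (d : ℝ) ^ 2 * (C₀ * S) := by gcongr
      _ = _ := by ring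
  refine ⟨fun y => posSq (bumpArg n y) / S, fun y => div_nonneg (posSq_nonneg _) hSp.le,
    fun y hy => ?_, ?_, fun y => ?_, fun y z => ?_, fun y z w => ?_⟩
  · rw [mem_fball, not_le] at hy
    rw [posSq_of_nonpos (bumpArg_nonpos hy.le), zero_div]
  · rw [← Finset.sum_div, div_self hSp.ne']
  · have h1 : posSq (bumpArg n y) ≤ (n : ℝ) ^ 4 := by
      unfold posSq
      have : max (bumpArg n y) 0 ≤ (n : ℝ) ^ 2 := max_le (bumpArg_le n y) (by positivity)
      calc max (bumpArg n y) 0 ^ 2 ≤ ((n : ℝ) ^ 2) ^ 2 := by gcongr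
        _ = _ := by ring
    have := key _ _ 1 one_pos h1 (by positivity) (by
      have : (0 : ℝ) ≤ (n : ℝ) ^ 4 := by positivity
      nlinarith)
    rwa [one_mul] at this
  · rw [← sub_div, abs_div, abs_of_pos hSp]
    refine key _ _ n hn' (abs_posSq_bumpArg_sub_le hn1 y z) (by positivity) ?_
    have : (0 : ℝ) ≤ (n : ℝ) ^ 4 := by positivity
    nlinarith
  · rw [← sub_div, ← sub_div, ← add_div, abs_div, abs_of_pos hSp]
    refine key _ _ _ (by positivity) (abs_second_difference_posSq_bumpArg_le hd hn1 y z w)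
      (by positivity) (le_of_eq (by ring))

end Bump

/-! ### Deterministic estimates on the lattice -/

section Lattice

variable {d : ℕ}

/-- The sum over a ball of the absolute values of the gradient. -/
def gradSum (a : ZLat d → ℝ) (n : ℕ) : ℝ≥0∞ :=
  ∑ x ∈ fball d n, ∑ z : Nbr d, ‖a (x + z) - a x‖ₑ

theorem gradSum_mono (a : ZLat d → ℝ) {m n : ℕ} (h : m ≤ n) : gradSum a m ≤ gradSum a n :=
  Finset.sum_le_sum_of_subset (fball_mono h)

theorem sum_fball_add_le (f : ZLat d → ℝ≥0∞) (m : ℕ) (p : ZLat d) :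
    ∑ x ∈ fball d m, f (x + p) ≤ ∑ x ∈ fball d (m + l1norm p), f x := by
  refine (le_of_eq (Finset.sum_map (fball d m) (addRightEmbedding p) f).symm).trans ?_
  refine Finset.sum_le_sum_of_subset fun x hx => ?_
  rw [Finset.mem_map] at hx
  obtain ⟨y, hy, rfl⟩ := hx
  rw [mem_fball] at hy ⊢
  exact (l1norm_add_le y p).trans (by omega)

/-- Each edge of the walk is a unit step carried out simultaneously from all points of the ball, and
costs one gradient sum over a slightly larger ball. -/
theorem sum_enorm_sub_le_of_walk (a : ZLat d → ℝ) {p q : ZLat d} (w : (latticeGraph d).Walk p q)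
    (m : ℕ) : ∑ x ∈ fball d m, ‖a (x + q) - a (x + p)‖ₑ
      ≤ w.length * gradSum a (m + l1norm p + w.length) := by
  induction w with
  | nil => simp
  | @cons p b q h w ih =>
    have h1 : ∑ x ∈ fball d m, ‖a (x + b) - a (x + p)‖ₑ ≤ gradSum a (m + l1norm p) := by
      refine le_trans ?_ (sum_fball_add_le (fun x : ZLat d => ∑ z : Nbr d, ‖a (x + z) - a x‖ₑ) m p)
      refine Finset.sum_le_sum fun x _ => ?_
      refine le_trans (le_of_eq ?_) (Finset.single_le_sum
        (f := fun z : Nbr d => ‖a (x + p + z) - a (x + p)‖ₑ) (fun _ _ => zero_le)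
        (Finset.mem_univ (Nbr.ofAdj h)))
      simp [Nbr.ofAdj]
    have hb : l1norm b ≤ l1norm p + 1 := by
      have h2 := l1norm_add_le p (b - p)
      rw [l1norm_sub_of_adj h] at h2
      simpa using h2
    calc ∑ x ∈ fball d m, ‖a (x + q) - a (x + p)‖ₑ
        ≤ ∑ x ∈ fball d m, (‖a (x + q) - a (x + b)‖ₑ + ‖a (x + b) - a (x + p)‖ₑ) := by
          refine Finset.sum_le_sum fun x _ => ?_
          refine le_trans (le_of_eq ?_) (enorm_add_le _ _)
          congr 1
          ring
      _ ≤ w.length * gradSum a (m + l1norm b + w.length) + gradSum a (m + l1norm p) := by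
          rw [Finset.sum_add_distrib]
          exact add_le_add ih h1
      _ ≤ w.length * gradSum a (m + l1norm p + (w.length + 1))
          + gradSum a (m + l1norm p + (w.length + 1)) := by
          gcongr
          · exact gradSum_mono a (by omega)
          · exact gradSum_mono a (by omega)
      _ = _ := by
          rw [SimpleGraph.Walk.length_cons]
          push_cast
          ring

theorem sum_enorm_sub_le (a : ZLat d → ℝ) (v : ZLat d) (m : ℕ) :
    ∑ x ∈ fball d m, ‖a (x + v) - a x‖ₑ ≤ l1norm v * gradSum a (m + l1norm v) := by
  obtain ⟨w, hw⟩ := exists_walk_length 0 v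
  rw [sub_zero] at hw
  have := sum_enorm_sub_le_of_walk a w m
  simpa [hw, l1norm_zero] using this

theorem enorm_sub_zero_le (a : ZLat d → ℝ) (v : ZLat d) {n : ℕ} (hv : l1norm v ≤ n) :
    ‖a v - a 0‖ₑ ≤ n * gradSum a n := by
  have h := sum_enorm_sub_le a v 0
  have h0 : fball d 0 = {0} := by
    ext x
    rw [mem_fball, Finset.mem_singleton, Nat.le_zero]
    constructor
    · intro hx
      funext i
      have := natAbs_le_l1norm x i
      simpa [hx] using this
    · rintro rfl
      exact l1norm_zero
  rw [h0, Finset.sum_singleton, zero_add, zero_add] at h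
  refine h.trans ?_
  gcongr
  exact gradSum_mono a hv

/-- The Poincaré inequality on balls. -/
theorem sum_sum_enorm_sub_le (a : ZLat d → ℝ) (n : ℕ) :
    ∑ x ∈ fball d n, ∑ y ∈ fball d n, ‖a x - a y‖ₑ
      ≤ (fball d (2 * n)).card * ((2 * n : ℕ) * gradSum a (3 * n)) := by
  classical
  -- The substitution x = y + v replaces pairs of points by displacements v in B(2n), each of which
  -- is joined to 0 by a walk of length at most 2n.
  have h1 : ∀ y ∈ fball d n, ∑ x ∈ fball d n, ‖a x - a y‖ₑ
      ≤ ∑ v ∈ fball d (2 * n), ‖a (y + v) - a y‖ₑ := by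
    intro y hy
    rw [mem_fball] at hy
    have := sum_fball_add_le (fun v => ‖a (y + v) - a y‖ₑ) n (-y)
    rw [l1norm_neg] at this
    refine le_trans (le_of_eq ?_) (this.trans
      (Finset.sum_le_sum_of_subset (fball_mono (by omega))))
    refine Finset.sum_congr rfl fun x _ => ?_
    rw [show y + (x + -y) = x by abel]
  rw [Finset.sum_comm]
  refine (Finset.sum_le_sum h1).trans ?_
  rw [Finset.sum_comm, ← nsmul_eq_mul]
  refine Finset.sum_le_card_nsmul _ _ _ fun v hv => ?_
  rw [mem_fball] at hv
  refine (sum_enorm_sub_le a v n).trans ?_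
  gcongr
  exact gradSum_mono a (by omega)

/-- Averages with respect to a bump weight are close to the values, in mean. -/
theorem sum_enorm_sub_bump_le (a : ZLat d → ℝ) {C : ℝ} {n : ℕ} {η : ZLat d → ℝ}
    (hη : IsBump C n η) :
    ∑ x ∈ fball d n, ‖a x - ∑ y ∈ fball d n, η y * a y‖ₑ
      ≤ ENNReal.ofReal (C / (fball d n).card) *
        ((fball d (2 * n)).card * ((2 * n : ℕ) * gradSum a (3 * n))) := by
  calc ∑ x ∈ fball d n, ‖a x - ∑ y ∈ fball d n, η y * a y‖ₑ
      ≤ ∑ x ∈ fball d n, ∑ y ∈ fball d n,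
          ENNReal.ofReal (C / (fball d n).card) * ‖a x - a y‖ₑ := by
        refine Finset.sum_le_sum fun x _ => ?_
        have : a x - ∑ y ∈ fball d n, η y * a y = ∑ y ∈ fball d n, η y * (a x - a y) := by
          simp only [mul_sub, Finset.sum_sub_distrib]
          rw [← Finset.sum_mul, hη.sum_eq, one_mul]
        rw [this]
        refine (enorm_sum_le _ _).trans (Finset.sum_le_sum fun y _ => ?_)
        rw [enorm_mul, Real.enorm_of_nonneg (hη.nonneg y)]
        gcongr
        exact hη.le y
    _ = ENNReal.ofReal (C / (fball d n).card) *
          ∑ x ∈ fball d n, ∑ y ∈ fball d n, ‖a x - a y‖ₑ := by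
        simp only [Finset.mul_sum]
    _ ≤ _ := by
        gcongr
        exact sum_sum_enorm_sub_le a n

theorem sum_fball_comp_add {g : ZLat d → ℝ} {n m : ℕ} (hg : ∀ y, y ∉ fball d n → g y = 0)
    (v : ZLat d) (hm : n + l1norm v ≤ m) :
    ∑ y ∈ fball d m, g (y + v) = ∑ y ∈ fball d m, g y := by
  have h1 : Function.support g ⊆ (fball d m : Set (ZLat d)) := by
    intro y hy
    by_contra h
    refine hy (hg y fun h' => h ?_)
    exact fball_mono (by omega) h'
  have h2 : Function.support (fun y => g (y + v)) ⊆ (fball d m : Set (ZLat d)) := by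
    intro y hy
    by_contra h
    refine hy (hg _ fun h' => h ?_)
    rw [mem_fball] at h'
    rw [Finset.mem_coe, mem_fball]
    have := l1norm_add_le (y + v) (-v)
    rw [l1norm_neg, add_neg_cancel_right] at this
    omega
  rw [← finsum_eq_sum_of_support_subset _ h1, ← finsum_eq_sum_of_support_subset _ h2]
  exact finsum_comp_equiv (Equiv.addRight v)

/-- The summation by parts formula for the divergence of an antisymmetric field. -/
theorem two_mul_sum_mul_div {η : ZLat d → ℝ} {n m : ℕ} (hη : ∀ y, y ∉ fball d n → η y = 0)
    (hm : n + 1 ≤ m) {f : Nbr d → ZLat d → ℝ}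
    (hf : ∀ y (z : Nbr d), f z.neg (y + z) = -f z y) :
    2 * ∑ y ∈ fball d m, η y * ∑ z, f z y
      = -∑ z : Nbr d, ∑ y ∈ fball d m, (η (y + z) - η y) * f z y := by
  have h1 : ∑ y ∈ fball d m, η y * ∑ z, f z y = ∑ z, ∑ y ∈ fball d m, η y * f z y := by
    simp only [Finset.mul_sum]
    exact Finset.sum_comm
  -- Every edge is reversed: z becomes -z, the base point moves by z, and antisymmetry of the field
  -- produces the sign.
  have h2 : ∑ z, ∑ y ∈ fball d m, η y * f z y
      = -∑ z : Nbr d, ∑ y ∈ fball d m, η (y + z) * f z y := by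
    rw [← Nbr.sum_neg, ← Finset.sum_neg_distrib]
    refine Finset.sum_congr rfl fun z _ => ?_
    rw [← sum_fball_comp_add (g := fun y => η y * f z.neg y) (n := n)
      (fun y hy => by simp [hη y hy]) z (by rw [z.l1norm_eq]; exact hm), ← Finset.sum_neg_distrib]
    refine Finset.sum_congr rfl fun y _ => ?_
    rw [hf y z]
    ring
  have h3 : ∑ z : Nbr d, ∑ y ∈ fball d m, (η (y + z) - η y) * f z y
      = ∑ z : Nbr d, ∑ y ∈ fball d m, η (y + z) * f z y
        - ∑ z, ∑ y ∈ fball d m, η y * f z y := by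
    simp only [sub_mul, Finset.sum_sub_distrib]
  rw [h3, h1]
  linarith

/-- The constant h disappears because differences of η have total mass zero. For the coboundary a
second summation by parts produces second differences of η, of relative size n⁻². The error e keeps
the first difference, of relative size n⁻¹. -/
theorem abs_sum_diff_mul_le {C : ℝ} {n : ℕ} {η : ZLat d → ℝ} (hη : IsBump C n η) (z : Nbr d)
    (h : ℝ) (g : Nbr d → ZLat d → ℝ) (e : ZLat d → ℝ) :
    |∑ y ∈ fball d (n + 2), (η (y + z) - η y) * (h + ∑ w : Nbr d, (g w (y + w) - g w y) + e y)|
      ≤ C / ((n : ℝ) ^ 2 * (fball d n).card) * ∑ w, ∑ y ∈ fball d (n + 2), |g w y|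
        + C / (n * (fball d n).card) * ∑ y ∈ fball d (n + 2), |e y| := by
  -- First differences of η are supported one step outside B(n); hence the sums run over B(n+2),
  -- where one more unit shift still loses nothing.
  have hz : ∀ y, y ∉ fball d (n + 1) → η (y + z) - η y = 0 := by
    intro y hy
    rw [mem_fball] at hy
    have h1 := l1norm_add_le (y + (z : ZLat d)) (-(z : ZLat d))
    rw [l1norm_neg, z.l1norm_eq, add_neg_cancel_right] at h1
    rw [hη.eq_zero y (by rw [mem_fball]; omega), hη.eq_zero (y + (z : ZLat d)) (by rw [mem_fball]; omega),
      sub_zero]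
  have e1 : ∑ y ∈ fball d (n + 2), (η (y + z) - η y) * h = 0 := by
    rw [← Finset.sum_mul, Finset.sum_sub_distrib,
      sum_fball_comp_add hη.eq_zero z (by rw [z.l1norm_eq]; omega), sub_self, zero_mul]
  have e2 : ∀ w : Nbr d, ∑ y ∈ fball d (n + 2), (η (y + z) - η y) * (g w (y + w) - g w y)
      = ∑ y ∈ fball d (n + 2),
          (η (y + w.neg + z) - η (y + w.neg) - η (y + z) + η y) * g w y := by
    intro w
    have h2 : ∑ y ∈ fball d (n + 2), (η (y + z) - η y) * g w (y + w)
        = ∑ y ∈ fball d (n + 2), (η (y + w.neg + z) - η (y + w.neg)) * g w y := by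
      have h3 := sum_fball_comp_add (m := n + 2) (n := n + 1)
        (g := fun y : ZLat d => (η (y + z) - η y) * g w (y + w)) (fun y hy => by simp [hz y hy]) w.neg
        (by rw [w.neg.l1norm_eq])
      rw [← h3]
      refine Finset.sum_congr rfl fun y _ => ?_
      rw [Nbr.coe_neg, neg_add_cancel_right]
    simp only [mul_sub]
    rw [Finset.sum_sub_distrib, h2, ← Finset.sum_sub_distrib]
    refine Finset.sum_congr rfl fun y _ => ?_
    ring
  have e3 : ∑ y ∈ fball d (n + 2),
      (η (y + z) - η y) * (h + ∑ w : Nbr d, (g w (y + w) - g w y) + e y)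
      = ∑ w : Nbr d, ∑ y ∈ fball d (n + 2),
          (η (y + w.neg + z) - η (y + w.neg) - η (y + z) + η y) * g w y
        + ∑ y ∈ fball d (n + 2), (η (y + z) - η y) * e y := by
    simp only [mul_add, Finset.sum_add_distrib, e1, zero_add, Finset.mul_sum]
    rw [Finset.sum_comm]
    congr 1
    exact Finset.sum_congr rfl fun w _ => e2 w
  rw [e3]
  refine (abs_add_le _ _).trans (add_le_add ?_ ?_)
  · refine (Finset.abs_sum_le_sum_abs _ _).trans ?_
    rw [Finset.mul_sum]
    refine Finset.sum_le_sum fun w _ => (Finset.abs_sum_le_sum_abs _ _).trans ?_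
    rw [Finset.mul_sum]
    refine Finset.sum_le_sum fun y _ => ?_
    rw [abs_mul]
    exact mul_le_mul_of_nonneg_right (hη.diff_diff_le y z w.neg) (abs_nonneg _)
  · refine (Finset.abs_sum_le_sum_abs _ _).trans ?_
    rw [Finset.mul_sum]
    refine Finset.sum_le_sum fun y _ => ?_
    rw [abs_mul]
    exact mul_le_mul_of_nonneg_right (hη.diff_le y z) (abs_nonneg _)

theorem abs_sum_bump_mul_div_le {C : ℝ} {n : ℕ} {η : ZLat d → ℝ} (hη : IsBump C n η)
    {f : Nbr d → ZLat d → ℝ} (hf : ∀ y (z : Nbr d), f z.neg (y + z) = -f z y)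
    (h : Nbr d → ℝ) (g : Nbr d → Nbr d → ZLat d → ℝ) (e : Nbr d → ZLat d → ℝ)
    (hdec : ∀ y z, f z y = h z + ∑ w : Nbr d, (g z w (y + w) - g z w y) + e z y) :
    |∑ y ∈ fball d n, η y * ∑ z, f z y|
      ≤ C / ((n : ℝ) ^ 2 * (fball d n).card)
          * ∑ y ∈ fball d (n + 2), ∑ z : Nbr d, ∑ w : Nbr d, |g z w y|
        + C / (n * (fball d n).card) * ∑ y ∈ fball d (n + 2), ∑ z : Nbr d, |e z y| := by
  have h1 : ∑ y ∈ fball d n, η y * ∑ z, f z y = ∑ y ∈ fball d (n + 2), η y * ∑ z, f z y :=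
    Finset.sum_subset (fball_mono (by omega)) fun y _ hy => by simp [hη.eq_zero y hy]
  have h2 := two_mul_sum_mul_div hη.eq_zero (m := n + 2) (by omega) hf
  have h3 : 2 * |∑ y ∈ fball d (n + 2), η y * ∑ z, f z y|
      ≤ C / ((n : ℝ) ^ 2 * (fball d n).card)
          * ∑ y ∈ fball d (n + 2), ∑ z : Nbr d, ∑ w : Nbr d, |g z w y|
        + C / (n * (fball d n).card) * ∑ y ∈ fball d (n + 2), ∑ z : Nbr d, |e z y| := by
    rw [← abs_two, ← abs_mul, h2, abs_neg]
    refine (Finset.abs_sum_le_sum_abs _ _).trans ?_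
    have h4 : ∑ y ∈ fball d (n + 2), ∑ z : Nbr d, ∑ w : Nbr d, |g z w y|
        = ∑ z : Nbr d, ∑ w, ∑ y ∈ fball d (n + 2), |g z w y| := by
      rw [Finset.sum_comm]
      exact Finset.sum_congr rfl fun z _ => Finset.sum_comm
    rw [h4, Finset.sum_comm (s := fball d (n + 2)), Finset.mul_sum, Finset.mul_sum,
      ← Finset.sum_add_distrib]
    refine Finset.sum_le_sum fun z _ => ?_
    simp only [hdec]
    exact abs_sum_diff_mul_le hη z (h z) (g z) (e z)
  rw [h1]
  linarith [abs_nonneg (∑ y ∈ fball d (n + 2), η y * ∑ z, f z y)]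

end Lattice

/-! ### Sublinearity of the corrector in mean -/

section MeanSublinear

variable {d : ℕ} [MeasurableSpace (Env d)] {P : Measure (Env d)} [IsProbabilityMeasure P]

/-- `ψ` is the potential part of the direction `q`, `φ` a sequence of approximate potentials of
`ψ`, and `χ` the extension of `ψ`. -/
structure IsCorrector (hP : StationaryErgodicEnv P) (q : Nbr d → ℝ) (ψ : Lp ℝ 2 (mMeasure P))
    (φ : ℕ → Env d → ℝ) (χ : Env d → ZLat d → ℝ) : Prop where
  odd : ∀ z, q z.neg = - q z
  mem : ψ ∈ L2pot P
  measurable_potential : ∀ k, Measurable (φ k)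
  bounded_potential : ∀ k, ∃ C, ∀ ω, |φ k ω| ≤ C
  approx : ∀ k z, ∫⁻ ω, ‖ψ (ω, z) - hgrad (φ k) (ω, z)‖ₑ ∂P ≤ (4⁻¹ : ℝ≥0∞) ^ k
  measurable_extension : ∀ x, Measurable fun ω => χ ω x
  step : ∀ᵐ ω ∂P, χ ω 0 = 0 ∧ ∀ x (z : Nbr d), χ ω (x + z) = χ ω x + ψ (shift 0 x ω, z)
  time : ∀ᵐ ω ∂P, ∀ x (t : ℝ), χ (shift t 0 ω) x = χ ω x
    - ∫ s in (0 : ℝ)..t, (drift hP q ψ (shift s 0 ω) - drift hP q ψ (shift s x ω))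

theorem exists_isCorrector (hP : StationaryErgodicEnv P) {q : Nbr d → ℝ}
    (hq : ∀ z, q z.neg = - q z) : ∃ ψ φ χ, IsCorrector hP q ψ φ χ := by
  obtain ⟨ψ, φ, χ, h1, h2, h3, h4, h5, h6, h7⟩ := exists_corrector hP hq
  exact ⟨ψ, φ, χ, hq, h1, h2, h3, h4, h5, h6, h7⟩

/-- The space-time corrector. -/
def corrField (χ : Env d → ZLat d → ℝ) (V : Env d → ℝ) (ω : Env d) (t : ℝ) (x : ZLat d) : ℝ :=
  -χ ω x - ∫ s in (0 : ℝ)..t, V (shift s x ω)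

variable {hP : StationaryErgodicEnv P} {q : Nbr d → ℝ} {ψ : Lp ℝ 2 (mMeasure P)}
  {φ : ℕ → Env d → ℝ} {χ : Env d → ZLat d → ℝ}

theorem ae_locallyIntegrable_drift (hP : StationaryErgodicEnv P) (q : Nbr d → ℝ)
    (ψ : Lp ℝ 2 (mMeasure P)) :
    ∀ᵐ ω ∂P, ∀ x : ZLat d, LocallyIntegrable (fun s => drift hP q ψ (shift s x ω)) volume :=
  hP.ae_locallyIntegrable (measurable_drift hP q ψ) (integrable_drift hP q ψ)

/-- The time increments of χ exchange the drift at x for the drift at 0. The left form makes the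
equation visible, the right form the cocycle and the spatial steps. -/
theorem IsCorrector.corrField_eq (hC : IsCorrector hP q ψ φ χ) :
    ∀ᵐ ω ∂P, ∀ (t : ℝ) x, corrField χ (drift hP q ψ) ω t x
      = -χ (shift t 0 ω) x - ∫ s in (0 : ℝ)..t, drift hP q ψ (shift s 0 ω) := by
  filter_upwards [hC.time, ae_locallyIntegrable_drift hP q ψ] with ω h1 h2 t x
  rw [h1 x t, corrField, intervalIntegral.integral_sub
    (intervalIntegrable_of_locallyIntegrable (h2 0) 0 t)
    (intervalIntegrable_of_locallyIntegrable (h2 x) 0 t)]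
  ring

theorem IsCorrector.corrField_step (hC : IsCorrector hP q ψ φ χ) :
    ∀ᵐ ω ∂P, ∀ᵐ t : ℝ, ∀ x (z : Nbr d), corrField χ (drift hP q ψ) ω t (x + z)
      = corrField χ (drift hP q ψ) ω t x - ψ (shift t x ω, z) := by
  filter_upwards [hC.corrField_eq, hP.ae_ae_shift hC.step] with ω h1 h2
  filter_upwards [h2] with t ht x z
  rw [h1, h1, (ht 0).2 x z, shift_shift]
  simp only [zero_add, add_zero]
  ring

theorem IsCorrector.corrField_zero (hC : IsCorrector hP q ψ φ χ) :
    ∀ᵐ ω ∂P, corrField χ (drift hP q ψ) ω 0 0 = 0 := by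
  filter_upwards [hC.step] with ω h1
  simp [corrField, h1.1]

theorem lintegral_unifT_le_three_mul {n : ℕ} (hn : 1 ≤ n) (f : ℝ → ℝ≥0∞) :
    ∫⁻ t, f t ∂(unifT n) ≤ 9 * ∫⁻ t, f t ∂(unifT (3 * n)) := by
  have hn' : (0 : ℝ) < n := by exact_mod_cast hn
  rw [lintegral_unifT, lintegral_unifT, ← mul_assoc]
  refine mul_le_mul' (le_of_eq ?_) (lintegral_mono_set (Set.Icc_subset_Icc le_rfl ?_))
  · have h9 : (9 : ℝ≥0∞) = ENNReal.ofReal 9 := by norm_num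
    rw [← ENNReal.ofReal_inv_of_pos (by positivity), ← ENNReal.ofReal_inv_of_pos
      (by push_cast; positivity), h9, ← ENNReal.ofReal_mul (by norm_num)]
    congr 1
    push_cast
    field_simp
    norm_num
  · push_cast
    nlinarith

theorem sum_fball_le_lintegral_unifB (hd : d ≠ 0) (n : ℕ) (f : ZLat d → ℝ≥0∞) :
    ∑ x ∈ fball d (3 * n), f x
      ≤ ((6 * d + 1) ^ d : ℕ) * (fball d n).card * ∫⁻ x, f x ∂(unifB d (3 * n)) := by
  have h0 : ((fball d (3 * n)).card : ℝ≥0∞) ≠ 0 := by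
    exact_mod_cast (fball_card_pos (d := d) (3 * n)).ne'
  have h1 : ((fball d (3 * n)).card : ℝ≥0∞) ≤ ((6 * d + 1) ^ d : ℕ) * (fball d n).card := by
    exact_mod_cast fball_card_mul_le hd 3 n
  rw [lintegral_unifB]
  calc ∑ x ∈ fball d (3 * n), f x
      = (fball d (3 * n)).card * (((fball d (3 * n)).card : ℝ≥0∞)⁻¹
          * ∑ x ∈ fball d (3 * n), f x) := by
        rw [← mul_assoc, ENNReal.mul_inv_cancel h0 (ENNReal.natCast_ne_top _), one_mul]
    _ ≤ _ := by gcongr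

/-- The remainder of the approximation of the potential. -/
def potRem (ψ : Lp ℝ 2 (mMeasure P)) (φ : Env d → ℝ) (ω : Env d) : ℝ≥0∞ :=
  ∑ z : Nbr d, ‖ψ (ω, z) - hgrad φ (ω, z)‖ₑ

/-- Adding the bounded approximate potential to X leaves a function whose gradient is the
approximation error. The Poincaré inequality bounds its oscillation by n times the mean error, and
the added potential costs at most 2M. -/
theorem lintegral_enorm_sub_bump_le_of_step (hd : d ≠ 0) {C : ℝ} {n : ℕ} {η : ZLat d → ℝ}
    (hη : IsBump C n η) {ω : Env d} {t : ℝ} {X : ZLat d → ℝ}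
    (hX : ∀ x (z : Nbr d), X (x + z) = X x - ψ (shift t x ω, z)) {φ : Env d → ℝ} {M : ℝ}
    (hM : ∀ ω, |φ ω| ≤ M) :
    ∫⁻ x, ‖X x - ∑ y ∈ fball d n, η y * X y‖ₑ ∂(unifB d n)
      ≤ ENNReal.ofReal C * ((4 * d + 1) ^ d * (6 * d + 1) ^ d * (2 * n) : ℕ)
          * ∫⁻ x, potRem ψ φ (shift t x ω) ∂(unifB d (3 * n)) + ENNReal.ofReal (2 * M) := by
  set a : ZLat d → ℝ := fun x => X x + φ (shift t x ω) with ha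
  have hgrad : ∀ m, gradSum a m = ∑ x ∈ fball d m, potRem ψ φ (shift t x ω) := by
    intro m
    refine Finset.sum_congr rfl fun x _ => Finset.sum_congr rfl fun z _ => ?_
    rw [ha]
    simp only [_root_.hgrad]
    rw [hX, shift_shift, zero_add, add_comm (z : ZLat d) x, ← enorm_neg]
    congr 1
    ring
  have hcard : (0 : ℝ) < (fball d n).card := by exact_mod_cast fball_card_pos n
  have hcard0 : ((fball d n).card : ℝ≥0∞) ≠ 0 := by exact_mod_cast (fball_card_pos n).ne'
  have hM0 : 0 ≤ M := (abs_nonneg _).trans (hM ω)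
  have hpt : ∀ x, ‖X x - ∑ y ∈ fball d n, η y * X y‖ₑ
      ≤ ‖a x - ∑ y ∈ fball d n, η y * a y‖ₑ + ENNReal.ofReal (2 * M) := by
    intro x
    have h1 : X x - ∑ y ∈ fball d n, η y * X y = (a x - ∑ y ∈ fball d n, η y * a y)
        + (∑ y ∈ fball d n, η y * φ (shift t y ω) - φ (shift t x ω)) := by
      simp only [ha, mul_add, Finset.sum_add_distrib]
      ring
    rw [h1]
    refine (enorm_add_le _ _).trans (add_le_add le_rfl ?_)
    rw [Real.enorm_eq_ofReal_abs]
    refine ENNReal.ofReal_le_ofReal ((abs_sub _ _).trans ?_)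
    have h2 : |∑ y ∈ fball d n, η y * φ (shift t y ω)| ≤ M := by
      refine (Finset.abs_sum_le_sum_abs _ _).trans ?_
      calc ∑ y ∈ fball d n, |η y * φ (shift t y ω)| ≤ ∑ y ∈ fball d n, η y * M := by
            refine Finset.sum_le_sum fun y _ => ?_
            rw [abs_mul, abs_of_nonneg (hη.nonneg y)]
            exact mul_le_mul_of_nonneg_left (hM _) (hη.nonneg y)
        _ = M := by rw [← Finset.sum_mul, hη.sum_eq, one_mul]
    linarith [hM (shift t x ω)]
  refine (lintegral_mono hpt).trans ?_
  rw [lintegral_add_right _ measurable_const, lintegral_const, measure_univ, mul_one]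
  refine add_le_add ?_ le_rfl
  rw [lintegral_unifB]
  have h2n : ((fball d (2 * n)).card : ℝ≥0∞) ≤ ((4 * d + 1) ^ d : ℕ) * (fball d n).card := by
    exact_mod_cast fball_card_mul_le hd 2 n
  have hC' : ENNReal.ofReal (C / (fball d n).card)
      = ENNReal.ofReal C * ((fball d n).card : ℝ≥0∞)⁻¹ := by
    rw [ENNReal.ofReal_div_of_pos hcard, ENNReal.ofReal_natCast, div_eq_mul_inv]
  set B : ℝ≥0∞ := ((fball d n).card : ℝ≥0∞) with hB
  have hBt : B ≠ ∞ := ENNReal.natCast_ne_top _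
  set I := ∫⁻ x, potRem ψ φ (shift t x ω) ∂(unifB d (3 * n)) with hI
  calc B⁻¹ * ∑ x ∈ fball d n, ‖a x - ∑ y ∈ fball d n, η y * a y‖ₑ
      ≤ B⁻¹ * (ENNReal.ofReal C * B⁻¹ * (((4 * d + 1) ^ d : ℕ) * B * ((2 * n : ℕ)
          * (((6 * d + 1) ^ d : ℕ) * B * I)))) := by
        gcongr
        refine (sum_enorm_sub_bump_le a hη).trans ?_
        rw [hC', hgrad]
        gcongr
        exact sum_fball_le_lintegral_unifB hd n _
    _ = (B⁻¹ * B) * (B⁻¹ * B) * (ENNReal.ofReal C * ((4 * d + 1) ^ d * (6 * d + 1) ^ d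
          * (2 * n) : ℕ) * I) := by
        push_cast
        ring
    _ = _ := by
        rw [ENNReal.inv_mul_cancel hcard0 hBt, one_mul, one_mul]

/-- The spatial oscillation around a weighted mean. -/
theorem lintegral_lintegral_enorm_sub_bump_le (hd : d ≠ 0) {C : ℝ} {n : ℕ} (hn : 1 ≤ n)
    {η : ZLat d → ℝ} (hη : IsBump C n η) {ω : Env d} {X : ℝ → ZLat d → ℝ}
    (hX : ∀ᵐ t : ℝ, ∀ x (z : Nbr d), X t (x + z) = X t x - ψ (shift t x ω, z))
    {φ : Env d → ℝ} {M : ℝ} (hM : ∀ ω, |φ ω| ≤ M) :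
    ∫⁻ t, ∫⁻ x, ‖X t x - ∑ y ∈ fball d n, η y * X t y‖ₑ ∂(unifB d n) ∂(unifT n)
      ≤ 9 * (ENNReal.ofReal C * ((4 * d + 1) ^ d * (6 * d + 1) ^ d * (2 * n) : ℕ))
          * maxFun (potRem ψ φ) ω + ENNReal.ofReal (2 * M) := by
  have := isProbabilityMeasure_unifT (N := n) hn
  have hac : ∀ᵐ t ∂(unifT n), ∀ x (z : Nbr d), X t (x + z) = X t x - ψ (shift t x ω, z) := by
    unfold unifT ProbabilityTheory.cond
    exact Measure.ae_smul_measure (ae_restrict_of_ae hX) _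
  calc _ ≤ ∫⁻ t, (ENNReal.ofReal C * ((4 * d + 1) ^ d * (6 * d + 1) ^ d * (2 * n) : ℕ)
          * ∫⁻ x, potRem ψ φ (shift t x ω) ∂(unifB d (3 * n)) + ENNReal.ofReal (2 * M))
            ∂(unifT n) :=
        lintegral_mono_ae (hac.mono fun t ht =>
          lintegral_enorm_sub_bump_le_of_step hd hη ht hM)
    _ = ENNReal.ofReal C * ((4 * d + 1) ^ d * (6 * d + 1) ^ d * (2 * n) : ℕ)
          * ∫⁻ t, ∫⁻ x, potRem ψ φ (shift t x ω) ∂(unifB d (3 * n)) ∂(unifT n)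
          + ENNReal.ofReal (2 * M) := by
        rw [lintegral_add_right _ measurable_const, lintegral_const, measure_univ, mul_one,
          lintegral_const_mul' _ _
            (ENNReal.mul_ne_top ENNReal.ofReal_ne_top (ENNReal.natCast_ne_top _))]
    _ ≤ ENNReal.ofReal C * ((4 * d + 1) ^ d * (6 * d + 1) ^ d * (2 * n) : ℕ)
          * (9 * maxFun (potRem ψ φ) ω) + ENNReal.ofReal (2 * M) := by
        gcongr
        refine (lintegral_unifT_le_three_mul hn _).trans ?_
        gcongr
        exact le_maxFun _ _ (by omega)
    _ = _ := by ring

/-- The drift is the divergence of the antisymmetric flux, so the summation by parts estimate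
applies. Spatial invariance makes h constant along the spatial orbit at the given time, as that
estimate requires. -/
theorem enorm_sum_bump_mul_drift_le {C : ℝ} (hC : 0 < C) {n : ℕ} {η : ZLat d → ℝ}
    (hη : IsBump C n η) {ω : Env d} {s : ℝ}
    (hanti : ∀ (y : ZLat d) (z : Nbr d), flux hP q ψ z.neg (shift 0 z (shift s y ω))
      = -flux hP q ψ z (shift s y ω)) {h : Nbr d → Env d → ℝ} {g : Nbr d → Nbr d → Env d → ℝ}
    (hinv : ∀ (y : ZLat d) (z w : Nbr d), h z (shift 0 w (shift s y ω)) = h z (shift s y ω)) :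
    ‖∑ y ∈ fball d n, η y * drift hP q ψ (shift s y ω)‖ₑ
      ≤ ENNReal.ofReal (C / ((n : ℝ) ^ 2 * (fball d n).card))
          * ∑ y ∈ fball d (n + 2), (∑ z, ∑ w, ‖g z w (shift s y ω)‖ₑ)
        + ENNReal.ofReal (C / (n * (fball d n).card))
          * ∑ y ∈ fball d (n + 2), ∑ z, ‖flux hP q ψ z (shift s y ω) - h z (shift s y ω)
            - ∑ w : Nbr d, (g z w (shift 0 w (shift s y ω)) - g z w (shift s y ω))‖ₑ := by
  have hconst : ∀ z (y : ZLat d), h z (shift s y ω) = h z (shift s 0 ω) := by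
    intro z
    refine lattice_induction (Q := fun y => h z (shift s y ω) = h z (shift s 0 ω)) rfl ?_
    intro x w hx
    rw [← hx, ← hinv x z w, shift_shift, zero_add, add_comm x]
  have key := abs_sum_bump_mul_div_le hη (f := fun z y => flux hP q ψ z (shift s y ω))
    (fun y z => by
      have := hanti y z
      rwa [shift_shift, zero_add, add_comm (z : ZLat d)] at this)
    (fun z => h z (shift s 0 ω)) (fun z w y => g z w (shift s y ω))
    (fun z y => flux hP q ψ z (shift s y ω) - h z (shift s y ω)
            - ∑ w : Nbr d, (g z w (shift 0 w (shift s y ω)) - g z w (shift s y ω)))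
    (fun y z => by
      simp only [hconst z y, shift_shift, zero_add, add_comm _ y]
      ring)
  have := ENNReal.ofReal_le_ofReal key
  rw [← Real.enorm_eq_ofReal_abs] at this
  refine this.trans ?_
  rw [ENNReal.ofReal_add (by positivity) (by positivity), ENNReal.ofReal_mul (by positivity),
    ENNReal.ofReal_mul (by positivity), ENNReal.ofReal_sum_of_nonneg (fun _ _ => by positivity),
    ENNReal.ofReal_sum_of_nonneg (fun _ _ => by positivity)]
  gcongr with y _ y _
  · rw [ENNReal.ofReal_sum_of_nonneg (fun _ _ => by positivity)]
    refine Finset.sum_le_sum fun z _ => ?_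
    rw [ENNReal.ofReal_sum_of_nonneg (fun _ _ => by positivity)]
    simp only [Real.enorm_eq_ofReal_abs]
    exact le_rfl
  · rw [ENNReal.ofReal_sum_of_nonneg (fun _ _ => by positivity)]
    simp only [Real.enorm_eq_ofReal_abs]
    exact le_rfl

theorem setLIntegral_sum_fball_le (hd : d ≠ 0) {n : ℕ} (hn : 1 ≤ n) (F : Env d → ℝ≥0∞) (ω : Env d) :
    ∫⁻ s in Set.Icc (0 : ℝ) ((n : ℝ) ^ 2), ∑ y ∈ fball d (n + 2), F (shift s y ω)
      ≤ ENNReal.ofReal (9 * (n : ℝ) ^ 2 * ((6 * d + 1) ^ d * (fball d n).card)) * maxFun F ω := by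
  have hn' : (0 : ℝ) < n := by exact_mod_cast hn
  have h1 : ∀ s, ∑ y ∈ fball d (n + 2), F (shift s y ω)
      ≤ ((6 * d + 1) ^ d : ℕ) * (fball d n).card * ∫⁻ x, F (shift s x ω) ∂(unifB d (3 * n)) :=
    fun s => (Finset.sum_le_sum_of_subset (fball_mono (by omega))).trans
      (sum_fball_le_lintegral_unifB hd n _)
  have h0 : ENNReal.ofReal (((3 * n : ℕ) : ℝ) ^ 2) ≠ 0 := by
    rw [ne_eq, ENNReal.ofReal_eq_zero, not_le]
    push_cast
    positivity
  calc _ ≤ ∫⁻ s in Set.Icc (0 : ℝ) (((3 * n : ℕ) : ℝ) ^ 2), ((6 * d + 1) ^ d : ℕ) *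
          (fball d n).card * ∫⁻ x, F (shift s x ω) ∂(unifB d (3 * n)) := by
        refine (lintegral_mono h1).trans (lintegral_mono_set (Set.Icc_subset_Icc le_rfl ?_))
        push_cast
        nlinarith
    _ = ((6 * d + 1) ^ d : ℕ) * (fball d n).card * (ENNReal.ofReal (((3 * n : ℕ) : ℝ) ^ 2) *
          ∫⁻ s, ∫⁻ x, F (shift s x ω) ∂(unifB d (3 * n)) ∂(unifT (3 * n))) := by
        rw [lintegral_const_mul' _ _
          (ENNReal.mul_ne_top (ENNReal.natCast_ne_top _) (ENNReal.natCast_ne_top _)),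
          lintegral_unifT, ← mul_assoc (ENNReal.ofReal _),
          ENNReal.mul_inv_cancel h0 ENNReal.ofReal_ne_top, one_mul]
    _ ≤ ((6 * d + 1) ^ d : ℕ) * (fball d n).card * (ENNReal.ofReal (((3 * n : ℕ) : ℝ) ^ 2) *
          maxFun F ω) := by
        gcongr
        exact le_maxFun _ _ (by omega)
    _ = _ := by
        rw [← mul_assoc]
        congr 1
        rw [← Nat.cast_mul, ← ENNReal.ofReal_natCast, ← ENNReal.ofReal_mul (by positivity)]
        congr 1
        push_cast
        ring

/-- The oscillation in time of the weighted mean. -/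
theorem enorm_sum_bump_mul_integral_drift_le (hd : d ≠ 0) {C : ℝ} (hC : 0 < C) {n : ℕ} (hn : 1 ≤ n)
    {η : ZLat d → ℝ} (hη : IsBump C n η) {ω : Env d}
    (hloc : ∀ x : ZLat d, LocallyIntegrable (fun s => drift hP q ψ (shift s x ω)) volume)
    (hanti : ∀ᵐ s : ℝ, ∀ (y : ZLat d) (z : Nbr d), flux hP q ψ z.neg (shift 0 z (shift s y ω))
      = -flux hP q ψ z (shift s y ω)) {h : Nbr d → Env d → ℝ} {g : Nbr d → Nbr d → Env d → ℝ}
    (hinv : ∀ᵐ s : ℝ, ∀ (y : ZLat d) (z w : Nbr d),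
      h z (shift 0 w (shift s y ω)) = h z (shift s y ω))
    (hg : Measurable fun s => ∑ y ∈ fball d (n + 2), ∑ z, ∑ w, ‖g z w (shift s y ω)‖ₑ)
    {t : ℝ} (ht : t ∈ Set.Icc (0 : ℝ) ((n : ℝ) ^ 2)) :
    ‖∑ y ∈ fball d n, η y * ∫ s in (0 : ℝ)..t, drift hP q ψ (shift s y ω)‖ₑ
      ≤ ENNReal.ofReal (9 * C * (6 * d + 1) ^ d)
          * (maxFun (fun ω => ∑ z, ∑ w, ‖g z w ω‖ₑ) ω
            + n * maxFun (fun ω => ∑ z, ‖flux hP q ψ z ω - h z ω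
              - ∑ w : Nbr d, (g z w (shift 0 w ω) - g z w ω)‖ₑ) ω) := by
  have hn' : (0 : ℝ) < n := by exact_mod_cast hn
  have hcard : (0 : ℝ) < (fball d n).card := by exact_mod_cast fball_card_pos n
  have h1 : ∑ y ∈ fball d n, η y * ∫ s in (0 : ℝ)..t, drift hP q ψ (shift s y ω)
      = ∫ s in (0 : ℝ)..t, ∑ y ∈ fball d n, η y * drift hP q ψ (shift s y ω) := by
    rw [intervalIntegral.integral_finsetSum fun y _ =>
      (intervalIntegrable_of_locallyIntegrable (hloc y) 0 t).const_mul (η y)]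
    simp only [intervalIntegral.integral_const_mul]
  rw [h1, intervalIntegral.integral_of_le ht.1]
  refine (enorm_integral_le_lintegral_enorm _).trans ?_
  set G : Env d → ℝ≥0∞ := fun ω => ∑ z, ∑ w, ‖g z w ω‖ₑ with hG
  set E : Env d → ℝ≥0∞ := fun ω => ∑ z, ‖flux hP q ψ z ω - h z ω
    - ∑ w : Nbr d, (g z w (shift 0 w ω) - g z w ω)‖ₑ with hE
  calc ∫⁻ s in Set.Ioc (0 : ℝ) t, ‖∑ y ∈ fball d n, η y * drift hP q ψ (shift s y ω)‖ₑ
      ≤ ∫⁻ s in Set.Icc (0 : ℝ) ((n : ℝ) ^ 2),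
          (ENNReal.ofReal (C / ((n : ℝ) ^ 2 * (fball d n).card))
            * ∑ y ∈ fball d (n + 2), G (shift s y ω)
          + ENNReal.ofReal (C / (n * (fball d n).card))
            * ∑ y ∈ fball d (n + 2), E (shift s y ω)) := by
        refine le_trans ?_ (lintegral_mono_set (μ := volume)
          (Set.Ioc_subset_Icc_self.trans (Set.Icc_subset_Icc le_rfl ht.2)))
        refine lintegral_mono_ae (ae_restrict_of_ae ?_)
        filter_upwards [hanti, hinv] with s hs1 hs2
        exact enorm_sum_bump_mul_drift_le hC hη hs1 hs2
    _ = ENNReal.ofReal (C / ((n : ℝ) ^ 2 * (fball d n).card))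
            * (∫⁻ s in Set.Icc (0 : ℝ) ((n : ℝ) ^ 2), ∑ y ∈ fball d (n + 2), G (shift s y ω))
          + ENNReal.ofReal (C / (n * (fball d n).card))
            * (∫⁻ s in Set.Icc (0 : ℝ) ((n : ℝ) ^ 2), ∑ y ∈ fball d (n + 2), E (shift s y ω)) := by
        rw [lintegral_add_left (hg.const_mul _), lintegral_const_mul' _ _ ENNReal.ofReal_ne_top,
          lintegral_const_mul' _ _ ENNReal.ofReal_ne_top]
    _ ≤ ENNReal.ofReal (C / ((n : ℝ) ^ 2 * (fball d n).card))
            * (ENNReal.ofReal (9 * (n : ℝ) ^ 2 * ((6 * d + 1) ^ d * (fball d n).card)) * maxFun G ω)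
          + ENNReal.ofReal (C / (n * (fball d n).card))
            * (ENNReal.ofReal (9 * (n : ℝ) ^ 2 * ((6 * d + 1) ^ d * (fball d n).card))
              * maxFun E ω) := by
        gcongr
        · exact setLIntegral_sum_fball_le hd hn G ω
        · exact setLIntegral_sum_fball_le hd hn E ω
    _ = _ := by
        -- The time length n² cancels the n⁻² of the coboundary term, and leaves one factor n with
        -- the error term.
        have e1 : ENNReal.ofReal (C / ((n : ℝ) ^ 2 * (fball d n).card))
            * ENNReal.ofReal (9 * (n : ℝ) ^ 2 * ((6 * d + 1) ^ d * (fball d n).card))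
            = ENNReal.ofReal (9 * C * (6 * d + 1) ^ d) := by
          rw [← ENNReal.ofReal_mul (by positivity)]
          congr 1
          field_simp
        have e2 : ENNReal.ofReal (C / (n * (fball d n).card))
            * ENNReal.ofReal (9 * (n : ℝ) ^ 2 * ((6 * d + 1) ^ d * (fball d n).card))
            = ENNReal.ofReal (9 * C * (6 * d + 1) ^ d) * n := by
          rw [← ENNReal.ofReal_natCast n, ← ENNReal.ofReal_mul (by positivity),
            ← ENNReal.ofReal_mul (by positivity)]
          congr 1
          field_simp
        rw [← mul_assoc (ENNReal.ofReal (C / _)) _ (maxFun G ω),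
          ← mul_assoc (ENNReal.ofReal (C / _)) _ (maxFun E ω), e1, e2]
        ring

theorem lintegral_potRem_le (hC : IsCorrector hP q ψ φ χ) (k : ℕ) :
    ∫⁻ ω, potRem ψ (φ k) ω ∂P ≤ Fintype.card (Nbr d) * (4 : ℝ≥0∞)⁻¹ ^ k := by
  unfold potRem
  have hm : ∀ z : Nbr d, Measurable fun ω => ‖ψ (ω, z) - hgrad (φ k) (ω, z)‖ₑ := fun z =>
    (((measurable_coeFn_mMeasure ψ).comp measurable_prodMk_right).sub (((hC.measurable_potential k).comp
      (hP.measurable_shift' 0 z)).sub (hC.measurable_potential k))).enorm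
  rw [lintegral_finsetSum _ fun z _ => hm z]
  refine (Finset.sum_le_card_nsmul _ _ _ fun z _ => hC.approx k z).trans ?_
  rw [nsmul_eq_mul, Finset.card_univ]

theorem measurable_potRem (hC : IsCorrector hP q ψ φ χ) (k : ℕ) :
    Measurable (potRem ψ (φ k)) := by
  unfold potRem
  have hm : ∀ z : Nbr d, Measurable fun ω => ‖ψ (ω, z) - hgrad (φ k) (ω, z)‖ₑ := fun z =>
    (((measurable_coeFn_mMeasure ψ).comp measurable_prodMk_right).sub (((hC.measurable_potential k).comp
      (hP.measurable_shift' 0 z)).sub (hC.measurable_potential k))).enorm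
  exact Finset.measurable_fun_sum _ fun z _ => hm z

/-- The corrector is close in mean to a constant on large cylinders. -/
theorem lintegral_lintegral_enorm_corrField_sub_le (hd : d ≠ 0) {C : ℝ} (hC : 0 < C) {n : ℕ}
    (hn : 1 ≤ n) {η : ZLat d → ℝ} (hη : IsBump C n η) {ω : Env d}
    (hX : ∀ᵐ t : ℝ, ∀ x (z : Nbr d), corrField χ (drift hP q ψ) ω t (x + z)
      = corrField χ (drift hP q ψ) ω t x - ψ (shift t x ω, z))
    {φ : Env d → ℝ} {M : ℝ} (hM : ∀ ω, |φ ω| ≤ M)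
    (hloc : ∀ x : ZLat d, LocallyIntegrable (fun s => drift hP q ψ (shift s x ω)) volume)
    (hanti : ∀ᵐ s : ℝ, ∀ (y : ZLat d) (z : Nbr d), flux hP q ψ z.neg (shift 0 z (shift s y ω))
      = -flux hP q ψ z (shift s y ω)) {h : Nbr d → Env d → ℝ} {g : Nbr d → Nbr d → Env d → ℝ}
    (hinv : ∀ᵐ s : ℝ, ∀ (y : ZLat d) (z w : Nbr d),
      h z (shift 0 w (shift s y ω)) = h z (shift s y ω))
    (hg : ∀ z w, Measurable (g z w)) :
    ∫⁻ t, ∫⁻ x, ‖corrField χ (drift hP q ψ) ω t x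
        - ∑ y ∈ fball d n, η y * corrField χ (drift hP q ψ) ω 0 y‖ₑ ∂(unifB d n) ∂(unifT n)
      ≤ 9 * (ENNReal.ofReal C * ((4 * d + 1) ^ d * (6 * d + 1) ^ d * (2 * n) : ℕ))
          * maxFun (potRem ψ φ) ω + ENNReal.ofReal (2 * M)
        + ENNReal.ofReal (9 * C * (6 * d + 1) ^ d)
          * (maxFun (fun ω => ∑ z, ∑ w, ‖g z w ω‖ₑ) ω
            + n * maxFun (fun ω => ∑ z, ‖flux hP q ψ z ω - h z ω
              - ∑ w : Nbr d, (g z w (shift 0 w ω) - g z w ω)‖ₑ) ω) := by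
  set X := corrField χ (drift hP q ψ) ω with hXdef
  have hgm : Measurable fun s => ∑ y ∈ fball d (n + 2), ∑ z, ∑ w, ‖g z w (shift s y ω)‖ₑ :=
    Finset.measurable_fun_sum _ fun y _ => Finset.measurable_fun_sum _ fun z _ =>
      Finset.measurable_fun_sum _ fun w _ => ((hg z w).comp (hP.measurable_orbit y ω)).enorm
  set D : ℝ≥0∞ := ENNReal.ofReal (9 * C * (6 * d + 1) ^ d)
          * (maxFun (fun ω => ∑ z, ∑ w, ‖g z w ω‖ₑ) ω
            + n * maxFun (fun ω => ∑ z, ‖flux hP q ψ z ω - h z ω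
              - ∑ w : Nbr d, (g z w (shift 0 w ω) - g z w ω)‖ₑ) ω) with hD
  have hpt : ∀ t ∈ Set.Icc (0 : ℝ) ((n : ℝ) ^ 2), ∫⁻ x, ‖X t x - ∑ y ∈ fball d n, η y * X 0 y‖ₑ
      ∂(unifB d n) ≤ ∫⁻ x, ‖X t x - ∑ y ∈ fball d n, η y * X t y‖ₑ ∂(unifB d n) + D := by
    intro t ht
    have h2 : ∑ y ∈ fball d n, η y * X t y - ∑ y ∈ fball d n, η y * X 0 y
        = -∑ y ∈ fball d n, η y * ∫ s in (0 : ℝ)..t, drift hP q ψ (shift s y ω) := by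
      rw [← Finset.sum_sub_distrib, ← Finset.sum_neg_distrib]
      refine Finset.sum_congr rfl fun y _ => ?_
      simp only [hXdef, corrField, intervalIntegral.integral_same]
      ring
    have h3 : ‖∑ y ∈ fball d n, η y * X t y - ∑ y ∈ fball d n, η y * X 0 y‖ₑ ≤ D := by
      rw [h2, enorm_neg]
      exact enorm_sum_bump_mul_integral_drift_le hd hC hn hη hloc hanti hinv hgm ht
    calc _ ≤ ∫⁻ x, (‖X t x - ∑ y ∈ fball d n, η y * X t y‖ₑ + D) ∂(unifB d n) := by
          refine lintegral_mono fun x => ?_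
          refine le_trans ?_ (add_le_add le_rfl h3)
          refine le_trans (le_of_eq ?_) (enorm_add_le _ _)
          congr 1
          ring
      _ = _ := by
          rw [lintegral_add_right _ measurable_const, lintegral_const, measure_univ, mul_one]
  have := isProbabilityMeasure_unifT (N := n) hn
  calc _ ≤ ∫⁻ t, (∫⁻ x, ‖X t x - ∑ y ∈ fball d n, η y * X t y‖ₑ ∂(unifB d n) + D) ∂(unifT n) :=
        lintegral_mono_ae (ae_unifT n hpt)
    _ = ∫⁻ t, ∫⁻ x, ‖X t x - ∑ y ∈ fball d n, η y * X t y‖ₑ ∂(unifB d n) ∂(unifT n) + D := by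
        rw [lintegral_add_right _ measurable_const, lintegral_const, measure_univ, mul_one]
    _ ≤ _ := add_le_add (lintegral_lintegral_enorm_sub_bump_le hd hn hη hX hM) le_rfl

/-- Sublinearity of the corrector in mean. -/
theorem IsCorrector.ae_mean_sublinear (hd : d ≠ 0) (hC : IsCorrector hP q ψ φ χ) :
    ∀ᵐ ω ∂P, ∀ ε : ℝ≥0∞, ε ≠ 0 → ∀ᶠ n : ℕ in atTop, ∃ c : ℝ,
      (∀ A : ℝ, (∀ y ∈ fball d n, |corrField χ (drift hP q ψ) ω 0 y| ≤ A) → |c| ≤ A) ∧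
      ∫⁻ t, ∫⁻ x, ‖corrField χ (drift hP q ψ) ω t x - c‖ₑ ∂(unifB d n) ∂(unifT n) ≤ ε * n := by
  obtain ⟨C, hCp, hbump⟩ := exists_isBump hd
  choose M hM using hC.bounded_potential
  have hdec := fun (k : ℕ) (z : Nbr d) => exists_invariant_add_coboundary hP
    (integrable_flux hP q ψ z) (δ := (4 : ℝ≥0∞)⁻¹ ^ k) (pow_ne_zero _ (by simp))
  choose h g hhm hgm hgi hinv hE using hdec
  have hEm : ∀ k, Measurable fun ω => ∑ z, ‖flux hP q ψ z ω - h k z ω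
      - ∑ w : Nbr d, (g k z w (shift 0 w ω) - g k z w ω)‖ₑ := fun k =>
    Finset.measurable_fun_sum _ fun z _ => (((measurable_flux hP q ψ z).sub (hhm k z)).sub
      (Finset.measurable_fun_sum _ fun w _ =>
        ((hgm k z w).comp (hP.measurable_shift' 0 w)).sub (hgm k z w))).enorm
  have hEi : ∀ k, ∫⁻ ω, ∑ z, ‖flux hP q ψ z ω - h k z ω
      - ∑ w : Nbr d, (g k z w (shift 0 w ω) - g k z w ω)‖ₑ ∂P
      ≤ Fintype.card (Nbr d) * (4 : ℝ≥0∞)⁻¹ ^ k := by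
    intro k
    have hm : ∀ z, Measurable fun ω => ‖flux hP q ψ z ω - h k z ω
      - ∑ w : Nbr d, (g k z w (shift 0 w ω) - g k z w ω)‖ₑ := fun z =>
        (((measurable_flux hP q ψ z).sub (hhm k z)).sub
      (Finset.measurable_fun_sum _ fun w _ =>
        ((hgm k z w).comp (hP.measurable_shift' 0 w)).sub (hgm k z w))).enorm
    rw [lintegral_finsetSum _ fun z _ => hm z]
    refine (Finset.sum_le_card_nsmul _ _ _ fun z _ => hE k z).trans ?_
    rw [nsmul_eq_mul, Finset.card_univ]
  have hGm : ∀ k, Measurable fun ω => ∑ z, ∑ w, ‖g k z w ω‖ₑ := fun k =>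
    Finset.measurable_fun_sum _ fun z _ => Finset.measurable_fun_sum _ fun w _ => (hgm k z w).enorm
  have hGi : ∀ k, ∫⁻ ω, ∑ z, ∑ w, ‖g k z w ω‖ₑ ∂P ≠ ∞ := by
    intro k
    have hm : ∀ z, Measurable fun ω => ∑ w, ‖g k z w ω‖ₑ := fun z =>
      Finset.measurable_fun_sum _ fun w _ => (hgm k z w).enorm
    rw [lintegral_finsetSum _ fun z _ => hm z]
    refine ENNReal.sum_ne_top.mpr fun z _ => ?_
    rw [lintegral_finsetSum _ fun w _ => (hgm k z w).enorm]
    exact ENNReal.sum_ne_top.mpr fun w _ => (hgi k z w).2.ne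
  have hinv' : ∀ᵐ ω ∂P, ∀ k, ∀ᵐ s : ℝ, ∀ (y : ZLat d) (z w : Nbr d),
      h k z (shift 0 w (shift s y ω)) = h k z (shift s y ω) := by
    refine ae_all_iff.mpr fun k => ?_
    filter_upwards [hP.ae_ae_shift (ae_all_iff.mpr (hinv k))] with ω hω
    filter_upwards [hω] with s hs y z w
    exact hs y z w
  have hcard : (Fintype.card (Nbr d) : ℝ≥0∞) ≠ ∞ := ENNReal.natCast_ne_top _
  filter_upwards [ae_eventually_maxFun_le hd hP (measurable_potRem hC) hcard
      (lintegral_potRem_le hC), ae_eventually_maxFun_le hd hP hEm hcard hEi,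
    ae_all_iff.mpr fun k => ae_maxFun_lt_top hd hP (hGm k) (hGi k), hC.corrField_step,
    ae_locallyIntegrable_drift hP q ψ, hP.ae_ae_shift (flux_antisymm hP hC.odd hC.mem), hinv']
    with ω hF hE' hG hstep hloc hanti hinv'' ε hε
  set K₁ : ℝ≥0∞ := 9 * (ENNReal.ofReal C * ((4 * d + 1) ^ d * (6 * d + 1) ^ d * 2 : ℕ)) with hK₁
  set K₂ : ℝ≥0∞ := ENNReal.ofReal (9 * C * (6 * d + 1) ^ d) with hK₂
  have hK₁t : K₁ ≠ ∞ := ENNReal.mul_ne_top (by simp)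
    (ENNReal.mul_ne_top ENNReal.ofReal_ne_top (ENNReal.natCast_ne_top _))
  have hε2 : ε / 2 ≠ 0 := by simpa using hε
  have hlim : Tendsto (fun k : ℕ => (K₁ + K₂) * (2 : ℝ≥0∞)⁻¹ ^ k) atTop (𝓝 0) := by
    have := ENNReal.Tendsto.const_mul (a := K₁ + K₂)
      (ENNReal.tendsto_pow_atTop_nhds_zero_of_lt_one (r := (2 : ℝ≥0∞)⁻¹) (by norm_num))
      (Or.inr (ENNReal.add_ne_top.mpr ⟨hK₁t, ENNReal.ofReal_ne_top⟩))
    rwa [mul_zero] at this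
  -- The approximation index k is fixed first, so that the coefficient of n is at most ε/2. The
  -- constants depending on k, namely the bound of the potential and the maximal function of the
  -- coboundary, are then absorbed by taking n large.
  obtain ⟨k, hk1, hk2, hk3⟩ := (hF.and (hE'.and
    (hlim.eventually (gt_mem_nhds (pos_iff_ne_zero.mpr hε2))))).exists
  set D : ℝ≥0∞ := ENNReal.ofReal (2 * M k) + K₂ * maxFun (fun ω => ∑ z, ∑ w, ‖g k z w ω‖ₑ) ω
    with hD
  have hDt : D ≠ ∞ := ENNReal.add_ne_top.mpr ⟨ENNReal.ofReal_ne_top,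
    ENNReal.mul_ne_top ENNReal.ofReal_ne_top (hG k).ne⟩
  have hDn : ∀ᶠ n : ℕ in atTop, D ≤ ε / 2 * n := by
    have h1 : D / (ε / 2) < ∞ := ENNReal.div_lt_top hDt hε2
    filter_upwards [ENNReal.tendsto_nat_nhds_top.eventually (lt_mem_nhds h1),
      eventually_ge_atTop 1] with n hn hn1
    have := (ENNReal.div_le_iff_le_mul (Or.inl hε2) (Or.inr (by
      exact_mod_cast (by omega : n ≠ 0)))).mp hn.le
    rwa [mul_comm] at this
  filter_upwards [hDn, eventually_ge_atTop (2 * d), eventually_ge_atTop 1] with n hn hnd hn1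
  obtain ⟨η, hη⟩ := hbump n hnd
  refine ⟨∑ y ∈ fball d n, η y * corrField χ (drift hP q ψ) ω 0 y, ?_, ?_⟩
  · intro A hA
    refine (Finset.abs_sum_le_sum_abs _ _).trans ?_
    calc ∑ y ∈ fball d n, |η y * corrField χ (drift hP q ψ) ω 0 y|
        ≤ ∑ y ∈ fball d n, η y * A := by
          refine Finset.sum_le_sum fun y hy => ?_
          rw [abs_mul, abs_of_nonneg (hη.nonneg y)]
          exact mul_le_mul_of_nonneg_left (hA y hy) (hη.nonneg y)
      _ = A := by rw [← Finset.sum_mul, hη.sum_eq, one_mul]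
  · refine (lintegral_lintegral_enorm_corrField_sub_le hd hCp hn1 hη hstep (hM k) hloc
      hanti (hinv'' k) (hgm k)).trans ?_
    calc _ ≤ K₁ * n * (2 : ℝ≥0∞)⁻¹ ^ k + ENNReal.ofReal (2 * M k)
          + K₂ * (maxFun (fun ω => ∑ z, ∑ w, ‖g k z w ω‖ₑ) ω + n * (2 : ℝ≥0∞)⁻¹ ^ k) := by
          have e : 9 * (ENNReal.ofReal C * ((4 * d + 1) ^ d * (6 * d + 1) ^ d * (2 * n) : ℕ))
              = K₁ * n := by
            rw [hK₁]
            push_cast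
            ring
          rw [e]
          gcongr
      _ = (K₁ + K₂) * (2 : ℝ≥0∞)⁻¹ ^ k * n + D := by
          rw [hD]
          ring
      _ ≤ ε / 2 * n + ε / 2 * n := by
          gcongr
      _ = ε * n := by rw [← add_mul, ENNReal.add_halves]

end MeanSublinear

/-! ### Sublinearity of the corrector -/

section Affine

variable {d : ℕ}

theorem absolutelyContinuousOnInterval_const {E : Type*} [PseudoMetricSpace E] (c : E) (a b : ℝ) :
    AbsolutelyContinuousOnInterval (fun _ : ℝ => c) a b :=
  (LipschitzWith.const (α := ℝ) c).lipschitzOnWith.absolutelyContinuousOnInterval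

theorem absolutelyContinuousOnInterval_integral {f : ℝ → ℝ} (hf : LocallyIntegrable f volume)
    (c a b : ℝ) : AbsolutelyContinuousOnInterval (fun t => ∫ s in c..t, f s) a b := by
  have h := (intervalIntegrable_of_locallyIntegrable hf (min (min a b) c)
    (max (max a b) c)).absolutelyContinuousOnInterval_intervalIntegral (c := c) (by
      rw [Set.uIcc_of_le ((min_le_right _ _).trans (le_max_right _ _))]
      exact ⟨min_le_right _ _, le_max_right _ _⟩)
  refine h.mono ?_
  rw [Set.uIcc_of_le ((min_le_right (min a b) c).trans (le_max_right (max a b) c))]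
  exact Set.Icc_subset_Icc (min_le_left _ _) (le_max_left _ _)

theorem IsCorrectorSolution.const_mul_sub {ω : Env d} {l : ZLat d → ℝ} {u : ℝ → ZLat d → ℝ}
    (hu : IsCorrectorSolution ω l u) (a c : ℝ) :
    IsCorrectorSolution ω (fun x => a * l x) (fun t x => a * (u t x - c)) := by
  refine ⟨fun x s t => ((hu.ac x s t).fun_sub
    (absolutelyContinuousOnInterval_const c s t)).const_mul a, ?_⟩
  filter_upwards [hu.hasDerivAt] with t ht x
  have := ((ht x).sub_const c).const_mul a
  refine this.congr_deriv ?_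
  rw [mul_neg, Finset.mul_sum]
  congr 1
  refine Finset.sum_congr rfl fun z _ => ?_
  ring

end Affine

/-! ### The corrector solves the equation. -/

section Regularity

variable {d : ℕ} [MeasurableSpace (Env d)] {P : Measure (Env d)} [IsProbabilityMeasure P]
  {hP : StationaryErgodicEnv P} {q : Nbr d → ℝ} {ψ : Lp ℝ 2 (mMeasure P)}
  {φ : ℕ → Env d → ℝ} {χ : Env d → ZLat d → ℝ}

/-- At a fixed point x the corrector is a constant minus the time integral of the locally integrable
drift at x, so it is differentiable at almost every time. Writing out the flux and replacing ψ by a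
step of the corrector gives the equation. -/
theorem IsCorrector.ae_isCorrectorSolution (hC : IsCorrector hP q ψ φ χ) {l : ZLat d → ℝ}
    (hl : ∀ z : Nbr d, l z = q z) :
    ∀ᵐ ω ∂P, IsCorrectorSolution ω l (corrField χ (drift hP q ψ) ω) := by
  filter_upwards [ae_locallyIntegrable_drift hP q ψ, hC.corrField_step, wver_ae_ae_eq hP]
    with ω hloc hstep hw
  refine ⟨fun x a b => (absolutelyContinuousOnInterval_const (-χ ω x) a b).fun_sub
    (absolutelyContinuousOnInterval_integral (hloc x) 0 a b), ?_⟩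
  have hder : ∀ᵐ t : ℝ, ∀ x : ZLat d, ∀ c, HasDerivAt
      (fun t => ∫ s in c..t, drift hP q ψ (shift s x ω)) (drift hP q ψ (shift t x ω)) t :=
    ae_all_iff.mpr fun x => LocallyIntegrable.ae_hasDerivAt_integral (hloc x)
  filter_upwards [hder, hstep, hw] with t h1 h2 h3 x
  have h4 := (h1 x 0).const_sub (-χ ω x)
  refine h4.congr_deriv ?_
  rw [drift, neg_inj]
  refine Finset.sum_congr rfl fun z _ => ?_
  rw [flux, h3, h2, hl]
  ring

end Regularity

/-! ### A priori polynomial growth. -/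

section Growth

variable {d : ℕ} [MeasurableSpace (Env d)] {P : Measure (Env d)} [IsProbabilityMeasure P]
  {hP : StationaryErgodicEnv P} {q : Nbr d → ℝ} {ψ : Lp ℝ 2 (mMeasure P)}
  {φ : ℕ → Env d → ℝ} {χ : Env d → ZLat d → ℝ}

/-- A single time slice is not controlled by space-time averages. Instead, the sum over all n,
weighted by (n+1)^{-(d+2)}, has finite mean, since the balls grow like n^d and ∑ n^{-2} converges.
-/
theorem ae_sum_fball_le (hP : StationaryErgodicEnv P) {F : Env d → ℝ≥0∞} (hF : Measurable F)
    (hFi : ∫⁻ ω, F ω ∂P ≠ ∞) :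
    ∀ᵐ ω ∂P, ∃ K : ℝ≥0∞, K ≠ ∞ ∧
      ∀ n : ℕ, ∑ x ∈ fball d n, F (shift 0 x ω) ≤ K * ((n + 1 : ℕ) : ℝ≥0∞) ^ (d + 2) := by
  set S : Env d → ℝ≥0∞ := fun ω => ∑' n : ℕ,
    (((n + 1 : ℕ) : ℝ≥0∞) ^ (d + 2))⁻¹ * ∑ x ∈ fball d n, F (shift 0 x ω) with hS
  have hSm : ∀ n : ℕ, Measurable fun ω =>
      (((n + 1 : ℕ) : ℝ≥0∞) ^ (d + 2))⁻¹ * ∑ x ∈ fball d n, F (shift 0 x ω) := fun n =>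
    (Finset.measurable_fun_sum _ fun x _ => hF.comp (hP.measurable_shift' 0 x)).const_mul _
  have hSi : ∫⁻ ω, S ω ∂P ≠ ∞ := by
    rw [hS, lintegral_tsum fun n => (hSm n).aemeasurable]
    have hterm : ∀ n : ℕ, ∫⁻ ω, (((n + 1 : ℕ) : ℝ≥0∞) ^ (d + 2))⁻¹
        * ∑ x ∈ fball d n, F (shift 0 x ω) ∂P
        ≤ (2 ^ d * ∫⁻ ω, F ω ∂P) * ENNReal.ofReal (1 / ((n + 1 : ℕ) : ℝ) ^ 2) := by
      intro n
      have hm : ∀ x : ZLat d, Measurable fun ω => F (shift 0 x ω) := fun x =>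
        hF.comp (hP.measurable_shift' 0 x)
      rw [lintegral_const_mul _ (Finset.measurable_fun_sum _ fun x _ => hm x),
        lintegral_finsetSum _ fun x _ => hm x]
      simp only [hP.lintegral_shift hF, Finset.sum_const, nsmul_eq_mul]
      have hc : ((fball d n).card : ℝ≥0∞) ≤ 2 ^ d * ((n + 1 : ℕ) : ℝ≥0∞) ^ d := by
        rw [← mul_pow]
        have h1 := (fball_card_le (d := d) n).trans
          (Nat.pow_le_pow_left (show 2 * n + 1 ≤ 2 * (n + 1) by omega) d)
        exact_mod_cast h1
      have hn0 : ((n + 1 : ℕ) : ℝ≥0∞) ^ d ≠ 0 := pow_ne_zero _ (by simp)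
      have hnt : ((n + 1 : ℕ) : ℝ≥0∞) ^ d ≠ ∞ := ENNReal.pow_ne_top (ENNReal.natCast_ne_top _)
      have he : ENNReal.ofReal (1 / ((n + 1 : ℕ) : ℝ) ^ 2) = (((n + 1 : ℕ) : ℝ≥0∞) ^ 2)⁻¹ := by
        rw [one_div, ENNReal.ofReal_inv_of_pos (by positivity), ENNReal.ofReal_pow (by positivity),
          ENNReal.ofReal_natCast]
      rw [he, pow_add, ENNReal.mul_inv (Or.inl hn0) (Or.inl hnt)]
      calc _ ≤ (((n + 1 : ℕ) : ℝ≥0∞) ^ d)⁻¹ * (((n + 1 : ℕ) : ℝ≥0∞) ^ 2)⁻¹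
            * (2 ^ d * ((n + 1 : ℕ) : ℝ≥0∞) ^ d * ∫⁻ ω, F ω ∂P) := by gcongr
        _ = ((((n + 1 : ℕ) : ℝ≥0∞) ^ d)⁻¹ * ((n + 1 : ℕ) : ℝ≥0∞) ^ d)
            * ((2 ^ d * ∫⁻ ω, F ω ∂P) * (((n + 1 : ℕ) : ℝ≥0∞) ^ 2)⁻¹) := by ring
        _ = _ := by rw [ENNReal.inv_mul_cancel hn0 hnt, one_mul]
    refine ((ENNReal.tsum_le_tsum hterm).trans_lt ?_).ne
    rw [ENNReal.tsum_mul_left]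
    refine ENNReal.mul_lt_top (ENNReal.mul_lt_top (ENNReal.pow_lt_top (by simp)) hFi.lt_top) ?_
    have hsum : Summable fun n : ℕ => 1 / ((n + 1 : ℕ) : ℝ) ^ 2 :=
      (summable_nat_add_iff 1).mpr (Real.summable_one_div_nat_pow.mpr one_lt_two)
    rw [← ENNReal.ofReal_tsum_of_nonneg (fun n => by positivity) hsum]
    exact ENNReal.ofReal_lt_top
  filter_upwards [ae_lt_top (Measurable.tsum hSm) hSi] with ω hω
  refine ⟨S ω, hω.ne, fun n => ?_⟩
  have h1 := ENNReal.le_tsum (f := fun n : ℕ =>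
    (((n + 1 : ℕ) : ℝ≥0∞) ^ (d + 2))⁻¹ * ∑ x ∈ fball d n, F (shift 0 x ω)) n
  have h2 : (((n + 1 : ℕ) : ℝ≥0∞) ^ (d + 2))⁻¹ * ∑ x ∈ fball d n, F (shift 0 x ω) ≤ S ω := h1
  rwa [mul_comm, ← div_eq_mul_inv, ENNReal.div_le_iff (pow_ne_zero _ (by simp))
    (ENNReal.pow_ne_top (ENNReal.natCast_ne_top _))] at h2

/-- The corrector grows at most polynomially. -/
theorem IsCorrector.ae_polynomial_growth (hd : d ≠ 0) (hC : IsCorrector hP q ψ φ χ) :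
    ∀ᵐ ω ∂P, ∃ K : ℝ, 0 ≤ K ∧ ∀ n : ℕ, 1 ≤ n → ∀ t ∈ Set.Icc (0 : ℝ) ((n : ℝ) ^ 2),
      ∀ x ∈ fball d n, |corrField χ (drift hP q ψ) ω t x| ≤ K * (n + 1 : ℝ) ^ (d + 3) := by
  have := isFiniteMeasure_mMeasure hP
  have hVm := measurable_drift hP q ψ
  have hVi := integrable_drift hP q ψ
  have hψm : ∀ z : Nbr d, Measurable fun ω => ‖ψ (ω, z)‖ₑ := fun z =>
    ((measurable_coeFn_mMeasure ψ).comp measurable_prodMk_right).enorm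
  have hψi : ∫⁻ ω, ∑ z : Nbr d, ‖ψ (ω, z)‖ₑ ∂P ≠ ∞ := by
    rw [lintegral_finsetSum _ fun z _ => hψm z]
    exact ENNReal.sum_ne_top.mpr fun z _ =>
      (integrable_of_memLp_mMeasure hP (measurable_coeFn_mMeasure ψ) (Lp.memLp ψ) z).2.ne
  filter_upwards [hC.step, ae_maxFun_lt_top hd hP hVm.enorm hVi.2.ne,
    ae_sum_fball_le hP (Finset.measurable_fun_sum _ fun z _ => hψm z) hψi] with ω h1 hV ⟨K, hK, hKn⟩
  set D : ℝ≥0∞ := ENNReal.ofReal (9 * (6 * d + 1) ^ d * 2 ^ d)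
    * maxFun (fun ω => ‖drift hP q ψ ω‖ₑ) ω with hD
  have hDt : D ≠ ∞ := ENNReal.mul_ne_top ENNReal.ofReal_ne_top hV.ne
  refine ⟨(K + D).toReal, ENNReal.toReal_nonneg, fun n hn t ht x hx => ?_⟩
  have hKD : K + D ≠ ∞ := ENNReal.add_ne_top.mpr ⟨hK, hDt⟩
  -- A path of length at most n inside B(n) crosses edges each bounded by the full gradient sum;
  -- this crude bound suffices.
  have hχ : ‖χ ω x‖ₑ ≤ K * ((n + 1 : ℕ) : ℝ≥0∞) ^ (d + 3) := by
    have h2 := enorm_sub_zero_le (χ ω) x (mem_fball.mp hx)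
    have h3 : gradSum (χ ω) n = ∑ x ∈ fball d n, ∑ z : Nbr d, ‖ψ (shift 0 x ω, z)‖ₑ := by
      refine Finset.sum_congr rfl fun x _ => Finset.sum_congr rfl fun z _ => ?_
      rw [h1.2, add_sub_cancel_left]
    rw [h1.1, sub_zero, h3] at h2
    calc ‖χ ω x‖ₑ ≤ (n : ℝ≥0∞) * (K * ((n + 1 : ℕ) : ℝ≥0∞) ^ (d + 2)) :=
          h2.trans (by gcongr; exact hKn n)
      _ ≤ ((n + 1 : ℕ) : ℝ≥0∞) * (K * ((n + 1 : ℕ) : ℝ≥0∞) ^ (d + 2)) := by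
          gcongr
          omega
      _ = _ := by ring
  have hI : ‖∫ s in (0 : ℝ)..t, drift hP q ψ (shift s x ω)‖ₑ
      ≤ D * ((n + 1 : ℕ) : ℝ≥0∞) ^ (d + 3) := by
    rw [intervalIntegral.integral_of_le ht.1]
    refine (enorm_integral_le_lintegral_enorm _).trans ?_
    calc ∫⁻ s in Set.Ioc (0 : ℝ) t, ‖drift hP q ψ (shift s x ω)‖ₑ
        ≤ ∫⁻ s in Set.Icc (0 : ℝ) ((n : ℝ) ^ 2),
            ∑ y ∈ fball d (n + 2), ‖drift hP q ψ (shift s y ω)‖ₑ := by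
          refine (lintegral_mono_set (Set.Ioc_subset_Icc_self.trans
            (Set.Icc_subset_Icc le_rfl ht.2))).trans (lintegral_mono fun s => ?_)
          exact Finset.single_le_sum (f := fun y : ZLat d => ‖drift hP q ψ (shift s y ω)‖ₑ)
            (fun _ _ => zero_le) (fball_mono (by omega) hx)
      _ ≤ _ := setLIntegral_sum_fball_le hd hn (fun ω => ‖drift hP q ψ ω‖ₑ) ω
      _ ≤ ENNReal.ofReal (9 * (6 * d + 1) ^ d * 2 ^ d * ((n + 1 : ℕ) : ℝ) ^ (d + 3))
            * maxFun (fun ω => ‖drift hP q ψ ω‖ₑ) ω := by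
          gcongr ENNReal.ofReal ?_ * _
          have hc : ((fball d n).card : ℝ) ≤ 2 ^ d * ((n + 1 : ℕ) : ℝ) ^ d := by
            rw [← mul_pow]
            have h1 := (fball_card_le (d := d) n).trans
              (Nat.pow_le_pow_left (show 2 * n + 1 ≤ 2 * (n + 1) by omega) d)
            exact_mod_cast h1
          have hn2 : (n : ℝ) ^ 2 ≤ ((n + 1 : ℕ) : ℝ) ^ 3 := by
            push_cast
            nlinarith [Nat.cast_nonneg (α := ℝ) n, sq_nonneg (n : ℝ),
              pow_nonneg (Nat.cast_nonneg (α := ℝ) n) 3]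
          calc 9 * (n : ℝ) ^ 2 * ((6 * d + 1) ^ d * (fball d n).card)
              ≤ 9 * ((n + 1 : ℕ) : ℝ) ^ 3
                * ((6 * d + 1) ^ d * (2 ^ d * ((n + 1 : ℕ) : ℝ) ^ d)) := by gcongr
            _ = _ := by ring
      _ = _ := by
          rw [ENNReal.ofReal_mul (by positivity), hD, ENNReal.ofReal_pow (by positivity),
            ENNReal.ofReal_natCast]
          ring
  have htot : ‖corrField χ (drift hP q ψ) ω t x‖ₑ ≤ (K + D) * ((n + 1 : ℕ) : ℝ≥0∞) ^ (d + 3) := by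
    rw [corrField, add_mul]
    refine (enorm_sub_le).trans (add_le_add ?_ hI)
    rw [enorm_neg]
    exact hχ
  have h5 := ENNReal.toReal_mono (ENNReal.mul_ne_top hKD
    (ENNReal.pow_ne_top (ENNReal.natCast_ne_top _))) htot
  rw [toReal_enorm, ENNReal.toReal_mul, ENNReal.toReal_pow, ENNReal.toReal_natCast,
    Real.norm_eq_abs] at h5
  push_cast at h5
  exact h5

end Growth

/-! ### Bootstrapping over dyadic scales. -/

section Iteration

/-- A sequence of polynomial growth that improves from each scale to the next is sublinear. -/
theorem sublinear_of_le_max {a : ℕ → ℝ} {K : ℝ} {r : ℕ}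
    (ha : ∀ n, 1 ≤ n → a n ≤ K * (n + 1 : ℝ) ^ r)
    (h : ∀ ε : ℝ, 0 < ε → ε ≤ 1 → ∀ᶠ n : ℕ in atTop, a n ≤ ε * max (a (2 * n)) n)
    {ε : ℝ} (hε : 0 < ε) : ∀ᶠ n : ℕ in atTop, a n ≤ ε * n := by
  -- This δ beats the polynomial growth across one doubling, δ 2^r ≤ 1/2, and it also satisfies δ ≤
  -- 1/2.
  set δ : ℝ := min ε ((2 : ℝ)⁻¹ ^ (r + 1)) with hδ
  have hδ0 : 0 < δ := lt_min hε (by positivity)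
  have hδr : δ * 2 ^ r ≤ 1 / 2 := by
    calc δ * 2 ^ r ≤ (2 : ℝ)⁻¹ ^ (r + 1) * 2 ^ r := by gcongr; exact min_le_right _ _
      _ = 1 / 2 := by
        rw [pow_succ, mul_assoc, mul_comm (2 : ℝ)⁻¹, ← mul_assoc, ← mul_pow]
        norm_num
  have hδ2 : δ ≤ 1 / 2 := by
    refine (min_le_right _ _).trans ?_
    rw [pow_succ]
    have : (2 : ℝ)⁻¹ ^ r ≤ 1 := pow_le_one₀ (by norm_num) (by norm_num)
    nlinarith
  obtain ⟨n₀, hn₀⟩ := eventually_atTop.mp (h δ hδ0 (by linarith))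
  -- J doublings. The linear terms of later scales are dominated by the first one because δ · 2 ≤ 1.
  have hit : ∀ J n, n₀ ≤ n → a n ≤ max (δ * n) (δ ^ J * a (2 ^ J * n)) := by
    intro J
    induction J with
    | zero => intro n _; simp
    | succ J ih =>
      intro n hn
      have h1 := ih (2 * n) (by omega)
      have h2 := hn₀ n hn
      rw [show 2 ^ J * (2 * n) = 2 ^ (J + 1) * n by ring] at h1
      push_cast at h1
      have hn' : (0 : ℝ) ≤ n := Nat.cast_nonneg n
      refine h2.trans ?_
      rw [mul_max_of_nonneg _ _ hδ0.le]
      refine max_le ?_ (le_max_left _ _)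
      calc δ * a (2 * n) ≤ δ * max (δ * (2 * n)) (δ ^ J * a (2 ^ (J + 1) * n)) := by gcongr
        _ = max (δ * (δ * (2 * n))) (δ * (δ ^ J * a (2 ^ (J + 1) * n))) :=
            mul_max_of_nonneg _ _ hδ0.le
        _ ≤ _ := by
            refine max_le_max ?_ (le_of_eq (by ring))
            nlinarith [mul_nonneg hδ0.le hn']
  filter_upwards [eventually_ge_atTop n₀, eventually_ge_atTop 1] with n hn hn1
  have hn' : (1 : ℝ) ≤ n := by exact_mod_cast hn1
  have hK0 : ∀ J : ℕ, δ ^ J * a (2 ^ J * n) ≤ (1 / 2) ^ J * (|K| * (2 * n) ^ r) := by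
    intro J
    have h1 := ha (2 ^ J * n) (Nat.one_le_iff_ne_zero.mpr (by positivity))
    have h2 : ((2 ^ J * n : ℕ) + 1 : ℝ) ≤ 2 ^ J * (2 * n) := by
      push_cast
      have : (1 : ℝ) ≤ 2 ^ J := one_le_pow₀ (by norm_num)
      nlinarith
    calc δ ^ J * a (2 ^ J * n) ≤ δ ^ J * (|K| * (2 ^ J * (2 * n)) ^ r) := by
          gcongr
          refine h1.trans ?_
          gcongr
          exact le_abs_self K
      _ = (δ * 2 ^ r) ^ J * (|K| * (2 * n) ^ r) := by
          have e : (2 ^ J * (2 * n) : ℝ) ^ r = (2 ^ r) ^ J * (2 * n) ^ r := by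
            rw [mul_pow (2 ^ J : ℝ), ← pow_mul, ← pow_mul, mul_comm J r]
          rw [e, mul_pow δ]
          ring
      _ ≤ _ := by gcongr
  have hlim : Tendsto (fun J : ℕ => (1 / 2 : ℝ) ^ J * (|K| * (2 * n) ^ r)) atTop (𝓝 0) := by
    have := (tendsto_pow_atTop_nhds_zero_of_lt_one (r := (1 / 2 : ℝ)) (by norm_num)
      (by norm_num)).mul_const (|K| * (2 * n) ^ r)
    rwa [zero_mul] at this
  obtain ⟨J, hJ⟩ := (hlim.eventually (gt_mem_nhds (show (0 : ℝ) < δ * n by positivity))).exists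
  refine (hit J n hn).trans (max_le ?_ (((hK0 J).trans hJ.le).trans ?_)) <;>
  · gcongr
    exact min_le_left _ _

end Iteration

/-! ### From De Giorgi's lemma to sublinearity. -/

section Sublinear

variable {d : ℕ}

/-- Normalisation by ε max(A,n)/2. The bound A, also valid for the constant c, makes the rescaled
function at most 4/ε, and the comparison with n makes the rescaled inhomogeneity at most (4/ε)/(2n).
-/
theorem isBoundedSolution_of_bound {ω : Env d} {p p' q q' : ℝ} {Λ : ℝ≥0∞} {l : ZLat d → ℝ}
    {X : ℝ → ZLat d → ℝ} (hsol : IsCorrectorSolution ω l X)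
    (hloc : ∀ x (z : Nbr d), LocallyIntegrable (fun t => conduct ω t x (x + z)) volume)
    (hodd : ∀ x, l (-x) = -l x) (hl : ∀ z : Nbr d, |l z| ≤ 1) {n : ℕ} (hn : 1 ≤ n)
    (hmu : cylNorm (ENNReal.ofReal p) (ENNReal.ofReal p') (2 * n) (muW ω) ≤ Λ)
    (hnu : cylNorm (ENNReal.ofReal q) (ENNReal.ofReal q') (2 * n) (nuW ω) ≤ Λ)
    {A c ε : ℝ} (hε : 0 < ε)
    (hA : ∀ t ∈ Set.Icc (0 : ℝ) (((2 * n : ℕ) : ℝ) ^ 2), ∀ x ∈ fball d (2 * n), |X t x| ≤ A)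
    (hc : |c| ≤ A) {σ : ℝ} (hσ : |σ| = 1) :
    IsBoundedSolution ω p p' q q' Λ (2 * n) (4 / ε) (fun x => σ / (ε * max A n / 2) * l x)
      (fun t x => σ / (ε * max A n / 2) * (X t x - c)) := by
  have hn' : (1 : ℝ) ≤ n := by exact_mod_cast hn
  have hM : (n : ℝ) ≤ max A n := le_max_right _ _
  have hAM : A ≤ max A n := le_max_left _ _
  set M : ℝ := max A n with hMdef
  have hMp : 0 < M := by linarith
  have habs : |σ / (ε * M / 2)| = 2 / (ε * M) := by
    rw [abs_div, hσ, abs_of_pos (by positivity)]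
    field_simp
  refine ⟨hsol.const_mul_sub _ c, hloc, by omega, fun x => by rw [hodd]; ring, fun z => ?_,
    fun t ht x hx => ?_, hmu, hnu⟩
  · rw [abs_mul, habs]
    push_cast
    calc 2 / (ε * M) * |l z| ≤ 2 / (ε * M) * 1 := by gcongr; exact hl z
      _ ≤ 2 / (ε * n) := by
          rw [mul_one]
          gcongr
      _ = 4 / ε / (2 * n) := by
          field_simp
          norm_num
  · refine (le_abs_self _).trans ?_
    rw [abs_mul, habs]
    have h1 : |X t x - c| ≤ 2 * M := by
      refine (abs_sub _ _).trans ?_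
      have := hA t ht x hx
      linarith
    calc 2 / (ε * M) * |X t x - c| ≤ 2 / (ε * M) * (2 * M) := by gcongr
      _ = 4 / ε := by
          field_simp
          norm_num

/-- De Giorgi's lemma on Q(2n) is applied to both signs of the normalised X - c, whose mean is below
the threshold by sublinearity in mean. Only the fixed bound 4/ε enters the threshold, so the
required smallness does not depend on n or A. -/
theorem exists_step_le (hd : 2 ≤ d) {p p' q q' P₁ P₁' ρ s κ α β : ℝ}
    (hX : IsExponentSystem d p p' q q' P₁ P₁' ρ s κ α β) {ω : Env d} {l : ZLat d → ℝ}
    {X : ℝ → ZLat d → ℝ} (hsol : IsCorrectorSolution ω l X)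
    (hloc : ∀ x (z : Nbr d), LocallyIntegrable (fun t => conduct ω t x (x + z)) volume)
    (hodd : ∀ x, l (-x) = -l x) (hl : ∀ z : Nbr d, |l z| ≤ 1) {Λ : ℝ≥0∞} (hΛ : Λ ≠ ∞)
    (hΛn : ∀ᶠ n : ℕ in atTop, cylNorm (ENNReal.ofReal p) (ENNReal.ofReal p') n (muW ω) ≤ Λ ∧
      cylNorm (ENNReal.ofReal q) (ENNReal.ofReal q') n (nuW ω) ≤ Λ)
    (hmean : ∀ ε : ℝ≥0∞, ε ≠ 0 → ∀ᶠ n : ℕ in atTop, ∃ c : ℝ,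
      (∀ A : ℝ, (∀ y ∈ fball d n, |X 0 y| ≤ A) → |c| ≤ A) ∧
      ∫⁻ t, ∫⁻ x, ‖X t x - c‖ₑ ∂(unifB d n) ∂(unifT n) ≤ ε * n)
    (hX0 : X 0 0 = 0) {ε : ℝ} (hε : 0 < ε) (hε1 : ε ≤ 1) :
    ∀ᶠ n : ℕ in atTop, ∀ A : ℝ,
      (∀ t ∈ Set.Icc (0 : ℝ) (((2 * n : ℕ) : ℝ) ^ 2), ∀ x ∈ fball d (2 * n), |X t x| ≤ A) →
      ∀ t ∈ Set.Icc (0 : ℝ) ((n : ℝ) ^ 2), ∀ x ∈ fball d n, |X t x| ≤ ε * max A n := by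
  obtain ⟨c₀, hc₀, hreg⟩ := exists_le_one_of_mean_le (d := d) hd hX hΛ (L := 4 / ε)
    (by rw [le_div_iff₀ hε]; linarith)
  have hε4 : ENNReal.ofReal (4 / ε) ≠ 0 := by
    rw [ne_eq, ENNReal.ofReal_eq_zero, not_le]
    positivity
  obtain ⟨n₁, hn₁⟩ := eventually_atTop.mp hΛn
  obtain ⟨n₂, hn₂⟩ := eventually_atTop.mp (hmean (c₀ / ENNReal.ofReal (4 / ε))
    (ENNReal.div_ne_zero.mpr ⟨hc₀, ENNReal.ofReal_ne_top⟩))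
  filter_upwards [eventually_ge_atTop n₁, eventually_ge_atTop n₂, eventually_ge_atTop 1]
    with n hn1 hn2 hn A hA
  obtain ⟨c, hcA, hcI⟩ := hn₂ (2 * n) (by omega)
  have hn' : (1 : ℝ) ≤ n := by exact_mod_cast hn
  have hc : |c| ≤ A := hcA A fun y hy => hA 0 ⟨le_rfl, by positivity⟩ y hy
  have hM : (n : ℝ) ≤ max A n := le_max_right _ _
  have hMp : 0 < max A n := by linarith
  have hKp : 0 < ε * max A n / 2 := by positivity
  have hone : ∀ σ : ℝ, |σ| = 1 → ∀ t ∈ Set.Icc (0 : ℝ) ((n : ℝ) ^ 2), ∀ x ∈ fball d n,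
      σ * (X t x - c) ≤ ε * max A n / 2 := by
    intro σ hσ t ht x hx
    have hsolb := isBoundedSolution_of_bound (Λ := Λ) hsol hloc hodd hl hn
      (hn₁ (2 * n) (by omega)).1 (hn₁ (2 * n) (by omega)).2 hε hA hc hσ
    have hint : ∫⁻ t, ∫⁻ x, ENNReal.ofReal (σ / (ε * max A n / 2) * (X t x - c))
        ∂(unifB d (2 * n)) ∂(unifT (2 * n)) ≤ c₀ := by
      have hpt : ∀ t x, ENNReal.ofReal (σ / (ε * max A n / 2) * (X t x - c))
          ≤ ENNReal.ofReal (2 / (ε * n)) * ‖X t x - c‖ₑ := by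
        intro t x
        rw [Real.enorm_eq_ofReal_abs, ← ENNReal.ofReal_mul (by positivity)]
        refine ENNReal.ofReal_le_ofReal ((le_abs_self _).trans ?_)
        rw [abs_mul, abs_div, hσ, abs_of_pos hKp]
        gcongr ?_ * _
        rw [div_le_div_iff₀ hKp (by positivity)]
        nlinarith
      calc _ ≤ ∫⁻ t, ∫⁻ x, ENNReal.ofReal (2 / (ε * n)) * ‖X t x - c‖ₑ
            ∂(unifB d (2 * n)) ∂(unifT (2 * n)) :=
            lintegral_mono fun t => lintegral_mono fun x => hpt t x
        _ = ENNReal.ofReal (2 / (ε * n)) * ∫⁻ t, ∫⁻ x, ‖X t x - c‖ₑ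
            ∂(unifB d (2 * n)) ∂(unifT (2 * n)) := by
            simp only [lintegral_const_mul' _ _ ENNReal.ofReal_ne_top]
        _ ≤ ENNReal.ofReal (2 / (ε * n)) * (c₀ / ENNReal.ofReal (4 / ε) * (2 * n : ℕ)) := by
            gcongr
        _ = c₀ / ENNReal.ofReal (4 / ε)
            * (ENNReal.ofReal (2 / (ε * n)) * ENNReal.ofReal ((2 * n : ℕ) : ℝ)) := by
            rw [ENNReal.ofReal_natCast]
            ring
        _ = c₀ / ENNReal.ofReal (4 / ε) * ENNReal.ofReal (4 / ε) := by
            rw [← ENNReal.ofReal_mul (by positivity)]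
            congr 2
            push_cast
            field_simp
            norm_num
        _ = c₀ := ENNReal.div_mul_cancel hε4 ENNReal.ofReal_ne_top
    have h1 := hreg ω (2 * n) _ _ hsolb hint t ⟨ht.1, ht.2.trans (by push_cast; linarith)⟩ x (by
      have : (l1norm x : ℝ) ≤ n := by exact_mod_cast mem_fball.mp hx
      push_cast
      linarith)
    rwa [div_mul_eq_mul_div, div_le_one hKp] at h1
  have habs : ∀ t ∈ Set.Icc (0 : ℝ) ((n : ℝ) ^ 2), ∀ x ∈ fball d n,
      |X t x - c| ≤ ε * max A n / 2 := by
    intro t ht x hx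
    have h1 := hone 1 (by simp) t ht x hx
    have h2 := hone (-1) (by simp) t ht x hx
    rw [abs_le]
    constructor <;> linarith
  intro t ht x hx
  have h1 := habs t ht x hx
  -- At the origin X vanishes, so the same estimate bounds the constant c.
  have h2 := habs 0 ⟨le_rfl, by positivity⟩ 0 (by simp [mem_fball, l1norm_zero])
  rw [hX0, zero_sub, abs_neg] at h2
  calc |X t x| = |(X t x - c) + c| := by ring_nf
    _ ≤ |X t x - c| + |c| := abs_add_le _ _
    _ ≤ ε * max A n := by linarith

/-- The abstract iteration is run on the suprema of |X| over the cylinders; the growth bound makes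
them finite. -/
theorem sublinear_of_step {X : ℝ → ZLat d → ℝ} {K : ℝ} {r : ℕ}
    (hgrow : ∀ n : ℕ, 1 ≤ n → ∀ t ∈ Set.Icc (0 : ℝ) ((n : ℝ) ^ 2), ∀ x ∈ fball d n,
      |X t x| ≤ K * (n + 1 : ℝ) ^ r)
    (hstep : ∀ ε : ℝ, 0 < ε → ε ≤ 1 → ∀ᶠ n : ℕ in atTop, ∀ A : ℝ,
      (∀ t ∈ Set.Icc (0 : ℝ) (((2 * n : ℕ) : ℝ) ^ 2), ∀ x ∈ fball d (2 * n), |X t x| ≤ A) →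
      ∀ t ∈ Set.Icc (0 : ℝ) ((n : ℝ) ^ 2), ∀ x ∈ fball d n, |X t x| ≤ ε * max A n)
    {ε : ℝ} (hε : 0 < ε) :
    ∀ᶠ n : ℕ in atTop, ∀ t ∈ Set.Icc (0 : ℝ) ((n : ℝ) ^ 2), ∀ x ∈ fball d n,
      |X t x| ≤ ε * n := by
  set S : ℕ → Set ℝ := fun n =>
    (fun p : ℝ × ZLat d => |X p.1 p.2|) '' (Set.Icc (0 : ℝ) ((n : ℝ) ^ 2) ×ˢ fball d n) with hS
  have hne : ∀ n, (S n).Nonempty := fun n =>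
    ⟨_, (0, 0), ⟨⟨le_rfl, by positivity⟩, by simp [mem_fball, l1norm_zero]⟩, rfl⟩
  have hbdd : ∀ n : ℕ, 1 ≤ n → BddAbove (S n) := by
    rintro n hn
    refine ⟨K * (n + 1 : ℝ) ^ r, ?_⟩
    rintro _ ⟨p, hp, rfl⟩
    exact hgrow n hn p.1 hp.1 p.2 hp.2
  have hle : ∀ n : ℕ, 1 ≤ n → ∀ t ∈ Set.Icc (0 : ℝ) ((n : ℝ) ^ 2), ∀ x ∈ fball d n,
      |X t x| ≤ sSup (S n) := fun n hn t ht x hx =>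
    le_csSup (hbdd n hn) ⟨(t, x), ⟨ht, hx⟩, rfl⟩
  have hsub := sublinear_of_le_max (a := fun n => sSup (S n)) (K := K) (r := r)
    (fun n hn => csSup_le (hne n) (by
      rintro _ ⟨p, hp, rfl⟩
      exact hgrow n hn p.1 hp.1 p.2 hp.2))
    (fun δ hδ hδ1 => by
      filter_upwards [hstep δ hδ hδ1, eventually_ge_atTop 1] with n hn hn1
      refine csSup_le (hne n) ?_
      rintro _ ⟨p, hp, rfl⟩
      exact hn _ (hle (2 * n) (by omega)) p.1 hp.1 p.2 hp.2) hε
  filter_upwards [hsub, eventually_ge_atTop 1] with n hn hn1 t ht x hx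
  exact (hle n hn1 t ht x hx).trans hn

variable [MeasurableSpace (Env d)] {P : Measure (Env d)} [IsProbabilityMeasure P]
  {hP : StationaryErgodicEnv P} {q : Nbr d → ℝ} {ψ : Lp ℝ 2 (mMeasure P)}
  {φ : ℕ → Env d → ℝ} {χ : Env d → ZLat d → ℝ}

/-- The corrector is sublinear. -/
theorem IsCorrector.ae_sublinear (hd : 2 ≤ d) (hmom : MomentCondition P)
    (hC : IsCorrector hP q ψ φ χ) {l : ZLat d → ℝ} (hodd : ∀ x, l (-x) = -l x)
    (hlq : ∀ z : Nbr d, l z = q z) (hl : ∀ z : Nbr d, |l z| ≤ 1) :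
    ∀ᵐ ω ∂P, ∀ ε : ℝ, 0 < ε → ∀ᶠ n : ℕ in atTop, ∀ t ∈ Set.Icc (0 : ℝ) ((n : ℝ) ^ 2),
      ∀ x ∈ fball d n, |corrField χ (drift hP q ψ) ω t x| ≤ ε * n := by
  have hd0 : d ≠ 0 := by omega
  obtain ⟨p, p', q₁, q₁', P₁, P₁', ρ, s, κ, α, β, hX, hΛ⟩ := hmom.exists_real hd hP
  filter_upwards [hΛ, hC.ae_isCorrectorSolution hlq, ae_locallyIntegrable_conduct hP,
    hC.ae_mean_sublinear hd0, hC.corrField_zero, hC.ae_polynomial_growth hd0]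
    with ω ⟨Λ, hΛt, hΛn⟩ hsol hloc hmean h0 ⟨K, _, hgrow⟩ ε hε
  exact sublinear_of_step hgrow (fun δ hδ hδ1 =>
    exists_step_le hd hX hsol hloc hodd hl hΛt hΛn hmean h0 hδ hδ1) hε

end Sublinear

/-! ### The harmonic coordinates -/

section Extension

variable {d : ℕ} [MeasurableSpace (Env d)] {P : Measure (Env d)} [IsProbabilityMeasure P]
  {hP : StationaryErgodicEnv P} {q : Nbr d → ℝ} {ψ : Lp ℝ 2 (mMeasure P)}
  {φ : ℕ → Env d → ℝ} {χ : Env d → ZLat d → ℝ}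

theorem IsCorrector.isExtension (hC : IsCorrector hP q ψ φ χ) : IsExtension P ψ χ := by
  filter_upwards [hC.step] with ω hω x w
  have h1 := walkSum_eq_of_step hω.2 w
  rw [hω.1, sub_zero] at h1
  exact h1.symm

theorem IsExtension.ae_eq {f : Env d × Nbr d → ℝ} {Ψ Ψ' : Env d → ZLat d → ℝ}
    (h : IsExtension P f Ψ) (h' : IsExtension P f Ψ') : ∀ᵐ ω ∂P, ∀ x, Ψ ω x = Ψ' ω x := by
  filter_upwards [h, h'] with ω h1 h2 x
  obtain ⟨w, _⟩ := exists_walk_length 0 x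
  rw [h1 x w, h2 x w]

/-- Both sides vanish at the base point and have the same steps, so they agree along every path. -/
theorem IsCorrector.ae_cocycle (hC : IsCorrector hP q ψ φ χ) :
    ∀ᵐ ω ∂P, ∀ x y : ZLat d, χ (shift 0 x ω) (y - x) = χ ω y - χ ω x := by
  filter_upwards [hC.step, hP.ae_shift_space hC.step 0] with ω h1 h2 x y
  have key : ∀ v, χ (shift 0 x ω) v = χ ω (x + v) - χ ω x := by
    refine fun v => lattice_induction
      (Q := fun v => χ (shift 0 x ω) v = χ ω (x + v) - χ ω x) ?_ ?_ v
    · rw [(h2 x).1, add_zero, sub_self]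
    · intro v z hv
      rw [(h2 x).2, hv, ← add_assoc, h1.2, shift_shift, add_zero, add_comm v x]
      ring
  rw [key, add_sub_cancel]

/-- On neighbours the field equals q - ψ, so the required square integrability is membership of q -
ψ in L²(m). The cocycle property is additivity of l together with that of χ. -/
theorem IsCorrector.isL2cov (hC : IsCorrector hP q ψ φ χ) {l : ZLat d → ℝ}
    (hadd : ∀ x y, l (x + y) = l x + l y) (hlq : ∀ z : Nbr d, l z = q z) :
    IsL2cov P fun ω x => l x - χ ω x := by
  have hl0 : l 0 = 0 := by simpa using hadd 0 0
  refine ⟨?_, ?_, ?_⟩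
  · exact measurable_from_prod_countable_left fun x =>
      (measurable_const (a := l x)).sub (hC.measurable_extension x)
  · filter_upwards [hC.ae_cocycle] with ω hω x y
    have h1 : l (y - x) = l y - l x := by
      have := hadd (y - x) x
      rw [sub_add_cancel] at this
      linarith
    rw [hω, h1]
    ring
  · have := isFiniteMeasure_mMeasure hP
    have hm : Measurable fun p : Env d × Nbr d => q p.2 - ψ p :=
      ((measurable_of_finite q).comp measurable_snd).sub (measurable_coeFn_mMeasure ψ)
    have hmem : MemLp (fun p : Env d × Nbr d => q p.2 - ψ p) 2 (mMeasure P) := by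
      refine MemLp.sub ?_ (Lp.memLp ψ)
      refine MemLp.of_bound ((measurable_of_finite q).comp measurable_snd).aestronglyMeasurable
        (∑ z, ‖q z‖) (ae_of_all _ fun p => ?_)
      exact Finset.single_le_sum (f := fun z => ‖q z‖) (fun _ _ => norm_nonneg _)
        (Finset.mem_univ p.2)
    have hfin := (eLpNorm_lt_top_iff_lintegral_rpow_enorm_lt_top (by norm_num) (by norm_num)).mp
      hmem.2
    rw [lintegral_mMeasure hP (hm.enorm.pow_const _)] at hfin
    have hw : ∀ z : Nbr d, Measurable fun ω => ENNReal.ofReal (wver hP z ω)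
        * ‖q z - ψ (ω, z)‖ₑ ^ ENNReal.toReal 2 := fun z =>
      (measurable_wver hP z).ennreal_ofReal.mul
        ((hm.comp measurable_prodMk_right).enorm.pow_const _)
    rw [← lintegral_finsetSum _ fun z _ => hw z] at hfin
    refine lt_of_le_of_lt (le_of_eq (lintegral_congr_ae ?_)) hfin
    filter_upwards [hC.step, wver_ae_eq hP] with ω h1 h2
    refine Finset.sum_congr rfl fun z _ => ?_
    have h3 := h1.2 0 z
    rw [h1.1, shift_zero, zero_add, zero_add] at h3
    rw [h2, hlq, h3, ENNReal.ofReal_mul (conduct_nonneg _ _ _ _), Real.enorm_eq_ofReal_abs,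
      ENNReal.ofReal_rpow_of_nonneg (abs_nonneg _) (by norm_num)]
    congr 2
    norm_num

end Extension

/-! ### Assembling the coordinates into a vector field. -/

section Coordinates

variable {d : ℕ}

theorem toLp_eq_sum (v : Fin d → ℝ) :
    (WithLp.toLp 2 v : EuclideanSpace ℝ (Fin d)) = ∑ j, v j • EuclideanSpace.single j (1 : ℝ) := by
  ext i
  simp [Finset.sum_apply, Pi.single_apply]

theorem absolutelyContinuousOnInterval_toLp {f : Fin d → ℝ → ℝ} {a b : ℝ}
    (hf : ∀ j, AbsolutelyContinuousOnInterval (f j) a b) :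
    AbsolutelyContinuousOnInterval
      (fun t => (WithLp.toLp 2 fun j => f j t : EuclideanSpace ℝ (Fin d))) a b := by
  classical
  simp only [toLp_eq_sum]
  have key : ∀ s : Finset (Fin d), AbsolutelyContinuousOnInterval
      (fun t => ∑ j ∈ s, f j t • (EuclideanSpace.single j (1 : ℝ) : EuclideanSpace ℝ (Fin d)))
      a b := by
    intro s
    induction s using Finset.induction_on with
    | empty => simpa using absolutelyContinuousOnInterval_const (0 : EuclideanSpace ℝ (Fin d)) a b
    | insert j s hj ih =>
      simp only [Finset.sum_insert hj]
      exact ((hf j).fun_smul (absolutelyContinuousOnInterval_const _ a b)).fun_add ih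
  exact key Finset.univ

theorem hasDerivAt_toLp {f : Fin d → ℝ → ℝ} {f' : Fin d → ℝ} {t : ℝ}
    (hf : ∀ j, HasDerivAt (f j) (f' j) t) :
    HasDerivAt (fun t => (WithLp.toLp 2 fun j => f j t : EuclideanSpace ℝ (Fin d)))
      (WithLp.toLp 2 f') t := by
  simp only [toLp_eq_sum]
  exact HasDerivAt.fun_sum fun j _ => (hf j).smul_const _

theorem norm_toLp_le_sum (v : Fin d → ℝ) :
    ‖(WithLp.toLp 2 v : EuclideanSpace ℝ (Fin d))‖ ≤ ∑ j, |v j| := by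
  rw [toLp_eq_sum]
  refine (norm_sum_le _ _).trans (Finset.sum_le_sum fun j _ => ?_)
  simp [norm_smul]

theorem gen_apply (ω : Env d) (t : ℝ) (f : ZLat d → EuclideanSpace ℝ (Fin d)) (x : ZLat d)
    (j : Fin d) : gen ω t f x j = ∑ z : Nbr d, conduct ω t x (x + z) * (f (x + z) j - f x j) := by
  rw [gen, sum_neighborFinset x (fun y => conduct ω t x y • (f y - f x))]
  simp

variable [MeasurableSpace (Env d)] {P : Measure (Env d)} [IsProbabilityMeasure P]
  {hP : StationaryErgodicEnv P}

/-- The direction of the `j`-th coordinate. -/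
def coordDir (j : Fin d) (z : Nbr d) : ℝ := ((z : ZLat d) j : ℝ)

/-- The harmonic coordinates at time `0`. -/
def harmField (χ : Fin d → Env d → ZLat d → ℝ) (ω : Env d) (x : ZLat d) :
    EuclideanSpace ℝ (Fin d) :=
  WithLp.toLp 2 fun j => (x j : ℝ) - χ j ω x

variable {ψ : Fin d → Lp ℝ 2 (mMeasure P)} {φ : Fin d → ℕ → Env d → ℝ}
  {χ : Fin d → Env d → ZLat d → ℝ}

theorem ae_driftAtZero_eq (hC : ∀ j, IsCorrector hP (coordDir j) (ψ j) (φ j) (χ j)) :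
    ∀ᵐ ω ∂P, ∀ᵐ s : ℝ, ∀ j, driftAtZero (harmField χ) ω s j
      = drift hP (coordDir j) (ψ j) (shift s 0 ω) := by
  filter_upwards [hP.ae_ae_shift (ae_all_iff.mpr fun j => (hC j).step), wver_ae_ae_eq hP]
    with ω h1 h2
  filter_upwards [h1, h2] with s h3 h4 j
  rw [driftAtZero, gen_apply, drift]
  refine Finset.sum_congr rfl fun z _ => ?_
  rw [flux, h4, coordDir]
  simp only [harmField]
  rw [(h3 0 j).2, (h3 0 j).1, shift_shift]
  simp

theorem ae_intervalIntegrable_driftAtZero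
    (hC : ∀ j, IsCorrector hP (coordDir j) (ψ j) (φ j) (χ j)) :
    ∀ᵐ ω ∂P, (∀ t : ℝ, IntervalIntegrable (driftAtZero (harmField χ) ω) volume 0 t) ∧
      ∀ (t : ℝ) j, (∫ s in (0 : ℝ)..t, driftAtZero (harmField χ) ω s) j
        = ∫ s in (0 : ℝ)..t, drift hP (coordDir j) (ψ j) (shift s 0 ω) := by
  filter_upwards [ae_driftAtZero_eq hC,
    ae_all_iff.mpr fun j => ae_locallyIntegrable_drift hP (coordDir j) (ψ j)] with ω h1 h2
  have h3 : ∀ (j : Fin d) (a b : ℝ), IntegrableOn (fun s => driftAtZero (harmField χ) ω s j)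
      (Set.Ioc a b) volume := by
    intro j a b
    have h4 : IntegrableOn (fun s => drift hP (coordDir j) (ψ j) (shift s 0 ω)) (Set.Ioc a b)
        volume := (intervalIntegrable_of_locallyIntegrable (h2 j 0) a b).1
    refine h4.congr (ae_restrict_of_ae ?_)
    filter_upwards [h1] with s hs
    exact (hs j).symm
  refine ⟨fun t => ⟨Integrable.of_eval_piLp fun j => h3 j 0 t,
    Integrable.of_eval_piLp fun j => h3 j t 0⟩, fun t j => ?_⟩
  have h5 : ∀ a b : ℝ, (∫ s in Set.Ioc a b, driftAtZero (harmField χ) ω s) j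
      = ∫ s in Set.Ioc a b, drift hP (coordDir j) (ψ j) (shift s 0 ω) := by
    intro a b
    rw [eval_integral_piLp fun i => h3 i a b]
    refine integral_congr_ae (ae_restrict_of_ae ?_)
    filter_upwards [h1] with s hs
    exact hs j
  rw [intervalIntegral, intervalIntegral, PiLp.sub_apply, h5, h5]

/-- This identifies the vector-valued harmonic coordinates, componentwise, with x plus the
correctors; everything already known for a single direction then transfers. -/
theorem ae_harmCoord_eq (hC : ∀ j, IsCorrector hP (coordDir j) (ψ j) (φ j) (χ j)) :
    ∀ᵐ ω ∂P, ∀ t x, harmCoord (harmField χ) ω t x = WithLp.toLp 2 fun j =>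
      (x j : ℝ) + corrField (χ j) (drift hP (coordDir j) (ψ j)) ω t x := by
  filter_upwards [ae_intervalIntegrable_driftAtZero hC,
    ae_all_iff.mpr fun j => (hC j).corrField_eq] with ω h1 h2 t x
  ext j
  rw [harmCoord, PiLp.sub_apply, h1.2]
  simp only [harmField]
  rw [h2 j]
  ring

theorem coordDir_neg (j : Fin d) (z : Nbr d) : coordDir j z.neg = -coordDir j z := by
  simp [coordDir]

theorem abs_coordDir_le (j : Fin d) (z : Nbr d) : |coordDir j z| ≤ 1 := by
  have h := natAbs_le_l1norm (z : ZLat d) j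
  rw [z.l1norm_eq] at h
  rw [coordDir, ← Int.cast_abs, Int.abs_eq_natAbs]
  exact_mod_cast h

theorem ae_harmonic (hC : ∀ j, IsCorrector hP (coordDir j) (ψ j) (φ j) (χ j)) :
    ∀ᵐ ω ∂P, (∀ (x : ZLat d) (a b : ℝ),
          AbsolutelyContinuousOnInterval (fun t => harmCoord (harmField χ) ω t x) a b) ∧
        (∀ᵐ t : ℝ, ∀ x : ZLat d,
          DifferentiableAt ℝ (fun s => harmCoord (harmField χ) ω s x) t ∧
          deriv (fun s => harmCoord (harmField χ) ω s x) t
            + gen ω t (harmCoord (harmField χ) ω t) x = 0) ∧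
        harmCoord (harmField χ) ω 0 0 = 0 := by
  filter_upwards [ae_harmCoord_eq hC, ae_all_iff.mpr fun j =>
    (hC j).ae_isCorrectorSolution (l := fun x => (x j : ℝ)) (fun z => rfl),
    ae_all_iff.mpr fun j => (hC j).corrField_zero] with ω h1 h2 h3
  simp only [h1]
  refine ⟨fun x a b => absolutelyContinuousOnInterval_toLp fun j =>
    (absolutelyContinuousOnInterval_const ((x j : ℤ) : ℝ) a b).fun_add ((h2 j).ac x a b), ?_, ?_⟩
  · filter_upwards [ae_all_iff.mpr fun j => (h2 j).hasDerivAt] with t ht x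
    have hder := hasDerivAt_toLp fun j => (ht j x).const_add ((x j : ℤ) : ℝ)
    refine ⟨hder.differentiableAt, ?_⟩
    rw [hder.deriv]
    ext j
    rw [PiLp.add_apply, gen_apply, PiLp.zero_apply, neg_add_eq_zero]
    refine Finset.sum_congr rfl fun z _ => ?_
    simp only [h1, Pi.add_apply]
    push_cast
    ring
  · ext j
    simp [h3 j]

theorem ae_tendsto_harmCoord (hd : 2 ≤ d) (hmom : MomentCondition P)
    (hC : ∀ j, IsCorrector hP (coordDir j) (ψ j) (φ j) (χ j)) :
    ∀ᵐ ω ∂P, Tendsto (fun n : ℕ => ⨆ p ∈ cylinder d n,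
      ENNReal.ofReal ((1 / (n : ℝ)) * ‖harmCoord (harmField χ) ω p.1 p.2 - posField p.2‖))
      atTop (𝓝 0) := by
  have hd0 : (0 : ℝ) < d := by
    have : 0 < d := by omega
    exact_mod_cast this
  filter_upwards [ae_harmCoord_eq hC, ae_all_iff.mpr fun j =>
    (hC j).ae_sublinear hd hmom (l := fun x => (x j : ℝ)) (fun x => by simp) (fun z => rfl)
      (abs_coordDir_le j)] with ω h1 h2
  rw [ENNReal.tendsto_nhds_zero]
  intro ε hε
  -- The minimum with 1 makes the tolerance finite, hence a positive real number; it is then shared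
  -- equally among the d components.
  set δ : ℝ := (min ε 1).toReal with hδ
  have hmin : min ε 1 ≠ ∞ := ne_top_of_le_ne_top ENNReal.one_ne_top (min_le_right _ _)
  have hδ0 : 0 < δ := ENNReal.toReal_pos (lt_min hε one_pos).ne' hmin
  filter_upwards [eventually_all.mpr fun j => h2 j (δ / d) (by positivity),
    eventually_ge_atTop 1] with n hn hn1
  have hn' : (0 : ℝ) < n := by exact_mod_cast hn1
  refine iSup₂_le fun p hp => ?_
  refine le_trans ?_ (min_le_left ε 1)
  rw [← ENNReal.ofReal_toReal hmin]
  refine ENNReal.ofReal_le_ofReal ?_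
  have hdiff : harmCoord (harmField χ) ω p.1 p.2 - posField p.2 = WithLp.toLp 2 fun j =>
      corrField (χ j) (drift hP (coordDir j) (ψ j)) ω p.1 p.2 := by
    rw [h1]
    ext j
    simp [posField]
  have hx : p.2 ∈ fball d n := by
    rw [← Finset.mem_coe, coe_fball]
    exact hp.2
  have hsum : ‖harmCoord (harmField χ) ω p.1 p.2 - posField p.2‖ ≤ δ * n := by
    rw [hdiff]
    refine (norm_toLp_le_sum _).trans ?_
    calc _ ≤ ∑ _j : Fin d, δ / d * n := Finset.sum_le_sum fun j _ => hn j p.1 hp.1 p.2 hx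
      _ = δ * n := by
        rw [Finset.sum_const, Finset.card_univ, Fintype.card_fin, nsmul_eq_mul]
        field_simp
  rw [one_div, inv_mul_le_iff₀ hn', mul_comm]
  exact hsum

end Coordinates

end

theorem theorem2p5 {d : ℕ} (hd : 2 ≤ d) [MeasurableSpace (Env d)] (P : Measure (Env d))
    [IsProbabilityMeasure P] (hP : StationaryErgodicEnv P) (hmom : MomentCondition P) :
    ∃ Φ₀ : Env d → ZLat d → EuclideanSpace ℝ (Fin d),
      (∀ j : Fin d, IsL2cov P fun ω x => Φ₀ ω x j) ∧
      -- (i) each `χ₀^j = Π^j - Φ₀^j` is the unique extension of an element of `L²_pot`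
      (∀ j : Fin d, ∃ ψ ∈ L2pot P,
        IsExtension P ψ (fun ω x => posField x j - Φ₀ ω x j) ∧
        ∀ Ψ : Env d → ZLat d → ℝ, IsExtension P ψ Ψ →
          ∀ᵐ ω ∂P, ∀ x, Ψ ω x = posField x j - Φ₀ ω x j) ∧
      -- (ii) `Φ` is well defined, locally absolutely continuous in time, and harmonic
      (∀ᵐ ω ∂P,
        (∀ t : ℝ, IntervalIntegrable (driftAtZero Φ₀ ω) volume 0 t) ∧
        (∀ (x : ZLat d) (a b : ℝ),
          AbsolutelyContinuousOnInterval (fun t => harmCoord Φ₀ ω t x) a b) ∧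
        (∀ᵐ t : ℝ, ∀ x : ZLat d,
          DifferentiableAt ℝ (fun s => harmCoord Φ₀ ω s x) t ∧
          deriv (fun s => harmCoord Φ₀ ω s x) t + gen ω t (harmCoord Φ₀ ω t) x = 0) ∧
        harmCoord Φ₀ ω 0 0 = 0) ∧
      -- (iii) `Φ` is a sublinear perturbation of the identity
      (∀ᵐ ω ∂P, Tendsto
        (fun n : ℕ => ⨆ p ∈ cylinder d n,
          ENNReal.ofReal ((1 / (n : ℝ)) * ‖harmCoord Φ₀ ω p.1 p.2 - posField p.2‖))
        atTop (𝓝 0)) := by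
  choose ψ φ χ hC using fun j : Fin d => exists_isCorrector hP (coordDir_neg j)
  have hχ : ∀ j, (fun ω (x : ZLat d) => posField x j - harmField χ ω x j) = χ j := by
    intro j
    funext ω x
    simp [posField, harmField]
  refine ⟨harmField χ, fun j => ?_, fun j => ⟨ψ j, (hC j).mem, ?_, fun Ψ hΨ => ?_⟩, ?_,
    ae_tendsto_harmCoord hd hmom hC⟩
  · exact (hC j).isL2cov (l := fun x => (x j : ℝ)) (fun x y => by simp) fun z => rfl
  · rw [hχ]
    exact (hC j).isExtension
  · have h := hΨ.ae_eq (hC j).isExtension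
    rwa [← hχ j] at h
  · filter_upwards [ae_intervalIntegrable_driftAtZero hC, ae_harmonic hC] with ω h1 h2
    exact ⟨h1.1, h2⟩
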